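/- **Corollary (Pure BGG reciprocity).** Let $\Bbbk$ be an algebraically closed field and let $A=\bigoplus_{i,j\in\mathbf I}1_iA1_j$ be a locally unital $\mathbb Z$-graded $\Bbbk$-algebra that is locally finite-dimensional and bounded below ($\dim 1_iA_d1_j<\infty$ for all $d$, and $1_iA_d1_j=0$ for $d\ll0$, for each $i,j$). Modules are locally unital graded left modules with degree-preserving morphisms; $q$ is the degree shift $(qV)_d=V_{d+1}$; $\dim_qV=\sum_d(\dim V_d)q^{-d}$; $\operatorname{Hom}_A(V,W)=\bigoplus_d\operatorname{Hom}_A(V,W)_d$ where $\operatorname{Hom}_A(V,W)_d$ consists of the homomorphisms of degree $d$; the bar is $q\mapsto q^{-1}$; and the coefficient of $q^d$ in $[V:L]_q$ is the maximal number of sections isomorphic to $q^dL$ in finite graded filtrations of $V$. A *graded triangular basis* of $A$ with weight poset $\Lambda$ consists of: a partial order on $\Lambda$ in which every $\{\mu\le\lambda\}$ is finite; a subset $\mathbf S\subseteq\mathbf I$ and a map $\mathbf S\to\Lambda$, $s\mapsto\dot s$, with finite fibres $\mathbf S_\lambda$; and sets of homogeneous elements $\mathrm X(i,s)\subset1_iA1_s$,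 $\mathrm H(s,t)\subset1_sA1_t$, $\mathrm Y(t,j)\subset1_tA1_j$ ($i,j\in\mathbf I$, $s,t\in\mathbf S$), such that the products $xhy$ with $x\in\mathrm X(i,s)$, $h\in\mathrm H(s,t)$, $y\in\mathrm Y(t,j)$ form a basis of $A$; $\mathrm X(s,s)=\mathrm Y(s,s)=\{1_s\}$; for $s\ne t$ in $\mathbf S$, $\mathrm X(s,t)\neq\varnothing\Rightarrow\dot s>\dot t$, $\mathrm H(s,t)\ne\varnothing\Rightarrow\dot s=\dot t$, $\mathrm Y(s,t)\ne\varnothing\Rightarrow\dot s<\dot t$; and for $i\in\mathbf I\setminus\mathbf S$ only finitely many $s$ have $\mathrm X(i,s)\cup\mathrm Y(s,i)\ne\varnothing$. Put $e_\lambda=\sum_{s\in\mathbf S_\lambda}1_s$, let $A_{\ge\lambda}$ be the quotient of $A$ by the two-sided ideal generated by the $e_\mu$ with $\mu\not\ge\lambda$, and let $A_\lambda=\bar e_\lambda A_{\ge\lambda}\bar e_\lambda$. For a graded $A_\lambda$-module $V$, view $j^\lambda_!V=A_{\ge\lambda}\bar e_\lambda\otimes_{A_\lambda}V$ and $j^\lambda_*V=\bigoplus_{i}\operatorname{Hom}_{A_\lambda}(\bar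 e_\lambda A_{\ge\lambda}\bar 1_i,V)$ as $A$-modules. The algebra is *based affine quasi-hereditary* if $s\mapsto\dot s$ is a bijection $\mathbf S\to\Lambda$ and each $A_\lambda$ is graded local, i.e. its quotient by its graded Jacobson radical is $\Bbbk$. In that case, for $\lambda\in\Lambda$, put $\Delta(\lambda)=j^\lambda_!A_\lambda$, $\bar\Delta(\lambda)=j^\lambda_!\Bbbk$, $\bar\nabla(\lambda)=j^\lambda_*\Bbbk$, $\nabla(\lambda)=j^\lambda_*I$ with $I$ the injective hull of the irreducible $A_\lambda$-module $\Bbbk$, and let $L(\lambda)$ be the irreducible head of $\Delta(\lambda)$; a $\Delta$-layer of type $\lambda$ is a module isomorphic to $j^\lambda_!V$ for a projective graded $A_\lambda$-module $V$ that is locally finite-dimensional and bounded below. *Refinement setting.* $A$ has a graded triangular basis with weight poset $\Lambda$ and, for each $\lambda\in\Lambda$, $(\mathbf B_\lambda,\le_\lambda)$ is a finite poset and $A_\lambda$ is equipped with a system of distinguished idempotents and a graded triangular basis with weight poset $\mathbf B_\lambda$ making it based affine quasi-hereditary. Write $\Delta_\lambda(b),\bar\Delta_\lambda(b),\bar\nabla_\lambda(b),\nabla_\lambda(b),L_\lambda(b)$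 for the resulting $A_\lambda$-modules, let $\mathbf B=\coprod_\lambda\mathbf B_\lambda$, and for $b\in\mathbf B_\lambda$ let $L(b)$ be the irreducible head of $j^\lambda_!L_\lambda(b)$, let $P(b)$ be a projective cover of $L(b)$ in the category of graded $A$-modules, and let $$\blacktriangle(b)=j^\lambda_!\Delta_\lambda(b),\qquad \bar\blacktriangle(b)=j^\lambda_!\bar\Delta_\lambda(b),\qquad \bar\blacktriangledown(b)=j^\lambda_*\bar\nabla_\lambda(b).$$ A $\blacktriangle$-layer of type $b$ is a module isomorphic to $j^\lambda_!V$ for a $\Delta_\lambda$-layer $V$ of type $b$, and a $\blacktriangle$-flag is a finite graded filtration whose sections are $\blacktriangle$-layers of distinct types. If $V$ has a $\blacktriangle$-flag, put $(V:\blacktriangle(a))_q=\overline{\dim_q\operatorname{Hom}_A(V,\bar\blacktriangledown(a))}$. Then for all $a,b\in\mathbf B$ the module $P(b)$ has a $\blacktriangle$-flag, the coefficients of $(P(b):\blacktriangle(a))_q$ are finite, and $$(P(b):\blacktriangle(a))_q=\overline{[\bar\blacktriangledown(a):L(b)]_q}.$$ Suppose moreover that $\tau:A\to A$ is a graded algebra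 anti-automorphism fixing every $1_i$, and let $V\mapsto V^{\tau}$ be the induced duality on graded $A_\lambda$-modules (graded dual, with action twisted by $\tau$). If $L_\lambda(b)^\tau\cong L_\lambda(b)$ and $\nabla_\lambda(b)^\tau\cong\Delta_\lambda(b)$ for all $\lambda\in\Lambda$ and $b\in\mathbf B_\lambda$, then also $$(P(b):\blacktriangle(a))_q=[\bar\blacktriangle(a):L(b)]_q\qquad\text{for all }a,b\in\mathbf B.$$ -/

import Mathlib

universe u

namespace PureBGG

section Grading

open DirectSum

variable {k : Type*} [Field k] {M : Type*} [AddCommGroup M] [Module k M]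

theorem isInternal_of_proj {ι : Type*} [DecidableEq ι] (G : ι → Submodule k M)
    (p : ι → M →ₗ[k] M) (h1 : ∀ d, ∀ v ∈ G d, p d v = v)
    (h2 : ∀ d e, e ≠ d → ∀ v ∈ G e, p d v = 0) (h3 : ⨆ d, G d = ⊤) :
    IsInternal G := by
  rw [isInternal_submodule_iff_iSupIndep_and_iSup_eq_top]
  refine ⟨?_, h3⟩
  intro d
  rw [Submodule.disjoint_def]
  intro x hx hx'
  have hle : (⨆ j, ⨆ (_ : j ≠ d), G j) ≤ LinearMap.ker (p d) := by
    refine iSup_le fun j => iSup_le fun hj => ?_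
    intro v hv
    exact h2 d j hj v hv
  rw [← h1 d x hx]
  exact hle hx'

theorem isInternal_sub {G : ℤ → Submodule k M} (hG : iSupIndep G) (C : Submodule k M)
    (hC : C ≤ ⨆ d, C ⊓ G d) : IsInternal (fun d => (G d).comap C.subtype) := by
  rw [isInternal_submodule_iff_iSupIndep_and_iSup_eq_top]
  have hmap : ∀ d, ((G d).comap C.subtype).map C.subtype = C ⊓ G d := fun d => by
    rw [Submodule.map_comap_subtype]
  constructor
  · intro d
    rw [Submodule.disjoint_def]
    intro x hx hx'
    have h0 : (x : M) ∈ ⨆ j, ⨆ (_ : j ≠ d), G j := by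
      have : (x : M) ∈ (⨆ j, ⨆ (_ : j ≠ d), (G j).comap C.subtype).map C.subtype :=
        ⟨x, hx', rfl⟩
      simp only [Submodule.map_iSup, hmap] at this
      refine SetLike.le_def.1 ?_ this
      exact iSup_mono fun j => iSup_mono fun _ => inf_le_right
    have := Submodule.disjoint_def.1 (hG d) x hx h0
    exact Subtype.ext this
  · apply Submodule.map_injective_of_injective C.injective_subtype
    simp only [Submodule.map_iSup, hmap, Submodule.map_subtype_top]
    exact le_antisymm (iSup_le fun d => inf_le_left) hC

/-- Decomposition of a graded space into its homogeneous components. -/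
noncomputable def dec {G : ℤ → Submodule k M} (hG : IsInternal G) : M ≃ₗ[k] ⨁ d, G d :=
  (LinearEquiv.ofBijective (DirectSum.coeLinearMap G)
    (show Function.Bijective (DirectSum.coeLinearMap G) from hG)).symm

theorem dec_of_mem {G : ℤ → Submodule k M} (hG : IsInternal G) {d : ℤ} {x : M} (hx : x ∈ G d) :
    dec hG x = DirectSum.lof k ℤ (fun i => G i) d ⟨x, hx⟩ := by
  unfold dec
  rw [LinearEquiv.symm_apply_eq]
  simp

/-- The projection onto the component of degree `d`. -/
noncomputable def gproj {G : ℤ → Submodule k M} (hG : IsInternal G) (d : ℤ) : M →ₗ[k] M :=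
  (G d).subtype ∘ₗ DirectSum.component k ℤ (fun i => G i) d ∘ₗ (dec hG).toLinearMap

theorem gproj_of_mem {G : ℤ → Submodule k M} (hG : IsInternal G) {d : ℤ} {x : M}
    (hx : x ∈ G d) : gproj hG d x = x := by
  simp [gproj, dec_of_mem hG hx, DirectSum.component.lof_self]

theorem gproj_of_mem_ne {G : ℤ → Submodule k M} (hG : IsInternal G) {d e : ℤ} (h : e ≠ d) {x : M}
    (hx : x ∈ G e) : gproj hG d x = 0 := by
  simp [gproj, dec_of_mem hG hx, DirectSum.component.of, h]

theorem isInternal_quot {G : ℤ → Submodule k M} (hG : IsInternal G) (N : Submodule k M)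
    (hN : N ≤ ⨆ d, N ⊓ G d) : IsInternal (fun d => (G d).map N.mkQ) := by
  have hst : ∀ d, N ≤ N.comap (gproj hG d) := by
    intro d
    refine hN.trans (iSup_le fun e => ?_)
    rintro x ⟨hx, hxe⟩
    by_cases h : e = d
    · subst h
      rw [Submodule.mem_comap, gproj_of_mem hG hxe]
      exact hx
    · rw [Submodule.mem_comap, gproj_of_mem_ne hG h hxe]
      exact zero_mem _
  refine isInternal_of_proj _ (fun d => N.mapQ N (gproj hG d) (hst d)) ?_ ?_ ?_
  · rintro d _ ⟨x, hx, rfl⟩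
    simp [gproj_of_mem hG hx]
  · rintro d e h _ ⟨x, hx, rfl⟩
    simp [gproj_of_mem_ne hG h hx]
  · rw [← Submodule.map_iSup, hG.submodule_iSup_eq_top, Submodule.map_top, Submodule.range_mkQ]

theorem isHomog_sInf {G : ℤ → Submodule k M} (hG : IsInternal G) (F : Set (Submodule k M))
    (hF : ∀ N ∈ F, N ≤ ⨆ d, N ⊓ G d) : sInf F ≤ ⨆ d, sInf F ⊓ G d := by
  classical
  intro x hx
  have key : ∀ N : Submodule k M, N ≤ (⨆ d, N ⊓ G d) → ∀ y ∈ N, ∀ d, gproj hG d y ∈ N := by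
    intro N hN y hy d
    have : N ≤ N.comap (gproj hG d) := by
      refine hN.trans (iSup_le fun e => ?_)
      rintro x ⟨hx, hxe⟩
      by_cases h : e = d
      · subst h
        rw [Submodule.mem_comap, gproj_of_mem hG hxe]
        exact hx
      · rw [Submodule.mem_comap, gproj_of_mem_ne hG h hxe]
        exact zero_mem _
    exact this hy
  have hmem : ∀ d, gproj hG d x ∈ sInf F ⊓ G d := by
    intro d
    refine ⟨?_, ?_⟩
    · rw [SetLike.mem_coe, Submodule.mem_sInf]
      intro N hN
      exact key N (hF N hN) x (Submodule.mem_sInf.1 hx N hN) d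
    · simp [gproj]
  have hsum : x = ∑ d ∈ (dec hG x).support, gproj hG d x := by
    have h : DirectSum.coeLinearMap G (dec hG x) = x := (dec hG).symm_apply_apply x
    conv_lhs => rw [← h]
    rw [DirectSum.coeLinearMap_eq_dfinsuppSum, DFinsupp.sum]
    rfl
  rw [hsum]
  exact Submodule.sum_mem _ fun d _ => Submodule.mem_iSup_of_mem d (hmem d)

/-- Maps of degree `d` between graded vector spaces. -/
def degHom {N : Type*} [AddCommGroup N] [Module k N] (G : ℤ → Submodule k M)
    (G' : ℤ → Submodule k N) (d : ℤ) : Submodule k (M →ₗ[k] N) where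
  carrier := {f | ∀ n, ∀ x ∈ G n, f x ∈ G' (n + d)}
  add_mem' hf hg n x hx := add_mem (hf n x hx) (hg n x hx)
  zero_mem' _ _ _ := zero_mem _
  smul_mem' c _ hf n x hx := Submodule.smul_mem _ c (hf n x hx)

theorem degHom_indep {N : Type*} [AddCommGroup N] [Module k N] {G : ℤ → Submodule k M}
    {G' : ℤ → Submodule k N} (hG : ⨆ d, G d = ⊤) (hG' : IsInternal G') :
    iSupIndep (degHom G G') := by
  intro d
  rw [Submodule.disjoint_def]
  intro f hf hf'
  have h0 : ∀ n, ∀ x ∈ G n, f x = 0 := by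
    intro n x hx
    let K : Submodule k (M →ₗ[k] N) :=
      LinearMap.ker ((gproj hG' (n + d)) ∘ₗ (LinearMap.applyₗ (R := k) x : (M →ₗ[k] N) →ₗ[k] N))
    have hK : (⨆ j, ⨆ (_ : j ≠ d), degHom G G' j) ≤ K := by
      refine iSup_le fun j => iSup_le fun hj => ?_
      intro g hg
      have := gproj_of_mem_ne hG' (d := n + d) (e := n + j) (by omega) (hg n x hx)
      simpa [K] using this
    have h1 : gproj hG' (n + d) (f x) = 0 := by simpa [K] using hK hf'
    rwa [gproj_of_mem hG' (hf n x hx)] at h1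
  ext x
  have hx : x ∈ ⨆ d, G d := by rw [hG]; trivial
  have : (⨆ d, G d) ≤ LinearMap.ker f := iSup_le fun n x hx => h0 n x hx
  simpa using this hx

open TensorProduct in
/-- Total grading on a tensor product. -/
def tensorDeg {N : Type*} [AddCommGroup N] [Module k N] (G : ℤ → Submodule k M)
    (G' : ℤ → Submodule k N) (n : ℤ) : Submodule k (M ⊗[k] N) :=
  Submodule.span k {t | ∃ p q : ℤ, p + q = n ∧ ∃ x ∈ G p, ∃ y ∈ G' q, t = x ⊗ₜ[k] y}

open TensorProduct in
theorem tensorDeg_isInternal {N : Type*} [AddCommGroup N] [Module k N] {G : ℤ → Submodule k M}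
    {G' : ℤ → Submodule k N} (hG : IsInternal G) (hG' : IsInternal G') :
    IsInternal (tensorDeg G G') := by
  let φ : ℤ → M →ₗ[k] N →ₗ[k] M ⊗[k] N := fun n =>
    (DirectSum.toModule k ℤ (N →ₗ[k] M ⊗[k] N) (fun p =>
      ((TensorProduct.mk k M N).compl₂ (gproj hG' (n - p))) ∘ₗ (G p).subtype)) ∘ₗ
    (dec hG).toLinearMap
  have hφ : ∀ n p x y, x ∈ G p → φ n x y = x ⊗ₜ gproj hG' (n - p) y := by
    intro n p x y hx
    simp [φ, dec_of_mem hG hx]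
  refine isInternal_of_proj _ (fun n => TensorProduct.lift (φ n)) ?_ ?_ ?_
  · intro d v hv
    induction hv using Submodule.span_induction with
    | mem t ht =>
      obtain ⟨p, q, hpq, x, hx, y, hy, rfl⟩ := ht
      rw [TensorProduct.lift.tmul, hφ d p x y hx,
        show d - p = q by omega, gproj_of_mem hG' hy]
    | zero => simp
    | add a b _ _ ha hb => simp [ha, hb]
    | smul c a _ ha => simp [ha]
  · intro d e h v hv
    induction hv using Submodule.span_induction with
    | mem t ht =>
      obtain ⟨p, q, hpq, x, hx, y, hy, rfl⟩ := ht
      rw [TensorProduct.lift.tmul, hφ d p x y hx,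
        gproj_of_mem_ne hG' (d := d - p) (e := q) (by omega) hy, tmul_zero]
    | zero => simp
    | add a b _ _ ha hb => simp [ha, hb]
    | smul c a _ ha => simp [ha]
  · rw [eq_top_iff, ← TensorProduct.span_tmul_eq_top, Submodule.span_le]
    rintro _ ⟨x, y, rfl⟩
    have hx : x ∈ ⨆ d, G d := by rw [hG.submodule_iSup_eq_top]; trivial
    have hy : y ∈ ⨆ d, G' d := by rw [hG'.submodule_iSup_eq_top]; trivial
    rw [SetLike.mem_coe]
    induction hx using Submodule.iSup_induction' with
    | mem p x hx =>
      induction hy using Submodule.iSup_induction' with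
      | mem q y hy =>
        exact Submodule.mem_iSup_of_mem (p + q)
          (Submodule.subset_span ⟨p, q, rfl, x, hx, y, hy, rfl⟩)
      | zero => simp
      | add a b _ _ ha hb => rw [tmul_add]; exact add_mem ha hb
    | zero => simp
    | add a b _ _ ha hb => rw [add_tmul]; exact add_mem ha hb

end Grading


/-- A `ℤ`-graded associative, not necessarily unital, algebra over `k`. -/
structure GrAlg (k : Type u) [Field k] where
  carrier : Type u
  [ring : NonUnitalRing carrier]
  [module : Module k carrier]
  [tower : IsScalarTower k carrier carrier]
  [comm : SMulCommClass k carrier carrier]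
  deg : ℤ → Submodule k carrier
  internal : DirectSum.IsInternal deg
  mul_mem : ∀ {m n : ℤ} {a b : carrier}, a ∈ deg m → b ∈ deg n → a * b ∈ deg (m + n)

namespace GrAlg

variable {k : Type u} [Field k]

instance : CoeSort (GrAlg k) (Type u) := ⟨GrAlg.carrier⟩

attribute [instance] GrAlg.ring GrAlg.module GrAlg.tower GrAlg.comm

/-- Homogeneous idempotents (these are necessarily of degree `0`). -/
structure Idem (A : GrAlg k) where
  val : A
  mem : val ∈ A.deg 0
  mul_self : val * val = val

/-- The Peirce component `e A f`, for idempotents `e` and `f`. -/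
def peirce (A : GrAlg k) (e f : A) : Submodule k A where
  carrier := {a | e * a = a ∧ a * f = a}
  add_mem' ha hb := ⟨by rw [mul_add, ha.1, hb.1], by rw [add_mul, ha.2, hb.2]⟩
  zero_mem' := ⟨mul_zero _, zero_mul _⟩
  smul_mem' c _ ha := ⟨by rw [mul_smul_comm, ha.1], by rw [smul_mul_assoc, ha.2]⟩

/-- The two-sided ideal generated by a set of homogeneous idempotents (each `t ∈ E` is `t * t * t`,
so the elements `a * t * b` span the ideal). -/
def ideal (A : GrAlg k) (E : Set A.Idem) : Submodule k A :=
  Submodule.span k {x | ∃ t ∈ E, ∃ a b : A, x = a * t.val * b}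

theorem exists_homog (A : GrAlg k) (a : A) : a ∈ ⨆ d, A.deg d := by
  rw [A.internal.submodule_iSup_eq_top]; trivial

theorem ideal_homog (A : GrAlg k) (E : Set A.Idem) :
    A.ideal E ≤ ⨆ d, A.ideal E ⊓ A.deg d := by
  refine Submodule.span_le.2 ?_
  rintro _ ⟨t, ht, a, b, rfl⟩
  rw [SetLike.mem_coe]
  induction A.exists_homog a using Submodule.iSup_induction' with
  | mem p a ha =>
    induction A.exists_homog b using Submodule.iSup_induction' with
    | mem q b hb =>
      exact Submodule.mem_iSup_of_mem (p + 0 + q)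
        ⟨Submodule.subset_span ⟨t, ht, a, b, rfl⟩, A.mul_mem (A.mul_mem ha t.mem) hb⟩
    | zero => simp
    | add x y _ _ hx hy => rw [mul_add]; exact add_mem hx hy
  | zero => simp
  | add x y _ _ hx hy => rw [add_mul, add_mul]; exact add_mem hx hy

theorem mul_mem_ideal_left (A : GrAlg k) (E : Set A.Idem) (a : A) {x : A} (hx : x ∈ A.ideal E) :
    a * x ∈ A.ideal E := by
  induction hx using Submodule.span_induction with
  | mem x h =>
    obtain ⟨t, ht, b, c, rfl⟩ := h
    exact Submodule.subset_span ⟨t, ht, a * b, c, by simp only [mul_assoc]⟩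
  | zero => simp
  | add x y _ _ hx hy => rw [mul_add]; exact add_mem hx hy
  | smul c x _ hx => rw [mul_smul_comm]; exact Submodule.smul_mem _ _ hx

theorem mul_mem_ideal_right (A : GrAlg k) (E : Set A.Idem) (a : A) {x : A} (hx : x ∈ A.ideal E) :
    x * a ∈ A.ideal E := by
  induction hx using Submodule.span_induction with
  | mem x h =>
    obtain ⟨t, ht, b, c, rfl⟩ := h
    exact Submodule.subset_span ⟨t, ht, b, c * a, by simp only [mul_assoc]⟩
  | zero => simp
  | add x y _ _ hx hy => rw [add_mul]; exact add_mem hx hy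
  | smul c x _ hx => rw [smul_mul_assoc]; exact Submodule.smul_mem _ _ hx

/-- Multiplication on the quotient by `A.ideal E`. -/
def quotMul (A : GrAlg k) (E : Set A.Idem) (x y : A ⧸ A.ideal E) : A ⧸ A.ideal E :=
  Quotient.map₂ (· * ·) (by
    intro a a' h b b' h'
    replace h := (Submodule.quotientRel_def _).1 h
    replace h' := (Submodule.quotientRel_def _).1 h'
    refine (Submodule.quotientRel_def _).2 ?_
    have : a * b - a' * b' = (a - a') * b + a' * (b - b') := by
      rw [sub_mul, mul_sub]; abel
    rw [this]
    exact add_mem (A.mul_mem_ideal_right E b h) (A.mul_mem_ideal_left E a' h')) x y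

/-- The quotient of `A` by the two-sided ideal generated by a set of homogeneous idempotents. -/
def quot (A : GrAlg k) (E : Set A.Idem) : GrAlg k :=
  letI : NonUnitalRing (A ⧸ A.ideal E) :=
    { (inferInstance : AddCommGroup (A ⧸ A.ideal E)) with
      mul := A.quotMul E
      left_distrib := by
        rintro ⟨a⟩ ⟨b⟩ ⟨c⟩; exact congrArg (A.ideal E).mkQ (mul_add a b c)
      right_distrib := by
        rintro ⟨a⟩ ⟨b⟩ ⟨c⟩; exact congrArg (A.ideal E).mkQ (add_mul a b c)
      zero_mul := by
        rintro ⟨a⟩; exact congrArg (A.ideal E).mkQ (zero_mul a)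
      mul_zero := by
        rintro ⟨a⟩; exact congrArg (A.ideal E).mkQ (mul_zero a)
      mul_assoc := by
        rintro ⟨a⟩ ⟨b⟩ ⟨c⟩; exact congrArg (A.ideal E).mkQ (mul_assoc a b c) }
  { carrier := A ⧸ A.ideal E
    tower := ⟨by rintro c ⟨a⟩ ⟨b⟩; exact congrArg (A.ideal E).mkQ (smul_mul_assoc c a b)⟩
    comm := ⟨by rintro c ⟨a⟩ ⟨b⟩; exact congrArg (A.ideal E).mkQ (mul_smul_comm c a b).symm⟩
    deg := fun d => (A.deg d).map (A.ideal E).mkQ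
    internal := isInternal_quot A.internal _ (A.ideal_homog E)
    mul_mem := by
      rintro m n _ _ ⟨a, ha, rfl⟩ ⟨b, hb, rfl⟩
      exact ⟨a * b, A.mul_mem ha hb, rfl⟩ }

/-- The quotient map. -/
def toQuot (A : GrAlg k) (E : Set A.Idem) : A →ₗ[k] A.quot E := (A.ideal E).mkQ

theorem toQuot_surjective (A : GrAlg k) (E : Set A.Idem) : Function.Surjective (A.toQuot E) :=
  (A.ideal E).mkQ_surjective

theorem toQuot_mul (A : GrAlg k) (E : Set A.Idem) (a b : A) :
    A.toQuot E (a * b) = A.toQuot E a * A.toQuot E b := rfl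

theorem toQuot_mem (A : GrAlg k) (E : Set A.Idem) {d : ℤ} {a : A} (h : a ∈ A.deg d) :
    A.toQuot E a ∈ (A.quot E).deg d := ⟨a, h, rfl⟩

/-- The image in a quotient of an idempotent. -/
def Idem.bar {A : GrAlg k} (E : Set A.Idem) (e : A.Idem) : (A.quot E).Idem where
  val := A.toQuot E e.val
  mem := A.toQuot_mem E e.mem
  mul_self := by rw [← A.toQuot_mul, e.mul_self]

/-- The underlying subalgebra of `e A e`. -/
def cornerSub (A : GrAlg k) (e : A.Idem) : NonUnitalSubalgebra k A where
  toSubmodule := A.peirce e.val e.val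
  mul_mem' {a b} ha hb := ⟨by rw [← mul_assoc, ha.1], by rw [mul_assoc, hb.2]⟩

theorem cornerSub_homog (A : GrAlg k) (e : A.Idem) :
    (A.cornerSub e).toSubmodule ≤ ⨆ d, (A.cornerSub e).toSubmodule ⊓ A.deg d := by
  intro a ha
  have key : ∀ b : A, e.val * b * e.val ∈ ⨆ d, (A.cornerSub e).toSubmodule ⊓ A.deg d := by
    intro b
    induction A.exists_homog b using Submodule.iSup_induction' with
    | mem p b hb =>
      have h := A.mul_mem (A.mul_mem e.mem hb) e.mem
      rw [zero_add, add_zero] at h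
      refine Submodule.mem_iSup_of_mem p ⟨⟨?_, ?_⟩, h⟩
      · rw [← mul_assoc, ← mul_assoc, e.mul_self]
      · rw [mul_assoc, e.mul_self]
    | zero => simp
    | add x y _ _ hx hy => rw [mul_add, add_mul]; exact add_mem hx hy
  have := key a
  rwa [ha.1, ha.2] at this

/-- The algebra `e A e`. -/
def corner (A : GrAlg k) (e : A.Idem) : GrAlg k where
  carrier := A.cornerSub e
  deg d := (A.deg d).comap (A.cornerSub e).toSubmodule.subtype
  internal := isInternal_sub A.internal.submodule_iSupIndep _ (A.cornerSub_homog e)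
  mul_mem ha hb := A.mul_mem ha hb

/-- The inclusion of `e A e` into `A`. -/
def incl (A : GrAlg k) (e : A.Idem) : A.corner e →ₗ[k] A := (A.cornerSub e).toSubmodule.subtype

/-- The identity element `e` of `e A e`. -/
def cornerOne (A : GrAlg k) (e : A.Idem) : A.corner e := ⟨e.val, e.mul_self, e.mul_self⟩

theorem cornerOne_mem (A : GrAlg k) (e : A.Idem) : A.cornerOne e ∈ (A.corner e).deg 0 := e.mem

theorem cornerOne_mul (A : GrAlg k) (e : A.Idem) (a : A.corner e) : A.cornerOne e * a = a :=
  Subtype.ext a.2.1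

theorem mul_cornerOne (A : GrAlg k) (e : A.Idem) (a : A.corner e) : a * A.cornerOne e = a :=
  Subtype.ext a.2.2

/-- A degree-preserving anti-automorphism. -/
structure Anti (A : GrAlg k) where
  toEquiv : A ≃ₗ[k] A
  map_mul : ∀ a b : A, toEquiv (a * b) = toEquiv b * toEquiv a
  map_deg : ∀ (d : ℤ) (a : A), a ∈ A.deg d → toEquiv a ∈ A.deg d

end GrAlg

/-- A distinguished system of mutually orthogonal homogeneous idempotents `one i` making `A` into a
locally unital algebra, `A` being the direct sum of the `one i * A * one j`. Only the fact that these
subspaces span `A` has to be demanded: their sum is direct by orthogonality. -/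
structure LocalUnits {k : Type u} [Field k] (A : GrAlg k) (I : Type*) where
  one : I → A.Idem
  orth : ∀ {i j : I}, i ≠ j → (one i).val * (one j).val = 0
  span : ⨆ i, ⨆ j, A.peirce (one i).val (one j).val = ⊤

namespace LocalUnits

variable {k : Type u} [Field k] {A : GrAlg k} {I : Type*} (U : LocalUnits A I)

theorem peirce_isInternal [DecidableEq (I × I)] : DirectSum.IsInternal
    (fun p : I × I => A.peirce (U.one p.1).val (U.one p.2).val) := by
  refine isInternal_of_proj _ (fun p =>
    (LinearMap.mulRight k (U.one p.2).val) ∘ₗ (LinearMap.mulLeft k (U.one p.1).val)) ?_ ?_ ?_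
  · rintro p v ⟨h1, h2⟩
    simp [h1, h2]
  · rintro p r h v ⟨h1, h2⟩
    simp only [LinearMap.comp_apply, LinearMap.mulLeft_apply, LinearMap.mulRight_apply]
    by_cases hp : p.1 = r.1
    · have hq : r.2 ≠ p.2 := fun hq => h (Prod.ext hp.symm hq)
      rw [← h2, mul_assoc, mul_assoc, U.orth hq, mul_zero, mul_zero]
    · rw [← h1, ← mul_assoc, U.orth hp, zero_mul, zero_mul]
  · rw [← U.span, iSup_prod]

/-- `A` is locally finite-dimensional and bounded below. -/
def LocFinBddBelow : Prop :=
  ∀ i j, (∀ d, FiniteDimensional k ↥(A.peirce (U.one i).val (U.one j).val ⊓ A.deg d)) ∧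
    ∃ N : ℤ, ∀ d < N, A.peirce (U.one i).val (U.one j).val ⊓ A.deg d = ⊥

/-- The induced local units in a quotient. -/
def quot (E : Set A.Idem) : LocalUnits (A.quot E) I where
  one i := (U.one i).bar E
  orth h := by
    change A.toQuot E _ * A.toQuot E _ = 0
    rw [← A.toQuot_mul, U.orth h, map_zero]
  span := by
    rw [eq_top_iff]
    intro x _
    obtain ⟨a, rfl⟩ := A.toQuot_surjective E x
    have ha : a ∈ ⨆ i, ⨆ j, A.peirce (U.one i).val (U.one j).val := by rw [U.span]; trivial
    have hle : (⨆ i, ⨆ j, A.peirce (U.one i).val (U.one j).val) ≤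
        (⨆ i, ⨆ j, (A.quot E).peirce ((U.one i).bar E).val ((U.one j).bar E).val).comap (A.toQuot E) := by
      refine iSup_le fun i => iSup_le fun j => ?_
      rintro b ⟨h1, h2⟩
      refine Submodule.mem_iSup_of_mem i (Submodule.mem_iSup_of_mem j ⟨?_, ?_⟩)
      · exact (A.toQuot_mul E _ _).symm.trans (congrArg _ h1)
      · exact (A.toQuot_mul E _ _).symm.trans (congrArg _ h2)
    exact hle ha

theorem mem_iSup_homog (a : A) :
    a ∈ ⨆ i, ⨆ d, (LinearMap.ker (LinearMap.mulLeft k (U.one i).val - LinearMap.id)) ⊓ A.deg d := by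
  have ha : a ∈ ⨆ i, ⨆ j, A.peirce (U.one i).val (U.one j).val := by rw [U.span]; trivial
  refine (iSup_le fun i => iSup_le fun j => ?_ :
    (⨆ i, ⨆ j, A.peirce (U.one i).val (U.one j).val) ≤ _) ha
  rintro b ⟨h1, -⟩
  refine Submodule.mem_iSup_of_mem i ?_
  rw [← h1]
  clear h1
  induction A.exists_homog b using Submodule.iSup_induction' with
  | mem p b hb =>
    have h := A.mul_mem (U.one i).mem hb
    rw [zero_add] at h
    refine Submodule.mem_iSup_of_mem p ⟨?_, h⟩
    simp [← mul_assoc, (U.one i).mul_self]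
  | zero => simp
  | add x y _ _ hx hy => rw [mul_add]; exact add_mem hx hy

end LocalUnits

/-- Graded left modules. The last field is local unitality: it says `A V = V`, which for a locally
unital algebra means that `V` is the direct sum of the subspaces `1_i V`, whatever the chosen
distinguished idempotents (see `GMod.isInternal_one`). -/
structure GMod {k : Type u} [Field k] (A : GrAlg k) where
  carrier : Type u
  [group : AddCommGroup carrier]
  [module : Module k carrier]
  act : A →ₗ[k] carrier →ₗ[k] carrier
  act_mul : ∀ (a b : A) (v : carrier), act (a * b) v = act a (act b v)
  deg : ℤ → Submodule k carrier
  internal : DirectSum.IsInternal deg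
  act_mem : ∀ {m n : ℤ} {a : A} {v : carrier}, a ∈ A.deg m → v ∈ deg n → act a v ∈ deg (m + n)
  span_act : ∀ v : carrier, v ∈ Submodule.span k {w | ∃ a u, w = act a u}

namespace GMod

variable {k : Type u} [Field k] {A : GrAlg k}

instance : CoeSort (GMod A) (Type u) := ⟨GMod.carrier⟩

attribute [instance] GMod.group GMod.module

theorem isInternal_one {I : Type*} [DecidableEq I] (U : LocalUnits A I) (V : GMod A) :
    DirectSum.IsInternal (fun i => LinearMap.range (V.act (U.one i).val)) := by
  refine isInternal_of_proj _ (fun i => V.act (U.one i).val) ?_ ?_ ?_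
  · rintro i _ ⟨v, rfl⟩
    rw [← V.act_mul, (U.one i).mul_self]
  · rintro i j h _ ⟨v, rfl⟩
    rw [← V.act_mul, U.orth h.symm, map_zero, LinearMap.zero_apply]
  · rw [eq_top_iff]
    intro v _
    refine (Submodule.span_le.2 ?_ : _ ≤ _) (V.span_act v)
    rintro _ ⟨a, w, rfl⟩
    have ha := U.mem_iSup_homog a
    have hle : (⨆ i, ⨆ d, (LinearMap.ker (LinearMap.mulLeft k (U.one i).val - LinearMap.id)) ⊓
        A.deg d) ≤ (⨆ i, LinearMap.range (V.act (U.one i).val)).comap (V.act.flip w) := by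
      refine iSup_le fun i => iSup_le fun d => ?_
      rintro b ⟨hb, -⟩
      have hb' : (U.one i).val * b = b := by simpa [sub_eq_zero] using hb
      refine Submodule.mem_iSup_of_mem i ⟨V.act b w, ?_⟩
      rw [LinearMap.flip_apply, ← V.act_mul, hb']
    exact hle ha

/-- The space `Hom_A(V, W)_d` of module homomorphisms of degree `d`. -/
def hom (V W : GMod A) (d : ℤ) : Submodule k (V →ₗ[k] W) where
  carrier := {f | f ∈ degHom V.deg W.deg d ∧ ∀ a v, f (V.act a v) = W.act a (f v)}
  add_mem' hf hg := ⟨add_mem hf.1 hg.1, fun a v => by simp [hf.2, hg.2]⟩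
  zero_mem' := ⟨zero_mem _, fun a v => by simp⟩
  smul_mem' c _ hf := ⟨Submodule.smul_mem _ c hf.1, fun a v => by simp [hf.2]⟩

/-- Isomorphism in the category of graded modules and degree-preserving homomorphisms. -/
def Iso (V W : GMod A) : Prop := ∃ e : V ≃ₗ[k] W, e.toLinearMap ∈ hom V W 0

/-- The degree shift `q ^ m V`, with `(q ^ m V)_d = V_(d + m)`. -/
def shift (V : GMod A) (m : ℤ) : GMod A where
  carrier := V
  act := V.act
  act_mul := V.act_mul
  deg d := V.deg (d + m)
  internal := by
    rw [DirectSum.isInternal_submodule_iff_iSupIndep_and_iSup_eq_top]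
    refine ⟨V.internal.submodule_iSupIndep.comp (add_left_injective m), ?_⟩
    rw [← V.internal.submodule_iSup_eq_top]
    exact (Equiv.addRight m).iSup_comp (g := V.deg)
  act_mem {p n a v} ha hv := by
    rw [add_assoc]; exact V.act_mem ha hv
  span_act := V.span_act

/-- Graded submodules. -/
def IsGSub (V : GMod A) (W : Submodule k V) : Prop :=
  (∀ a, ∀ w ∈ W, V.act a w ∈ W) ∧ W ≤ ⨆ d, W ⊓ V.deg d

/-- The quotient by a graded submodule. -/
def quot (V : GMod A) (W : Submodule k V) (hW : V.IsGSub W) : GMod A where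
  carrier := V ⧸ W
  act :=
    { toFun := fun a => W.mapQ W (V.act a) (hW.1 a)
      map_add' := fun a b => by ext v; simp
      map_smul' := fun c a => by ext v; simp }
  act_mul a b v := by
    induction v using Submodule.Quotient.induction_on with
    | H v => simp [V.act_mul]
  deg d := (V.deg d).map W.mkQ
  internal := isInternal_quot V.internal W hW.2
  act_mem := by
    rintro m n a _ ha ⟨v, hv, rfl⟩
    exact ⟨V.act a v, V.act_mem ha hv, by simp⟩
  span_act v := by
    obtain ⟨v, rfl⟩ := W.mkQ_surjective v
    have h := Submodule.mem_map_of_mem (f := W.mkQ) (V.span_act v)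
    rw [Submodule.map_span] at h
    refine Submodule.span_mono ?_ h
    rintro _ ⟨_, ⟨a, w, rfl⟩, rfl⟩
    exact ⟨a, W.mkQ w, by simp⟩

/-- Maximal (proper) graded submodules. -/
def IsMaxGSub (V : GMod A) (W : Submodule k V) : Prop :=
  V.IsGSub W ∧ W ≠ ⊤ ∧ ∀ W', V.IsGSub W' → W ≤ W' → W' = W ∨ W' = ⊤

/-- The radical: the intersection of all maximal graded submodules. -/
def rad (V : GMod A) : Submodule k V := sInf {W | V.IsMaxGSub W}

theorem rad_isGSub (V : GMod A) : V.IsGSub V.rad := by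
  refine ⟨fun a w hw => ?_, isHomog_sInf V.internal _ fun W hW => hW.1.2⟩
  rw [rad, Submodule.mem_sInf] at hw ⊢
  exact fun W hW => hW.1.1 a w (hw W hW)

/-- The cosocle `V / rad V`. -/
def cosoc (V : GMod A) : GMod A := V.quot V.rad V.rad_isGSub

/-- Projective objects in the category of graded modules. -/
def Projective (P : GMod A) : Prop :=
  ∀ (V W : GMod A) (g : V →ₗ[k] W) (f : P →ₗ[k] W), g ∈ hom V W 0 → f ∈ hom P W 0 →
    Function.Surjective g → ∃ h ∈ hom P V 0, g ∘ₗ h = f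

/-- Injective objects in the category of graded modules. -/
def Injective (J : GMod A) : Prop :=
  ∀ (V W : GMod A) (g : V →ₗ[k] W) (f : V →ₗ[k] J), g ∈ hom V W 0 → f ∈ hom V J 0 →
    Function.Injective g → ∃ h ∈ hom W J 0, h ∘ₗ g = f

/-- `P` is a projective cover of `L`: projective with a surjection onto `L` whose kernel is
superfluous. -/
def IsProjectiveCover (P L : GMod A) : Prop :=
  P.Projective ∧ ∃ f ∈ hom P L 0, Function.Surjective f ∧
    ∀ W, P.IsGSub W → W ⊔ LinearMap.ker f = ⊤ → W = ⊤

/-- `J` is an injective hull of `L`: injective with an embedding of `L` as an essential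
submodule. -/
def IsInjectiveHull (J L : GMod A) : Prop :=
  J.Injective ∧ ∃ f ∈ hom L J 0, Function.Injective f ∧
    ∀ W, J.IsGSub W → W ⊓ LinearMap.range f = ⊥ → W = ⊥

/-- For graded submodules `W' ≤ W` of `V`, the section `W / W'` is isomorphic to `M`. -/
def IsSection (V : GMod A) (W' W : Submodule k V) (M : GMod A) : Prop :=
  ∃ f : W →ₗ[k] M, Function.Surjective f ∧ LinearMap.ker f = W'.comap W.subtype ∧
    (∀ d, ∀ w : W, (w : V) ∈ V.deg d → f w ∈ M.deg d) ∧
    ∀ a, ∀ w w' : W, (w' : V) = V.act a w → f w' = M.act a (f w)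

/-- Finite graded filtrations `0 = V_0 ⊆ V_1 ⊆ ... ⊆ V_n = V`. -/
structure Filtration (V : GMod A) (n : ℕ) where
  toFun : Fin (n + 1) → Submodule k V
  isGSub : ∀ r, V.IsGSub (toFun r)
  mono : Monotone toFun
  bot : toFun 0 = ⊥
  top : toFun (Fin.last n) = ⊤

/-- The section `V_(r + 1) / V_r` of the filtration is isomorphic to `M`. -/
def Filtration.SectionIso {V : GMod A} {n : ℕ} (F : V.Filtration n) (r : Fin n) (M : GMod A) :
    Prop :=
  V.IsSection (F.toFun r.castSucc) (F.toFun r.succ) M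

/-- The graded multiplicity `[V : L]_q`, as the sequence of its coefficients. -/
noncomputable def mult (V L : GMod A) (d : ℤ) : ℕ∞ :=
  ⨆ (n : ℕ) (F : V.Filtration n), {r : Fin n | F.SectionIso r (L.shift d)}.encard

/-- The graded dimension of `Hom_A(V, W)`, as the sequence of its coefficients: the coefficient of
`q ^ d` is the dimension of `Hom_A(V, W)_(-d)`. -/
noncomputable def dimHom (V W : GMod A) (d : ℤ) : ℕ∞ :=
  Cardinal.toENat (Module.rank k (hom V W (-d)))

/-- Locally finite-dimensional and bounded below modules, for a unital algebra. -/
def LocFinBddBelow (V : GMod A) : Prop :=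
  (∀ d, FiniteDimensional k (V.deg d)) ∧ ∃ N : ℤ, ∀ d < N, V.deg d = ⊥

/-- Modules over a quotient of `A` viewed as `A`-modules. -/
def inflate {E : Set A.Idem} (V : GMod (A.quot E)) : GMod A where
  carrier := V
  act := V.act ∘ₗ A.toQuot E
  act_mul a b v := V.act_mul (A.toQuot E a) (A.toQuot E b) v
  deg := V.deg
  internal := V.internal
  act_mem ha hv := V.act_mem (A.toQuot_mem E ha) hv
  span_act v := by
    refine Submodule.span_mono ?_ (V.span_act v)
    rintro _ ⟨a, w, rfl⟩
    obtain ⟨a, rfl⟩ := A.toQuot_surjective E a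
    exact ⟨a, w, rfl⟩

section Corner

variable (e : A.Idem)

/-- The left regular module of the unital algebra `e A e`. -/
def regular : GMod (A.corner e) where
  carrier := A.corner e
  act := LinearMap.mul k (A.corner e)
  act_mul a b v := mul_assoc a b v
  deg := (A.corner e).deg
  internal := (A.corner e).internal
  act_mem := (A.corner e).mul_mem
  span_act v := Submodule.subset_span ⟨A.cornerOne e, v, (A.cornerOne_mul e v).symm⟩

theorem act_cornerOne (V : GMod (A.corner e)) (v : V) : V.act (A.cornerOne e) v = v := by
  induction V.span_act v using Submodule.span_induction with
  | mem x h =>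
    obtain ⟨a, w, rfl⟩ := h
    rw [← V.act_mul, A.cornerOne_mul]
  | zero => simp
  | add x y _ _ hx hy => rw [map_add, hx, hy]
  | smul c x _ hx => rw [map_smul, hx]

/-- The right `e A e`-module `A e`. -/
def leftIdeal : Submodule k A where
  carrier := {x | x * e.val = x}
  add_mem' hx hy := (add_mul _ _ _).trans (congrArg₂ _ hx hy)
  zero_mem' := zero_mul _
  smul_mem' c x hx := (smul_mul_assoc c x _).trans (congrArg _ hx)

/-- The left `e A e`-module `e A`. -/
def rightIdeal : Submodule k A where
  carrier := {x | e.val * x = x}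
  add_mem' hx hy := (mul_add _ _ _).trans (congrArg₂ _ hx hy)
  zero_mem' := mul_zero _
  smul_mem' c x hx := (mul_smul_comm c _ x).trans (congrArg _ hx)

theorem leftIdeal_homog : leftIdeal e ≤ ⨆ d, leftIdeal e ⊓ A.deg d := by
  intro a ha
  have key : ∀ b : A, b * e.val ∈ ⨆ d, leftIdeal e ⊓ A.deg d := by
    intro b
    induction A.exists_homog b using Submodule.iSup_induction' with
    | mem p b hb =>
      have h := A.mul_mem hb e.mem
      rw [add_zero] at h
      refine Submodule.mem_iSup_of_mem p ⟨?_, h⟩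
      change b * e.val * e.val = b * e.val
      rw [mul_assoc, e.mul_self]
    | zero => simp
    | add x y _ _ hx hy => rw [add_mul]; exact add_mem hx hy
  have := key a
  rwa [show a * e.val = a from ha] at this

theorem rightIdeal_homog : rightIdeal e ≤ ⨆ d, rightIdeal e ⊓ A.deg d := by
  intro a ha
  have key : ∀ b : A, e.val * b ∈ ⨆ d, rightIdeal e ⊓ A.deg d := by
    intro b
    induction A.exists_homog b using Submodule.iSup_induction' with
    | mem p b hb =>
      have h := A.mul_mem e.mem hb
      rw [zero_add] at h
      refine Submodule.mem_iSup_of_mem p ⟨?_, h⟩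
      change e.val * (e.val * b) = e.val * b
      rw [← mul_assoc, e.mul_self]
    | zero => simp
    | add x y _ _ hx hy => rw [mul_add]; exact add_mem hx hy
  have := key a
  rwa [show e.val * a = a from ha] at this

/-- The grading on `A e`. -/
def leftDeg (d : ℤ) : Submodule k (leftIdeal e) := (A.deg d).comap (leftIdeal e).subtype

/-- The grading on `e A`. -/
def rightDeg (d : ℤ) : Submodule k (rightIdeal e) := (A.deg d).comap (rightIdeal e).subtype

theorem leftDeg_isInternal : DirectSum.IsInternal (leftDeg e) :=
  isInternal_sub A.internal.submodule_iSupIndep _ (leftIdeal_homog e)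

theorem rightDeg_isInternal : DirectSum.IsInternal (rightDeg e) :=
  isInternal_sub A.internal.submodule_iSupIndep _ (rightIdeal_homog e)

/-- Left multiplication of `A` on `A e`. -/
def leftMul : A →ₗ[k] leftIdeal e →ₗ[k] leftIdeal e :=
  LinearMap.mk₂ k (fun a x => ⟨a * x, by
      change a * x.1 * e.val = a * x.1
      rw [mul_assoc, show x.1 * e.val = x.1 from x.2]⟩)
    (fun a b x => Subtype.ext (add_mul a b x.1)) (fun c a x => Subtype.ext (smul_mul_assoc c a x.1))
    (fun a x y => Subtype.ext (mul_add a x.1 y.1)) (fun c a x => Subtype.ext (mul_smul_comm c a x.1))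

/-- Right multiplication of `A` on `e A`. -/
def rightMul : A →ₗ[k] rightIdeal e →ₗ[k] rightIdeal e :=
  LinearMap.mk₂ k (fun a x => ⟨x * a, by
      change e.val * (x.1 * a) = x.1 * a
      rw [← mul_assoc, show e.val * x.1 = x.1 from x.2]⟩)
    (fun a b x => Subtype.ext (mul_add x.1 a b)) (fun c a x => Subtype.ext (mul_smul_comm c x.1 a))
    (fun a x y => Subtype.ext (add_mul x.1 y.1 a)) (fun c a x => Subtype.ext (smul_mul_assoc c x.1 a))

/-- Right multiplication of `e A e` on `A e`. -/
def leftIdealMul (x : leftIdeal e) (a : A.corner e) : leftIdeal e :=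
  ⟨x.1 * A.incl e a, by
    change x.1 * a.1 * e.val = x.1 * a.1
    rw [mul_assoc, a.2.2]⟩

/-- Left multiplication of `e A e` on `e A`. -/
def rightIdealMul (a : A.corner e) (x : rightIdeal e) : rightIdeal e :=
  ⟨A.incl e a * x.1, by
    change e.val * (a.1 * x.1) = a.1 * x.1
    rw [← mul_assoc, a.2.1]⟩

open TensorProduct

/-- The relations `x a ⊗ v = x ⊗ a v` (for `a` in `e A e`) in `A e ⊗ V`. -/
def stdRel (V : GMod (A.corner e)) : Submodule k (leftIdeal e ⊗[k] V) :=
  Submodule.span k {t | ∃ (x : leftIdeal e) (a : A.corner e) (v : V),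
    t = leftIdealMul e x a ⊗ₜ[k] v - x ⊗ₜ[k] V.act a v}

theorem stdRel_homog (V : GMod (A.corner e)) :
    stdRel e V ≤ ⨆ d, stdRel e V ⊓ tensorDeg (leftDeg e) V.deg d := by
  refine Submodule.span_le.2 ?_
  rintro _ ⟨x, a, v, rfl⟩
  rw [SetLike.mem_coe]
  have hx : x ∈ ⨆ d, leftDeg e d := by
    rw [(leftDeg_isInternal e).submodule_iSup_eq_top]; trivial
  have hv : v ∈ ⨆ d, V.deg d := by rw [V.internal.submodule_iSup_eq_top]; trivial
  induction hx using Submodule.iSup_induction' with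
  | mem p x hx =>
    induction (A.corner e).exists_homog a using Submodule.iSup_induction' with
    | mem m a ha =>
      induction hv using Submodule.iSup_induction' with
      | mem q v hv =>
        refine Submodule.mem_iSup_of_mem (p + m + q) ⟨Submodule.subset_span ⟨x, a, v, rfl⟩, ?_⟩
        refine sub_mem (Submodule.subset_span ⟨p + m, q, rfl, _, ?_, v, hv, rfl⟩)
          (Submodule.subset_span ⟨p, m + q, (add_assoc _ _ _).symm, x, hx, _, V.act_mem ha hv, rfl⟩)
        exact A.mul_mem hx ha
      | zero => simp
      | add u w _ _ hu hw =>
        convert add_mem hu hw using 1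
        simp only [map_add, tmul_add]
        abel
    | zero =>
      have : leftIdealMul e x 0 = 0 := Subtype.ext (mul_zero x.1)
      simp [this]
    | add a b _ _ ha hb =>
      have : leftIdealMul e x (a + b) = leftIdealMul e x a + leftIdealMul e x b :=
        Subtype.ext (mul_add x.1 a.1 b.1)
      convert add_mem ha hb using 1
      simp only [this, map_add, LinearMap.add_apply, tmul_add, add_tmul]
      abel
  | zero =>
    have : leftIdealMul e 0 a = 0 := Subtype.ext (zero_mul a.1)
    simp [this]
  | add x y _ _ hx hy =>
    have : leftIdealMul e (x + y) a = leftIdealMul e x a + leftIdealMul e y a :=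
      Subtype.ext (add_mul x.1 y.1 a.1)
    convert add_mem hx hy using 1
    simp only [this, add_tmul]
    abel

theorem stdRel_stable (V : GMod (A.corner e)) (a : A) :
    stdRel e V ≤ (stdRel e V).comap (LinearMap.rTensor V (leftMul e a)) := by
  refine Submodule.span_le.2 ?_
  rintro _ ⟨x, b, v, rfl⟩
  rw [SetLike.mem_coe, Submodule.mem_comap, map_sub]
  refine Submodule.subset_span ⟨leftMul e a x, b, v, ?_⟩
  simp only [LinearMap.rTensor_tmul]
  congr 2
  exact Subtype.ext (mul_assoc a x.1 b.1).symm

/-- The underlying space of `A e ⊗_(e A e) V`. -/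
abbrev ShriekSpace (V : GMod (A.corner e)) : Type u := (leftIdeal e ⊗[k] V) ⧸ stdRel e V

/-- The element `x ⊗ v` of `A e ⊗_(e A e) V`. -/
def shriekMk (V : GMod (A.corner e)) (x : leftIdeal e) (v : V) : ShriekSpace e V :=
  (stdRel e V).mkQ (x ⊗ₜ[k] v)

theorem shriek_ext (V : GMod (A.corner e)) {f g : ShriekSpace e V →ₗ[k] ShriekSpace e V}
    (h : ∀ x v, f (shriekMk e V x v) = g (shriekMk e V x v)) : f = g := by
  apply Submodule.linearMap_qext
  apply TensorProduct.ext'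
  exact h

/-- The action `a (x ⊗ v) = a x ⊗ v`. -/
def shriekAct (V : GMod (A.corner e)) : A →ₗ[k] ShriekSpace e V →ₗ[k] ShriekSpace e V where
  toFun a := (stdRel e V).mapQ _ (LinearMap.rTensor V (leftMul e a)) (stdRel_stable e V a)
  map_add' a b := by
    refine shriek_ext e V fun x v => ?_
    change (stdRel e V).mkQ ((leftMul e (a + b) x) ⊗ₜ[k] v) =
      (stdRel e V).mkQ ((leftMul e a x) ⊗ₜ[k] v) + (stdRel e V).mkQ ((leftMul e b x) ⊗ₜ[k] v)
    rw [← map_add, ← add_tmul, map_add, LinearMap.add_apply]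
  map_smul' c a := by
    refine shriek_ext e V fun x v => ?_
    change (stdRel e V).mkQ ((leftMul e (c • a) x) ⊗ₜ[k] v) =
      c • (stdRel e V).mkQ ((leftMul e a x) ⊗ₜ[k] v)
    rw [← map_smul, smul_tmul', map_smul, LinearMap.smul_apply]

theorem shriekAct_mk (V : GMod (A.corner e)) (a : A) (x : leftIdeal e) (v : V) :
    shriekAct e V a (shriekMk e V x v) = shriekMk e V (leftMul e a x) v := rfl

theorem shriekAct_mul (V : GMod (A.corner e)) (a b : A) :
    shriekAct e V (a * b) = shriekAct e V a ∘ₗ shriekAct e V b := by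
  refine shriek_ext e V fun x v => ?_
  rw [LinearMap.comp_apply, shriekAct_mk, shriekAct_mk, shriekAct_mk]
  exact congrArg (fun y => shriekMk e V y v) (Subtype.ext (mul_assoc a b x.1))

theorem shriekAct_mem (V : GMod (A.corner e)) {m n : ℤ} {a : A} {v : ShriekSpace e V}
    (ha : a ∈ A.deg m) (hv : v ∈ (tensorDeg (leftDeg e) V.deg n).map (stdRel e V).mkQ) :
    shriekAct e V a v ∈ (tensorDeg (leftDeg e) V.deg (m + n)).map (stdRel e V).mkQ := by
  obtain ⟨v, hv, rfl⟩ := hv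
  refine ⟨LinearMap.rTensor V (leftMul e a) v, ?_, rfl⟩
  refine (Submodule.span_le.2 ?_ : _ ≤ (tensorDeg (leftDeg e) V.deg (m + n)).comap
    (LinearMap.rTensor V (leftMul e a))) hv
  rintro _ ⟨p, q, hpq, x, hx, y, hy, rfl⟩
  exact Submodule.subset_span ⟨m + p, q, by omega, leftMul e a x, A.mul_mem ha hx, y, hy, rfl⟩

theorem shriek_span (V : GMod (A.corner e)) (v : ShriekSpace e V) :
    v ∈ Submodule.span k {w | ∃ a u, w = shriekAct e V a u} := by
  obtain ⟨v, rfl⟩ := (stdRel e V).mkQ_surjective v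
  induction v using TensorProduct.induction_on with
  | zero => rw [map_zero]; exact zero_mem _
  | tmul x v =>
    refine Submodule.subset_span ⟨x.1, shriekMk e V ⟨e.val, e.mul_self⟩ v, ?_⟩
    rw [shriekAct_mk]
    exact congrArg (fun y => shriekMk e V y v) (Subtype.ext x.2.symm)
  | add x y hx hy => rw [map_add]; exact add_mem hx hy

/-- The left adjoint `A e ⊗_(e A e) V` of truncation by the idempotent `e`. -/
def jShriek (V : GMod (A.corner e)) : GMod A where
  carrier := ShriekSpace e V
  act := shriekAct e V
  act_mul a b v := by rw [shriekAct_mul]; rfl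
  deg d := (tensorDeg (leftDeg e) V.deg d).map (stdRel e V).mkQ
  internal := isInternal_quot (tensorDeg_isInternal (leftDeg_isInternal e) V.internal) _
    (stdRel_homog e V)
  act_mem := shriekAct_mem e V
  span_act := shriek_span e V

section Star

variable {I : Type*} (U : LocalUnits A I) (V : GMod (A.corner e))

/-- The space `Hom_(e A e)(e A 1_i, V)_d`; homomorphisms on `e A 1_i` are extended by zero to the
other summands `e A 1_j` of `e A`. -/
def starPiece (i : I) (d : ℤ) : Submodule k (rightIdeal e →ₗ[k] V) where
  carrier := {f | f ∈ degHom (rightDeg e) V.deg d ∧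
    (∀ a x, f (rightIdealMul e a x) = V.act a (f x)) ∧ ∀ x, f (rightMul e (U.one i).val x) = f x}
  add_mem' hf hg := ⟨add_mem hf.1 hg.1, fun a x => by simp [hf.2.1, hg.2.1],
    fun x => by simp [hf.2.2, hg.2.2]⟩
  zero_mem' := ⟨zero_mem _, fun a x => by simp, fun x => by simp⟩
  smul_mem' c _ hf := ⟨Submodule.smul_mem _ c hf.1, fun a x => by simp [hf.2.1],
    fun x => by simp [hf.2.2]⟩

/-- The underlying space of the direct sum over `i` of the `Hom_(e A e)(e A 1_i, V)`. -/
def starSpace : Submodule k (rightIdeal e →ₗ[k] V) := ⨆ i, ⨆ d, starPiece e U V i d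

theorem starSpace_homog :
    starSpace e U V ≤ ⨆ d, starSpace e U V ⊓ degHom (rightDeg e) V.deg d := by
  refine iSup_le fun i => iSup_le fun d => ?_
  intro f hf
  exact Submodule.mem_iSup_of_mem d
    ⟨Submodule.mem_iSup_of_mem i (Submodule.mem_iSup_of_mem d hf), hf.1⟩

theorem starPiece_act {i j : I} {d m : ℤ} {a : A} (ha : a ∈ A.deg m) (hj : (U.one j).val * a = a)
    {f : rightIdeal e →ₗ[k] V} (hf : f ∈ starPiece e U V i d) :
    f ∘ₗ rightMul e a ∈ starPiece e U V j (m + d) := by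
  refine ⟨fun n x hx => ?_, fun b x => ?_, fun x => ?_⟩
  · rw [← add_assoc]
    exact hf.1 (n + m) _ (A.mul_mem hx ha)
  · rw [LinearMap.comp_apply, LinearMap.comp_apply, ← hf.2.1]
    exact congrArg f (Subtype.ext (mul_assoc b.1 x.1 a))
  · rw [LinearMap.comp_apply, LinearMap.comp_apply]
    refine congrArg f (Subtype.ext ?_)
    change x.1 * (U.one j).val * a = x.1 * a
    rw [mul_assoc, hj]

/-- The action `(a f)(x) = f (x a)`. -/
def starAct : A →ₗ[k] (rightIdeal e →ₗ[k] V) →ₗ[k] (rightIdeal e →ₗ[k] V) :=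
  LinearMap.mk₂ k (fun a f => f ∘ₗ rightMul e a)
    (fun a b f => by ext x; simp) (fun c a f => by ext x; simp)
    (fun a f g => by ext x; simp) (fun c a f => by ext x; simp)

theorem starSpace_stable (a : A) {f : rightIdeal e →ₗ[k] V} (hf : f ∈ starSpace e U V) :
    starAct e V a f ∈ starSpace e U V := by
  have hle : (⨆ j, ⨆ m, (LinearMap.ker (LinearMap.mulLeft k (U.one j).val - LinearMap.id)) ⊓
      A.deg m) ≤ (starSpace e U V).comap ((starAct e V).flip f) := by
    refine iSup_le fun j => iSup_le fun m => ?_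
    rintro b ⟨hb, hbm⟩
    have hb' : (U.one j).val * b = b := by simpa [sub_eq_zero] using hb
    refine (iSup_le fun i => iSup_le fun d => ?_ :
      starSpace e U V ≤ (starSpace e U V).comap (starAct e V b)) hf
    intro g hg
    exact Submodule.mem_iSup_of_mem j (Submodule.mem_iSup_of_mem (m + d)
      (starPiece_act e U V hbm hb' hg))
  exact hle (U.mem_iSup_homog a)

/-- The action of `A` on `starSpace`. -/
def starSpaceAct : A →ₗ[k] starSpace e U V →ₗ[k] starSpace e U V :=
  LinearMap.mk₂ k (fun a f => ⟨starAct e V a f.1, starSpace_stable e U V a f.2⟩)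
    (fun a b f => Subtype.ext (by simp)) (fun c a f => Subtype.ext (by simp))
    (fun a f g => Subtype.ext (by simp)) (fun c a f => Subtype.ext (by simp))

/-- The right adjoint of truncation by the idempotent `e`, i.e. the direct sum over `i` of the
`Hom_(e A e)(e A 1_i, V)`. -/
def jStar : GMod A where
  carrier := starSpace e U V
  act := starSpaceAct e U V
  act_mul a b f := by
    refine Subtype.ext (LinearMap.ext fun x => congrArg f.1 (Subtype.ext ?_))
    exact (mul_assoc x.1 a b).symm
  deg d := (degHom (rightDeg e) V.deg d).comap (starSpace e U V).subtype
  internal := isInternal_sub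
    (degHom_indep (rightDeg_isInternal e).submodule_iSup_eq_top V.internal) _
    (starSpace_homog e U V)
  act_mem {m d a f} ha hf := by
    intro n x hx
    rw [← add_assoc]
    exact hf (n + m) _ (A.mul_mem hx ha)
  span_act := by
    rintro ⟨f, hf⟩
    have hle : starSpace e U V ≤
        (Submodule.span k {w | ∃ a u, w = starSpaceAct e U V a u}).map
          (starSpace e U V).subtype := by
      refine iSup_le fun i => iSup_le fun d => ?_
      intro g hg
      have hg' : g ∈ starSpace e U V :=
        Submodule.mem_iSup_of_mem i (Submodule.mem_iSup_of_mem d hg)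
      refine ⟨⟨g, hg'⟩, Submodule.subset_span ⟨(U.one i).val, ⟨g, hg'⟩, ?_⟩, rfl⟩
      exact Subtype.ext (LinearMap.ext fun x => (hg.2.2 x).symm)
    obtain ⟨y, hy, hyf⟩ := hle hf
    have : y = ⟨f, hf⟩ := Subtype.ext hyf
    rw [← this]
    exact hy

end Star

section Dual

/-- The field `k` as a graded space concentrated in degree `0`. -/
def trivDeg (k : Type u) [Field k] (d : ℤ) : Submodule k k := if d = 0 then ⊤ else ⊥

theorem trivDeg_isInternal : DirectSum.IsInternal (trivDeg k) := by
  refine isInternal_of_proj _ (fun d => if d = 0 then LinearMap.id else 0) ?_ ?_ ?_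
  · intro d v hv
    by_cases h : d = 0
    · simp [h]
    · simp only [trivDeg, h, if_false, Submodule.mem_bot] at hv
      simp [hv]
  · intro d d' h v hv
    by_cases h' : d' = 0
    · have : d ≠ 0 := fun h'' => h (h'.trans h''.symm)
      simp [this]
    · simp only [trivDeg, h', if_false, Submodule.mem_bot] at hv
      simp [hv]
  · rw [eq_top_iff]
    exact le_iSup_of_le 0 (by simp [trivDeg])

variable {e}

theorem anti_cornerOne (t : (A.corner e).Anti) : t.toEquiv (A.cornerOne e) = A.cornerOne e := by
  obtain ⟨a, ha⟩ := t.toEquiv.surjective (A.cornerOne e)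
  have h := t.map_mul (A.cornerOne e) a
  rw [A.cornerOne_mul, ha, A.cornerOne_mul] at h
  exact h.symm

variable (t : (A.corner e).Anti) (V : GMod (A.corner e))

/-- The underlying space of the graded dual; its degree `d` component is the dual of `V_(-d)`. -/
def dualSpace : Submodule k (V →ₗ[k] k) := ⨆ d, degHom V.deg (trivDeg k) d

theorem dualSpace_stable (a : A.corner e) {f : V →ₗ[k] k} (hf : f ∈ dualSpace V) :
    f ∘ₗ V.act (t.toEquiv a) ∈ dualSpace V := by
  let φ : A.corner e →ₗ[k] (V →ₗ[k] k) →ₗ[k] (V →ₗ[k] k) :=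
    LinearMap.mk₂ k (fun a f => f ∘ₗ V.act (t.toEquiv a))
      (fun a b f => by ext x; simp) (fun c a f => by ext x; simp)
      (fun a f g => by ext x; simp) (fun c a f => by ext x; simp)
  have hle : (⨆ m, (A.corner e).deg m) ≤ (dualSpace V).comap (φ.flip f) := by
    refine iSup_le fun m => ?_
    intro b hb
    refine (iSup_le fun d => ?_ : dualSpace V ≤ (dualSpace V).comap (φ b)) hf
    intro g hg
    refine Submodule.mem_iSup_of_mem (m + d) fun n x hx => ?_
    have := hg (m + n) _ (V.act_mem (t.map_deg m b hb) hx)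
    rwa [show n + (m + d) = m + n + d by ring]
  exact hle ((A.corner e).exists_homog a)

/-- The action `(a f)(v) = f (t(a) v)`. -/
def dualAct : A.corner e →ₗ[k] dualSpace V →ₗ[k] dualSpace V :=
  LinearMap.mk₂ k (fun a f => ⟨f.1 ∘ₗ V.act (t.toEquiv a), dualSpace_stable t V a f.2⟩)
    (fun a b f => Subtype.ext (LinearMap.ext fun x => by
      change f.1 (V.act (t.toEquiv (a + b)) x) = _
      rw [map_add, map_add, LinearMap.add_apply, map_add]; rfl))
    (fun c a f => Subtype.ext (LinearMap.ext fun x => by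
      change f.1 (V.act (t.toEquiv (c • a)) x) = _
      rw [map_smul, map_smul, LinearMap.smul_apply, map_smul]; rfl))
    (fun a f g => rfl) (fun c a f => rfl)

theorem dualAct_mem {m d : ℤ} {a : A.corner e} {f : dualSpace V} (ha : a ∈ (A.corner e).deg m)
    (hf : f ∈ (degHom V.deg (trivDeg k) d).comap (dualSpace V).subtype) :
    dualAct t V a f ∈ (degHom V.deg (trivDeg k) (m + d)).comap (dualSpace V).subtype := by
  intro n x hx
  have h : f.1 (V.act (t.toEquiv a) x) ∈ trivDeg k (m + n + d) :=
    hf (m + n) (V.act (t.toEquiv a) x) (V.act_mem (t.map_deg m a ha) hx)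
  rw [show m + n + d = n + (m + d) by ring] at h
  exact h

theorem dualDeg_isInternal : DirectSum.IsInternal
    (fun d => (degHom V.deg (trivDeg k) d).comap (dualSpace V).subtype) := by
  have h : iSupIndep (degHom V.deg (trivDeg k)) :=
    degHom_indep V.internal.submodule_iSup_eq_top trivDeg_isInternal
  refine isInternal_sub h _ ?_
  refine iSup_le fun d => ?_
  intro f hf
  exact Submodule.mem_iSup_of_mem d ⟨Submodule.mem_iSup_of_mem d hf, hf⟩

/-- The contravariant functor on graded `e A e`-modules given by the graded dual followed by
restriction along the anti-automorphism `t`. -/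
def dual : GMod (A.corner e) where
  carrier := dualSpace V
  group := (dualSpace V).addCommGroup
  module := (dualSpace V).module
  act := dualAct t V
  act_mul a b f := by
    refine Subtype.ext (LinearMap.ext fun x => congrArg f.1 ?_)
    change V.act (t.toEquiv (a * b)) x = V.act (t.toEquiv b) (V.act (t.toEquiv a) x)
    rw [t.map_mul, V.act_mul]
  deg d := (degHom V.deg (trivDeg k) d).comap (dualSpace V).subtype
  internal := dualDeg_isInternal V
  act_mem := dualAct_mem t V
  span_act f := by
    refine Submodule.subset_span ⟨A.cornerOne e, f, ?_⟩
    refine Subtype.ext (LinearMap.ext fun x => congrArg f.1 ?_)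
    change x = V.act (t.toEquiv (A.cornerOne e)) x
    rw [anti_cornerOne, act_cornerOne]

end Dual

end Corner

end GMod

namespace GrAlg

variable {k : Type u} [Field k] {A : GrAlg k}

namespace Anti

theorem map_ideal (t : A.Anti) (E : Set A.Idem) (hE : ∀ e ∈ E, t.toEquiv e.val = e.val) :
    (A.ideal E).map t.toEquiv.toLinearMap = A.ideal E := by
  apply le_antisymm
  · rw [Submodule.map_le_iff_le_comap]
    refine Submodule.span_le.2 ?_
    rintro _ ⟨e, he, a, b, rfl⟩
    refine Submodule.subset_span ⟨e, he, t.toEquiv b, t.toEquiv a, ?_⟩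
    change t.toEquiv (a * e.val * b) = _
    rw [t.map_mul, t.map_mul, hE e he, mul_assoc]
  · refine Submodule.span_le.2 ?_
    rintro _ ⟨e, he, a, b, rfl⟩
    refine ⟨t.toEquiv.symm b * e.val * t.toEquiv.symm a, Submodule.subset_span ⟨e, he, _, _, rfl⟩, ?_⟩
    change t.toEquiv _ = _
    rw [t.map_mul, t.map_mul, hE e he, LinearEquiv.apply_symm_apply, LinearEquiv.apply_symm_apply,
      mul_assoc]

/-- The anti-automorphism induced on a quotient. -/
def quot (t : A.Anti) (E : Set A.Idem) (hE : ∀ e ∈ E, t.toEquiv e.val = e.val) :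
    (A.quot E).Anti where
  toEquiv := Submodule.Quotient.equiv (A.ideal E) (A.ideal E) t.toEquiv (t.map_ideal E hE)
  map_mul := by
    rintro ⟨a⟩ ⟨b⟩
    exact congrArg (A.ideal E).mkQ (t.map_mul a b)
  map_deg := by
    rintro d _ ⟨a, ha, rfl⟩
    exact ⟨t.toEquiv a, t.map_deg d a ha, rfl⟩

theorem map_cornerSub (t : A.Anti) (e : A.Idem) (he : t.toEquiv e.val = e.val) :
    (A.cornerSub e).toSubmodule.map t.toEquiv.toLinearMap = (A.cornerSub e).toSubmodule := by
  have key : ∀ a : A, t.toEquiv a ∈ A.cornerSub e ↔ a ∈ A.cornerSub e := by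
    intro a
    have h1 : e.val * t.toEquiv a = t.toEquiv a ↔ a * e.val = a := by
      conv_lhs => lhs; rw [← he, ← t.map_mul]
      exact t.toEquiv.injective.eq_iff
    have h2 : t.toEquiv a * e.val = t.toEquiv a ↔ e.val * a = a := by
      conv_lhs => lhs; rw [← he, ← t.map_mul]
      exact t.toEquiv.injective.eq_iff
    exact ⟨fun h => ⟨h2.1 h.2, h1.1 h.1⟩, fun h => ⟨h1.2 h.2, h2.2 h.1⟩⟩
  apply le_antisymm
  · rintro _ ⟨a, ha, rfl⟩
    exact (key a).2 ha
  · intro a ha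
    refine ⟨t.toEquiv.symm a, (key _).1 ?_, t.toEquiv.apply_symm_apply a⟩
    rw [LinearEquiv.apply_symm_apply]
    exact ha

/-- The anti-automorphism induced on `e A e`. -/
def corner (t : A.Anti) (e : A.Idem) (he : t.toEquiv e.val = e.val) : (A.corner e).Anti where
  toEquiv := t.toEquiv.ofSubmodules _ _ (t.map_cornerSub e he)
  map_mul a b := Subtype.ext (t.map_mul a.1 b.1)
  map_deg d a ha := t.map_deg d a.1 ha

end Anti

end GrAlg

/-- A graded triangular basis of a locally unital graded algebra, with weight poset `W`. -/
structure TriBasis {k : Type u} [Field k] {A : GrAlg k} {I : Type*} (U : LocalUnits A I)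
    (W : Type*) [PartialOrder W] where
  /-- The indices of the special idempotents. -/
  S : Set I
  lower_finite : ∀ w : W, (Set.Iic w).Finite
  dot : S → W
  fiber_finite : ∀ w : W, {s | dot s = w}.Finite
  X : I → S → Set A
  H : S → S → Set A
  Y : S → I → Set A
  X_mem : ∀ i s, ∀ x ∈ X i s, x ∈ A.peirce (U.one i).val (U.one s).val
  H_mem : ∀ s t, ∀ h ∈ H s t, h ∈ A.peirce (U.one s).val (U.one t).val
  Y_mem : ∀ t j, ∀ y ∈ Y t j, y ∈ A.peirce (U.one t).val (U.one j).val
  X_homog : ∀ i s, ∀ x ∈ X i s, ∃ d, x ∈ A.deg d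
  H_homog : ∀ s t, ∀ h ∈ H s t, ∃ d, h ∈ A.deg d
  Y_homog : ∀ t j, ∀ y ∈ Y t j, ∃ d, y ∈ A.deg d
  basis_indep : LinearIndependent k
    (fun p : Σ c : (I × S) × (S × I), X c.1.1 c.1.2 × H c.1.2 c.2.1 × Y c.2.1 c.2.2 =>
      p.2.1.val * p.2.2.1.val * p.2.2.2.val)
  basis_span : Submodule.span k (Set.range
    (fun p : Σ c : (I × S) × (S × I), X c.1.1 c.1.2 × H c.1.2 c.2.1 × Y c.2.1 c.2.2 =>
      p.2.1.val * p.2.2.1.val * p.2.2.2.val)) = ⊤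
  X_self : ∀ s : S, X s s = {(U.one s).val}
  Y_self : ∀ s : S, Y s s = {(U.one s).val}
  X_ne : ∀ s t : S, s ≠ t → (X s t).Nonempty → dot t < dot s
  H_ne : ∀ s t : S, s ≠ t → (H s t).Nonempty → dot s = dot t
  Y_ne : ∀ s t : S, s ≠ t → (Y s t).Nonempty → dot s < dot t
  finite_of_not_mem : ∀ i, i ∉ S → {s | (X i s ∪ Y s i).Nonempty}.Finite

/-- An anti-automorphism of a locally unital graded algebra fixing the distinguished idempotents. -/
structure AntiFix {k : Type u} [Field k] {A : GrAlg k} {I : Type*} (U : LocalUnits A I) extends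
    A.Anti where
  map_one : ∀ i, toEquiv (U.one i).val = (U.one i).val

namespace TriBasis

variable {k : Type u} [Field k] {A : GrAlg k} {I : Type*} {U : LocalUnits A I} {W : Type*}
  [PartialOrder W] (T : TriBasis U W)

/-- The weight idempotent `e_w`, the sum of the `1_s` with `dot s = w`. -/
noncomputable def e (w : W) : A.Idem where
  val := ∑ s ∈ (T.fiber_finite w).toFinset, (U.one s).val
  mem := Submodule.sum_mem _ fun s _ => (U.one s).mem
  mul_self := by
    classical
    rw [Finset.sum_mul_sum]
    refine Finset.sum_congr rfl fun s hs => ?_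
    rw [Finset.sum_eq_single s]
    · exact (U.one s).mul_self
    · intro t _ h
      exact U.orth fun h' => h (Subtype.ext h'.symm)
    · exact fun h => absurd hs h

/-- The weight idempotents `e_m` with `m` not greater than or equal to `w`. -/
def below (w : W) : Set A.Idem := {x | ∃ m, ¬ w ≤ m ∧ x = T.e m}

/-- The algebra `A_(≥ w)`, the quotient of `A` by the two-sided ideal generated by the `e_m` with `m`
not greater than or equal to `w`. -/
def ge (w : W) : GrAlg k := A.quot (T.below w)

/-- The image of `e_w` in `A_(≥ w)`. -/
noncomputable def eBar (w : W) : (T.ge w).Idem := (T.e w).bar (T.below w)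

/-- The algebra `A_w`, the truncation of `A_(≥ w)` by the image of `e_w`. -/
noncomputable def cartan (w : W) : GrAlg k := (T.ge w).corner (T.eBar w)

/-- The standardization functor from `A_w`-modules to `A`-modules. -/
noncomputable def std (w : W) (V : GMod (T.cartan w)) : GMod A :=
  GMod.inflate (E := T.below w) (GMod.jShriek (A := T.ge w) (T.eBar w) V)

/-- The costandardization functor from `A_w`-modules to `A`-modules. -/
noncomputable def costd (w : W) (V : GMod (T.cartan w)) : GMod A :=
  GMod.inflate (E := T.below w) (GMod.jStar (A := T.ge w) (T.eBar w) (U.quot (T.below w)) V)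

/-- The left regular module of `A_w`. -/
noncomputable def regular (w : W) : GMod (T.cartan w) :=
  GMod.regular (A := T.ge w) (T.eBar w)

/-- A based affine quasi-hereditary algebra: the special idempotents are indexed by the weight poset
and each `A_w` is graded local, i.e. its quotient by its graded Jacobson radical (the intersection
of its maximal graded left ideals) is the ground field. -/
def IsBasedAffineQuasiHereditary : Prop :=
  Function.Bijective T.dot ∧ ∀ w, Module.finrank k (T.regular w).cosoc = 1

theorem map_e (t : AntiFix U) (w : W) : t.toEquiv (T.e w).val = (T.e w).val := by
  change t.toEquiv (∑ s ∈ _, _) = ∑ s ∈ _, _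
  rw [map_sum]
  exact Finset.sum_congr rfl fun s _ => t.map_one s

/-- The anti-automorphism of `A_(≥ w)` induced by one of `A`. -/
noncomputable def geAnti (t : AntiFix U) (w : W) : (T.ge w).Anti :=
  t.toAnti.quot (T.below w) (by rintro _ ⟨m, -, rfl⟩; exact T.map_e t m)

/-- The anti-automorphism of `A_w` induced by one of `A`. -/
noncomputable def cartanAnti (t : AntiFix U) (w : W) : (T.cartan w).Anti :=
  (T.geAnti t w).corner (T.eBar w) (congrArg (A.toQuot (T.below w)) (T.map_e t w))

/-- The duality on graded `A_w`-modules induced by an anti-automorphism of `A`. -/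
noncomputable def cartanDual (t : AntiFix U) (w : W) (V : GMod (T.cartan w)) : GMod (T.cartan w) :=
  GMod.dual (A := T.ge w) (e := T.eBar w) (T.cartanAnti t w) V

/-! The modules attached to a based affine quasi-hereditary algebra; here the projective cover of
the irreducible module of the graded local algebra `A_w` is its regular module. -/

/-- The irreducible graded `A_w`-module, when `A_w` is graded local. -/
noncomputable def simple (w : W) : GMod (T.cartan w) := (T.regular w).cosoc

/-- The standard module `Δ(w)`. -/
noncomputable def delta (w : W) : GMod A := T.std w (T.regular w)

/-- The proper standard module. -/
noncomputable def properDelta (w : W) : GMod A := T.std w (T.simple w)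

/-- The proper costandard module. -/
noncomputable def properNabla (w : W) : GMod A := T.costd w (T.simple w)

/-- The irreducible module `L(w)`, the head of `Δ(w)`. -/
noncomputable def irr (w : W) : GMod A := (T.delta w).cosoc

/-- `Δ`-layers of type `w`. -/
def IsDeltaLayer (w : W) (M : GMod A) : Prop :=
  ∃ V : GMod (T.cartan w), V.Projective ∧ V.LocFinBddBelow ∧ M.Iso (T.std w V)

end TriBasis

/-- The refinement setting: every `A_w` is made into a based affine quasi-hereditary algebra with
weight poset `B w`, with respect to some system of distinguished idempotents of `A_w`. -/
structure Refinement {k : Type u} [Field k] {A : GrAlg k} {I : Type*} {U : LocalUnits A I}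
    {W : Type*} [PartialOrder W] (T : TriBasis U W) (B : W → Type*)
    [∀ w, PartialOrder (B w)] where
  J : W → Type*
  units : ∀ w, LocalUnits (T.cartan w) (J w)
  basis : ∀ w, TriBasis (units w) (B w)
  based : ∀ w, (basis w).IsBasedAffineQuasiHereditary

namespace Refinement

variable {k : Type u} [Field k] {A : GrAlg k} {I : Type*} {U : LocalUnits A I} {W : Type*}
  [PartialOrder W] {T : TriBasis U W} {B : W → Type*} [∀ w, PartialOrder (B w)]
  (R : Refinement T B)

/-- The irreducible `A`-module `L(b)`, the head of the proper standard module obtained by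
standardization from the irreducible `A_w`-module `L_w(b)`. -/
noncomputable def irr (b : Σ w, B w) : GMod A := (T.std b.1 ((R.basis b.1).irr b.2)).cosoc

/-- The pure proper standard module. -/
noncomputable def pureProperDelta (b : Σ w, B w) : GMod A :=
  T.std b.1 ((R.basis b.1).properDelta b.2)

/-- The pure proper costandard module. -/
noncomputable def pureProperNabla (b : Σ w, B w) : GMod A :=
  T.costd b.1 ((R.basis b.1).properNabla b.2)

/-- Pure `Δ`-layers of type `b`. -/
def IsPureDeltaLayer (b : Σ w, B w) (M : GMod A) : Prop :=
  ∃ V : GMod (T.cartan b.1), (R.basis b.1).IsDeltaLayer b.2 V ∧ M.Iso (T.std b.1 V)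

/-- `V` has a pure `Δ`-flag: a finite graded filtration whose sections are pure `Δ`-layers of
distinct types. (Steps at which the filtration does not grow can be dropped.) -/
def HasPureDeltaFlag (V : GMod A) : Prop :=
  ∃ (n : ℕ) (F : V.Filtration n) (c : Fin n → Σ w, B w), Function.Injective c ∧
    ∀ r, ∃ M, R.IsPureDeltaLayer (c r) M ∧ F.SectionIso r M

/-- The multiplicity of the pure standard module of type `a` in a module `V` with a pure `Δ`-flag,
as the sequence of its coefficients: the bar-conjugate of the graded dimension of the space of
homomorphisms from `V` to the pure proper costandard module of type `a`. -/
noncomputable def pureDeltaMult (V : GMod A) (a : Σ w, B w) (d : ℤ) : ℕ∞ :=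
  V.dimHom (R.pureProperNabla a) (-d)

end Refinement

end PureBGG

/-! Both multiplicities are compared with dimensions of spaces of homomorphisms out of P(b). If L is
irreducible with projective cover P and only scalar endomorphisms of degree 0, then the largest
number of sections q^(-m) L in filtrations of V is dim Hom(P, V)_m whenever that dimension is finite
(`GMod.mult_eq_finrank`). As (P(b) : ▲(a)) is by definition a graded dimension of Hom(P(b),
▽bar(a)), the reciprocity is the case V = ▽bar(a). Finiteness comes from A being bounded below while
the irreducible modules of the local algebras sit in degree 0 (`costd_finite`). Irreducibility of
L(b) and scalarity of its endomorphisms come from truncation: the truncation of the head of a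
standardization is the head one started with (`exists_isTruncation_cosoc`), so a rank one operator
on a one-dimensional module lifts to a rank one operator on L(b).

For the flag, the basis elements with weights in a lower set Γ span a two-sided ideal
(`mul_one_mul_mem`), so a projective V is filtered by the images of these ideals. Let w be a weight
outside Γ all of whose smaller weights lie in Γ. The basis elements x of weight w act independently
on V modulo the layer of Γ (`xIndep_quot`), so the next layer is the standardization of the
e_w-truncation, and a filtration of the truncation induces one of the layer
(`XIndep.isSection_gen`). The truncation is projective over A_w because e_w A_(≥ w) is
(`IsCostdFun.exists_lift`). The same argument applied to A_w with its own triangular basis gives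
Δ-flags of truncations; gluing them gives the pure flag. P(b) is generated by one vector fixed by
some 1_i, so finitely many weights suffice.

The duality statement is handled by pairings (`IsDualPair`), which costandardization and
standardization preserve (`exists_isDualPair_costd_std`). The delicate point is over A_λ: from a
pairing of Δ with ∇ one needs a pairing of the proper versions. The proper costandard submodule of ∇
is exactly the annihilator of the part of Δ generated by the radical
(`pairing_eq_zero_of_mem_range`, `mem_range_of_pairing_eq_zero`), which gives
`exists_isDualPair_proper`. Finally P(b) is A ε for a homogeneous idempotent ε. Self-duality of
L_λ(b) makes τ(ε) and its analogue for the inverse of τ act nontrivially on L(b), and two chains of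
inequalities identify the dimensions of homomorphisms into the proper standard and proper costandard
modules (`finrank_hom_std`). -/

namespace PureBGG

open DirectSum

/-! ### Graded vector spaces and graded modules: projections, submodules, sections. -/

section Grading

variable {k : Type*} [Field k] {M N : Type*} [AddCommGroup M] [Module k M] [AddCommGroup N]
  [Module k N] {G : ℤ → Submodule k M} {G' : ℤ → Submodule k N}

theorem gproj_mem (hG : IsInternal G) (d : ℤ) (x : M) : gproj hG d x ∈ G d := by
  simp [gproj]

theorem graded_induction (hG : IsInternal G) {p : M → Prop} (h0 : p 0)
    (hadd : ∀ x y, p x → p y → p (x + y)) (hd : ∀ d, ∀ x ∈ G d, p x) (x : M) : p x := by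
  have hx : x ∈ ⨆ d, G d := by rw [hG.submodule_iSup_eq_top]; trivial
  exact Submodule.iSup_induction G (motive := p) hx hd h0 hadd

theorem graded_ext (hG : IsInternal G) {f g : M →ₗ[k] N} (h : ∀ d, ∀ x ∈ G d, f x = g x) :
    f = g := by
  ext x
  refine graded_induction hG (p := fun x => f x = g x) (by simp) ?_ h x
  intro x y hx hy
  rw [map_add, map_add, hx, hy]

theorem gproj_map (hG : IsInternal G) (hG' : IsInternal G') {f : M →ₗ[k] N} {m : ℤ}
    (hf : ∀ n, ∀ x ∈ G n, f x ∈ G' (n + m)) (n : ℤ) (x : M) :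
    gproj hG' (n + m) (f x) = f (gproj hG n x) := by
  have : gproj hG' (n + m) ∘ₗ f = f ∘ₗ gproj hG n := by
    refine graded_ext hG fun d x hx => ?_
    rw [LinearMap.comp_apply, LinearMap.comp_apply]
    by_cases h : d = n
    · subst h
      rw [gproj_of_mem hG hx, gproj_of_mem hG' (hf _ x hx)]
    · rw [gproj_of_mem_ne hG h hx, gproj_of_mem_ne hG' (by omega) (hf _ x hx), map_zero]
  exact LinearMap.congr_fun this x

theorem gproj_ext (hG : IsInternal G) {x : M} (h : ∀ d, gproj hG d x = 0) : x = 0 := by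
  apply (dec hG).injective
  rw [map_zero]
  ext d
  have := h d
  simp only [gproj, LinearMap.comp_apply, Submodule.subtype_apply, ZeroMemClass.coe_eq_zero] at this
  exact congrArg Subtype.val this

theorem eq_zero_of_mem_ne (hG : IsInternal G) {d e : ℤ} (h : d ≠ e) {x : M} (hd : x ∈ G d)
    (he : x ∈ G e) : x = 0 := by
  rw [← gproj_of_mem hG hd, gproj_of_mem_ne hG (Ne.symm h) he]

/-- A subspace stable under the projections to homogeneous components is homogeneous. -/
theorem homog_of_gproj (hG : IsInternal G) {C : Submodule k M}
    (h : ∀ d, ∀ x ∈ C, gproj hG d x ∈ C) : C ≤ ⨆ d, C ⊓ G d := by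
  classical
  intro x hx
  have hsum : x = ∑ d ∈ (dec hG x).support, gproj hG d x := by
    have h : DirectSum.coeLinearMap G (dec hG x) = x := (dec hG).symm_apply_apply x
    conv_lhs => rw [← h]
    rw [DirectSum.coeLinearMap_eq_dfinsuppSum, DFinsupp.sum]
    rfl
  rw [hsum]
  exact Submodule.sum_mem _ fun d _ => Submodule.mem_iSup_of_mem d ⟨h d x hx, gproj_mem hG d x⟩

theorem gproj_mem_of_homog (hG : IsInternal G) {C : Submodule k M} (hC : C ≤ ⨆ d, C ⊓ G d)
    (d : ℤ) {x : M} (hx : x ∈ C) : gproj hG d x ∈ C := by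
  have : C ≤ C.comap (gproj hG d) := by
    refine hC.trans (iSup_le fun e => ?_)
    rintro x ⟨hx, hxe⟩
    by_cases h : e = d
    · subst h
      rw [Submodule.mem_comap, gproj_of_mem hG hxe]
      exact hx
    · rw [Submodule.mem_comap, gproj_of_mem_ne hG h hxe]
      exact zero_mem _
  exact this hx

theorem homog_span {s : Set M} (h : ∀ x ∈ s, ∃ d, x ∈ G d) :
    Submodule.span k s ≤ ⨆ d, Submodule.span k s ⊓ G d := by
  refine Submodule.span_le.2 fun x hx => ?_
  obtain ⟨d, hd⟩ := h x hx
  exact Submodule.mem_iSup_of_mem d ⟨Submodule.subset_span hx, hd⟩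

end Grading

namespace GMod

variable {k : Type u} [Field k] {A : GrAlg k}

theorem homog_induction (V : GMod A) {p : V → Prop} (h0 : p 0)
    (hadd : ∀ x y, p x → p y → p (x + y)) (hd : ∀ d, ∀ x ∈ V.deg d, p x) (x : V) : p x :=
  graded_induction V.internal h0 hadd hd x

theorem alg_induction {A : GrAlg k} {p : A → Prop} (h0 : p 0)
    (hadd : ∀ x y, p x → p y → p (x + y)) (hd : ∀ d, ∀ x ∈ A.deg d, p x) (x : A) : p x :=
  graded_induction A.internal h0 hadd hd x

theorem unit_homog_induction {I : Type*} (U : LocalUnits A I) {p : A → Prop} (h0 : p 0)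
    (hadd : ∀ x y, p x → p y → p (x + y))
    (hd : ∀ i d, ∀ x ∈ A.deg d, (U.one i).val * x = x → p x) (x : A) : p x := by
  have hx := U.mem_iSup_homog x
  refine Submodule.iSup_induction _ (motive := p) hx (fun i y hy => ?_) h0 hadd
  refine Submodule.iSup_induction _ (motive := p) hy (fun d z hz => ?_) h0 hadd
  exact hd i d z hz.2 (by simpa [sub_eq_zero] using hz.1)

theorem peirce_induction {I : Type*} (U : LocalUnits A I) {p : A → Prop} (h0 : p 0)
    (hadd : ∀ x y, p x → p y → p (x + y))
    (hd : ∀ i j, ∀ x, (U.one i).val * x = x → x * (U.one j).val = x → p x) (x : A) : p x := by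
  have hx : x ∈ ⨆ i, ⨆ j, A.peirce (U.one i).val (U.one j).val := by rw [U.span]; trivial
  refine Submodule.iSup_induction _ (motive := p) hx (fun i y hy => ?_) h0 hadd
  refine Submodule.iSup_induction _ (motive := p) hy (fun d z hz => ?_) h0 hadd
  exact hd i d z hz.1 hz.2

theorem act_gproj (V : GMod A) {m : ℤ} {a : A} (ha : a ∈ A.deg m) (n : ℤ) (v : V) :
    gproj V.internal (m + n) (V.act a v) = V.act a (gproj V.internal n v) := by
  rw [add_comm]
  exact gproj_map V.internal V.internal (fun n x hx => by
    rw [add_comm]; exact V.act_mem ha hx) n v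

theorem act_gproj_zero (V : GMod A) {a : A} (ha : a ∈ A.deg 0) (n : ℤ) (v : V) :
    gproj V.internal n (V.act a v) = V.act a (gproj V.internal n v) := by
  have := V.act_gproj ha n v
  rwa [zero_add] at this

theorem act_mem_zero (V : GMod A) {a : A} (ha : a ∈ A.deg 0) {n : ℤ} {v : V}
    (hv : v ∈ V.deg n) : V.act a v ∈ V.deg n := by
  have := V.act_mem ha hv
  rwa [zero_add] at this

/-- A module over a locally unital algebra is spanned by homogeneous vectors fixed by a
distinguished idempotent. -/
theorem unit_induction {I : Type*} (U : LocalUnits A I) (V : GMod A) {p : V → Prop} (h0 : p 0)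
    (hadd : ∀ x y, p x → p y → p (x + y))
    (hd : ∀ i d, ∀ x ∈ V.deg d, V.act (U.one i).val x = x → p x) (x : V) : p x := by
  classical
  have hx : x ∈ ⨆ i, LinearMap.range (V.act (U.one i).val) := by
    rw [(isInternal_one U V).submodule_iSup_eq_top]; trivial
  refine Submodule.iSup_induction _ (motive := p) hx ?_ h0 hadd
  rintro i _ ⟨v, rfl⟩
  refine V.homog_induction (p := fun v => p (V.act (U.one i).val v)) (by simpa using h0)
    (fun x y hx hy => by rw [map_add]; exact hadd _ _ hx hy) (fun d v hv => ?_) v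
  refine hd i d _ (V.act_mem_zero (U.one i).mem hv) ?_
  rw [← V.act_mul, (U.one i).mul_self]

theorem hom_smul {V W : GMod A} {d : ℤ} {f : V →ₗ[k] W} (hf : f ∈ hom V W d) (a : A) (v : V) :
    f (V.act a v) = W.act a (f v) := hf.2 a v

theorem hom_deg {V W : GMod A} {d : ℤ} {f : V →ₗ[k] W} (hf : f ∈ hom V W d) {n : ℤ} {v : V}
    (hv : v ∈ V.deg n) : f v ∈ W.deg (n + d) := hf.1 n v hv

theorem hom_comp {V W Z : GMod A} {d e : ℤ} {g : W →ₗ[k] Z} {f : V →ₗ[k] W} (hg : g ∈ hom W Z e)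
    (hf : f ∈ hom V W d) : g ∘ₗ f ∈ hom V Z (d + e) := by
  refine ⟨fun n x hx => ?_, fun a v => ?_⟩
  · rw [← add_assoc]; exact hom_deg hg (hom_deg hf hx)
  · rw [LinearMap.comp_apply, LinearMap.comp_apply, hf.2, hg.2]

theorem hom_gproj {V W : GMod A} {d : ℤ} {f : V →ₗ[k] W} (hf : f ∈ hom V W d) (n : ℤ) (v : V) :
    gproj W.internal (n + d) (f v) = f (gproj V.internal n v) :=
  gproj_map V.internal W.internal hf.1 n v

theorem hom_gproj_zero {V W : GMod A} {f : V →ₗ[k] W} (hf : f ∈ hom V W 0) (n : ℤ) (v : V) :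
    gproj W.internal n (f v) = f (gproj V.internal n v) := by
  have := hom_gproj hf n v
  rwa [add_zero] at this

theorem hom_deg_zero {V W : GMod A} {f : V →ₗ[k] W} (hf : f ∈ hom V W 0) {n : ℤ} {v : V}
    (hv : v ∈ V.deg n) : f v ∈ W.deg n := by
  have := hom_deg hf hv
  rwa [add_zero] at this

theorem Iso.refl (V : GMod A) : V.Iso V :=
  ⟨LinearEquiv.refl k V, fun n x hx => by rw [add_zero]; exact hx, fun _ _ => rfl⟩

/-- A bijection commuting with the projections onto components has an inverse commuting with them,
so only one direction of degree preservation has to be assumed. -/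
theorem symm_mem_hom {V W : GMod A} {e : V ≃ₗ[k] W} (he : e.toLinearMap ∈ hom V W 0) :
    e.symm.toLinearMap ∈ hom W V 0 := by
  refine ⟨fun n x hx => ?_, fun a v => ?_⟩
  · have h1 := hom_gproj he n (e.symm x)
    rw [add_zero] at h1
    simp only [LinearEquiv.coe_coe, LinearEquiv.apply_symm_apply] at h1
    rw [gproj_of_mem _ hx] at h1
    rw [add_zero]
    have h2 : e.symm x = gproj V.internal n (e.symm x) := by
      rw [LinearEquiv.symm_apply_eq]; exact h1
    change e.symm x ∈ V.deg n
    rw [h2]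
    exact gproj_mem _ _ _
  · change e.symm (W.act a v) = V.act a (e.symm v)
    rw [LinearEquiv.symm_apply_eq]
    have := he.2 a (e.symm v)
    simp only [LinearEquiv.coe_coe, LinearEquiv.apply_symm_apply] at this
    exact this.symm

/-- Stability under the projections passes to sums, images and preimages at once, unlike the
supremum condition. -/
theorem isGSub_iff (V : GMod A) (W : Submodule k V) : V.IsGSub W ↔
    (∀ a, ∀ w ∈ W, V.act a w ∈ W) ∧ ∀ d, ∀ w ∈ W, gproj V.internal d w ∈ W :=
  ⟨fun h => ⟨h.1, fun d _ hw => gproj_mem_of_homog V.internal h.2 d hw⟩,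
    fun h => ⟨h.1, homog_of_gproj V.internal h.2⟩⟩

theorem isGSub_bot (V : GMod A) : V.IsGSub ⊥ :=
  (V.isGSub_iff _).2 ⟨fun a w hw => by simp [(Submodule.mem_bot k).1 hw],
    fun d w hw => by simp [(Submodule.mem_bot k).1 hw]⟩

theorem isGSub_top (V : GMod A) : V.IsGSub ⊤ :=
  (V.isGSub_iff _).2 ⟨fun _ _ _ => trivial, fun _ _ _ => trivial⟩

theorem IsGSub.sup {V : GMod A} {W W' : Submodule k V} (h : V.IsGSub W) (h' : V.IsGSub W') :
    V.IsGSub (W ⊔ W') := by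
  rw [isGSub_iff] at *
  constructor
  · intro a w hw
    obtain ⟨x, hx, y, hy, rfl⟩ := Submodule.mem_sup.1 hw
    rw [map_add]
    exact Submodule.add_mem_sup (h.1 a x hx) (h'.1 a y hy)
  · intro a w hw
    obtain ⟨x, hx, y, hy, rfl⟩ := Submodule.mem_sup.1 hw
    rw [map_add]
    exact Submodule.add_mem_sup (h.2 a x hx) (h'.2 a y hy)

theorem IsGSub.map {V W : GMod A} {f : V →ₗ[k] W} {d : ℤ} (hf : f ∈ hom V W d)
    {S : Submodule k V} (hS : V.IsGSub S) : W.IsGSub (S.map f) := by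
  rw [isGSub_iff] at *
  constructor
  · rintro a _ ⟨v, hv, rfl⟩
    exact ⟨V.act a v, hS.1 a v hv, hom_smul hf a v⟩
  · rintro n _ ⟨v, hv, rfl⟩
    refine ⟨gproj V.internal (n - d) v, hS.2 _ v hv, ?_⟩
    have := hom_gproj hf (n - d) v
    rw [sub_add_cancel] at this
    exact this.symm

theorem IsGSub.comap {V W : GMod A} {f : V →ₗ[k] W} {d : ℤ} (hf : f ∈ hom V W d)
    {S : Submodule k W} (hS : W.IsGSub S) : V.IsGSub (S.comap f) := by
  rw [isGSub_iff] at *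
  constructor
  · intro a v hv
    rw [Submodule.mem_comap, hom_smul hf]
    exact hS.1 a _ hv
  · intro n v hv
    rw [Submodule.mem_comap, ← hom_gproj hf]
    exact hS.2 _ _ hv

theorem isGSub_range {V W : GMod A} {f : V →ₗ[k] W} {d : ℤ} (hf : f ∈ hom V W d) :
    W.IsGSub (LinearMap.range f) := by
  rw [← Submodule.map_top]; exact (isGSub_top V).map hf

theorem isGSub_ker {V W : GMod A} {f : V →ₗ[k] W} {d : ℤ} (hf : f ∈ hom V W d) :
    V.IsGSub (LinearMap.ker f) := (isGSub_bot W).comap hf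

/-- The quotient map, as a map of graded modules. -/
def qmap (V : GMod A) (W : Submodule k V) (hW : V.IsGSub W) : V →ₗ[k] V.quot W hW := W.mkQ

section Quot

variable {V : GMod A} {W : Submodule k V} (hW : V.IsGSub W)

theorem qmap_mem_hom : V.qmap W hW ∈ hom V (V.quot W hW) 0 :=
  ⟨fun n x hx => by rw [add_zero]; exact ⟨x, hx, rfl⟩, fun a v => rfl⟩

theorem qmap_surjective : Function.Surjective (V.qmap W hW) := W.mkQ_surjective

theorem qmap_eq_zero {v : V} : V.qmap W hW v = 0 ↔ v ∈ W := Submodule.Quotient.mk_eq_zero W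

theorem ker_qmap : LinearMap.ker (V.qmap W hW) = W := by
  ext v; exact qmap_eq_zero hW

theorem qmap_act (a : A) (v : V) :
    V.qmap W hW (V.act a v) = (V.quot W hW).act a (V.qmap W hW v) := rfl

theorem qmap_mem_deg {d : ℤ} {v : V} (hv : v ∈ V.deg d) : V.qmap W hW v ∈ (V.quot W hW).deg d :=
  ⟨v, hv, rfl⟩

theorem exists_qmap_of_mem_deg {d : ℤ} {x : V.quot W hW} (hx : x ∈ (V.quot W hW).deg d) :
    ∃ v ∈ V.deg d, V.qmap W hW v = x := hx

end Quot

theorem id_mem_hom (V : GMod A) : LinearMap.id ∈ hom V V 0 :=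
  ⟨fun n x hx => by rw [add_zero]; exact hx, fun _ _ => rfl⟩

/-- The graded submodule generated by a homogeneous vector. -/
def cyc (V : GMod A) (v : V) : Submodule k V := LinearMap.range (V.act.flip v)

theorem isGSub_cyc (V : GMod A) {v : V} {d : ℤ} (hv : v ∈ V.deg d) : V.IsGSub (V.cyc v) := by
  rw [isGSub_iff]
  constructor
  · rintro a _ ⟨b, rfl⟩
    exact ⟨a * b, by simp [V.act_mul]⟩
  · rintro n _ ⟨a, rfl⟩
    refine alg_induction (p := fun a => gproj V.internal n (V.act.flip v a) ∈ V.cyc v)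
      (by simp) (fun x y hx hy => by rw [map_add, map_add]; exact add_mem hx hy) ?_ a
    intro m a ha
    by_cases h : m + d = n
    · subst h
      rw [gproj_of_mem _ (by exact V.act_mem ha hv)]
      exact ⟨a, rfl⟩
    · rw [gproj_of_mem_ne _ h (by exact V.act_mem ha hv)]
      exact zero_mem _

/-- Irreducible graded modules. -/
def IsSimple (V : GMod A) : Prop :=
  (∃ v : V, v ≠ 0) ∧ ∀ W, V.IsGSub W → W = ⊥ ∨ W = ⊤

/-- `N` is the greatest proper graded submodule. -/
def IsGreatestProper (V : GMod A) (N : Submodule k V) : Prop :=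
  V.IsGSub N ∧ N ≠ ⊤ ∧ ∀ W, V.IsGSub W → W ≠ ⊤ → W ≤ N

theorem IsGreatestProper.rad_eq {V : GMod A} {N : Submodule k V} (h : V.IsGreatestProper N) :
    V.rad = N := by
  have hmax : V.IsMaxGSub N := ⟨h.1, h.2.1, fun W' hW' hle => by
    by_cases ht : W' = ⊤
    · exact Or.inr ht
    · exact Or.inl (le_antisymm (h.2.2 W' hW' ht) hle)⟩
  apply le_antisymm
  · exact sInf_le hmax
  · refine le_sInf fun W hW => ?_
    rcases hW.2.2 N h.1 (h.2.2 W hW.1 hW.2.1) with h' | h'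
    · exact h'.le
    · exact absurd h' h.2.1

theorem IsGreatestProper.isSimple_quot {V : GMod A} {N : Submodule k V}
    (h : V.IsGreatestProper N) (hN : V.IsGSub N) : (V.quot N hN).IsSimple := by
  constructor
  · obtain ⟨v, hv⟩ : ∃ v, v ∉ N := by
      by_contra hc
      push Not at hc
      exact h.2.1 (eq_top_iff.2 fun v _ => hc v)
    exact ⟨V.qmap N hN v, fun h0 => hv ((qmap_eq_zero hN).1 h0)⟩
  · intro W hW
    have hW' := hW.comap (qmap_mem_hom hN)
    by_cases ht : W.comap (V.qmap N hN) = ⊤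
    · right
      rw [eq_top_iff]
      rintro x -
      obtain ⟨v, rfl⟩ := qmap_surjective hN x
      have : v ∈ W.comap (V.qmap N hN) := by rw [ht]; trivial
      exact this
    · left
      rw [eq_bot_iff]
      intro x hx
      obtain ⟨v, rfl⟩ := qmap_surjective hN x
      exact (qmap_eq_zero hN).2 (h.2.2 _ hW' ht hx)

theorem IsGreatestProper.isSimple_cosoc {V : GMod A} {N : Submodule k V}
    (h : V.IsGreatestProper N) : V.cosoc.IsSimple := by
  have := h.rad_eq
  subst this
  exact h.isSimple_quot _

theorem IsSimple.isGreatestProper {V : GMod A} (h : V.IsSimple) : V.IsGreatestProper ⊥ := by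
  refine ⟨V.isGSub_bot, ?_, fun W hW ht => ?_⟩
  · obtain ⟨v, hv⟩ := h.1
    intro hb
    have : v ∈ (⊥ : Submodule k V) := by rw [hb]; trivial
    exact hv (by simpa using this)
  · rcases h.2 W hW with h | h
    · exact h.le
    · exact absurd h ht

theorem exists_unit_homog_ne_zero {I : Type*} (U : LocalUnits A I) (V : GMod A)
    (h : ∃ v : V, v ≠ 0) : ∃ i d, ∃ v ∈ V.deg d, V.act (U.one i).val v = v ∧ v ≠ 0 := by
  obtain ⟨v, hv⟩ := h
  by_contra hc
  push Not at hc
  exact hv (V.unit_induction U (p := fun v => v = 0) rfl (fun x y hx hy => by simp [hx, hy]) hc v)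

/-- In an irreducible module, every nonzero homogeneous vector is a generator, provided it is fixed
by some element of the algebra. -/
theorem IsSimple.cyc_eq_top {V : GMod A} (h : V.IsSimple) {v : V} {d : ℤ} (hv : v ∈ V.deg d)
    {a : A} (ha : V.act a v = v) (h0 : v ≠ 0) : V.cyc v = ⊤ := by
  rcases h.2 _ (V.isGSub_cyc hv) with h | h
  · exact absurd (by simpa [h] using (show v ∈ V.cyc v from ⟨a, ha⟩)) h0
  · exact h

/-- A nonzero endomorphism (of any degree) of an irreducible module is injective. -/
theorem IsSimple.injective {V W : GMod A} (h : V.IsSimple) {d : ℤ} {f : V →ₗ[k] W}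
    (hf : f ∈ hom V W d) (h0 : f ≠ 0) : Function.Injective f := by
  rw [← LinearMap.ker_eq_bot]
  rcases h.2 _ (isGSub_ker hf) with h | h
  · exact h
  · exact absurd (LinearMap.ker_eq_top.1 h) h0

theorem IsSection.of_quot {V : GMod A} {W : Submodule k V} (hW : V.IsGSub W)
    {W₁ W₂ : Submodule k (V.quot W hW)} {M : GMod A} (h : (V.quot W hW).IsSection W₁ W₂ M) :
    V.IsSection (W₁.comap (V.qmap W hW)) (W₂.comap (V.qmap W hW)) M := by
  obtain ⟨f, hs, hk, hd, ha⟩ := h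
  let g : W₂.comap (V.qmap W hW) →ₗ[k] W₂ :=
    ((V.qmap W hW) ∘ₗ (W₂.comap (V.qmap W hW)).subtype).codRestrict W₂ fun x => x.2
  have hg : Function.Surjective g := by
    rintro ⟨y, hy⟩
    obtain ⟨x, rfl⟩ := qmap_surjective hW y
    exact ⟨⟨x, hy⟩, rfl⟩
  refine ⟨f ∘ₗ g, hs.comp hg, ?_, ?_, ?_⟩
  · rw [LinearMap.ker_comp, hk]; rfl
  · intro d w hw
    exact hd d (g w) ⟨w.1, hw, rfl⟩
  · intro a w w' hw
    refine ha a (g w) (g w') ?_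
    change (V.qmap W hW) w'.1 = (V.qmap W hW) (V.act a w.1)
    rw [hw]

/-- An isomorphism of `M` with a submodule of a quotient `V / W'` gives a section. -/
theorem IsSection.of_hom {V M : GMod A} {W' W : Submodule k V} (hW' : V.IsGSub W')
    {g : M →ₗ[k] V.quot W' hW'} (hg : g ∈ hom M (V.quot W' hW') 0) (hi : Function.Injective g)
    (hr : LinearMap.range g = W.map (V.qmap W' hW')) : V.IsSection W' W M := by
  let e : M ≃ₗ[k] LinearMap.range g := LinearEquiv.ofInjective g hi
  let h : W →ₗ[k] LinearMap.range g := ((V.qmap W' hW') ∘ₗ W.subtype).codRestrict (LinearMap.range g)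
    fun w => by rw [hr]; exact ⟨w.1, w.2, rfl⟩
  have key : ∀ w : W, g (e.symm (h w)) = (V.qmap W' hW') w.1 := fun w =>
    congrArg Subtype.val (e.apply_symm_apply (h w))
  refine ⟨e.symm.toLinearMap ∘ₗ h, ?_, ?_, ?_, ?_⟩
  · refine e.symm.surjective.comp ?_
    rintro ⟨y, hy⟩
    have hy' := hy
    rw [hr] at hy'
    obtain ⟨x, hx, hxy⟩ := hy'
    exact ⟨⟨x, hx⟩, Subtype.ext hxy⟩
  · ext w
    simp only [LinearMap.mem_ker, LinearMap.comp_apply, LinearEquiv.coe_coe,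
      LinearEquiv.map_eq_zero_iff, Submodule.mem_comap, Submodule.subtype_apply]
    rw [Subtype.ext_iff]
    exact qmap_eq_zero hW'
  · intro d w hw
    have h1 : g (e.symm (h w)) ∈ (V.quot W' hW').deg d := by
      rw [key]; exact ⟨w.1, hw, rfl⟩
    -- An injective graded map reflects degrees: the preimage and its degree `d` component have the
    -- same image.
    have h2 := hom_gproj hg d (e.symm (h w))
    rw [add_zero, gproj_of_mem _ h1] at h2
    change e.symm (h w) ∈ M.deg d
    rw [hi h2]
    exact gproj_mem _ _ _
  · intro a w w' hw
    apply hi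
    rw [hom_smul hg]
    change g (e.symm (h w')) = (V.quot W' hW').act a (g (e.symm (h w)))
    rw [key, key, hw]
    rfl

end GMod

end PureBGG

/-! ### The triangular basis: ideals attached to lower sets of weights, and independence of the
elements x. -/

namespace PureBGG

namespace TriBasis

variable {k : Type u} [Field k] {A : GrAlg k} {I : Type*} {U : LocalUnits A I} {W : Type*}
  [PartialOrder W] (T : TriBasis U W)

theorem one_mul_of_mem_X {i : I} {s : T.S} {x : A} (hx : x ∈ T.X i s) : (U.one i).val * x = x :=
  (T.X_mem i s x hx).1

theorem mul_one_of_mem_X {i : I} {s : T.S} {x : A} (hx : x ∈ T.X i s) : x * (U.one s).val = x :=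
  (T.X_mem i s x hx).2

theorem one_mul_of_mem_H {s t : T.S} {x : A} (hx : x ∈ T.H s t) : (U.one s).val * x = x :=
  (T.H_mem s t x hx).1

theorem mul_one_of_mem_H {s t : T.S} {x : A} (hx : x ∈ T.H s t) : x * (U.one t).val = x :=
  (T.H_mem s t x hx).2

theorem one_mul_of_mem_Y {t : T.S} {j : I} {x : A} (hx : x ∈ T.Y t j) : (U.one t).val * x = x :=
  (T.Y_mem t j x hx).1

theorem mul_one_of_mem_Y {t : T.S} {j : I} {x : A} (hx : x ∈ T.Y t j) : x * (U.one j).val = x :=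
  (T.Y_mem t j x hx).2

theorem dot_eq_of_mem_H {s t : T.S} {h : A} (hh : h ∈ T.H s t) : T.dot s = T.dot t := by
  by_cases hst : s = t
  · rw [hst]
  · exact T.H_ne s t hst ⟨h, hh⟩

theorem cases_of_mem_X {s t : T.S} {x : A} (hx : x ∈ T.X s t) :
    (s = t ∧ x = (U.one s).val) ∨ T.dot t < T.dot s := by
  by_cases hst : s = t
  · subst hst
    rw [T.X_self] at hx
    exact Or.inl ⟨rfl, hx⟩
  · exact Or.inr (T.X_ne s t hst ⟨x, hx⟩)

theorem cases_of_mem_Y {s t : T.S} {y : A} (hy : y ∈ T.Y s t) :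
    (s = t ∧ y = (U.one s).val) ∨ T.dot s < T.dot t := by
  by_cases hst : s = t
  · subst hst
    rw [T.Y_self] at hy
    exact Or.inl ⟨rfl, hy⟩
  · exact Or.inr (T.Y_ne s t hst ⟨y, hy⟩)

/-- The indices of the elements of the triangular basis. -/
abbrev Idx : Type _ := Σ c : (I × T.S) × (T.S × I), T.X c.1.1 c.1.2 × T.H c.1.2 c.2.1 × T.Y c.2.1 c.2.2

/-- The triangular basis, as a basis of the vector space `A`. -/
noncomputable def toBasis : Module.Basis T.Idx k A := Module.Basis.mk T.basis_indep T.basis_span.ge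

theorem toBasis_apply (p : T.Idx) : T.toBasis p = p.2.1.val * p.2.2.1.val * p.2.2.2.val :=
  Module.Basis.mk_apply _ _ p

theorem basis_induction {p : A → Prop} (h0 : p 0) (hadd : ∀ a b, p a → p b → p (a + b))
    (hsmul : ∀ (c : k) a, p a → p (c • a))
    (hb : ∀ i s t j x h y, x ∈ T.X i s → h ∈ T.H s t → y ∈ T.Y t j → p (x * h * y)) (a : A) :
    p a := by
  have ha : a ∈ Submodule.span k (Set.range (fun p : T.Idx =>
      p.2.1.val * p.2.2.1.val * p.2.2.2.val)) := by rw [T.basis_span]; trivial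
  induction ha using Submodule.span_induction with
  | mem a ha =>
    obtain ⟨⟨⟨⟨i, s⟩, ⟨t, j⟩⟩, ⟨⟨x, hx⟩, ⟨h, hh⟩, ⟨y, hy⟩⟩⟩, rfl⟩ := ha
    exact hb i s t j x h y hx hh hy
  | zero => exact h0
  | add a b _ _ ha hb => exact hadd a b ha hb
  | smul c a _ ha => exact hsmul c a ha

theorem left_induction {p : A → Prop} (h0 : p 0) (hadd : ∀ a b, p a → p b → p (a + b))
    (hsmul : ∀ (c : k) a, p a → p (c • a)) (i : I)
    (hb : ∀ s t j x h y, x ∈ T.X i s → h ∈ T.H s t → y ∈ T.Y t j → p (x * h * y)) (a : A)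
    (ha : (U.one i).val * a = a) : p a := by
  rw [← ha]
  clear ha
  refine T.basis_induction (p := fun a => p ((U.one i).val * a)) (by simpa using h0)
    (fun a b ha hb => by rw [mul_add]; exact hadd _ _ ha hb)
    (fun c a ha => by rw [mul_smul_comm]; exact hsmul c _ ha) ?_ a
  intro i' s t j x h y hx hh hy
  by_cases hi : i = i'
  · subst hi
    rw [← mul_assoc, ← mul_assoc, T.one_mul_of_mem_X hx]
    exact hb s t j x h y hx hh hy
  · rw [← T.one_mul_of_mem_X hx]
    simpa only [← mul_assoc, U.orth hi, zero_mul] using h0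

theorem right_induction {p : A → Prop} (h0 : p 0) (hadd : ∀ a b, p a → p b → p (a + b))
    (hsmul : ∀ (c : k) a, p a → p (c • a)) (j : I)
    (hb : ∀ i s t x h y, x ∈ T.X i s → h ∈ T.H s t → y ∈ T.Y t j → p (x * h * y)) (a : A)
    (ha : a * (U.one j).val = a) : p a := by
  rw [← ha]
  clear ha
  refine T.basis_induction (p := fun a => p (a * (U.one j).val)) (by simpa using h0)
    (fun a b ha hb => by rw [add_mul]; exact hadd _ _ ha hb)
    (fun c a ha => by rw [smul_mul_assoc]; exact hsmul c _ ha) ?_ a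
  intro i s t j' x h y hx hh hy
  by_cases hj : j' = j
  · subst hj
    rw [mul_assoc, T.mul_one_of_mem_Y hy]
    exact hb i s t x h y hx hh hy
  · rw [← T.mul_one_of_mem_Y hy]
    simpa only [mul_assoc, U.orth hj, mul_zero] using h0

theorem peirce_induction {p : A → Prop} (h0 : p 0) (hadd : ∀ a b, p a → p b → p (a + b))
    (hsmul : ∀ (c : k) a, p a → p (c • a)) (i j : I)
    (hb : ∀ s t x h y, x ∈ T.X i s → h ∈ T.H s t → y ∈ T.Y t j → p (x * h * y)) (a : A)
    (ha : (U.one i).val * a = a) (ha' : a * (U.one j).val = a) : p a := by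
  rw [← ha']
  clear ha'
  refine T.left_induction (p := fun a => p (a * (U.one j).val)) (by simpa using h0)
    (fun a b ha hb => by rw [add_mul]; exact hadd _ _ ha hb)
    (fun c a ha => by rw [smul_mul_assoc]; exact hsmul c _ ha) i ?_ a ha
  intro s t j' x h y hx hh hy
  by_cases hj : j' = j
  · subst hj
    rw [mul_assoc, T.mul_one_of_mem_Y hy]
    exact hb s t x h y hx hh hy
  · rw [← T.mul_one_of_mem_Y hy]
    simpa only [mul_assoc, U.orth hj, mul_zero] using h0

/-- The span of the basis elements with weight in a given set. -/
def wspan (Γ : Set W) : Submodule k A :=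
  Submodule.span k {a | ∃ i s t j x h y, x ∈ T.X i s ∧ h ∈ T.H s t ∧ y ∈ T.Y t j ∧ T.dot s ∈ Γ ∧
    a = x * h * y}

theorem mem_wspan {Γ : Set W} {i s t j x h y} (hx : x ∈ T.X i s) (hh : h ∈ T.H s t)
    (hy : y ∈ T.Y t j) (hs : T.dot s ∈ Γ) : x * h * y ∈ T.wspan Γ :=
  Submodule.subset_span ⟨i, s, t, j, x, h, y, hx, hh, hy, hs, rfl⟩

theorem wspan_mono {Γ Γ' : Set W} (h : Γ ⊆ Γ') : T.wspan Γ ≤ T.wspan Γ' := by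
  refine Submodule.span_mono ?_
  rintro _ ⟨i, s, t, j, x, h', y, hx, hh, hy, hs, rfl⟩
  exact ⟨i, s, t, j, x, h', y, hx, hh, hy, h hs, rfl⟩

theorem wspan_univ : T.wspan Set.univ = ⊤ := by
  rw [eq_top_iff]
  rintro a -
  refine T.basis_induction (p := fun a => a ∈ T.wspan Set.univ) (zero_mem _)
    (fun _ _ => add_mem) (fun c _ => Submodule.smul_mem _ c) ?_ a
  exact fun i s t j x h y hx hh hy => T.mem_wspan hx hh hy trivial

/-- This is where triangularity acts. Expanding `1_s b`, then `a 1_s`, then the product in the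
middle, each expansion either contributes a trivial factor `1` or lets the product factor through an
idempotent of strictly smaller weight. The latter terms are covered by induction; the surviving term
is a basis element of weight `dot s`. -/
theorem mul_one_mul_mem (s : T.S) (a b : A) :
    a * (U.one s).val * b ∈ T.wspan (Set.Iic (T.dot s)) := by
  -- Lower intervals are finite, so their cardinality serves as induction parameter in place of
  -- well-foundedness of the order.
  induction hn : (Set.Iic (T.dot s)).ncard using Nat.strong_induction_on generalizing s a b with
  | _ n ih =>
  have IH : ∀ s' : T.S, T.dot s' < T.dot s → ∀ a b,
      a * (U.one s').val * b ∈ T.wspan (Set.Iic (T.dot s)) := by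
    intro s' hs' a b
    have hlt : (Set.Iic (T.dot s')).ncard < (Set.Iic (T.dot s)).ncard :=
      Set.ncard_lt_ncard (Set.Iic_ssubset_Iic.2 hs') (T.lower_finite _)
    exact T.wspan_mono (Set.Iic_subset_Iic.2 hs'.le) (ih _ (hn ▸ hlt) s' a b rfl)
  have IH' : ∀ s' : T.S, T.dot s' < T.dot s → ∀ a b, a * (U.one s').val = a →
      a * b ∈ T.wspan (Set.Iic (T.dot s)) := by
    intro s' hs' a b hab
    have := IH s' hs' a b
    rwa [hab] at this
  rw [mul_assoc]
  have hsb : (U.one s).val * ((U.one s).val * b) = (U.one s).val * b := by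
    rw [← mul_assoc, (U.one s).mul_self]
  generalize (U.one s).val * b = b at hsb
  refine T.left_induction (p := fun b => a * b ∈ T.wspan (Set.Iic (T.dot s))) (by simp)
    (fun x y hx hy => by rw [mul_add]; exact add_mem hx hy)
    (fun c x hx => by rw [mul_smul_comm]; exact Submodule.smul_mem _ c hx) s ?_ b hsb
  intro s' t j x h y hx hh hy
  rcases T.cases_of_mem_X hx with ⟨rfl, rfl⟩ | hlt
  swap
  · have := IH' s' hlt (a * x) (h * y) (by rw [mul_assoc, T.mul_one_of_mem_X hx])
    simpa only [mul_assoc] using this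
  rw [T.one_mul_of_mem_H hh]
  have has : a * (U.one s).val * (U.one s).val = a * (U.one s).val := by
    rw [mul_assoc, (U.one s).mul_self]
  have hah : a * (h * y) = a * (U.one s).val * (h * y) := by
    rw [mul_assoc a (U.one s).val, ← mul_assoc (U.one s).val h, T.one_mul_of_mem_H hh]
  rw [hah]
  generalize a * (U.one s).val = a at has
  refine T.right_induction (p := fun a => a * (h * y) ∈ T.wspan (Set.Iic (T.dot s))) (by simp)
    (fun x y hx hy => by rw [add_mul]; exact add_mem hx hy)
    (fun c x hx => by rw [smul_mul_assoc]; exact Submodule.smul_mem _ c hx) s ?_ a has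
  intro i s' t' x' h' y' hx' hh' hy'
  rcases T.cases_of_mem_Y hy' with ⟨rfl, rfl⟩ | hlt
  swap
  · have := IH' t' hlt (x' * h') (y' * (h * y)) (by rw [mul_assoc, T.mul_one_of_mem_H hh'])
    simpa only [mul_assoc] using this
  -- The product of two elements of the sets H need not be a combination of such elements, so it is
  -- expanded once more; both of its ends have weight `dot s`.
  have hc1 : (U.one s').val * (h' * h) = h' * h := by
    rw [← mul_assoc, T.one_mul_of_mem_H hh']
  have hc2 : h' * h * (U.one t).val = h' * h := by
    rw [mul_assoc, T.mul_one_of_mem_H hh]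
  have hcc : x' * h' * (U.one t').val * (h * y) = x' * (h' * h) * y := by
    rw [mul_assoc x', T.mul_one_of_mem_H hh']; simp only [mul_assoc]
  rw [hcc]
  have hs't' := T.dot_eq_of_mem_H hh'
  generalize h' * h = c at hc1 hc2
  refine T.peirce_induction (p := fun c => x' * c * y ∈ T.wspan (Set.Iic (T.dot t'))) (by simp)
    (fun x y hx hy => by rw [mul_add, add_mul]; exact add_mem hx hy)
    (fun c x hx => by rw [mul_smul_comm, smul_mul_assoc]; exact Submodule.smul_mem _ c hx)
    s' t ?_ c hc1 hc2
  intro s'' t'' x'' h'' y'' hx'' hh'' hy''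
  rcases T.cases_of_mem_X hx'' with ⟨rfl, rfl⟩ | hlt
  swap
  · have := IH' s'' (hs't' ▸ hlt) (x' * x'') (h'' * y'' * y)
      (by rw [mul_assoc, T.mul_one_of_mem_X hx''])
    simpa only [mul_assoc] using this
  rcases T.cases_of_mem_Y hy'' with ⟨rfl, rfl⟩ | hlt
  swap
  · have := IH' t'' ((T.dot_eq_of_mem_H hh) ▸ hlt) (x' * (U.one s').val * h'') (y'' * y)
      (by rw [mul_assoc, T.mul_one_of_mem_H hh''])
    simpa only [mul_assoc] using this
  rw [T.one_mul_of_mem_H hh'', T.mul_one_of_mem_H hh'']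
  exact T.mem_wspan hx' hh'' hy hs't'.le

section Lower

variable {Γ : Set W} (hΓ : IsLowerSet Γ)
include hΓ

theorem mul_one_mul_mem_of_mem {s : T.S} (hs : T.dot s ∈ Γ) (a b : A) :
    a * (U.one s).val * b ∈ T.wspan Γ :=
  T.wspan_mono (fun _ hw => hΓ hw hs) (T.mul_one_mul_mem s a b)

theorem mul_mem_wspan (a : A) {b : A} (hb : b ∈ T.wspan Γ) : a * b ∈ T.wspan Γ := by
  induction hb using Submodule.span_induction with
  | mem b hb =>
    obtain ⟨i, s, t, j, x, h, y, hx, hh, hy, hs, rfl⟩ := hb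
    have := T.mul_one_mul_mem_of_mem hΓ hs (a * x) (h * y)
    rw [mul_assoc a, T.mul_one_of_mem_X hx] at this
    simpa only [mul_assoc] using this
  | zero => simp
  | add x y _ _ hx hy => rw [mul_add]; exact add_mem hx hy
  | smul c x _ hx => rw [mul_smul_comm]; exact Submodule.smul_mem _ c hx

theorem wspan_mul_mem {a : A} (ha : a ∈ T.wspan Γ) (b : A) : a * b ∈ T.wspan Γ := by
  induction ha using Submodule.span_induction with
  | mem a ha =>
    obtain ⟨i, s, t, j, x, h, y, hx, hh, hy, hs, rfl⟩ := ha
    have := T.mul_one_mul_mem_of_mem hΓ hs x (h * y * b)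
    rw [T.mul_one_of_mem_X hx] at this
    simpa only [mul_assoc] using this
  | zero => simp
  | add x y _ _ hx hy => rw [add_mul]; exact add_mem hx hy
  | smul c x _ hx => rw [smul_mul_assoc]; exact Submodule.smul_mem _ c hx

end Lower

theorem e_val (w : W) : (T.e w).val = ∑ s ∈ (T.fiber_finite w).toFinset, (U.one s).val := rfl

theorem one_mul_e (s : T.S) : (U.one s).val * (T.e (T.dot s)).val = (U.one s).val := by
  rw [e_val, Finset.mul_sum, Finset.sum_eq_single s]
  · exact (U.one s).mul_self
  · intro t _ h
    exact U.orth fun h' => h (Subtype.ext h'.symm)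
  · intro h; simp at h

theorem e_mul_one (s : T.S) : (T.e (T.dot s)).val * (U.one s).val = (U.one s).val := by
  rw [e_val, Finset.sum_mul, Finset.sum_eq_single s]
  · exact (U.one s).mul_self
  · intro t _ h
    exact U.orth fun h' => h (Subtype.ext h')
  · intro h; simp at h

theorem e_mul_one_of_ne {w : W} {i : I} (h : ∀ s : T.S, T.dot s = w → (s : I) ≠ i) :
    (T.e w).val * (U.one i).val = 0 := by
  rw [e_val, Finset.sum_mul]
  refine Finset.sum_eq_zero fun s hs => U.orth (h s ?_)
  simpa using hs

theorem mul_e_mul_mem (γ : W) (a b : A) : a * (T.e γ).val * b ∈ T.wspan (Set.Iic γ) := by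
  rw [e_val, Finset.mul_sum, Finset.sum_mul]
  refine Submodule.sum_mem _ fun s hs => ?_
  have : T.dot s = γ := by simpa using hs
  subst this
  exact T.mul_one_mul_mem s a b

/-- With Γ the weights not above `w`, this turns the ideal defining A_(≥ w) into the span of an
explicit part of the basis. -/
theorem mem_wspan_iff_ideal {Γ : Set W} (hΓ : IsLowerSet Γ) :
    T.wspan Γ = Submodule.span k {a | ∃ γ ∈ Γ, ∃ x y, a = x * (T.e γ).val * y} := by
  apply le_antisymm
  · refine Submodule.span_le.2 ?_
    rintro _ ⟨i, s, t, j, x, h, y, hx, hh, hy, hs, rfl⟩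
    refine Submodule.subset_span ⟨_, hs, x, h * y, ?_⟩
    have hxe : x * (T.e (T.dot s)).val = x := by
      conv_lhs => rw [← T.mul_one_of_mem_X hx]
      rw [mul_assoc x, T.one_mul_e, T.mul_one_of_mem_X hx]
    rw [hxe, mul_assoc]
  · refine Submodule.span_le.2 ?_
    rintro _ ⟨γ, hγ, x, y, rfl⟩
    exact T.wspan_mono (fun _ hw => hΓ hw hγ) (T.mul_e_mul_mem γ x y)

/-- The weights that are not greater than or equal to `w`. -/
def notGe (w : W) : Set W := {m | ¬ w ≤ m}

theorem isLowerSet_notGe (w : W) : IsLowerSet (notGe w) := fun _ _ h hm hw => hm (hw.trans h)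

theorem ideal_below (w : W) : A.ideal (T.below w) = T.wspan (notGe w) := by
  rw [T.mem_wspan_iff_ideal (isLowerSet_notGe w)]
  refine congrArg (Submodule.span k) (Set.ext fun a => ⟨?_, ?_⟩)
  · rintro ⟨_, ⟨m, hm, rfl⟩, x, y, rfl⟩
    exact ⟨m, hm, x, y, rfl⟩
  · rintro ⟨m, hm, x, y, rfl⟩
    exact ⟨_, ⟨m, hm, rfl⟩, x, y, rfl⟩

/-- The span of the products `x * h`, of weight `w`. -/
theorem mul_one_decomp (s : T.S) {p : A → Prop} (h0 : p 0) (hadd : ∀ a b, p a → p b → p (a + b))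
    (hsmul : ∀ (c : k) a, p a → p (c • a))
    (hlow : ∀ a ∈ T.wspan (Set.Iio (T.dot s)), a * (U.one s).val = a → p a)
    (hb : ∀ i s' x h, x ∈ T.X i s' → h ∈ T.H s' s → p (x * h)) (a : A)
    (ha : a * (U.one s).val = a) : p a := by
  refine T.right_induction h0 hadd hsmul s ?_ a ha
  intro i s' t x h y hx hh hy
  rcases T.cases_of_mem_Y hy with ⟨rfl, rfl⟩ | hlt
  · rw [mul_assoc, T.mul_one_of_mem_H hh]
    exact hb i s' x h hx hh
  · refine hlow _ (T.mem_wspan hx hh hy ?_) (by rw [mul_assoc, T.mul_one_of_mem_Y hy])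
    exact (T.dot_eq_of_mem_H hh).trans_lt hlt

theorem one_mul_decomp (s : T.S) {p : A → Prop} (h0 : p 0) (hadd : ∀ a b, p a → p b → p (a + b))
    (hsmul : ∀ (c : k) a, p a → p (c • a))
    (hlow : ∀ a ∈ T.wspan (Set.Iio (T.dot s)), (U.one s).val * a = a → p a)
    (hb : ∀ t j h y, h ∈ T.H s t → y ∈ T.Y t j → p (h * y)) (a : A)
    (ha : (U.one s).val * a = a) : p a := by
  refine T.left_induction h0 hadd hsmul s ?_ a ha
  intro s' t j x h y hx hh hy
  rcases T.cases_of_mem_X hx with ⟨rfl, rfl⟩ | hlt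
  · rw [T.one_mul_of_mem_H hh]
    exact hb t j h y hh hy
  · refine hlow _ (T.mem_wspan hx hh hy hlt) ?_
    rw [← mul_assoc, ← mul_assoc, T.one_mul_of_mem_X hx]

/-- The indices of all elements of the sets `X i s`. -/
abbrev XIdx : Type _ := Σ c : I × T.S, T.X c.1 c.2

open Classical in
/-- Taking coefficients with respect to `x`: the linear map sending a basis element `x * h * y` to
`h * y`, and the basis elements with a different first factor to zero. -/
noncomputable def coeffX (x : T.XIdx) : A →ₗ[k] A :=
  T.toBasis.constr k fun p => if (⟨p.1.1, p.2.1⟩ : T.XIdx) = x then p.2.2.1.val * p.2.2.2.val else 0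

open Classical in
theorem coeffX_apply (x₀ : T.XIdx) {i s t j x h y} (hx : x ∈ T.X i s) (hh : h ∈ T.H s t)
    (hy : y ∈ T.Y t j) :
    T.coeffX x₀ (x * h * y) = if (⟨(i, s), ⟨x, hx⟩⟩ : T.XIdx) = x₀ then h * y else 0 := by
  have h1 := T.toBasis_apply ⟨((i, s), (t, j)), ⟨⟨x, hx⟩, ⟨h, hh⟩, ⟨y, hy⟩⟩⟩
  have h2 : x * h * y = T.toBasis ⟨((i, s), (t, j)), ⟨⟨x, hx⟩, ⟨h, hh⟩, ⟨y, hy⟩⟩⟩ := h1.symm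
  rw [h2, coeffX, Module.Basis.constr_basis]

/-- Since `1_s` belongs to `X s s`, the product `h * y` is itself a basis element of the same weight
as `x * h * y`. -/
theorem coeffX_mem (x₀ : T.XIdx) {Γ : Set W} {a : A} (ha : a ∈ T.wspan Γ) :
    T.coeffX x₀ a ∈ T.wspan Γ := by
  classical
  induction ha using Submodule.span_induction with
  | mem a ha =>
    obtain ⟨i, s, t, j, x, h, y, hx, hh, hy, hs, rfl⟩ := ha
    rw [T.coeffX_apply x₀ hx hh hy]
    split
    · have hs1 : (U.one s).val ∈ T.X s s := by rw [T.X_self]; rfl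
      have := T.mem_wspan hs1 hh hy hs
      rwa [T.one_mul_of_mem_H hh] at this
    · exact zero_mem _
  | zero => simp
  | add x y _ _ hx hy => rw [map_add]; exact add_mem hx hy
  | smul c x _ hx => rw [map_smul]; exact Submodule.smul_mem _ c hx

open Classical in
-- Modulo smaller weights `c` is a combination of products `h * y`, and for those `x * h * y` is
-- literally a basis element. So reading off coefficients inverts multiplication by `x` up to lower
-- terms.
theorem coeffX_mul (x₀ : T.XIdx) {Γ : Set W} (hΓ : IsLowerSet Γ) {i s x} (hx : x ∈ T.X i s)
    (hs : Set.Iio (T.dot s) ⊆ Γ) (c : A) (hc : (U.one s).val * c = c) :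
    T.coeffX x₀ (x * c) - (if (⟨(i, s), ⟨x, hx⟩⟩ : T.XIdx) = x₀ then c else 0) ∈ T.wspan Γ := by
  refine T.one_mul_decomp s (p := fun c => T.coeffX x₀ (x * c) -
    (if (⟨(i, s), ⟨x, hx⟩⟩ : T.XIdx) = x₀ then c else 0) ∈ T.wspan Γ) (by simp) ?_ ?_ ?_ ?_ c hc
  · intro a b ha hb
    convert add_mem ha hb using 1
    rw [mul_add, map_add]
    split <;> abel
  · intro r a ha
    convert Submodule.smul_mem _ r ha using 1
    rw [mul_smul_comm, map_smul]
    split <;> simp [smul_sub]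
  · intro a ha _
    have ha' := T.wspan_mono hs ha
    refine sub_mem (T.coeffX_mem x₀ (T.mul_mem_wspan hΓ x ha')) ?_
    split
    · exact ha'
    · exact zero_mem _
  · intro t j h y hh hy
    rw [← mul_assoc, T.coeffX_apply x₀ hx hh hy]
    split <;> simp

/-- The basis elements `x` are independent modulo lower terms. -/
theorem X_indep {Γ : Set W} (hΓ : IsLowerSet Γ) {w : W} (hw : Set.Iio w ⊆ Γ) (c : T.XIdx →₀ A)
    (hc : ∀ x, (U.one x.1.2).val * c x = c x) (hs : ∀ x ∈ c.support, T.dot x.1.2 = w)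
    (h : (c.sum fun x a => x.2.val * a) ∈ T.wspan Γ) (x : T.XIdx) : c x ∈ T.wspan Γ := by
  classical
  -- The coefficient map for `x` is applied to the relation; modulo `wspan Γ` only the summand
  -- indexed by `x` survives.
  have h1 := T.coeffX_mem x h
  rw [Finsupp.sum, map_sum] at h1
  have h2 : ∑ y ∈ c.support, (T.coeffX x (y.2.val * c y) - if y = x then c y else 0) ∈
      T.wspan Γ := by
    refine Submodule.sum_mem _ fun y hy => ?_
    exact T.coeffX_mul x hΓ y.2.2 (by rw [hs y hy]; exact hw) (c y) (hc y)
  rw [Finset.sum_sub_distrib] at h2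
  have h3 := sub_mem h1 h2
  rw [sub_sub_cancel, Finset.sum_ite_eq'] at h3
  split at h3
  · exact h3
  · rename_i hx
    rw [Finsupp.notMem_support_iff.1 hx]
    exact zero_mem _

/-- If the indexing set is lower, an element fixed by `1_i` lies in the span of the basis elements
with weights in a finite lower set. -/
theorem exists_finite_lower (i : I) : ∃ Γ : Set W, Γ.Finite ∧ IsLowerSet Γ ∧
    ∀ a : A, a * (U.one i).val = a → a ∈ T.wspan Γ := by
  -- For special `i` these weights are at most `dot i`; for other `i` finiteness is an axiom of the
  -- triangular basis.
  have hfin : {w | ∃ t, T.dot t = w ∧ (T.Y t i).Nonempty}.Finite := by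
    by_cases hi : i ∈ T.S
    · refine (T.lower_finite (T.dot ⟨i, hi⟩)).subset ?_
      rintro _ ⟨t, rfl, y, hy⟩
      rcases T.cases_of_mem_Y (t := ⟨i, hi⟩) hy with ⟨rfl, -⟩ | h
      · exact le_refl _
      · exact h.le
    · refine ((T.finite_of_not_mem i hi).image T.dot).subset ?_
      rintro _ ⟨t, rfl, y, hy⟩
      exact ⟨t, ⟨y, Or.inr hy⟩, rfl⟩
  refine ⟨⋃ w ∈ {w | ∃ t, T.dot t = w ∧ (T.Y t i).Nonempty}, Set.Iic w,
    hfin.biUnion fun w _ => T.lower_finite w, ?_, ?_⟩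
  · intro a b hab ha
    simp only [Set.mem_iUnion] at ha ⊢
    obtain ⟨w, hw, ha⟩ := ha
    exact ⟨w, hw, hab.trans ha⟩
  · refine T.right_induction (zero_mem _) (fun _ _ => add_mem)
      (fun c _ => Submodule.smul_mem _ c) i ?_
    intro i' s t x h y hx hh hy
    refine T.mem_wspan hx hh hy ?_
    simp only [Set.mem_iUnion]
    exact ⟨_, ⟨t, rfl, y, hy⟩, (T.dot_eq_of_mem_H hh).le⟩

end TriBasis

end PureBGG

/-! ### Standardization, costandardization and truncation described by elements and functions on A
itself. -/

namespace PureBGG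

namespace TriBasis

open TensorProduct

variable {k : Type u} [Field k] {A : GrAlg k} {I : Type*} {U : LocalUnits A I} {W : Type*}
  [PartialOrder W] (T : TriBasis U W) (w : W)

/-- The map `a ↦ e a e` from `A` to `A_w`. -/
noncomputable def toCartan : A →ₗ[k] T.cartan w :=
  LinearMap.codRestrict ((T.ge w).cornerSub (T.eBar w)).toSubmodule
    (A.toQuot (T.below w) ∘ₗ LinearMap.mulLeft k (T.e w).val ∘ₗ LinearMap.mulRight k (T.e w).val)
    (fun a => by
      constructor
      · change A.toQuot (T.below w) ((T.e w).val * ((T.e w).val * (a * (T.e w).val))) = _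
        rw [← mul_assoc, (T.e w).mul_self]; rfl
      · change A.toQuot (T.below w) ((T.e w).val * (a * (T.e w).val) * (T.e w).val) = _
        rw [mul_assoc, mul_assoc, (T.e w).mul_self]; rfl)

theorem cartan_ext {a b : T.cartan w}
    (h : (T.ge w).incl (T.eBar w) a = (T.ge w).incl (T.eBar w) b) : a = b := Subtype.ext h

theorem toQuot_eq_zero {a : A} : A.toQuot (T.below w) a = 0 ↔ a ∈ A.ideal (T.below w) :=
  Submodule.Quotient.mk_eq_zero _

theorem toCartan_surjective : Function.Surjective (T.toCartan w) := by
  rintro ⟨a, ha⟩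
  obtain ⟨a, rfl⟩ := A.toQuot_surjective (T.below w) a
  refine ⟨a, Subtype.ext ?_⟩
  have h2 : A.toQuot (T.below w) a * A.toQuot (T.below w) (T.e w).val = A.toQuot (T.below w) a :=
    ha.2
  have h1 : A.toQuot (T.below w) (T.e w).val * A.toQuot (T.below w) a = A.toQuot (T.below w) a :=
    ha.1
  change A.toQuot (T.below w) ((T.e w).val * (a * (T.e w).val)) = A.toQuot (T.below w) a
  rw [A.toQuot_mul, A.toQuot_mul, h2, h1]

theorem toCartan_eq_zero {a : A} :
    T.toCartan w a = 0 ↔ (T.e w).val * (a * (T.e w).val) ∈ A.ideal (T.below w) := by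
  rw [← toQuot_eq_zero]
  exact ⟨fun h => congrArg ((T.ge w).incl (T.eBar w)) h, fun h => T.cartan_ext w h⟩

theorem toCartan_of_mem_ideal {a : A} (ha : a ∈ A.ideal (T.below w)) : T.toCartan w a = 0 :=
  (T.toCartan_eq_zero w).2 (A.mul_mem_ideal_left _ _ (A.mul_mem_ideal_right _ _ ha))

theorem toCartan_mem {d : ℤ} {a : A} (ha : a ∈ A.deg d) :
    T.toCartan w a ∈ (T.cartan w).deg d := by
  have h := A.mul_mem (T.e w).mem (A.mul_mem ha (T.e w).mem)
  rw [add_zero, zero_add] at h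
  exact A.toQuot_mem (T.below w) h

/-- Any lift may be replaced by its component of degree `d`, as the projection is a graded map. -/
theorem exists_toCartan_of_mem {d : ℤ} {c : T.cartan w} (hc : c ∈ (T.cartan w).deg d) :
    ∃ a ∈ A.deg d, T.toCartan w a = c := by
  obtain ⟨a, rfl⟩ := T.toCartan_surjective w c
  refine ⟨gproj A.internal d a, gproj_mem _ _ _, ?_⟩
  have := gproj_map (m := 0) A.internal (T.cartan w).internal (f := T.toCartan w)
    (fun n x hx => by rw [add_zero]; exact T.toCartan_mem w hx) d a
  rw [← this, add_zero, gproj_of_mem _ hc]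

theorem toCartan_mul (a b : A) :
    T.toCartan w a * T.toCartan w b = T.toCartan w (a * (T.e w).val * b) := by
  apply T.cartan_ext
  change A.toQuot (T.below w) (((T.e w).val * (a * (T.e w).val)) *
    ((T.e w).val * (b * (T.e w).val))) = A.toQuot (T.below w) _
  refine congrArg (A.toQuot (T.below w)) ?_
  change _ = (T.e w).val * (a * (T.e w).val * b * (T.e w).val)
  simp only [mul_assoc]
  rw [← mul_assoc (T.e w).val (T.e w).val, (T.e w).mul_self]

theorem toCartan_e : T.toCartan w (T.e w).val = (T.ge w).cornerOne (T.eBar w) := by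
  apply T.cartan_ext
  change A.toQuot (T.below w) ((T.e w).val * ((T.e w).val * (T.e w).val)) = _
  rw [(T.e w).mul_self, (T.e w).mul_self]; rfl

theorem toCartan_e_mul (a : A) : T.toCartan w ((T.e w).val * a) = T.toCartan w a := by
  apply T.cartan_ext
  change A.toQuot (T.below w) ((T.e w).val * ((T.e w).val * a * (T.e w).val)) =
    A.toQuot (T.below w) ((T.e w).val * (a * (T.e w).val))
  rw [mul_assoc, ← mul_assoc, (T.e w).mul_self]

theorem toCartan_mul_e (a : A) : T.toCartan w (a * (T.e w).val) = T.toCartan w a := by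
  apply T.cartan_ext
  change A.toQuot (T.below w) ((T.e w).val * (a * (T.e w).val * (T.e w).val)) =
    A.toQuot (T.below w) ((T.e w).val * (a * (T.e w).val))
  rw [mul_assoc, (T.e w).mul_self]

variable {w}

theorem act_toCartan_e (V : GMod (T.cartan w)) (v : V) :
    V.act (T.toCartan w (T.e w).val) v = v := by
  rw [toCartan_e]; exact GMod.act_cornerOne (A := T.ge w) (T.eBar w) V v

theorem act_toCartan_mul (V : GMod (T.cartan w)) (a b : A) (v : V) :
    V.act (T.toCartan w (a * (T.e w).val * b)) v =
      V.act (T.toCartan w a) (V.act (T.toCartan w b) v) := by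
  rw [← toCartan_mul, V.act_mul]

variable (w)

/-- The projection `x ↦ x e` onto the bimodule `A_(≥ w) e`. -/
noncomputable def toLeft : A →ₗ[k] GMod.leftIdeal (T.eBar w) :=
  LinearMap.codRestrict _ (A.toQuot (T.below w) ∘ₗ LinearMap.mulRight k (T.e w).val) (fun a => by
      change A.toQuot (T.below w) (a * (T.e w).val * (T.e w).val) = _
      rw [mul_assoc, (T.e w).mul_self]; rfl)

/-- The projection `x ↦ e x` onto the bimodule `e A_(≥ w)`. -/
noncomputable def toRight : A →ₗ[k] GMod.rightIdeal (T.eBar w) :=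
  LinearMap.codRestrict _ (A.toQuot (T.below w) ∘ₗ LinearMap.mulLeft k (T.e w).val) (fun a => by
      change A.toQuot (T.below w) ((T.e w).val * ((T.e w).val * a)) = _
      rw [← mul_assoc, (T.e w).mul_self]; rfl)

theorem toLeft_surjective : Function.Surjective (T.toLeft w) := by
  rintro ⟨a, ha⟩
  obtain ⟨a, rfl⟩ := A.toQuot_surjective (T.below w) a
  exact ⟨a, Subtype.ext ha⟩

theorem toRight_surjective : Function.Surjective (T.toRight w) := by
  rintro ⟨a, ha⟩
  obtain ⟨a, rfl⟩ := A.toQuot_surjective (T.below w) a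
  exact ⟨a, Subtype.ext ha⟩

theorem toLeft_mem {d : ℤ} {a : A} (ha : a ∈ A.deg d) : T.toLeft w a ∈ GMod.leftDeg (T.eBar w) d := by
  have h := A.mul_mem ha (T.e w).mem
  rw [add_zero] at h
  exact A.toQuot_mem (T.below w) h

theorem toRight_mem {d : ℤ} {a : A} (ha : a ∈ A.deg d) :
    T.toRight w a ∈ GMod.rightDeg (T.eBar w) d := by
  have h := A.mul_mem (T.e w).mem ha
  rw [zero_add] at h
  exact A.toQuot_mem (T.below w) h

theorem exists_toLeft_of_mem {d : ℤ} {x : GMod.leftIdeal (T.eBar w)}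
    (hx : x ∈ GMod.leftDeg (T.eBar w) d) : ∃ a ∈ A.deg d, T.toLeft w a = x := by
  obtain ⟨a, rfl⟩ := T.toLeft_surjective w x
  refine ⟨gproj A.internal d a, gproj_mem _ _ _, ?_⟩
  have := gproj_map (m := 0) A.internal (GMod.leftDeg_isInternal (T.eBar w)) (f := T.toLeft w)
    (fun n x hx => by rw [add_zero]; exact T.toLeft_mem w hx) d a
  rw [← this, add_zero, gproj_of_mem _ hx]

theorem exists_toRight_of_mem {d : ℤ} {x : GMod.rightIdeal (T.eBar w)}
    (hx : x ∈ GMod.rightDeg (T.eBar w) d) : ∃ a ∈ A.deg d, T.toRight w a = x := by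
  obtain ⟨a, rfl⟩ := T.toRight_surjective w x
  refine ⟨gproj A.internal d a, gproj_mem _ _ _, ?_⟩
  have := gproj_map (m := 0) A.internal (GMod.rightDeg_isInternal (T.eBar w)) (f := T.toRight w)
    (fun n x hx => by rw [add_zero]; exact T.toRight_mem w hx) d a
  rw [← this, add_zero, gproj_of_mem _ hx]

section Std

variable {w} (V : GMod (T.cartan w))

/-- The element `x e ⊗ v` of a standardization. -/
noncomputable def stdMk : A →ₗ[k] V →ₗ[k] T.std w V :=
  LinearMap.compr₂ (TensorProduct.mk k (GMod.leftIdeal (T.eBar w)) V ∘ₗ T.toLeft w)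
    (GMod.stdRel (T.eBar w) V).mkQ

theorem stdMk_apply (x : A) (v : V) :
    T.stdMk V x v = GMod.shriekMk (T.eBar w) V (T.toLeft w x) v := rfl

theorem std_act_mk (a x : A) (v : V) :
    (T.std w V).act a (T.stdMk V x v) = T.stdMk V (a * x) v := by
  rw [stdMk_apply, stdMk_apply]
  refine (GMod.shriekAct_mk (A := T.ge w) (T.eBar w) V (A.toQuot (T.below w) a) _ _).trans ?_
  refine congrArg (fun y => GMod.shriekMk (T.eBar w) V y v) (Subtype.ext ?_)
  change A.toQuot (T.below w) a * A.toQuot (T.below w) (x * (T.e w).val) =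
    A.toQuot (T.below w) (a * x * (T.e w).val)
  rw [← A.toQuot_mul, mul_assoc]

/-- The defining tensor relation over A_w, written with representatives in A; `e u e` is moved
across the tensor sign. -/
theorem stdMk_mul (x u : A) (v : V) :
    T.stdMk V (x * (T.e w).val * u) v = T.stdMk V x (V.act (T.toCartan w u) v) := by
  have h : GMod.leftIdealMul (T.eBar w) (T.toLeft w x) (T.toCartan w u) =
      T.toLeft w (x * (T.e w).val * u) := by
    apply Subtype.ext
    change A.toQuot (T.below w) (x * (T.e w).val) *
      A.toQuot (T.below w) ((T.e w).val * (u * (T.e w).val)) =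
      A.toQuot (T.below w) (x * (T.e w).val * u * (T.e w).val)
    rw [← A.toQuot_mul]
    congr 1
    simp only [mul_assoc]
    rw [← mul_assoc (T.e w).val (T.e w).val, (T.e w).mul_self]
  have h2 : (GMod.stdRel (T.eBar w) V).mkQ ((T.toLeft w (x * (T.e w).val * u)) ⊗ₜ[k] v) =
      (GMod.stdRel (T.eBar w) V).mkQ ((T.toLeft w x) ⊗ₜ[k] (V.act (T.toCartan w u) v)) := by
    rw [← h]
    exact (Submodule.Quotient.eq _).2 (Submodule.subset_span ⟨_, _, _, rfl⟩)
  exact h2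

theorem stdMk_mul_e (x : A) (v : V) : T.stdMk V (x * (T.e w).val) v = T.stdMk V x v := by
  have := T.stdMk_mul V x (T.e w).val v
  rwa [T.act_toCartan_e, mul_assoc, (T.e w).mul_self] at this

theorem stdMk_of_mem_ideal {x : A} (hx : x ∈ A.ideal (T.below w)) : T.stdMk V x = 0 := by
  have : T.toLeft w x = 0 :=
    Subtype.ext ((T.toQuot_eq_zero w).2 (A.mul_mem_ideal_right _ _ hx))
  ext v
  change (GMod.stdRel (T.eBar w) V).mkQ ((T.toLeft w x) ⊗ₜ[k] v) = 0
  rw [this, TensorProduct.zero_tmul, map_zero]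

theorem stdMk_mem {p q : ℤ} {x : A} {v : V} (hx : x ∈ A.deg p) (hv : v ∈ V.deg q) :
    T.stdMk V x v ∈ (T.std w V).deg (p + q) :=
  ⟨_, Submodule.subset_span ⟨p, q, rfl, T.toLeft w x, T.toLeft_mem w hx, v, hv, rfl⟩, rfl⟩

theorem std_induction {p : T.std w V → Prop} (hadd : ∀ x y, p x → p y → p (x + y))
    (hmk : ∀ x v, p (T.stdMk V x v)) (z : T.std w V) : p z := by
  obtain ⟨z, rfl⟩ := (GMod.stdRel (T.eBar w) V).mkQ_surjective z
  induction z using TensorProduct.induction_on with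
  | zero =>
    have := hmk 0 0
    rwa [map_zero] at this
  | tmul x v =>
    obtain ⟨x, rfl⟩ := T.toLeft_surjective w x
    exact hmk x v
  | add x y hx hy => rw [map_add]; exact hadd _ _ hx hy

theorem std_deg_eq (n : ℤ) : (T.std w V).deg n =
    Submodule.span k {z | ∃ i j, i + j = n ∧ ∃ x ∈ A.deg i, ∃ v ∈ V.deg j, z = T.stdMk V x v} := by
  change (Submodule.span k _).map (GMod.stdRel (T.eBar w) V).mkQ = _
  refine (Submodule.map_span _ _).trans (congrArg (Submodule.span k) (Set.ext fun z => ?_))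
  constructor
  · rintro ⟨_, ⟨i, j, hij, x, hx, v, hv, rfl⟩, rfl⟩
    obtain ⟨y, hy, rfl⟩ := T.exists_toLeft_of_mem w hx
    exact ⟨i, j, hij, y, hy, v, hv, rfl⟩
  · rintro ⟨i, j, hij, x, hx, v, hv, rfl⟩
    exact ⟨_, ⟨i, j, hij, _, T.toLeft_mem w hx, v, hv, rfl⟩, rfl⟩

theorem std_ext {N : Type*} [AddCommGroup N] [Module k N] {f g : T.std w V →ₗ[k] N}
    (h : ∀ x v, f (T.stdMk V x v) = g (T.stdMk V x v)) : f = g := by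
  ext z
  exact T.std_induction V (p := fun z => f z = g z)
    (fun x y hx hy => by rw [map_add, map_add, hx, hy]) h z

/-- The universal property of standardization. -/
theorem exists_std_lift {N : Type*} [AddCommGroup N] [Module k N] (Φ : A →ₗ[k] V →ₗ[k] N)
    (h1 : ∀ a ∈ A.ideal (T.below w), Φ a = 0)
    (h2 : ∀ x u v, Φ (x * (T.e w).val * u) v = Φ x (V.act (T.toCartan w u) v)) :
    ∃ f : T.std w V →ₗ[k] N, ∀ x v, f (T.stdMk V x v) = Φ x v := by
  have h3 : ∀ x v, Φ (x * (T.e w).val) v = Φ x v := fun x v => by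
    have := h2 x (T.e w).val v
    rwa [T.act_toCartan_e, mul_assoc, (T.e w).mul_self] at this
  let Ψ : (A ⧸ A.ideal (T.below w)) →ₗ[k] V →ₗ[k] N := (A.ideal (T.below w)).liftQ Φ h1
  let Θ : GMod.leftIdeal (T.eBar w) →ₗ[k] V →ₗ[k] N :=
    Ψ ∘ₗ (GMod.leftIdeal (T.eBar w)).subtype
  have hΘ : ∀ x v, Θ (T.toLeft w x) v = Φ x v := fun x v => h3 x v
  have hrel : GMod.stdRel (T.eBar w) V ≤ LinearMap.ker (TensorProduct.lift Θ) := by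
    refine Submodule.span_le.2 ?_
    rintro _ ⟨x, a, v, rfl⟩
    obtain ⟨x, rfl⟩ := T.toLeft_surjective w x
    obtain ⟨a, rfl⟩ := T.toCartan_surjective w a
    have h : GMod.leftIdealMul (T.eBar w) (T.toLeft w x) (T.toCartan w a) =
        T.toLeft w (x * (T.e w).val * a) := by
      apply Subtype.ext
      change A.toQuot (T.below w) (x * (T.e w).val) *
        A.toQuot (T.below w) ((T.e w).val * (a * (T.e w).val)) =
        A.toQuot (T.below w) (x * (T.e w).val * a * (T.e w).val)
      rw [← A.toQuot_mul]
      congr 1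
      simp only [mul_assoc]
      rw [← mul_assoc (T.e w).val (T.e w).val, (T.e w).mul_self]
    rw [SetLike.mem_coe, LinearMap.mem_ker, map_sub, h, TensorProduct.lift.tmul,
      TensorProduct.lift.tmul]
    exact sub_eq_zero.2 (((hΘ _ _).trans (h2 _ _ _)).trans (hΘ _ _).symm)
  exact ⟨(GMod.stdRel (T.eBar w) V).liftQ _ hrel, fun x v => hΘ x v⟩

end Std

section Costd

variable {w} (V : GMod (T.cartan w))

/-- The elements of a costandardization, viewed as functions on `A`. -/
noncomputable def costdEval : T.costd w V →ₗ[k] A →ₗ[k] V :=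
  (LinearMap.lcomp k V (T.toRight w)) ∘ₗ
    (GMod.starSpace (T.eBar w) (U.quot (T.below w)) V).subtype

/-- The functions on `A` that are obtained from functions on `e A_(≥ w)` which are homomorphisms of
left `A_w`-modules. -/
structure IsCostdFun (φ : A →ₗ[k] V) : Prop where
  ideal : ∀ a ∈ A.ideal (T.below w), φ a = 0
  mul : ∀ u a, φ (u * (T.e w).val * a) = V.act (T.toCartan w u) (φ a)

variable {T V} in
theorem IsCostdFun.e_mul {φ : A →ₗ[k] V} (h : T.IsCostdFun V φ) (a : A) :
    φ ((T.e w).val * a) = φ a := by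
  have := h.mul (T.e w).val a
  rwa [T.act_toCartan_e, (T.e w).mul_self] at this

theorem costdEval_injective : Function.Injective (T.costdEval V) := by
  intro f g h
  refine Subtype.ext (LinearMap.ext fun x => ?_)
  obtain ⟨x, rfl⟩ := T.toRight_surjective w x
  exact LinearMap.congr_fun h x

theorem costdEval_act (a : A) (f : T.costd w V) (x : A) :
    T.costdEval V ((T.costd w V).act a f) x = T.costdEval V f (x * a) := by
  refine congrArg f.1 (Subtype.ext ?_)
  change A.toQuot (T.below w) ((T.e w).val * x) * A.toQuot (T.below w) a =
    A.toQuot (T.below w) ((T.e w).val * (x * a))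
  rw [← A.toQuot_mul, mul_assoc]

theorem costdEval_mem {d : ℤ} {f : T.costd w V} (hf : f ∈ (T.costd w V).deg d) {n : ℤ} {x : A}
    (hx : x ∈ A.deg n) : T.costdEval V f x ∈ V.deg (n + d) :=
  hf n (T.toRight w x) (T.toRight_mem w hx)

theorem mem_costd_deg {d : ℤ} {f : T.costd w V}
    (hf : ∀ n, ∀ x ∈ A.deg n, T.costdEval V f x ∈ V.deg (n + d)) : f ∈ (T.costd w V).deg d := by
  intro n x hx
  obtain ⟨y, hy, rfl⟩ := T.exists_toRight_of_mem w hx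
  exact hf n y hy

theorem rightIdealMul_toRight (u x : A) :
    GMod.rightIdealMul (T.eBar w) (T.toCartan w u) (T.toRight w x) =
      T.toRight w (u * (T.e w).val * x) := by
  apply Subtype.ext
  change A.toQuot (T.below w) ((T.e w).val * (u * (T.e w).val)) *
    A.toQuot (T.below w) ((T.e w).val * x) =
    A.toQuot (T.below w) ((T.e w).val * (u * (T.e w).val * x))
  rw [← A.toQuot_mul]
  congr 1
  simp only [mul_assoc]
  rw [← mul_assoc (T.e w).val (T.e w).val, (T.e w).mul_self]

theorem isCostdFun_costdEval (f : T.costd w V) : T.IsCostdFun V (T.costdEval V f) := by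
  constructor
  · intro a ha
    have : T.toRight w a = 0 :=
      Subtype.ext ((T.toQuot_eq_zero w).2 (A.mul_mem_ideal_left _ _ ha))
    change f.1 (T.toRight w a) = 0
    rw [this, map_zero]
  · intro u a
    change f.1 (T.toRight w _) = V.act _ (f.1 (T.toRight w a))
    rw [← rightIdealMul_toRight]
    obtain ⟨f, hf⟩ := f
    refine Submodule.iSup_induction _ (motive := fun f : GMod.rightIdeal (T.eBar w) →ₗ[k] V =>
      f (GMod.rightIdealMul (T.eBar w) (T.toCartan w u) (T.toRight w a)) =
      V.act (T.toCartan w u) (f (T.toRight w a))) hf ?_ (by simp)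
      (fun f g hf hg => by simp only [LinearMap.add_apply, map_add, hf, hg])
    intro i f hf
    refine Submodule.iSup_induction _ (motive := fun f : GMod.rightIdeal (T.eBar w) →ₗ[k] V =>
      f (GMod.rightIdealMul (T.eBar w) (T.toCartan w u) (T.toRight w a)) =
      V.act (T.toCartan w u) (f (T.toRight w a))) hf ?_ (by simp)
      (fun f g hf hg => by simp only [LinearMap.add_apply, map_add, hf, hg])
    intro d f hf
    exact hf.2.1 _ _

variable {V} in
-- Homogeneity and invariance under right multiplication by a single `1_i` place the function in one
-- summand of the direct sum that defines costandardization; they have to be supplied because an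
-- arbitrary such function need not lie in that sum.
theorem IsCostdFun.exists_costd {φ : A →ₗ[k] V} (h : T.IsCostdFun V φ) {d : ℤ}
    (hd : ∀ n, ∀ x ∈ A.deg n, φ x ∈ V.deg (n + d)) {i : I}
    (hi : ∀ x, φ (x * (U.one i).val) = φ x) :
    ∃ f ∈ (T.costd w V).deg d, (T.costd w V).act (U.one i).val f = f ∧ T.costdEval V f = φ := by
  let Ψ : (A ⧸ A.ideal (T.below w)) →ₗ[k] V := (A.ideal (T.below w)).liftQ φ h.ideal
  let g : GMod.rightIdeal (T.eBar w) →ₗ[k] V := Ψ ∘ₗ (GMod.rightIdeal (T.eBar w)).subtype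
  have hg : ∀ x, g (T.toRight w x) = φ x := fun x => h.e_mul x
  have hgi : g ∈ GMod.starPiece (T.eBar w) (U.quot (T.below w)) V i d := by
    refine ⟨?_, ?_, ?_⟩
    · intro n x hx
      obtain ⟨y, hy, rfl⟩ := T.exists_toRight_of_mem w hx
      rw [hg]; exact hd n y hy
    · intro a x
      obtain ⟨x, rfl⟩ := T.toRight_surjective w x
      obtain ⟨a, rfl⟩ := T.toCartan_surjective w a
      rw [rightIdealMul_toRight, hg, hg, h.mul]
      rfl
    · intro x
      obtain ⟨x, rfl⟩ := T.toRight_surjective w x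
      have : GMod.rightMul (T.eBar w) ((U.quot (T.below w)).one i).val (T.toRight w x) =
          T.toRight w (x * (U.one i).val) := by
        apply Subtype.ext
        change A.toQuot (T.below w) ((T.e w).val * x) * A.toQuot (T.below w) (U.one i).val =
          A.toQuot (T.below w) ((T.e w).val * (x * (U.one i).val))
        rw [← A.toQuot_mul, mul_assoc]
      rw [this, hg, hg, hi]
  let f : T.costd w V :=
    ⟨g, Submodule.mem_iSup_of_mem i (Submodule.mem_iSup_of_mem d hgi)⟩
  have hf : T.costdEval V f = φ := LinearMap.ext hg
  refine ⟨f, hgi.1, ?_, hf⟩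
  apply T.costdEval_injective
  ext x
  rw [costdEval_act, hf, hi]

end Costd

section Trunc

variable {w} (N : GMod A)

/-- The condition on a module `N` under which `e_w N` is a module over `A_w`. -/
def Truncatable (w : W) (N : GMod A) : Prop :=
  ∀ a ∈ A.ideal (T.below w), ∀ v, N.act a (N.act (T.e w).val v) = 0

variable {N} (hN : T.Truncatable w N)

/-- The action of `A_w` on `e_w N`. -/
noncomputable def truncAct :
    T.cartan w →ₗ[k] LinearMap.range (N.act (T.e w).val) →ₗ[k] LinearMap.range (N.act (T.e w).val) :=
  let φ : A →ₗ[k] LinearMap.range (N.act (T.e w).val) →ₗ[k] LinearMap.range (N.act (T.e w).val) :=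
    LinearMap.mk₂ k (fun a v => ⟨N.act (T.e w).val (N.act a v.1), ⟨_, rfl⟩⟩)
      (fun a b v => Subtype.ext (by simp)) (fun c a v => Subtype.ext (by simp))
      (fun a v v' => Subtype.ext (by simp)) (fun c a v => Subtype.ext (by simp))
  -- The formula `v ↦ e (a v)` is not multiplicative on all of A; it kills the ideal, and it becomes
  -- an action after restriction to the corner algebra.
  ((A.ideal (T.below w)).liftQ φ (fun a ha => by
    ext ⟨_, v, rfl⟩
    change N.act (T.e w).val (N.act a (N.act (T.e w).val v)) = 0
    rw [hN a ha, map_zero])) ∘ₗ ((T.ge w).cornerSub (T.eBar w)).toSubmodule.subtype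

theorem act_e_of_mem_range {v : N} (hv : v ∈ LinearMap.range (N.act (T.e w).val)) :
    N.act (T.e w).val v = v := by
  obtain ⟨v, rfl⟩ := hv
  rw [← N.act_mul, (T.e w).mul_self]

theorem truncAct_toCartan (a : A) (v : LinearMap.range (N.act (T.e w).val)) :
    (T.truncAct hN (T.toCartan w a) v).1 = N.act (T.e w).val (N.act a v.1) := by
  change N.act (T.e w).val (N.act ((T.e w).val * (a * (T.e w).val)) v.1) = _
  rw [← N.act_mul, ← mul_assoc, (T.e w).mul_self, N.act_mul, N.act_mul,
    T.act_e_of_mem_range v.2]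

/-- The `A_w`-module `e_w N`. -/
noncomputable def trunc : GMod (T.cartan w) where
  carrier := LinearMap.range (N.act (T.e w).val)
  act := T.truncAct hN
  act_mul a b v := by
    obtain ⟨a, rfl⟩ := T.toCartan_surjective w a
    obtain ⟨b, rfl⟩ := T.toCartan_surjective w b
    apply Subtype.ext
    rw [toCartan_mul, truncAct_toCartan, truncAct_toCartan, truncAct_toCartan, N.act_mul,
      N.act_mul]
  deg d := (N.deg d).comap (LinearMap.range (N.act (T.e w).val)).subtype
  internal := isInternal_sub N.internal.submodule_iSupIndep _
    (homog_of_gproj N.internal (by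
      rintro d _ ⟨v, rfl⟩
      exact ⟨_, (N.act_gproj_zero (T.e w).mem d v).symm⟩))
  act_mem := by
    intro m n a v ha hv
    obtain ⟨b, hb, rfl⟩ := T.exists_toCartan_of_mem w ha
    change (T.truncAct hN (T.toCartan w b) v).1 ∈ N.deg (m + n)
    rw [truncAct_toCartan]
    exact N.act_mem_zero (T.e w).mem (N.act_mem hb hv)
  span_act v := by
    refine Submodule.subset_span ⟨T.toCartan w (T.e w).val, v, ?_⟩
    apply Subtype.ext
    rw [truncAct_toCartan, T.act_e_of_mem_range v.2, T.act_e_of_mem_range v.2]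

/-- The inclusion of `e_w N` into `N`. -/
noncomputable def truncIncl : T.trunc hN →ₗ[k] N :=
  (LinearMap.range (N.act (T.e w).val)).subtype

theorem truncIncl_injective : Function.Injective (T.truncIncl hN) := Subtype.val_injective

theorem truncIncl_act (a : A) (v : T.trunc hN) :
    T.truncIncl hN ((T.trunc hN).act (T.toCartan w a) v) =
      N.act (T.e w).val (N.act a (T.truncIncl hN v)) := T.truncAct_toCartan hN a v

theorem act_e_truncIncl (v : T.trunc hN) :
    N.act (T.e w).val (T.truncIncl hN v) = T.truncIncl hN v := T.act_e_of_mem_range v.2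

theorem truncIncl_mem {d : ℤ} {v : T.trunc hN} :
    T.truncIncl hN v ∈ N.deg d ↔ v ∈ (T.trunc hN).deg d := Iff.rfl

/-- The projection of `N` onto `e_w N`. -/
noncomputable def truncProj : N →ₗ[k] T.trunc hN := (N.act (T.e w).val).rangeRestrict

theorem truncIncl_truncProj (v : N) : T.truncIncl hN (T.truncProj hN v) = N.act (T.e w).val v := rfl

theorem truncProj_truncIncl (v : T.trunc hN) : T.truncProj hN (T.truncIncl hN v) = v :=
  T.truncIncl_injective hN (T.act_e_truncIncl hN v)

theorem truncProj_mem {d : ℤ} {v : N} (hv : v ∈ N.deg d) :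
    T.truncProj hN v ∈ (T.trunc hN).deg d := N.act_mem_zero (T.e w).mem hv

end Trunc

end TriBasis

end PureBGG

/-! ### Expansion of standardizations along the basis, and sections induced from truncations. -/

namespace PureBGG

namespace TriBasis

variable {k : Type u} [Field k] {A : GrAlg k} {I : Type*} {U : LocalUnits A I} {W : Type*}
  [PartialOrder W] (T : TriBasis U W) {w : W}

theorem one_mul_e_of_eq {s : T.S} (h : T.dot s = w) :
    (U.one s).val * (T.e w).val = (U.one s).val := by subst h; exact T.one_mul_e s

theorem e_mul_one_of_eq {s : T.S} (h : T.dot s = w) :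
    (T.e w).val * (U.one s).val = (U.one s).val := by subst h; exact T.e_mul_one s

theorem one_mul_e_of_ne {w : W} {i : I} (h : ∀ s : T.S, T.dot s = w → (s : I) ≠ i) :
    (U.one i).val * (T.e w).val = 0 := by
  rw [e_val, Finset.mul_sum]
  refine Finset.sum_eq_zero fun s hs => U.orth (Ne.symm (h s ?_))
  simpa using hs

/-- Right multiplication by e_w keeps only basis elements ending at a special index of weight `w`.
Such an element has weight `w`, which is excluded, or strictly less by triangularity of Y. Hence
killing the weights below `w` already makes the e_w-part a module over A_w. -/
theorem mul_e_mem_Iio {a : A} (ha : a ∈ T.wspan (notGe w)) :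
    a * (T.e w).val ∈ T.wspan (Set.Iio w) := by
  induction ha using Submodule.span_induction with
  | mem a ha =>
    obtain ⟨i, s, t, j, x, h, y, hx, hh, hy, hs, rfl⟩ := ha
    by_cases hj : ∃ s : T.S, T.dot s = w ∧ (s : I) = j
    · obtain ⟨r, rfl, rfl⟩ := hj
      rw [mul_assoc, ← T.mul_one_of_mem_Y hy, mul_assoc y, T.one_mul_e, T.mul_one_of_mem_Y hy]
      refine T.mem_wspan hx hh hy ?_
      rcases T.cases_of_mem_Y hy with ⟨rfl, -⟩ | h
      · exact absurd (T.dot_eq_of_mem_H hh).ge hs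
      · exact (T.dot_eq_of_mem_H hh).trans_lt h
    · push Not at hj
      rw [mul_assoc, ← T.mul_one_of_mem_Y hy, mul_assoc y, T.one_mul_e_of_ne hj]
      simp
  | zero => simp
  | add x y _ _ hx hy => rw [add_mul]; exact add_mem hx hy
  | smul c x _ hx => rw [smul_mul_assoc]; exact Submodule.smul_mem _ c hx

theorem e_mul_mem_Iio {a : A} (ha : a ∈ T.wspan (notGe w)) :
    (T.e w).val * a ∈ T.wspan (Set.Iio w) := by
  induction ha using Submodule.span_induction with
  | mem a ha =>
    obtain ⟨i, s, t, j, x, h, y, hx, hh, hy, hs, rfl⟩ := ha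
    by_cases hj : ∃ s : T.S, T.dot s = w ∧ (s : I) = i
    · obtain ⟨r, rfl, rfl⟩ := hj
      have hex : (T.e (T.dot r)).val * x = x := by
        conv_lhs => rw [← T.one_mul_of_mem_X hx]
        rw [← mul_assoc, T.e_mul_one, T.one_mul_of_mem_X hx]
      rw [← mul_assoc, ← mul_assoc, hex]
      refine T.mem_wspan hx hh hy ?_
      rcases T.cases_of_mem_X hx with ⟨rfl, -⟩ | h
      · exact absurd (le_refl _) hs
      · exact h
    · push Not at hj
      have hex : (T.e w).val * x = 0 := by
        rw [← T.one_mul_of_mem_X hx, ← mul_assoc, T.e_mul_one_of_ne hj, zero_mul]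
      rw [← mul_assoc, ← mul_assoc, hex]
      simp
  | zero => simp
  | add x y _ _ hx hy => rw [mul_add]; exact add_mem hx hy
  | smul c x _ hx => rw [mul_smul_comm]; exact Submodule.smul_mem _ c hx

theorem Iio_subset_notGe : Set.Iio w ⊆ notGe w := fun _ h h' => not_le_of_gt h h'

/-- Bilinear maps which factor through `A_(≥ w) e ⊗ V`. -/
structure IsStdMap (V : GMod (T.cartan w)) {N : Type*} [AddCommGroup N] [Module k N]
    (Φ : A →ₗ[k] V →ₗ[k] N) : Prop where
  ideal : ∀ a ∈ A.ideal (T.below w), Φ a = 0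
  mul : ∀ x u v, Φ (x * (T.e w).val * u) v = Φ x (V.act (T.toCartan w u) v)

theorem isStdMap_stdMk (V : GMod (T.cartan w)) : T.IsStdMap V (T.stdMk V) :=
  ⟨fun _ h => T.stdMk_of_mem_ideal V h, fun x u v => T.stdMk_mul V x u v⟩

section Expand

variable {V : GMod (T.cartan w)} {N : Type*} [AddCommGroup N] [Module k N]
  {Φ : A →ₗ[k] V →ₗ[k] N}

variable {T} in
theorem IsStdMap.mul_e (h : T.IsStdMap V Φ) (x : A) (v : V) :
    Φ (x * (T.e w).val) v = Φ x v := by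
  have := h.mul x (T.e w).val v
  rwa [T.act_toCartan_e, mul_assoc, (T.e w).mul_self] at this

variable {T} in
/-- Every element of the image of `A_(≥ w) e ⊗ V` is a sum of terms `x ⊗ v`, for elements `x` of the
triangular basis. -/
theorem IsStdMap.expand (hΦ : T.IsStdMap V Φ) {K : Submodule k V}
    (hK : ∀ a, ∀ v ∈ K, V.act a v ∈ K) {z : N}
    (hz : z ∈ Submodule.span k {z | ∃ a, ∃ v ∈ K, z = Φ a v}) :
    ∃ n : T.XIdx →₀ V, (∀ x, n x ∈ K) ∧
      (∀ x, V.act (T.toCartan w (U.one x.1.2).val) (n x) = n x) ∧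
      (∀ x ∈ n.support, T.dot x.1.2 = w) ∧ z = n.sum fun x v => Φ x.2.val v := by
  classical
  let P : N → Prop := fun z => ∃ n : T.XIdx →₀ V, (∀ x, n x ∈ K) ∧
      (∀ x, V.act (T.toCartan w (U.one x.1.2).val) (n x) = n x) ∧
      (∀ x ∈ n.support, T.dot x.1.2 = w) ∧ z = n.sum fun x v => Φ x.2.val v
  have P0 : P 0 := ⟨0, by simp, by simp, by simp, by simp⟩
  have Padd : ∀ a b, P a → P b → P (a + b) := by
    rintro _ _ ⟨n, h1, h2, h3, rfl⟩ ⟨n', h1', h2', h3', rfl⟩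
    refine ⟨n + n', fun x => add_mem (h1 x) (h1' x), fun x => by simp [h2, h2'], ?_, ?_⟩
    · intro x hx
      rcases Finset.mem_union.1 (Finsupp.support_add hx) with h | h
      · exact h3 x h
      · exact h3' x h
    · rw [Finsupp.sum_add_index'] <;> simp
  have Psmul : ∀ (c : k) a, P a → P (c • a) := by
    rintro c _ ⟨n, h1, h2, h3, rfl⟩
    refine ⟨c • n, fun x => Submodule.smul_mem _ c (h1 x), fun x => by simp [h2],
      fun x hx => h3 x (Finsupp.support_smul hx), ?_⟩
    rw [Finsupp.sum_smul_index' (by simp), Finsupp.smul_sum]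
    simp
  -- Modulo the ideal, an element ending in `1_s` is a combination of products `x * h`; the factor
  -- `h` is absorbed by the module, leaving `x` alone.
  have key : ∀ s : T.S, T.dot s = w → ∀ a, a * (U.one s).val = a → ∀ v ∈ K, P (Φ a v) := by
    intro s hs a ha
    subst hs
    refine T.mul_one_decomp s (p := fun a => ∀ v ∈ K, P (Φ a v)) ?_ ?_ ?_ ?_ ?_ a ha
    · intro v _; simpa using P0
    · intro a b h1 h2 v hv
      rw [map_add, LinearMap.add_apply]
      exact Padd _ _ (h1 v hv) (h2 v hv)
    · intro c a h1 v hv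
      rw [map_smul, LinearMap.smul_apply]
      exact Psmul _ _ (h1 v hv)
    · intro a ha _ v _
      rw [hΦ.ideal a (by rw [T.ideal_below]; exact T.wspan_mono Iio_subset_notGe ha)]
      exact P0
    · intro i s' x h hx hh v hv
      have hd := T.dot_eq_of_mem_H hh
      -- Inserting e_w between `x` and `h` is what permits the use of the tensor relation.
      have h1 : x * h = x * (T.e (T.dot s)).val * h := by
        rw [← hd, ← T.one_mul_of_mem_H hh, mul_assoc x, ← mul_assoc (T.e _).val, T.e_mul_one]
      rw [h1, hΦ.mul]
      refine ⟨Finsupp.single ⟨(i, s'), ⟨x, hx⟩⟩ (V.act (T.toCartan _ h) v), ?_, ?_, ?_, ?_⟩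
      · intro y
        rw [Finsupp.single_apply]
        split
        · exact hK _ v hv
        · exact zero_mem _
      · intro y
        rw [Finsupp.single_apply]
        split
        · rename_i hy
          subst hy
          rw [← V.act_mul, toCartan_mul]
          change V.act (T.toCartan _ ((U.one s').val * (T.e (T.dot s)).val * h)) v = _
          rw [T.one_mul_e_of_eq hd, T.one_mul_of_mem_H hh]
        · simp
      · intro y hy
        have := Finsupp.support_single_subset hy
        rw [Finset.mem_singleton] at this
        subst this
        exact hd
      · rw [Finsupp.sum_single_index (by simp)]
  induction hz using Submodule.span_induction with
  | mem z hz =>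
    obtain ⟨a, v, hv, rfl⟩ := hz
    change P _
    rw [← hΦ.mul_e, e_val, Finset.mul_sum, map_sum, LinearMap.sum_apply]
    refine Finset.sum_induction _ P Padd P0 fun s hs => ?_
    refine key s (by simpa using hs) _ ?_ v hv
    rw [mul_assoc, (U.one s).mul_self]
  | zero => exact P0
  | add a b _ _ ha hb => exact Padd a b ha hb
  | smul c a _ ha => exact Psmul c a ha

end Expand

section Layer

variable {N : GMod A} (hN : T.Truncatable w N)

/-- The bilinear map `(a, v) ↦ a v` on `A × e_w N`. -/
noncomputable def truncMul : A →ₗ[k] T.trunc hN →ₗ[k] N := N.act.compl₂ (T.truncIncl hN)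

theorem truncMul_apply (a : A) (v : T.trunc hN) :
    T.truncMul hN a v = N.act a (T.truncIncl hN v) := rfl

theorem isStdMap_truncMul : T.IsStdMap (T.trunc hN) (T.truncMul hN) := by
  constructor
  · intro a ha
    ext v
    rw [truncMul_apply, ← act_e_truncIncl, hN a ha]; rfl
  · intro x u v
    rw [truncMul_apply, truncMul_apply, truncIncl_act, N.act_mul, N.act_mul]

/-- The submodule of `N` generated by a submodule of `e_w N`. -/
noncomputable def gen (K : Submodule k (T.trunc hN)) : Submodule k N :=
  Submodule.span k {z | ∃ a, ∃ v ∈ K, z = T.truncMul hN a v}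

theorem isGSub_gen {K : Submodule k (T.trunc hN)} (hK : (T.trunc hN).IsGSub K) :
    N.IsGSub (T.gen hN K) := by
  constructor
  · intro a z hz
    induction hz using Submodule.span_induction with
    | mem z hz =>
      obtain ⟨b, v, hv, rfl⟩ := hz
      exact Submodule.subset_span ⟨a * b, v, hv, (N.act_mul a b _).symm⟩
    | zero => simp
    | add x y _ _ hx hy => rw [map_add]; exact add_mem hx hy
    | smul c x _ hx => rw [map_smul]; exact Submodule.smul_mem _ c hx
  · refine Submodule.span_le.2 ?_
    rintro _ ⟨a, v, hv, rfl⟩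
    rw [SetLike.mem_coe]
    have hv' := hK.2 hv
    refine GMod.alg_induction (p := fun a => T.truncMul hN a v ∈
      ⨆ d, T.gen hN K ⊓ N.deg d) (by simp) (fun x y hx hy => by
        rw [map_add, LinearMap.add_apply]; exact add_mem hx hy) ?_ a
    intro m a ha
    refine Submodule.iSup_induction _ (motive := fun v => T.truncMul hN a v ∈
      ⨆ d, T.gen hN K ⊓ N.deg d) hv' ?_ (by simp)
      (fun x y hx hy => by rw [map_add]; exact add_mem hx hy)
    rintro d x ⟨hx, hxd⟩
    exact Submodule.mem_iSup_of_mem (m + d) ⟨Submodule.subset_span ⟨a, x, hx, rfl⟩,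
      N.act_mem ha ((T.truncIncl_mem hN).2 hxd)⟩

theorem gen_bot : T.gen hN ⊥ = ⊥ := by
  rw [eq_bot_iff]
  refine Submodule.span_le.2 ?_
  rintro _ ⟨a, v, hv, rfl⟩
  rw [(Submodule.mem_bot k).1 hv]; simp

theorem gen_mono {K' K : Submodule k (T.trunc hN)} (h : K' ≤ K) : T.gen hN K' ≤ T.gen hN K := by
  refine Submodule.span_mono ?_
  rintro _ ⟨a, v, hv, rfl⟩
  exact ⟨a, v, h hv, rfl⟩

/-- The elements `x` of the triangular basis of weight `w` act independently on `N`. -/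
def XIndep (w : W) (N : GMod A) : Prop :=
  ∀ n : T.XIdx →₀ N, (∀ x, N.act (U.one x.1.2).val (n x) = n x) →
    (∀ x ∈ n.support, T.dot x.1.2 = w) → (n.sum fun x v => N.act x.2.val v) = 0 → n = 0

variable {T} in
-- The map a ⊗ z ↦ a z from the standardization of K/K' is always well defined and onto A K / A K'.
-- For injectivity, an element is written as a sum of terms x ⊗ n(x). If the image lies in A K', it
-- is also a sum of terms x n'(x) with n'(x) in K'; independence of the elements x compares
-- coefficients and gives n = 0.
theorem XIndep.isSection_gen (hI : T.XIndep w N) {K' K : Submodule k (T.trunc hN)}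
    (hK' : (T.trunc hN).IsGSub K') (hK : (T.trunc hN).IsGSub K)
    {Z : GMod (T.cartan w)} (hZ : (T.trunc hN).IsSection K' K Z) :
    N.IsSection (T.gen hN K') (T.gen hN K) (T.std w Z) := by
  classical
  obtain ⟨f, hfs, hfk, hfd, hfa⟩ := hZ
  obtain ⟨σ, hσ⟩ := f.exists_rightInverse_of_surjective (LinearMap.range_eq_top.2 hfs)
  have hσ' : ∀ z, f (σ z) = z := LinearMap.congr_fun hσ
  have hG' := T.isGSub_gen hN hK'
  have hfK : ∀ κ : K, f κ = 0 → κ.1 ∈ K' := fun κ hκ => by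
    have : κ ∈ LinearMap.ker f := hκ
    rw [hfk] at this
    exact this
  have hfK' : ∀ κ : K, κ.1 ∈ K' → f κ = 0 := fun κ hκ => by
    have : κ ∈ LinearMap.ker f := by rw [hfk]; exact hκ
    exact this
  let q := N.qmap (T.gen hN K') hG'
  -- The linear section `σ` is not a homomorphism; modulo the submodule generated by `K'` the choice
  -- of lift does not matter, which is `key`.
  let Φ : A →ₗ[k] Z →ₗ[k] N.quot (T.gen hN K') hG' :=
    (T.truncMul hN).compr₂ q |>.compl₂ (K.subtype ∘ₗ σ)
  have hΦ : ∀ a z, Φ a z = q (T.truncMul hN a (σ z).1) := fun _ _ => rfl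
  have key : ∀ a (κ : K), Φ a (f κ) = q (T.truncMul hN a κ.1) := by
    intro a κ
    rw [hΦ, ← sub_eq_zero, ← map_sub, ← map_sub]
    refine (GMod.qmap_eq_zero hG').2 (Submodule.subset_span ⟨a, _, ?_, rfl⟩)
    refine hfK (σ (f κ) - κ) ?_
    rw [map_sub, hσ', sub_self]
  have hΦs : T.IsStdMap Z Φ := by
    constructor
    · intro a ha
      ext z
      rw [hΦ, (T.isStdMap_truncMul hN).ideal a ha]; simp
    · intro x u z
      have h1 : Z.act (T.toCartan w u) z =
          f ⟨(T.trunc hN).act (T.toCartan w u) (σ z).1, hK.1 _ _ (σ z).2⟩ := by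
        rw [hfa (T.toCartan w u) (σ z) ⟨_, hK.1 _ _ (σ z).2⟩ rfl, hσ']
      rw [h1, key, hΦ, (T.isStdMap_truncMul hN).mul]
  obtain ⟨g, hg⟩ := T.exists_std_lift Z Φ hΦs.ideal hΦs.mul
  have hgh : g ∈ GMod.hom (T.std w Z) (N.quot (T.gen hN K') hG') 0 := by
    constructor
    · intro n z hz
      rw [add_zero]
      rw [std_deg_eq] at hz
      refine (Submodule.span_le.2 ?_ : _ ≤ ((N.quot (T.gen hN K') hG').deg n).comap g) hz
      rintro _ ⟨i, j, rfl, x, hx, v, hv, rfl⟩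
      rw [SetLike.mem_coe, Submodule.mem_comap, hg]
      have hmem : ∀ m ∈ K, gproj (T.trunc hN).internal j m ∈ K :=
        fun m hm => gproj_mem_of_homog _ hK.2 j hm
      -- `σ` need not respect degrees, so `σ v` is replaced by its degree `j` component, which still
      -- lifts `v`.
      let κ : K := ⟨gproj (T.trunc hN).internal j (σ v).1, hmem _ (σ v).2⟩
      have hκ : f κ = v := by
        have : gproj Z.internal j (f (σ v)) = f κ := by
          let G : ℤ → Submodule k K := fun d => ((T.trunc hN).deg d).comap K.subtype
          have hG := isInternal_sub (T.trunc hN).internal.submodule_iSupIndep K hK.2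
          have h1 := gproj_map (m := 0) hG Z.internal (f := f)
            (fun n x hx => by rw [add_zero]; exact hfd n x hx) j (σ v)
          have h2 := gproj_map (m := 0) hG (T.trunc hN).internal (f := K.subtype)
            (fun n x hx => by rw [add_zero]; exact hx) j (σ v)
          rw [add_zero] at h1 h2
          rw [h1]
          congr 1
          exact Subtype.ext h2.symm
        rw [← this, hσ', gproj_of_mem _ hv]
      rw [← hκ, key]
      exact GMod.qmap_mem_deg hG' (N.act_mem hx ((T.truncIncl_mem hN).2 (gproj_mem _ _ _)))
    · intro a
      refine LinearMap.congr_fun (?_ : g ∘ₗ (T.std w Z).act a =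
        (N.quot (T.gen hN K') hG').act a ∘ₗ g)
      refine T.std_ext Z fun x v => ?_
      rw [LinearMap.comp_apply, LinearMap.comp_apply, std_act_mk, hg, hg, hΦ, hΦ]
      change _ = q (N.act a _)
      rw [truncMul_apply, truncMul_apply, N.act_mul]
  refine GMod.IsSection.of_hom hG' hgh ?_ ?_
  · rw [← LinearMap.ker_eq_bot, eq_bot_iff]
    intro z hz
    have hz' : z ∈ Submodule.span k {z | ∃ a, ∃ v ∈ (⊤ : Submodule k Z), z = T.stdMk Z a v} :=
      T.std_induction Z (fun x y hx hy => add_mem hx hy)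
        (fun x v => Submodule.subset_span (Exists.intro x ⟨v, trivial, rfl⟩)) z
    obtain ⟨n, -, hn1, hn2, rfl⟩ := (T.isStdMap_stdMk Z).expand (K := ⊤) (fun _ _ _ => trivial) hz'
    have hz2 : g (n.sum fun x v => T.stdMk Z x.2.val v) = 0 := hz
    rw [Finsupp.sum, map_sum] at hz2
    -- The lifts are cut down by `1_s`: independence only concerns coefficients fixed by the
    -- idempotent at the right end of `x`.
    let c : T.XIdx → K := fun x =>
      ⟨(T.trunc hN).act (T.toCartan w (U.one x.1.2).val) (σ (n x)).1, hK.1 _ _ (σ (n x)).2⟩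
    have hc : ∀ x, f (c x) = n x := fun x => by
      rw [hfa (T.toCartan w (U.one x.1.2).val) (σ (n x)) (c x) rfl, hσ', hn1]
    have hc0 : ∀ x, x ∉ n.support → c x = 0 := fun x hx => by
      refine Subtype.ext ?_
      change (T.trunc hN).act (T.toCartan w (U.one x.1.2).val) (σ (n x)).1 = 0
      rw [Finsupp.notMem_support_iff.1 hx]
      simp
    have h3 : ∑ x ∈ n.support, T.truncMul hN x.2.val (c x).1 ∈ T.gen hN K' := by
      rw [← GMod.qmap_eq_zero hG', map_sum, ← hz2]
      refine Finset.sum_congr rfl fun x _ => ?_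
      rw [hg, ← hc x]
      exact (key _ _).symm
    obtain ⟨n', hn0', hn1', hn2', h4⟩ := (T.isStdMap_truncMul hN).expand hK'.1 h3
    let m : T.XIdx →₀ T.trunc hN := Finsupp.onFinset n.support (fun x => (c x).1) (by
      intro x hx
      by_contra hx'
      exact hx (by rw [hc0 x hx']; rfl))
    have hm : (m.sum fun x v => T.truncMul hN x.2.val v) =
        ∑ x ∈ n.support, T.truncMul hN x.2.val (c x).1 :=
      Finsupp.onFinset_sum _ (fun _ => by simp)
    have hone : ∀ (x : T.XIdx), T.dot x.1.2 = w → ∀ v : T.trunc hN,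
        (T.trunc hN).act (T.toCartan w (U.one x.1.2).val) v = v →
        N.act (U.one x.1.2).val (T.truncIncl hN v) = T.truncIncl hN v := by
      intro x hx v hv
      rw [← hv, truncIncl_act, ← N.act_mul, ← N.act_mul, ← N.act_mul, T.one_mul_e_of_eq hx,
        (U.one _).mul_self, T.e_mul_one_of_eq hx]
    have hsup : ∀ x ∈ (m - n').support, T.dot x.1.2 = w := by
      intro x hx
      rcases Finset.mem_union.1 (Finsupp.support_sub hx) with h | h
      · exact hn2 x (Finsupp.support_onFinset_subset h)
      · exact hn2' x h
    -- Both expansions represent the same vector of `N`, so their difference is a relation among the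
    -- elements x and vanishes.
    have h5 : (m - n').mapRange (T.truncIncl hN) (map_zero _) = 0 := by
      apply hI
      · intro x
        by_cases hx : x ∈ (m - n').support
        · rw [Finsupp.mapRange_apply]
          refine hone x (hsup x hx) _ ?_
          rw [Finsupp.sub_apply, map_sub, hn1']
          refine congrArg (fun v => v - n' x) ?_
          change (T.trunc hN).act (T.toCartan w (U.one x.1.2).val)
            ((T.trunc hN).act (T.toCartan w (U.one x.1.2).val) (σ (n x)).1) = _
          rw [← GMod.act_mul, toCartan_mul, T.one_mul_e_of_eq (hsup x hx), (U.one _).mul_self]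
          rfl
        · rw [Finsupp.mapRange_apply, Finsupp.notMem_support_iff.1 hx]
          simp
      · intro x hx
        exact hsup x (Finsupp.support_mapRange hx)
      · rw [Finsupp.sum_mapRange_index (by simp)]
        change ((m - n').sum fun x v => T.truncMul hN x.2.val v) = 0
        rw [Finsupp.sum_sub_index (by simp), hm, ← h4, sub_self]
    have h6 : ∀ x, n x = 0 := by
      intro x
      have h7 := DFunLike.congr_fun h5 x
      rw [Finsupp.mapRange_apply, Finsupp.zero_apply] at h7
      have h8 : (m - n') x = 0 := T.truncIncl_injective hN (by rw [h7, map_zero])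
      rw [Finsupp.sub_apply, sub_eq_zero] at h8
      rw [← hc x]
      refine hfK' _ ?_
      change m x ∈ K'
      rw [h8]
      exact hn0' x
    have : n = 0 := Finsupp.ext h6
    rw [this]
    simp
  · apply le_antisymm
    · rintro _ ⟨z, rfl⟩
      refine T.std_induction Z (p := fun z => g z ∈ (T.gen hN K).map q)
        (fun x y hx hy => by rw [map_add]; exact add_mem hx hy) (fun x v => ?_) z
      rw [hg, hΦ]
      exact ⟨_, Submodule.subset_span ⟨x, _, (σ v).2, rfl⟩, rfl⟩
    · change (Submodule.span k _).map q ≤ _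
      rw [Submodule.map_span, Submodule.span_le]
      rintro _ ⟨_, ⟨a, v, hv, rfl⟩, rfl⟩
      exact ⟨T.stdMk Z a (f ⟨v, hv⟩), by rw [hg, key]⟩

end Layer

end TriBasis

end PureBGG

/-! ### Projective modules: coordinates in free modules, layers by weight, and lifting of functions
on e_w A_(≥ w). -/

namespace PureBGG

namespace GMod

variable {k : Type u} [Field k] {A : GrAlg k}

/-- The homogeneous elements of a graded module. -/
abbrev Homog (V : GMod A) : Type u := Σ d : ℤ, V.deg d

/-- Multiplication of `A` on finitely supported functions with values in `A`. -/
noncomputable def freeAct (A : GrAlg k) (J : Type u) : A →ₗ[k] (J →₀ A) →ₗ[k] (J →₀ A) where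
  toFun a := Finsupp.mapRange.linearMap (LinearMap.mulLeft k a)
  map_add' a b := LinearMap.ext fun f => Finsupp.ext fun j => add_mul a b (f j)
  map_smul' c a := LinearMap.ext fun f => Finsupp.ext fun j => smul_mul_assoc c a (f j)

theorem freeAct_apply {J : Type u} (a : A) (f : J →₀ A) (j : J) :
    freeAct A J a f j = a * f j := rfl

theorem freeAct_single {J : Type u} (a b : A) (j : J) :
    freeAct A J a (Finsupp.single j b) = Finsupp.single j (a * b) := by
  simp [freeAct]

/-- The grading on a free module with generators `j` of degree `δ j`. -/
def freeDeg (A : GrAlg k) {J : Type u} (δ : J → ℤ) (n : ℤ) : Submodule k (J →₀ A) where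
  carrier := {f | ∀ j, f j ∈ A.deg (n - δ j)}
  add_mem' hf hg j := add_mem (hf j) (hg j)
  zero_mem' _ := zero_mem _
  smul_mem' c _ hf j := Submodule.smul_mem _ c (hf j)

theorem single_mem_freeDeg {J : Type u} (δ : J → ℤ) {j : J} {d n : ℤ} {a : A} (ha : a ∈ A.deg d)
    (h : d + δ j = n) : Finsupp.single j a ∈ freeDeg A δ n := by
  classical
  intro i
  rw [Finsupp.single_apply]
  split
  · rename_i h'
    subst h'
    rwa [show n - δ j = d by omega]
  · exact zero_mem _

theorem freeDeg_isInternal {J : Type u} (δ : J → ℤ) : DirectSum.IsInternal (freeDeg A δ) := by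
  classical
  let p : ℤ → (J →₀ A) →ₗ[k] (J →₀ A) := fun n =>
    Finsupp.lsum k fun j => Finsupp.lsingle j ∘ₗ gproj A.internal (n - δ j)
  have hp : ∀ n f j, p n f j = gproj A.internal (n - δ j) (f j) := by
    intro n f j
    induction f using Finsupp.induction_linear with
    | zero => simp
    | add f g hf hg => rw [map_add, Finsupp.add_apply, hf, hg, Finsupp.add_apply, map_add]
    | single i a =>
      simp only [p, Finsupp.lsum_single, LinearMap.comp_apply, Finsupp.lsingle_apply,
        Finsupp.single_apply]
      split
      · rename_i h; rw [h]
      · simp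
  refine isInternal_of_proj _ p ?_ ?_ ?_
  · intro n f hf
    ext j
    rw [hp, gproj_of_mem _ (hf j)]
  · intro n m h f hf
    ext j
    rw [hp, gproj_of_mem_ne _ (by omega) (hf j)]; rfl
  · rw [eq_top_iff]
    rintro f -
    induction f using Finsupp.induction_linear with
    | zero => exact zero_mem _
    | add f g hf hg => exact add_mem hf hg
    | single j a =>
      refine alg_induction (p := fun a => Finsupp.single j a ∈ ⨆ n, freeDeg A δ n) (by simp)
        (fun x y hx hy => by rw [Finsupp.single_add]; exact add_mem hx hy) (fun d a ha => ?_) a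
      exact Submodule.mem_iSup_of_mem _ (single_mem_freeDeg δ ha rfl)

/-- A free module over a locally unital algebra. -/
noncomputable def free {I : Type*} (U : LocalUnits A I) {J : Type u} (δ : J → ℤ) : GMod A where
  carrier := J →₀ A
  act := freeAct A J
  act_mul a b v := by ext j; simp only [freeAct_apply, mul_assoc]
  deg := freeDeg A δ
  internal := freeDeg_isInternal δ
  act_mem {m n a v} ha hv j := by
    have := A.mul_mem ha (hv j)
    rwa [← add_sub_assoc] at this
  span_act f := by
    induction f using Finsupp.induction_linear with
    | zero => exact zero_mem _
    | add f g hf hg => exact add_mem hf hg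
    | single j a =>
      refine peirce_induction U (p := fun a => Finsupp.single j a ∈ Submodule.span k
        {w | ∃ a u, w = freeAct A J a u}) (by simp)
        (fun x y hx hy => by rw [Finsupp.single_add]; exact add_mem hx hy) ?_ a
      intro i i' x hx _
      refine Submodule.subset_span ⟨(U.one i).val, Finsupp.single j x, ?_⟩
      rw [freeAct_single, hx]

/-- The dual basis lemma: a projective module embeds into a free module. -/
theorem Projective.exists_coord {I : Type*} (U : LocalUnits A I) {V : GMod A} (hV : V.Projective) :
    ∃ c : V →ₗ[k] (V.Homog →₀ A), (∀ a v j, c (V.act a v) j = a * c v j) ∧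
      (∀ n, ∀ v ∈ V.deg n, ∀ j, c v j ∈ A.deg (n - j.1)) ∧
      ∀ v, ((c v).sum fun j a => V.act a j.2.val) = v := by
  -- All homogeneous vectors are taken as generators, each in its own degree; the resulting free
  -- module stays in the universe over which projectivity is tested.
  let δ : V.Homog → ℤ := fun j => j.1
  let π : free U δ →ₗ[k] V := Finsupp.lsum k fun j : V.Homog => V.act.flip j.2.val
  have hπ : ∀ f : V.Homog →₀ A, π f = f.sum fun j a => V.act a j.2.val := fun f => by
    change (Finsupp.lsum k fun j : V.Homog => V.act.flip j.2.val) f = _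
    rw [Finsupp.lsum_apply]; rfl
  have hh : π ∈ hom (free U δ) V 0 := by
    constructor
    · intro n (f : V.Homog →₀ A) hf
      have h1 : (f.sum fun j a => V.act a j.2.val) ∈ V.deg (n + 0) := ?_
      · rwa [← hπ] at h1
      rw [add_zero]
      refine Submodule.sum_mem _ fun j _ => ?_
      have := V.act_mem (hf j) j.2.2
      rwa [sub_add_cancel] at this
    · intro a (f : V.Homog →₀ A)
      have h1 : ((freeAct A V.Homog a f).sum fun j a => V.act a j.2.val) =
          V.act a (f.sum fun j a => V.act a j.2.val) := ?_
      · rwa [← hπ, ← hπ] at h1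
      change (Finsupp.sum (Finsupp.mapRange (LinearMap.mulLeft k a) (map_zero _) f) _) = _
      rw [Finsupp.sum_mapRange_index (by simp), Finsupp.sum, Finsupp.sum, map_sum]
      refine Finset.sum_congr rfl fun j _ => ?_
      exact V.act_mul a _ _
  have hs : Function.Surjective π := by
    rw [← LinearMap.range_eq_top, eq_top_iff]
    rintro v -
    refine (Submodule.span_le.2 ?_ : _ ≤ LinearMap.range π) (V.span_act v)
    rintro _ ⟨a, u, rfl⟩
    refine V.homog_induction (p := fun u => V.act a u ∈ LinearMap.range π) (by simp)
      (fun x y hx hy => by rw [map_add]; exact add_mem hx hy) (fun d u hu => ?_) u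
    refine ⟨Finsupp.single ⟨d, ⟨u, hu⟩⟩ a, ?_⟩
    rw [hπ, Finsupp.sum_single_index (by simp)]
  obtain ⟨c, hc, hcπ⟩ := hV _ _ π LinearMap.id hh (id_mem_hom V) hs
  refine ⟨c, fun a v j => ?_, fun n v hv j => ?_, fun v => ?_⟩
  · exact congrArg (fun f : V.Homog →₀ A => f j) (hom_smul hc a v)
  · have := hom_deg hc hv
    rw [add_zero] at this
    exact this j
  · rw [← hπ]; exact LinearMap.congr_fun hcπ v

end GMod

namespace TriBasis

variable {k : Type u} [Field k] {A : GrAlg k} {I : Type*} {U : LocalUnits A I} {W : Type*}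
  [PartialOrder W] (T : TriBasis U W) {w : W}

theorem exists_deg_of_mem_wspan_gen {i s t j x h y} (hx : x ∈ T.X i s) (hh : h ∈ T.H s t)
    (hy : y ∈ T.Y t j) : ∃ d, x * h * y ∈ A.deg d := by
  obtain ⟨p, hp⟩ := T.X_homog _ _ _ hx
  obtain ⟨q, hq⟩ := T.H_homog _ _ _ hh
  obtain ⟨r, hr⟩ := T.Y_homog _ _ _ hy
  exact ⟨_, A.mul_mem (A.mul_mem hp hq) hr⟩

/-- The submodule of `V` generated by the weight spaces with weights in `Γ`. -/
def layer (Γ : Set W) (V : GMod A) : Submodule k V :=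
  Submodule.span k {v | ∃ a ∈ T.wspan Γ, ∃ u, v = V.act a u}

theorem act_mem_layer {Γ : Set W} {V : GMod A} {a : A} (ha : a ∈ T.wspan Γ) (v : V) :
    V.act a v ∈ T.layer Γ V := Submodule.subset_span ⟨a, ha, v, rfl⟩

theorem isGSub_layer {Γ : Set W} (hΓ : IsLowerSet Γ) (V : GMod A) :
    V.IsGSub (T.layer Γ V) := by
  constructor
  · intro a v hv
    induction hv using Submodule.span_induction with
    | mem v hv =>
      obtain ⟨b, hb, u, rfl⟩ := hv
      rw [← V.act_mul]
      exact T.act_mem_layer (T.mul_mem_wspan hΓ a hb) u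
    | zero => simp
    | add x y _ _ hx hy => rw [map_add]; exact add_mem hx hy
    | smul c x _ hx => rw [map_smul]; exact Submodule.smul_mem _ c hx
  · refine Submodule.span_le.2 ?_
    rintro _ ⟨a, ha, u, rfl⟩
    rw [SetLike.mem_coe]
    induction ha using Submodule.span_induction with
    | mem a ha =>
      obtain ⟨i, s, t, j, x, h, y, hx, hh, hy, hs, rfl⟩ := ha
      obtain ⟨d, hd⟩ := T.exists_deg_of_mem_wspan_gen hx hh hy
      refine V.homog_induction (p := fun u => V.act (x * h * y) u ∈
        ⨆ d, T.layer Γ V ⊓ V.deg d) (by simp) (fun x y hx hy => by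
          rw [map_add]; exact add_mem hx hy) (fun n u hu => ?_) u
      exact Submodule.mem_iSup_of_mem (d + n) ⟨T.act_mem_layer (T.mem_wspan hx hh hy hs) u,
        V.act_mem hd hu⟩
    | zero => simp
    | add x y _ _ hx hy => rw [map_add, LinearMap.add_apply]; exact add_mem hx hy
    | smul c x _ hx => rw [map_smul, LinearMap.smul_apply]; exact Submodule.smul_mem _ c hx

theorem layer_empty (V : GMod A) : T.layer ∅ V = ⊥ := by
  have : T.wspan ∅ = ⊥ := by
    rw [eq_bot_iff]
    refine Submodule.span_le.2 ?_
    rintro _ ⟨i, s, t, j, x, h, y, hx, hh, hy, hs, rfl⟩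
    exact hs.elim
  rw [eq_bot_iff]
  refine Submodule.span_le.2 ?_
  rintro _ ⟨a, ha, u, rfl⟩
  rw [this] at ha
  rw [(Submodule.mem_bot k).1 ha]
  simp

theorem layer_univ (V : GMod A) : T.layer Set.univ V = ⊤ := by
  rw [eq_top_iff]
  rintro v -
  refine Submodule.span_mono ?_ (V.span_act v)
  rintro _ ⟨a, u, rfl⟩
  exact ⟨a, by rw [wspan_univ]; trivial, u, rfl⟩

section Coord

variable {V : GMod A} {c : V →ₗ[k] (V.Homog →₀ A)} (hc : ∀ a v j, c (V.act a v) j = a * c v j)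
  (hcs : ∀ v, ((c v).sum fun j a => V.act a j.2.val) = v)
include hc hcs

/-- The coordinates embed V as a summand of a free module, and the layer of a free module is taken
coordinatewise. Statements about layers of projectives thereby reduce to statements about ideals of
A. -/
theorem mem_layer_iff {Γ : Set W} (hΓ : IsLowerSet Γ) {v : V} :
    v ∈ T.layer Γ V ↔ ∀ j, c v j ∈ T.wspan Γ := by
  constructor
  · intro hv j
    induction hv using Submodule.span_induction with
    | mem v hv =>
      obtain ⟨a, ha, u, rfl⟩ := hv
      rw [hc]
      exact T.wspan_mul_mem hΓ ha _
    | zero => simp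
    | add x y _ _ hx hy => rw [map_add]; exact add_mem hx hy
    | smul r x _ hx => rw [map_smul]; exact Submodule.smul_mem _ r hx
  · intro h
    rw [← hcs v]
    exact Submodule.sum_mem _ fun j _ => T.act_mem_layer (h j) _

end Coord

section Adjoin

variable {Γ : Set W} (hΓ : IsLowerSet Γ) (hw : w ∉ Γ) (hlt : Set.Iio w ⊆ Γ)

include hΓ hw in
theorem subset_notGe : Γ ⊆ notGe w := fun _ hm hle => hw (hΓ hle hm)

/-- The ideal times e_w involves only weights below `w`, and these have been killed in the quotient.
-/
theorem truncatable_quot (hlt : Set.Iio w ⊆ Γ) (V : GMod A) :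
    T.Truncatable w (V.quot (T.layer Γ V) (T.isGSub_layer hΓ V)) := by
  intro a ha v
  obtain ⟨v, rfl⟩ := GMod.qmap_surjective (T.isGSub_layer hΓ V) v
  rw [← GMod.qmap_act, ← GMod.qmap_act, GMod.qmap_eq_zero, ← V.act_mul]
  rw [ideal_below] at ha
  exact T.act_mem_layer (T.wspan_mono hlt (T.mul_e_mem_Iio ha)) v

include hlt in
-- A relation among the elements x modulo the layer becomes, in each coordinate, a relation in A
-- modulo `wspan Γ`, where `X_indep` applies. Projectivity is needed for the coordinates to detect
-- membership in the layer.
theorem xIndep_quot {V : GMod A} (hV : V.Projective) :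
    T.XIndep w (V.quot (T.layer Γ V) (T.isGSub_layer hΓ V)) := by
  classical
  obtain ⟨c, hc, -, hcs⟩ := hV.exists_coord U
  have hG := T.isGSub_layer hΓ V
  obtain ⟨σ, hσ⟩ := (V.qmap _ hG).exists_rightInverse_of_surjective
    (LinearMap.range_eq_top.2 (GMod.qmap_surjective hG))
  have hσ' : ∀ z, V.qmap _ hG (σ z) = z := LinearMap.congr_fun hσ
  intro n hn hs h0
  -- Lifts to `V`, multiplied by `1_s` so that they are again fixed by it.
  let m : T.XIdx →₀ V := Finsupp.onFinset n.support
    (fun x => V.act (U.one x.1.2).val (σ (n x))) (by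
      intro x hx
      by_contra hx'
      rw [Finsupp.notMem_support_iff.1 hx'] at hx
      exact hx (by simp))
  have hm : ∀ x, m x = V.act (U.one x.1.2).val (σ (n x)) := fun _ => rfl
  have hmn : ∀ x, V.qmap _ hG (m x) = n x := fun x => by
    rw [hm, GMod.qmap_act, hσ', hn]
  have hsum : (m.sum fun x v => V.act x.2.val v) ∈ T.layer Γ V := by
    rw [← GMod.qmap_eq_zero hG, ← h0, Finsupp.onFinset_sum _ (fun _ => by simp), map_sum]
    refine Finset.sum_congr rfl fun x _ => ?_
    rw [GMod.qmap_act]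
    exact congrArg _ (hmn x)
  ext x
  rw [← hmn x, Finsupp.zero_apply, GMod.qmap_eq_zero, T.mem_layer_iff hc hcs hΓ]
  intro j
  let ev : V →ₗ[k] A := Finsupp.lapply j ∘ₗ c
  have hev : ∀ v, ev v = c v j := fun _ => rfl
  have := T.X_indep hΓ hlt (m.mapRange ev (map_zero _)) ?_ ?_ ?_ x
  · exact this
  · intro y
    rw [Finsupp.mapRange_apply, hev, hm, hc, ← mul_assoc, (U.one _).mul_self]
  · intro y hy
    exact hs y (Finsupp.support_onFinset_subset (Finsupp.support_mapRange hy))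
  · rw [Finsupp.sum_mapRange_index (by simp)]
    have h1 := (T.mem_layer_iff hc hcs hΓ).1 hsum j
    rw [← hev, Finsupp.sum, map_sum] at h1
    convert h1 using 1
    refine Finset.sum_congr rfl fun y _ => ?_
    exact (hc _ _ j).symm

theorem comap_gen_bot (V : GMod A) (hN : T.Truncatable w (V.quot _ (T.isGSub_layer hΓ V))) :
    (T.gen hN ⊥).comap (V.qmap _ (T.isGSub_layer hΓ V)) = T.layer Γ V := by
  rw [gen_bot]
  exact GMod.ker_qmap _

/-- The layer of `insert w Γ` modulo that of `Γ` is generated by the e_w-part, because a basis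
element of weight `w` equals itself with e_w inserted after `x`. With the companion statement for
`⊥`, this identifies the ends of the filtration induced from the truncation. -/
theorem comap_gen_top (hlt : Set.Iio w ⊆ Γ) (V : GMod A)
    (hN : T.Truncatable w (V.quot _ (T.isGSub_layer hΓ V))) :
    (T.gen hN ⊤).comap (V.qmap _ (T.isGSub_layer hΓ V)) = T.layer (insert w Γ) V := by
  have hG := T.isGSub_layer hΓ V
  apply le_antisymm
  · intro v hv
    rw [Submodule.mem_comap] at hv
    have hle : T.gen hN ⊤ ≤ (T.layer (insert w Γ) V).map (V.qmap _ hG) := by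
      refine Submodule.span_le.2 ?_
      rintro _ ⟨a, m, -, rfl⟩
      obtain ⟨v, hv⟩ := GMod.qmap_surjective hG (T.truncIncl hN m)
      refine ⟨V.act (a * (T.e w).val) v, T.act_mem_layer ?_ v, ?_⟩
      · have := T.mul_e_mul_mem w a (T.e w).val
        rw [mul_assoc, (T.e w).mul_self] at this
        refine T.wspan_mono ?_ this
        intro m hm
        rcases eq_or_lt_of_le hm with h | h
        · exact Or.inl h
        · exact Or.inr (hlt h)
      · rw [V.act_mul, GMod.qmap_act, GMod.qmap_act, hv, act_e_truncIncl]; rfl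
    obtain ⟨v', hv', hvv⟩ := hle hv
    rw [← sub_add_cancel v v']
    refine add_mem ?_ hv'
    have h1 : v - v' ∈ T.layer Γ V := by
      rw [← GMod.qmap_eq_zero hG, map_sub, hvv, sub_self]
    refine Submodule.span_mono ?_ h1
    rintro _ ⟨a, ha, u, rfl⟩
    exact ⟨a, T.wspan_mono (Set.subset_insert _ _) ha, u, rfl⟩
  · refine Submodule.span_le.2 ?_
    rintro _ ⟨a, ha, u, rfl⟩
    rw [SetLike.mem_coe, Submodule.mem_comap]
    induction ha using Submodule.span_induction with
    | mem a ha =>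
      obtain ⟨i, s, t, j, x, h, y, hx, hh, hy, hs, rfl⟩ := ha
      rcases hs with hs | hs
      · have hxe : x * (T.e w).val = x := by
          conv_lhs => rw [← T.mul_one_of_mem_X hx]
          rw [mul_assoc x, T.one_mul_e_of_eq hs, T.mul_one_of_mem_X hx]
        refine Submodule.subset_span ⟨x, T.truncProj hN (V.qmap _ hG (V.act (h * y) u)),
          trivial, ?_⟩
        rw [truncMul_apply, truncIncl_truncProj, ← GMod.qmap_act, ← GMod.qmap_act, ← V.act_mul,
          ← V.act_mul, ← mul_assoc, hxe, mul_assoc]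
      · rw [(GMod.qmap_eq_zero hG).2 (T.act_mem_layer (T.mem_wspan hx hh hy hs) u)]
        exact zero_mem _
    | zero => simp
    | add x y _ _ hx hy =>
      rw [map_add, LinearMap.add_apply, map_add]; exact add_mem hx hy
    | smul r x _ hx =>
      rw [map_smul, LinearMap.smul_apply, map_smul]; exact Submodule.smul_mem _ r hx

end Adjoin

section Lift

/-- Left multiplication by e_w kills `x` unless its left end is special of weight `w`, and then
triangularity of X leaves only an idempotent or a drop in weight. -/
theorem e_mul_cases {i : I} {s : T.S} {x : A} (hx : x ∈ T.X i s) :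
    (T.e w).val * x = 0 ∨ ((i = s ∧ T.dot s = w) ∧ x = (U.one s).val) ∨ T.dot s < w := by
  by_cases hj : ∃ r : T.S, T.dot r = w ∧ (r : I) = i
  · obtain ⟨r, rfl, rfl⟩ := hj
    rcases T.cases_of_mem_X hx with ⟨rfl, h⟩ | h
    · exact Or.inr (Or.inl ⟨⟨rfl, rfl⟩, h⟩)
    · exact Or.inr (Or.inr h)
  · push Not at hj
    left
    rw [← T.one_mul_of_mem_X hx, ← mul_assoc, T.e_mul_one_of_ne hj, zero_mul]

/-- Functions on `e A_(≥ w)` can be lifted along surjections, as `e A_(≥ w)` is projective. -/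
theorem IsCostdFun.exists_lift {V V' : GMod (T.cartan w)} {g : V →ₗ[k] V'}
    (hg : g ∈ GMod.hom V V' 0) (hgs : Function.Surjective g) {φ : A →ₗ[k] V'}
    (hφ : T.IsCostdFun V' φ) {d : ℤ} (hd : ∀ n, ∀ x ∈ A.deg n, φ x ∈ V'.deg (n + d)) :
    ∃ Φ : A →ₗ[k] V, T.IsCostdFun V Φ ∧ (∀ n, ∀ x ∈ A.deg n, Φ x ∈ V.deg (n + d)) ∧
      g ∘ₗ Φ = φ := by
  classical
  -- As an A_w-module e A_(≥ w) is a direct sum of modules A_w 1_t, one for each y with `dot t = w`.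
  -- It suffices to lift the value at each y to a vector of the right degree fixed by `1_t`; other
  -- weights receive the value 0.
  have hex : ∀ (t : T.S) (j : I) (y : T.Y t j), ∃ v : V, T.dot t = w → g v = φ y.1 ∧
      V.act (T.toCartan w (U.one t).val) v = v ∧ ∀ n, y.1 ∈ A.deg n → v ∈ V.deg (n + d) := by
    rintro t j ⟨y, hy⟩
    by_cases ht : T.dot t = w
    swap
    · exact ⟨0, fun h => absurd h ht⟩
    -- The zero element lies in every degree, so the degree requirement can only be met by lifting
    -- its value to 0.
    by_cases hy0 : y = 0
    · exact ⟨0, fun _ => ⟨by simp [hy0], by simp, fun _ _ => zero_mem _⟩⟩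
    obtain ⟨n, hn⟩ := T.Y_homog _ _ _ hy
    obtain ⟨v, hv⟩ := hgs (φ y)
    have h1 : V'.act (T.toCartan w (U.one t).val) (φ y) = φ y := by
      rw [← hφ.mul, T.one_mul_e_of_eq ht, T.one_mul_of_mem_Y hy]
    have h2 : g (gproj V.internal (n + d) v) = φ y := by
      rw [← GMod.hom_gproj_zero hg, hv, gproj_of_mem _ (hd n y hn)]
    refine ⟨V.act (T.toCartan w (U.one t).val) (gproj V.internal (n + d) v), fun _ =>
      ⟨?_, ?_, ?_⟩⟩
    · rw [GMod.hom_smul hg, h2, h1]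
    · rw [← V.act_mul, toCartan_mul, T.one_mul_e_of_eq ht, (U.one t).mul_self]
    · intro m hm
      by_cases hmn : m = n
      · subst hmn
        exact V.act_mem_zero (T.toCartan_mem w (U.one t).mem) (gproj_mem _ _ _)
      · exact absurd (eq_zero_of_mem_ne A.internal hmn hm hn) hy0
  choose v hv using hex
  -- On the basis, `h * y` of weight `w` goes to `h` applied to the lift of y, and every other
  -- element goes to 0. The condition that both indices of `x` agree says `x = 1_s`.
  let Φ : A →ₗ[k] V := T.toBasis.constr k fun p =>
    if p.1.1.1 = p.1.1.2 ∧ T.dot p.1.1.2 = w then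
      V.act (T.toCartan w p.2.2.1.val) (v p.1.2.1 p.1.2.2 p.2.2.2) else 0
  have hΦ : ∀ {i s t j x h y} (hx : x ∈ T.X i s) (hh : h ∈ T.H s t) (hy : y ∈ T.Y t j),
      Φ (x * h * y) = if i = s ∧ T.dot s = w then
        V.act (T.toCartan w h) (v t j ⟨y, hy⟩) else 0 := by
    intro i s t j x h y hx hh hy
    have h1 := T.toBasis_apply ⟨((i, s), (t, j)), ⟨⟨x, hx⟩, ⟨h, hh⟩, ⟨y, hy⟩⟩⟩
    have h2 : x * h * y = T.toBasis ⟨((i, s), (t, j)), ⟨⟨x, hx⟩, ⟨h, hh⟩, ⟨y, hy⟩⟩⟩ := h1.symm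
    rw [h2, Module.Basis.constr_basis]
  have hideal : ∀ a ∈ T.wspan (notGe w), Φ a = 0 := by
    intro a ha
    induction ha using Submodule.span_induction with
    | mem a ha =>
      obtain ⟨i, s, t, j, x, h, y, hx, hh, hy, hs, rfl⟩ := ha
      rw [hΦ hx hh hy, if_neg]
      rintro ⟨-, rfl⟩
      exact hs (le_refl _)
    | zero => simp
    | add x y _ _ hx hy => rw [map_add, hx, hy, add_zero]
    | smul c x _ hx => rw [map_smul, hx, smul_zero]
  have hone : ∀ s : T.S, (U.one s).val ∈ T.X s s := fun s => by rw [T.X_self]; rfl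
  -- Linearity over A_w is checked on the generators y: modulo the ideal `u` is a combination of
  -- products `x * h`, and e_w kills those whose `x` is not an idempotent of weight `w`.
  have hright : ∀ t, T.dot t = w → ∀ j y (hy : y ∈ T.Y t j) u, u * (U.one t).val = u →
      Φ (u * y) = V.act (T.toCartan w u) (v t j ⟨y, hy⟩) := by
    intro t ht j y hy u hu
    refine T.mul_one_decomp t (p := fun u => Φ (u * y) = V.act (T.toCartan w u) (v t j ⟨y, hy⟩))
      (by simp) (fun a b ha hb => by rw [add_mul, map_add, ha, hb, map_add, map_add,
        LinearMap.add_apply]) (fun c a ha => by rw [smul_mul_assoc, map_smul, ha, map_smul,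
        map_smul, LinearMap.smul_apply]) ?_ ?_ u hu
    · intro a ha _
      have ha' : a ∈ T.wspan (notGe w) := T.wspan_mono (by rw [ht]; exact Iio_subset_notGe) ha
      rw [hideal _ (T.wspan_mul_mem (isLowerSet_notGe w) ha' y),
        T.toCartan_of_mem_ideal w (by rw [T.ideal_below]; exact ha'), map_zero,
        LinearMap.zero_apply]
    · intro i s' x h hx hh
      have hs' : T.dot s' = w := (T.dot_eq_of_mem_H hh).trans ht
      rw [hΦ hx hh hy]
      rcases T.e_mul_cases (w := w) hx with h0 | ⟨h1, rfl⟩ | h1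
      · split
        · rename_i h2
          obtain ⟨rfl, -⟩ := h2
          have : x = (U.one s').val := by rw [T.X_self] at hx; exact hx
          rw [this, T.one_mul_of_mem_H hh]
        · rw [← T.toCartan_e_mul, ← mul_assoc, h0, zero_mul, map_zero, map_zero,
            LinearMap.zero_apply]
      · rw [if_pos h1, T.one_mul_of_mem_H hh]
      · exact absurd hs' h1.ne
  have hcf : T.IsCostdFun V Φ := by
    constructor
    · intro a ha
      rw [T.ideal_below] at ha
      exact hideal a ha
    · intro u a
      refine T.basis_induction (p := fun a => Φ (u * (T.e w).val * a) =
        V.act (T.toCartan w u) (Φ a)) (by simp) (fun a b ha hb => by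
          rw [mul_add, map_add, ha, hb, map_add, map_add]) (fun c a ha => by
          rw [mul_smul_comm, map_smul, ha, map_smul, map_smul]) ?_ a
      intro i s t j x h y hx hh hy
      rcases T.e_mul_cases (w := w) hx with h0 | ⟨h1, rfl⟩ | h1
      · have h2 : u * (T.e w).val * (x * h * y) = 0 := by
          rw [mul_assoc, ← mul_assoc (T.e w).val, ← mul_assoc (T.e w).val, h0]; simp
        rw [h2, map_zero, hΦ hx hh hy]
        split
        · rename_i h3
          obtain ⟨rfl, h3⟩ := h3
          have hx1 : x = (U.one s).val := by rw [T.X_self] at hx; exact hx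
          rw [hx1, T.e_mul_one_of_eq h3] at h0
          have hh0 : h = 0 := by rw [← T.one_mul_of_mem_H hh, h0, zero_mul]
          simp [hh0]
        · simp
      · have ht : T.dot t = w := (T.dot_eq_of_mem_H hh).symm.trans h1.2
        rw [hΦ hx hh hy, if_pos h1, T.one_mul_of_mem_H hh, ← mul_assoc,
          hright t ht j y hy _ (by rw [mul_assoc, T.mul_one_of_mem_H hh]), T.act_toCartan_mul]
      · have hmem : x * h * y ∈ T.wspan (notGe w) := T.mem_wspan hx hh hy (Iio_subset_notGe h1)
        rw [hideal _ hmem, hideal _ (T.mul_mem_wspan (isLowerSet_notGe w) _ hmem), map_zero]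
  refine ⟨Φ, hcf, ?_, ?_⟩
  · have hgp : ∀ a n, gproj V.internal (n + d) (Φ a) = Φ (gproj A.internal n a) := by
      intro a n
      refine T.basis_induction (p := fun a => gproj V.internal (n + d) (Φ a) =
        Φ (gproj A.internal n a)) (by simp) (fun a b ha hb => by
          rw [map_add, map_add, map_add, ha, hb, map_add]) (fun c a ha => by
          rw [map_smul, map_smul, map_smul, ha, map_smul]) ?_ a
      intro i s t j x h y hx hh hy
      obtain ⟨m, hm, hm'⟩ : ∃ m, x * h * y ∈ A.deg m ∧ Φ (x * h * y) ∈ V.deg (m + d) := by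
        rw [hΦ hx hh hy]
        split
        · rename_i h3
          obtain ⟨rfl, h3⟩ := h3
          have hx1 : x = (U.one s).val := by rw [T.X_self] at hx; exact hx
          obtain ⟨q, hq⟩ := T.H_homog _ _ _ hh
          obtain ⟨r, hr⟩ := T.Y_homog _ _ _ hy
          refine ⟨q + r, ?_, ?_⟩
          · rw [hx1, T.one_mul_of_mem_H hh]; exact A.mul_mem hq hr
          · rw [add_assoc]
            refine V.act_mem (T.toCartan_mem w hq) ((hv t j ⟨y, hy⟩ ?_).2.2 r hr)
            exact (T.dot_eq_of_mem_H hh).symm.trans h3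
        · obtain ⟨m, hm⟩ := T.exists_deg_of_mem_wspan_gen hx hh hy
          exact ⟨m, hm, zero_mem _⟩
      by_cases hmn : m = n
      · subst hmn
        rw [gproj_of_mem _ hm, gproj_of_mem _ hm']
      · rw [gproj_of_mem_ne _ hmn hm, gproj_of_mem_ne _ (by omega) hm', map_zero]
    intro n a ha
    have := hgp a n
    rw [gproj_of_mem _ ha] at this
    rw [← this]
    exact gproj_mem _ _ _
  · ext a
    refine T.basis_induction (p := fun a => g (Φ a) = φ a) (by simp) (fun a b ha hb => by
      rw [map_add, map_add, ha, hb, map_add]) (fun c a ha => by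
      rw [map_smul, map_smul, ha, map_smul]) ?_ a
    intro i s t j x h y hx hh hy
    rw [hΦ hx hh hy]
    split
    · rename_i h3
      obtain ⟨rfl, h3⟩ := h3
      have hx1 : x = (U.one s).val := by rw [T.X_self] at hx; exact hx
      have ht : T.dot t = w := (T.dot_eq_of_mem_H hh).symm.trans h3
      rw [GMod.hom_smul hg, (hv t j ⟨y, hy⟩ ht).1, ← hφ.mul, hx1, T.one_mul_of_mem_H hh]
      congr 2
      conv_lhs => rw [← T.mul_one_of_mem_H hh]
      rw [mul_assoc, T.one_mul_e_of_eq ht, T.mul_one_of_mem_H hh]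
    · rename_i h3
      rw [map_zero, ← hφ.e_mul]
      rcases T.e_mul_cases (w := w) hx with h0 | ⟨h1, rfl⟩ | h1
      · rw [← mul_assoc, ← mul_assoc, h0]; simp
      · exact absurd h1 h3
      · rw [hφ.e_mul, hφ.ideal _ (by
          rw [T.ideal_below]; exact T.mem_wspan hx hh hy (Iio_subset_notGe h1))]

end Lift

end TriBasis

end PureBGG

/-! ### Construction of Δ-flags and pure Δ-flags of projective modules. -/

namespace PureBGG

namespace GMod

variable {k : Type u} [Field k] {A : GrAlg k}

/-- Finite chains of graded submodules whose successive sections are, up to isomorphism, modules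
of the types in a given list. -/
inductive Chain {α : Type*} (V : GMod A) (R : α → GMod A → Prop) :
    Submodule k V → Submodule k V → List α → Prop
  | nil (W : Submodule k V) (hW : V.IsGSub W) : Chain V R W W []
  | cons {W₁ W₂ W₃ : Submodule k V} {c : α} {l : List α} (M : GMod A) (hW : V.IsGSub W₁)
      (hle : W₁ ≤ W₂) (hM : R c M) (hs : V.IsSection W₁ W₂ M) (h : Chain V R W₂ W₃ l) :
      Chain V R W₁ W₃ (c :: l)

namespace Chain

variable {α : Type*} {V : GMod A} {R : α → GMod A → Prop}

theorem append {W₁ W₂ W₃ : Submodule k V} {l l' : List α} (h : V.Chain R W₁ W₂ l)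
    (h' : V.Chain R W₂ W₃ l') : V.Chain R W₁ W₃ (l ++ l') := by
  induction h with
  | nil => exact h'
  | cons M hW hle hM hs _ ih => exact cons M hW hle hM hs (ih h')

theorem isGSub_left {W₁ W₂ : Submodule k V} {l : List α} (h : V.Chain R W₁ W₂ l) :
    V.IsGSub W₁ := by
  cases h <;> assumption

/-- The algebra is allowed to change: the chain lives in a truncation over A_w and is moved into V
by taking preimages of generated submodules. -/
theorem map {V' : GMod A} {β : Type*} {B : GrAlg k} {V : GMod B} {R : α → GMod B → Prop}
    {R' : β → GMod A → Prop} (g : α → β) (F : Submodule k V → Submodule k V')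
    (hF : ∀ W, V.IsGSub W → V'.IsGSub (F W)) (hmono : Monotone F)
    (hstep : ∀ W W' c M, V.IsGSub W → V.IsGSub W' → R c M → V.IsSection W W' M →
      ∃ M', R' (g c) M' ∧ V'.IsSection (F W) (F W') M')
    {W₁ W₂ : Submodule k V} {l : List α} (h : V.Chain R W₁ W₂ l) :
    V'.Chain R' (F W₁) (F W₂) (l.map g) := by
  induction h with
  | nil W hW => exact nil _ (hF W hW)
  | cons M hW hle hM hs h ih =>
    obtain ⟨M', hM', hs'⟩ := hstep _ _ _ M hW h.isGSub_left hM hs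
    exact cons M' (hF _ hW) (hmono hle) hM' hs' ih

theorem exists_seq {W₁ W₂ : Submodule k V} {l : List α} (h : V.Chain R W₁ W₂ l) :
    ∃ F : Fin (l.length + 1) → Submodule k V, (∀ r, V.IsGSub (F r)) ∧
      (∀ r : Fin l.length, F r.castSucc ≤ F r.succ) ∧ F 0 = W₁ ∧ F (Fin.last _) = W₂ ∧
      ∀ r : Fin l.length, ∃ M, R (l.get r) M ∧ V.IsSection (F r.castSucc) (F r.succ) M := by
  induction h with
  | nil W hW => exact ⟨fun _ => W, fun _ => hW, fun r => r.elim0, rfl, rfl, fun r => r.elim0⟩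
  | @cons W₁ W₂ W₃ c l M hW hle hM hs h ih =>
    obtain ⟨F, h1, h2, h3, h4, h5⟩ := ih
    refine ⟨Fin.cons W₁ F, ?_, ?_, rfl, ?_, ?_⟩
    · intro r
      refine Fin.cases hW (fun r => h1 r) r
    · intro r
      refine Fin.cases ?_ (fun r => ?_) r
      · change W₁ ≤ F 0
        rw [h3]; exact hle
      · exact h2 r
    · exact h4
    · intro r
      refine Fin.cases ?_ (fun r => ?_) r
      · refine ⟨M, hM, ?_⟩
        change V.IsSection W₁ (F 0) M
        rw [h3]; exact hs
      · exact h5 r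

end Chain

end GMod

namespace TriBasis

variable {k : Type u} [Field k] {A : GrAlg k} {I : Type*} {U : LocalUnits A I} {W : Type*}
  [PartialOrder W] (T : TriBasis U W) {w : W}

/-- A maximal weight of Γ is removed at each stage, so that what remains is a lower set containing
everything below that weight. Since `tag` remembers the weight, types from different stages cannot
coincide. -/
theorem exists_chain_layer {α : Type*} (tag : α → W) (V : GMod A) (R : α → GMod A → Prop)
    (hstep : ∀ (Γ : Set W) (w : W), IsLowerSet Γ → w ∉ Γ → Set.Iio w ⊆ Γ →
      ∃ l : List α, V.Chain R (T.layer Γ V) (T.layer (insert w Γ) V) l ∧ l.Nodup ∧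
        ∀ c ∈ l, tag c = w) {Γ : Set W} (hfin : Γ.Finite) (hΓ : IsLowerSet Γ) :
    ∃ l : List α, V.Chain R ⊥ (T.layer Γ V) l ∧ l.Nodup ∧ ∀ c ∈ l, tag c ∈ Γ := by
  induction hn : Γ.ncard using Nat.strong_induction_on generalizing Γ with
  | _ n ih =>
  rcases Γ.eq_empty_or_nonempty with rfl | hne
  · refine ⟨[], ?_, List.nodup_nil, by simp⟩
    rw [layer_empty]
    exact GMod.Chain.nil _ V.isGSub_bot
  · obtain ⟨w, hw⟩ := hfin.exists_maximal hne
    have hΓ' : IsLowerSet (Γ \ {w}) := by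
      rintro a b hab ⟨ha, haw⟩
      refine ⟨hΓ hab ha, ?_⟩
      rintro rfl
      exact haw (le_antisymm (hw.2 ha hab) hab)
    have hins : insert w (Γ \ {w}) = Γ := Set.insert_sdiff_self_of_mem hw.1
    have hlt : Set.Iio w ⊆ Γ \ {w} := fun m hm => ⟨hΓ hm.le hw.1, hm.ne⟩
    have hcard : (Γ \ {w}).ncard < n := hn ▸ Set.ncard_sdiff_singleton_lt_of_mem hw.1 hfin
    obtain ⟨l, h1, h2, h3⟩ := ih _ hcard (hfin.subset Set.sdiff_subset) hΓ' rfl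
    obtain ⟨l', h1', h2', h3'⟩ := hstep _ w hΓ' (fun h => h.2 rfl) hlt
    rw [hins] at h1'
    refine ⟨l ++ l', h1.append h1', List.nodup_append'.2 ⟨h2, h2', ?_⟩, ?_⟩
    · intro c hc hc'
      exact (h3 c hc).2 (h3' c hc')
    · intro c hc
      rcases List.mem_append.1 hc with h | h
      · exact (h3 c h).1
      · rw [h3' c h]; exact hw.1

section Adjoin

variable {Γ : Set W} (hΓ : IsLowerSet Γ)

/-- V is a summand of a free A-module, so its truncation is a summand of a sum of shifted copies of
e_w A_(≥ w), each of which has the lifting property. The proof lifts one coordinate at a time. -/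
theorem projective_trunc (hw : w ∉ Γ) (hlt : Set.Iio w ⊆ Γ) {V : GMod A} (hV : V.Projective)
    (hN : T.Truncatable w (V.quot _ (T.isGSub_layer hΓ V))) : (T.trunc hN).Projective := by
  obtain ⟨c, hc, hcd, hcs⟩ := hV.exists_coord U
  have hG := T.isGSub_layer hΓ V
  intro V₁ V₂ g f hg hf hgs
  let π : V →ₗ[k] T.trunc hN := T.truncProj hN ∘ₗ V.qmap _ hG
  have hπi : ∀ v, T.truncIncl hN (π v) = V.qmap _ hG (V.act (T.e w).val v) := fun v => by
    change T.truncIncl hN (T.truncProj hN _) = _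
    rw [truncIncl_truncProj]; rfl
  have hπ0 : ∀ v, V.act (T.e w).val v ∈ T.layer Γ V → π v = 0 := by
    intro v hv
    apply T.truncIncl_injective hN
    rw [hπi, map_zero]
    exact (GMod.qmap_eq_zero hG).2 hv
  have hπe : ∀ v, π (V.act (T.e w).val v) = π v := by
    intro v
    apply T.truncIncl_injective hN
    rw [hπi, hπi, ← V.act_mul, (T.e w).mul_self]
  have hπa : ∀ u v, π (V.act (u * (T.e w).val) v) = (T.trunc hN).act (T.toCartan w u) (π v) := by
    intro u v
    apply T.truncIncl_injective hN
    rw [truncIncl_act, hπi, hπi, ← GMod.qmap_act, ← GMod.qmap_act, V.act_mul]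
  have hπd : ∀ n, ∀ v ∈ V.deg n, π v ∈ (T.trunc hN).deg n := fun n v hv =>
    T.truncProj_mem hN (GMod.qmap_mem_deg hG hv)
  have hπs : ∀ n, ∀ m ∈ (T.trunc hN).deg n, ∃ v ∈ V.deg n, π v = m := by
    intro n m hm
    obtain ⟨v, hv, hvm⟩ := GMod.exists_qmap_of_mem_deg hG ((T.truncIncl_mem hN).2 hm)
    refine ⟨v, hv, ?_⟩
    change T.truncProj hN (V.qmap _ hG v) = m
    rw [hvm, truncProj_truncIncl]
  have hπsurj : Function.Surjective π := by
    intro m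
    obtain ⟨v, hv⟩ := GMod.qmap_surjective hG (T.truncIncl hN m)
    refine ⟨v, ?_⟩
    change T.truncProj hN (V.qmap _ hG v) = m
    rw [hv, truncProj_truncIncl]
  -- The restriction of `f` to the coordinate `j`: the function sending `a` to the value of `f` on
  -- the class of `e a j`.
  let φ : V.Homog → A →ₗ[k] V₂ := fun j => f ∘ₗ π ∘ₗ V.act.flip j.2.val
  have hφa : ∀ j a, φ j a = f (π (V.act a j.2.val)) := fun _ _ => rfl
  have hφ : ∀ j, T.IsCostdFun V₂ (φ j) := by
    intro j
    constructor
    · intro a ha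
      rw [ideal_below] at ha
      rw [hφa, hπ0 _ (by
        rw [← V.act_mul]
        exact T.act_mem_layer (T.wspan_mono hlt (T.e_mul_mem_Iio ha)) _), map_zero]
    · intro u a
      rw [hφa, hφa, V.act_mul, hπa, GMod.hom_smul hf]
  have hφd : ∀ j n, ∀ x ∈ A.deg n, φ j x ∈ V₂.deg (n + j.1) := by
    intro j n x hx
    exact GMod.hom_deg_zero hf (hπd _ _ (V.act_mem hx j.2.2))
  choose Φ hΦ hΦd hΦg using fun j => IsCostdFun.exists_lift T hg hgs (hφ j) (hφd j)
  -- The lifted functions, evaluated at the coordinates and added up. Coordinates of vectors in the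
  -- layer lie in the ideal, where every lifted function vanishes, so `H` descends to the quotient.
  let H : V →ₗ[k] V₁ := Finsupp.lsum k Φ ∘ₗ c
  have hH : ∀ v, H v = (c v).sum fun j a => Φ j a := fun v => by
    change Finsupp.lsum k Φ (c v) = _
    rw [Finsupp.lsum_apply]
  have hcsum : ∀ a v, (c (V.act a v)).sum (fun j a => Φ j a) = (c v).sum fun j b => Φ j (a * b) := by
    intro a v
    have : c (V.act a v) = Finsupp.mapRange (LinearMap.mulLeft k a) (map_zero _) (c v) := by
      ext j
      rw [hc]; rfl
    rw [this, Finsupp.sum_mapRange_index (by simp)]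
    rfl
  have hHlayer : T.layer Γ V ≤ LinearMap.ker H := by
    intro v hv
    rw [LinearMap.mem_ker, hH]
    refine Finset.sum_eq_zero fun j _ => (hΦ j).ideal _ ?_
    rw [ideal_below]
    exact T.wspan_mono (subset_notGe hΓ hw) ((T.mem_layer_iff hc hcs hΓ).1 hv j)
  have hHe : ∀ v, H (V.act (T.e w).val v) = H v := by
    intro v
    rw [hH, hH, hcsum]
    exact Finset.sum_congr rfl fun j _ => (hΦ j).e_mul _
  have hHa : ∀ u v, H (V.act (u * (T.e w).val) v) = V₁.act (T.toCartan w u) (H v) := by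
    intro u v
    rw [hH, hH, hcsum, Finsupp.sum, Finsupp.sum, map_sum]
    exact Finset.sum_congr rfl fun j _ => (hΦ j).mul u _
  have hHd : ∀ n, ∀ v ∈ V.deg n, H v ∈ V₁.deg n := by
    intro n v hv
    rw [hH]
    refine Submodule.sum_mem _ fun j _ => ?_
    have := hΦd j _ _ (hcd n v hv j)
    rwa [sub_add_cancel] at this
  have hHg : ∀ v, g (H v) = f (π v) := by
    intro v
    conv_rhs => rw [← hcs v]
    rw [hH, Finsupp.sum, Finsupp.sum, map_sum, map_sum, map_sum]
    refine Finset.sum_congr rfl fun j _ => ?_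
    exact LinearMap.congr_fun (hΦg j) _
  let Hb : V.quot _ hG →ₗ[k] V₁ := (T.layer Γ V).liftQ H hHlayer
  have hHb : ∀ v, Hb (V.qmap _ hG v) = H v := fun _ => rfl
  let h : T.trunc hN →ₗ[k] V₁ := Hb ∘ₗ T.truncIncl hN
  have hh : ∀ v, h (π v) = H v := fun v => by
    change Hb (T.truncIncl hN (π v)) = _
    rw [hπi, hHb, hHe]
  refine ⟨h, ⟨fun n m hm => ?_, fun a m => ?_⟩, ?_⟩
  · obtain ⟨v, hv, rfl⟩ := hπs n m hm
    rw [hh, add_zero]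
    exact hHd n v hv
  · obtain ⟨v, rfl⟩ := hπsurj m
    obtain ⟨u, rfl⟩ := T.toCartan_surjective w a
    rw [← hπa, hh, hh, hHa]
  · ext m
    obtain ⟨v, rfl⟩ := hπsurj m
    rw [LinearMap.comp_apply, hh, hHg]

theorem locFinBddBelow_trunc {V : GMod A}
    (hfin : ∀ d, FiniteDimensional k ↥(LinearMap.range (V.act (T.e w).val) ⊓ V.deg d))
    (hbdd : ∃ n : ℤ, ∀ d < n, LinearMap.range (V.act (T.e w).val) ⊓ V.deg d = ⊥)
    (hN : T.Truncatable w (V.quot _ (T.isGSub_layer hΓ V))) : (T.trunc hN).LocFinBddBelow := by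
  have hG := T.isGSub_layer hΓ V
  have hle : ∀ d, (T.trunc hN).deg d ≤ (LinearMap.range (V.act (T.e w).val) ⊓ V.deg d).map
      (T.truncProj hN ∘ₗ V.qmap _ hG) := by
    intro d m hm
    obtain ⟨v, hv, hvm⟩ := GMod.exists_qmap_of_mem_deg hG ((T.truncIncl_mem hN).2 hm)
    refine ⟨V.act (T.e w).val v, ⟨⟨v, rfl⟩, V.act_mem_zero (T.e w).mem hv⟩, ?_⟩
    rw [LinearMap.comp_apply, GMod.qmap_act, hvm, act_e_truncIncl, truncProj_truncIncl]
  constructor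
  · intro d
    have := hfin d
    exact Submodule.finiteDimensional_of_le (hle d)
  · obtain ⟨n, hn⟩ := hbdd
    refine ⟨n, fun d hd => ?_⟩
    have := hle d
    rw [hn d hd, Submodule.map_bot] at this
    exact eq_bot_iff.2 this

/-- The main step in the construction of flags: a chain in the truncation of `V` modulo lower
terms gives a chain between successive layers of `V`. -/
theorem chain_layer_of_trunc {α β : Type*} {V : GMod A} (hV : V.Projective) (g : β → α)
    {R : β → GMod (T.cartan w) → Prop} {R' : α → GMod A → Prop}
    (hR : ∀ c Z, R c Z → R' (g c) (T.std w Z))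
    (hN : T.Truncatable w (V.quot _ (T.isGSub_layer hΓ V))) {l : List β}
    (h : (T.trunc hN).Chain R ⊥ ⊤ l) (hlt : Set.Iio w ⊆ Γ) :
    V.Chain R' (T.layer Γ V) (T.layer (insert w Γ) V) (l.map g) := by
  have hG := T.isGSub_layer hΓ V
  rw [← T.comap_gen_bot hΓ V hN, ← T.comap_gen_top hΓ hlt V hN]
  refine h.map g (fun K => (T.gen hN K).comap (V.qmap _ hG))
    (fun K hK => (T.isGSub_gen hN hK).comap (GMod.qmap_mem_hom hG))
    (fun K K' hle => Submodule.comap_mono (T.gen_mono hN hle)) ?_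
  intro K K' c Z hK hK' hc hs
  -- A section of the truncation standardizes to a section modulo the lower layer, which is then
  -- pulled back to `V`.
  exact ⟨T.std w Z, hR c Z hc,
    ((T.xIndep_quot hΓ hlt hV).isSection_gen hN hK hK' hs).of_quot hG⟩

end Adjoin

theorem isSection_bot_top (V : GMod A) : V.IsSection ⊥ ⊤ V := by
  refine ⟨(⊤ : Submodule k V).subtype, fun v => ⟨⟨v, trivial⟩, rfl⟩, ?_, fun d w hw => hw,
    fun a w w' h => h⟩
  rw [Submodule.ker_subtype]
  ext v
  simp

/-- Over an algebra with a finite weight poset, projective modules have `Δ`-flags. -/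
theorem exists_chain_deltaLayer [Finite W] {V : GMod A} (hV : V.Projective)
    (hfin : V.LocFinBddBelow) :
    ∃ l : List W, V.Chain T.IsDeltaLayer ⊥ ⊤ l ∧ l.Nodup := by
  suffices hstep : _ by
    obtain ⟨l, h1, h2, -⟩ := T.exists_chain_layer id V T.IsDeltaLayer hstep Set.finite_univ
      isLowerSet_univ
    rw [layer_univ] at h1
    exact ⟨l, h1, h2⟩
  intro Γ w hΓ hw hlt
  have hN := T.truncatable_quot hΓ hlt V
  -- Each weight contributes exactly one layer, possibly zero, since the zero module is also
  -- projective.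
  refine ⟨[w], ?_, List.nodup_singleton w, by simp⟩
  have hch : (T.trunc hN).Chain (fun (c : W) Z => c = w ∧ Z = T.trunc hN) ⊥ ⊤ [w] :=
    GMod.Chain.cons _ (GMod.isGSub_bot _) bot_le ⟨rfl, rfl⟩ (isSection_bot_top _)
      (GMod.Chain.nil _ (GMod.isGSub_top _))
  refine T.chain_layer_of_trunc hΓ hV id ?_ hN hch hlt
  rintro c Z ⟨rfl, rfl⟩
  refine ⟨_, T.projective_trunc hΓ hw hlt hV hN, ?_, GMod.Iso.refl _⟩
  refine T.locFinBddBelow_trunc hΓ (fun d => ?_) ?_ hN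
  · have := hfin.1 d
    exact Submodule.finiteDimensional_of_le (inf_le_right (b := V.deg d))
  · obtain ⟨n, hn⟩ := hfin.2
    exact ⟨n, fun d hd => by rw [hn d hd, inf_bot_eq]⟩

end TriBasis

namespace Refinement

variable {k : Type u} [Field k] {A : GrAlg k} {I : Type*} {U : LocalUnits A I} {W : Type*}
  [PartialOrder W] {T : TriBasis U W} {B : W → Type*} [∀ w, PartialOrder (B w)]
  (R : Refinement T B)

/-- A projective module that is locally finite-dimensional and bounded below, and generated by
finitely many weight spaces, has a pure `Δ`-flag. -/
theorem hasPureDeltaFlag [∀ w, Finite (B w)] {V : GMod A} (hV : V.Projective)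
    (hfin : ∀ w d, FiniteDimensional k ↥(LinearMap.range (V.act (T.e w).val) ⊓ V.deg d))
    (hbdd : ∀ w, ∃ n : ℤ, ∀ d < n, LinearMap.range (V.act (T.e w).val) ⊓ V.deg d = ⊥)
    {Γ : Set W} (hΓf : Γ.Finite) (hΓ : IsLowerSet Γ) (htop : T.layer Γ V = ⊤) :
    R.HasPureDeltaFlag V := by
  suffices hstep : _ by
    obtain ⟨l, h1, h2, -⟩ := T.exists_chain_layer (α := Σ w, B w) Sigma.fst V R.IsPureDeltaLayer
      hstep hΓf hΓ
    rw [htop] at h1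
    obtain ⟨F, hF1, hF2, hF3, hF4, hF5⟩ := h1.exists_seq
    exact ⟨l.length, ⟨F, hF1, Fin.monotone_iff_le_succ.2 hF2, hF3, hF4⟩, l.get,
      List.nodup_iff_injective_get.1 h2, hF5⟩
  intro Γ w hΓ hw hlt
  have hN := T.truncatable_quot hΓ hlt V
  -- The argument is used a second time inside A_w, whose weight poset is finite; the resulting
  -- Δ-flag of the truncation refines the single step at `w`.
  obtain ⟨l, h1, h2⟩ := (R.basis w).exists_chain_deltaLayer
    (T.projective_trunc hΓ hw hlt hV hN) (T.locFinBddBelow_trunc hΓ (hfin w) (hbdd w) hN)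
  refine ⟨l.map (Sigma.mk w), T.chain_layer_of_trunc hΓ hV _ ?_ hN h1 hlt,
    h2.map sigma_mk_injective, ?_⟩
  · intro c Z hZ
    exact ⟨Z, hZ, GMod.Iso.refl _⟩
  · intro c hc
    obtain ⟨b, -, rfl⟩ := List.mem_map.1 hc
    rfl

end Refinement

end PureBGG

/-! ### Irreducible heads, their truncations and endomorphisms, and generators of projective covers.
-/

namespace PureBGG

namespace GMod

variable {k : Type u} [Field k] {A : GrAlg k}

/-- The element `u` acts on `V` by an endomorphism of rank one. -/
def RankOne (V : GMod A) (u : A) : Prop :=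
  (∃ v, V.act u v ≠ 0) ∧ ∀ v v', V.act u v ≠ 0 → ∃ c : k, V.act u v' = c • V.act u v

/-- An endomorphism commutes with `u`, hence acts on the line `u V` by a scalar. Subtracting that
scalar leaves an endomorphism with nonzero kernel, which is zero by irreducibility. -/
theorem RankOne.exists_smul {V : GMod A} {u : A} (h : V.RankOne u) (hV : V.IsSimple)
    {f : V →ₗ[k] V} (hf : f ∈ hom V V 0) : ∃ c : k, f = c • LinearMap.id := by
  obtain ⟨v, hv⟩ := h.1
  obtain ⟨c, hc⟩ := h.2 v (f v) hv
  refine ⟨c, ?_⟩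
  by_contra hne
  have hg : f - c • LinearMap.id ∈ hom V V 0 :=
    sub_mem hf (Submodule.smul_mem _ _ (id_mem_hom V))
  have := hV.injective hg (sub_ne_zero.2 hne)
  apply hv
  apply this
  rw [map_zero, LinearMap.sub_apply, hom_smul hf, hc]
  simp

theorem exists_act_of_cyc_eq_top {V : GMod A} {p : V} {s : ℤ} (hp : p ∈ V.deg s)
    (h : V.cyc p = ⊤) {d : ℤ} {v : V} (hv : v ∈ V.deg d) : ∃ a ∈ A.deg (d - s), V.act a p = v := by
  obtain ⟨a, rfl⟩ : v ∈ V.cyc p := by rw [h]; trivial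
  refine ⟨gproj A.internal (d - s) a, gproj_mem _ _ _, ?_⟩
  have := gproj_map A.internal V.internal (f := V.act.flip p) (m := s)
    (fun n x hx => V.act_mem hx hp) (d - s) a
  rw [sub_add_cancel, gproj_of_mem _ hv] at this
  exact this.symm

theorem exists_homog_preimage {V V' : GMod A} {f : V →ₗ[k] V'} (hf : f ∈ hom V V' 0)
    (hs : Function.Surjective f) {d : ℤ} {v : V'} (hv : v ∈ V'.deg d) :
    ∃ u ∈ V.deg d, f u = v := by
  obtain ⟨u, rfl⟩ := hs v
  refine ⟨gproj V.internal d u, gproj_mem _ _ _, ?_⟩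
  rw [← hom_gproj_zero hf, gproj_of_mem _ hv]

/-- A homogeneous element of an irreducible module lifts to a generator of its projective cover. -/
theorem exists_generator {P L : GMod A} (hL : L.IsSimple) {f : P →ₗ[k] L} (hf : f ∈ hom P L 0)
    (hs : Function.Surjective f) (hsf : ∀ W, P.IsGSub W → W ⊔ LinearMap.ker f = ⊤ → W = ⊤)
    {η : A} (hη : η ∈ A.deg 0) (hηη : η * η = η) {s : ℤ} {l : L} (hl : l ∈ L.deg s)
    (hηl : L.act η l = l) (h0 : l ≠ 0) :
    ∃ p ∈ P.deg s, P.act η p = p ∧ f p = l ∧ P.cyc p = ⊤ := by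
  obtain ⟨p, hp, hpl⟩ := exists_homog_preimage hf hs hl
  have hfp : f (P.act η p) = l := by rw [hom_smul hf, hpl, hηl]
  have hηp : P.act η (P.act η p) = P.act η p := by rw [← P.act_mul, hηη]
  refine ⟨P.act η p, P.act_mem_zero hη hp, hηp, hfp, ?_⟩
  have hg := P.isGSub_cyc (P.act_mem_zero hη hp)
  -- The generated submodule maps onto the irreducible module, so together with the superfluous
  -- kernel it is everything.
  refine hsf _ hg ?_
  have htop : (P.cyc (P.act η p)).map f = ⊤ := by
    rcases hL.2 _ (hg.map hf) with h | h
    · have : l ∈ (P.cyc (P.act η p)).map f := ⟨_, ⟨η, hηp⟩, hfp⟩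
      rw [h] at this
      exact absurd ((Submodule.mem_bot k).1 this) h0
    · exact h
  rw [eq_top_iff]
  intro v _
  obtain ⟨x, hx, hxv⟩ : f v ∈ (P.cyc (P.act η p)).map f := by rw [htop]; trivial
  refine Submodule.mem_sup.2 ⟨x, hx, v - x, ?_, by abel⟩
  rw [LinearMap.mem_ker, map_sub, hxv, sub_self]

end GMod

namespace TriBasis

variable {k : Type u} [Field k] {A : GrAlg k} {I : Type*} {U : LocalUnits A I} {W : Type*}
  [PartialOrder W] (T : TriBasis U W) {w : W}

section Retract

variable (V : GMod (T.cartan w))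

/-- The map `x ⊗ v ↦ (e x e) v` from a standardization back to the original module. -/
noncomputable def retract : T.std w V →ₗ[k] V :=
  (T.exists_std_lift V (V.act ∘ₗ T.toCartan w)
    (fun a ha => by rw [LinearMap.comp_apply, T.toCartan_of_mem_ideal w ha, map_zero])
    (fun x u v => T.act_toCartan_mul V x u v)).choose

theorem retract_mk (x : A) (v : V) : T.retract V (T.stdMk V x v) = V.act (T.toCartan w x) v :=
  (T.exists_std_lift V (V.act ∘ₗ T.toCartan w)
    (fun a ha => by rw [LinearMap.comp_apply, T.toCartan_of_mem_ideal w ha, map_zero])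
    (fun x u v => T.act_toCartan_mul V x u v)).choose_spec x v

theorem retract_mk_e (v : V) : T.retract V (T.stdMk V (T.e w).val v) = v := by
  rw [retract_mk, act_toCartan_e]

/-- The truncation of a standardization is the original module, `retract` being the identification.
No analysis of the tensor product beyond its universal property is needed. -/
theorem act_e_eq_mk (z : T.std w V) :
    (T.std w V).act (T.e w).val z = T.stdMk V (T.e w).val (T.retract V z) := by
  refine T.std_induction V (p := fun z => (T.std w V).act (T.e w).val z =
    T.stdMk V (T.e w).val (T.retract V z)) (fun x y hx hy => ?_) (fun x v => ?_) z
  · rw [map_add, map_add, map_add, hx, hy]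
  · rw [std_act_mk, retract_mk, ← T.stdMk_mul, (T.e w).mul_self]

theorem retract_act (a : A) (z : T.std w V) :
    T.retract V ((T.std w V).act a ((T.std w V).act (T.e w).val z)) =
      V.act (T.toCartan w a) (T.retract V z) := by
  rw [act_e_eq_mk, std_act_mk, retract_mk, toCartan_mul_e]

theorem retract_act_e (z : T.std w V) :
    T.retract V ((T.std w V).act (T.e w).val z) = T.retract V z := by
  rw [act_e_eq_mk, retract_mk_e]

theorem retract_mem {n : ℤ} {z : T.std w V} (hz : z ∈ (T.std w V).deg n) :
    T.retract V z ∈ V.deg n := by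
  rw [std_deg_eq] at hz
  refine (Submodule.span_le.2 ?_ : _ ≤ (V.deg n).comap (T.retract V)) hz
  rintro _ ⟨i, j, rfl, x, hx, v, hv, rfl⟩
  rw [SetLike.mem_coe, Submodule.mem_comap, retract_mk]
  exact V.act_mem (T.toCartan_mem w hx) hv

variable {V}

/-- The elements of a standardization generating a submodule whose retraction lies in `N`. -/
noncomputable def coreOf (N : Submodule k V) : Submodule k (T.std w V) :=
  ⨅ a, N.comap (T.retract V ∘ₗ (T.std w V).act a)

theorem mem_coreOf {N : Submodule k V} {z : T.std w V} :
    z ∈ T.coreOf N ↔ ∀ a, T.retract V ((T.std w V).act a z) ∈ N := by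
  simp [coreOf, Submodule.mem_iInf]

/-- A standardization is generated by its e_w-part, a copy of V. The retraction of a proper graded
submodule is therefore proper in V, hence inside N, and this holds after applying any element of A.
-/
theorem isGreatestProper_std {N : Submodule k V} (hN : V.IsGreatestProper N) :
    (T.std w V).IsGreatestProper (T.coreOf N) := by
  have hgr : ∀ n z, gproj V.internal n (T.retract V z) =
      T.retract V (gproj (T.std w V).internal n z) := by
    intro n z
    have := gproj_map (T.std w V).internal V.internal (f := T.retract V) (m := 0)
      (fun n z hz => by rw [add_zero]; exact T.retract_mem V hz) n z
    rwa [add_zero] at this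
  refine ⟨((T.std w V).isGSub_iff _).2 ⟨fun a z hz => ?_, fun n z hz => ?_⟩, ?_, ?_⟩
  · rw [mem_coreOf] at hz ⊢
    intro b
    rw [← (T.std w V).act_mul]
    exact hz _
  · rw [mem_coreOf] at hz ⊢
    intro a
    refine GMod.alg_induction (p := fun a => T.retract V ((T.std w V).act a
      (gproj (T.std w V).internal n z)) ∈ N) (by simp) (fun x y hx hy => ?_) (fun m x hx => ?_) a
    · rw [map_add, LinearMap.add_apply, map_add]
      exact add_mem hx hy
    · rw [← (T.std w V).act_gproj hx, ← hgr]
      exact gproj_mem_of_homog _ hN.1.2 _ (hz x)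
  · intro ht
    apply hN.2.1
    rw [eq_top_iff]
    intro v _
    have hv : T.stdMk V (T.e w).val v ∈ T.coreOf N := by rw [ht]; trivial
    have := T.mem_coreOf.1 hv (T.e w).val
    rwa [retract_act_e, retract_mk_e] at this
  · intro K hK ht z hz
    rw [mem_coreOf]
    intro a
    by_contra ha
    apply ht
    -- If the retraction of `K` were all of V, then `K` would contain every `e ⊗ v`, and these
    -- generate the standardization.
    have hmap : V.IsGSub (K.map (T.retract V)) := by
      refine (V.isGSub_iff _).2 ⟨?_, ?_⟩
      · rintro c _ ⟨y, hy, rfl⟩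
        obtain ⟨b, rfl⟩ := T.toCartan_surjective w c
        exact ⟨_, hK.1 b _ (hK.1 (T.e w).val y hy), T.retract_act V b y⟩
      · rintro n _ ⟨y, hy, rfl⟩
        rw [hgr]
        exact ⟨_, gproj_mem_of_homog _ hK.2 n hy, rfl⟩
    have htop : K.map (T.retract V) = ⊤ := by
      by_contra hne
      exact ha (hN.2.2 _ hmap hne ⟨_, hK.1 a z hz, rfl⟩)
    rw [eq_top_iff]
    intro y _
    refine T.std_induction V (p := fun y => y ∈ K) (fun x y hx hy => add_mem hx hy)
      (fun x v => ?_) y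
    obtain ⟨y, hy, rfl⟩ : v ∈ K.map (T.retract V) := by rw [htop]; trivial
    rw [← stdMk_mul_e, ← std_act_mk, ← act_e_eq_mk]
    exact hK.1 _ _ (hK.1 _ _ hy)

end Retract

/-- The map `r` identifies `Z` with the truncation of `M` by the idempotent `e_w`. -/
structure IsTruncation (w : W) (M : GMod A) (Z : GMod (T.cartan w)) (r : M →ₗ[k] Z) : Prop where
  surjective : Function.Surjective r
  mem : ∀ n, ∀ z ∈ M.deg n, r z ∈ Z.deg n
  act : ∀ a z, r (M.act a (M.act (T.e w).val z)) = Z.act (T.toCartan w a) (r z)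
  act_e : ∀ z, r z = 0 → M.act (T.e w).val z = 0

namespace IsTruncation

variable {T} {M : GMod A} {Z : GMod (T.cartan w)} {r : M →ₗ[k] Z} (h : T.IsTruncation w M Z r)

theorem map_act_e (h : T.IsTruncation w M Z r) (z : M) : r (M.act (T.e w).val z) = r z := by
  have := h.act (T.e w).val z
  rwa [← M.act_mul, (T.e w).mul_self, T.act_toCartan_e] at this

/-- A lift of `c`, cut down by e_w on both sides, acts through the truncation only, so its rank on M
is the rank of `c` on Z. -/
theorem exists_rankOne (h : T.IsTruncation w M Z r) {c : T.cartan w} (hc : Z.RankOne c) :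
    ∃ u, M.RankOne u := by
  obtain ⟨u, rfl⟩ := T.toCartan_surjective w c
  have hu : ∀ z, M.act ((T.e w).val * u * (T.e w).val) z =
      M.act (T.e w).val (M.act u (M.act (T.e w).val z)) := fun z => by
    rw [M.act_mul, M.act_mul]
  refine ⟨(T.e w).val * u * (T.e w).val, ?_, ?_⟩
  · obtain ⟨z₀, hz₀⟩ := hc.1
    obtain ⟨z, rfl⟩ := h.surjective z₀
    refine ⟨z, fun h0 => hz₀ ?_⟩
    rw [hu] at h0
    rw [← h.act, ← h.map_act_e, h0, map_zero]
  · intro z z' hz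
    rw [hu] at hz
    obtain ⟨c, hc'⟩ := hc.2 (r z) (r z') (fun h0 => hz (h.act_e _ (by rw [h.act, h0])))
    refine ⟨c, ?_⟩
    rw [hu, hu]
    have := h.act_e (M.act u (M.act (T.e w).val z') - c • M.act u (M.act (T.e w).val z))
      (by rw [map_sub, map_smul, h.act, h.act, hc', sub_self])
    rwa [map_sub, map_smul, sub_eq_zero] at this

end IsTruncation

/-- Used in two ways: with V the regular module and Z its one-dimensional head, giving L(w), and
with r₀ the identity of an irreducible module, giving L(b). -/
theorem exists_isTruncation_cosoc {V Z : GMod (T.cartan w)} {r₀ : V →ₗ[k] Z}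
    (hr₀ : r₀ ∈ GMod.hom V Z 0) (hs : Function.Surjective r₀)
    (hN : V.IsGreatestProper (LinearMap.ker r₀)) :
    (T.std w V).cosoc.IsSimple ∧ ∃ r, T.IsTruncation w (T.std w V).cosoc Z r := by
  have hG := T.isGreatestProper_std hN
  have hrad := hG.rad_eq
  refine ⟨hG.isSimple_cosoc, ?_⟩
  have hle : (T.std w V).rad ≤ LinearMap.ker (r₀ ∘ₗ T.retract V) := by
    rw [hrad]
    intro z hz
    have := T.mem_coreOf.1 hz (T.e w).val
    rwa [retract_act_e] at this
  let r : (T.std w V).cosoc →ₗ[k] Z := (T.std w V).rad.liftQ _ hle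
  have hr : ∀ z, r ((T.std w V).qmap _ (T.std w V).rad_isGSub z) = r₀ (T.retract V z) :=
    fun _ => rfl
  refine ⟨r, ?_, ?_, ?_, ?_⟩
  · intro z
    obtain ⟨v, rfl⟩ := hs z
    exact ⟨(T.std w V).qmap _ (T.std w V).rad_isGSub (T.stdMk V (T.e w).val v), by
      rw [hr, retract_mk_e]⟩
  · intro n z hz
    obtain ⟨y, hy, rfl⟩ := GMod.exists_qmap_of_mem_deg _ hz
    rw [hr]
    exact GMod.hom_deg_zero hr₀ (T.retract_mem V hy)
  · intro a z
    obtain ⟨y, rfl⟩ := GMod.qmap_surjective (T.std w V).rad_isGSub z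
    refine (congrArg r₀ (T.retract_act V a y)).trans ?_
    rw [GMod.hom_smul hr₀, hr]
  · intro z hz
    obtain ⟨y, rfl⟩ := GMod.qmap_surjective (T.std w V).rad_isGSub z
    rw [hr] at hz
    refine (GMod.qmap_act (T.std w V).rad_isGSub _ y).symm.trans ((GMod.qmap_eq_zero _).2 ?_)
    rw [hrad, mem_coreOf]
    intro a
    rw [retract_act]
    exact hN.1.1 _ _ hz

end TriBasis

namespace GMod

variable {k : Type u} [Field k] {A : GrAlg k}

/-- In a cyclic module whose cosocle is one-dimensional, the radical is the greatest proper graded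
submodule. -/
theorem isGreatestProper_rad {V : GMod A} {v : V} (hv : V.cyc v = ⊤)
    (h : Module.finrank k V.cosoc = 1) : V.IsGreatestProper V.rad := by
  have hvW : ∀ W, V.IsGSub W → v ∈ W → W = ⊤ := by
    intro W hW hvW
    rw [eq_top_iff, ← hv]
    rintro _ ⟨a, rfl⟩
    exact hW.1 a v hvW
  -- A maximal submodule larger than the radical would fill the one-dimensional cosocle, hence be
  -- everything.
  have hmax : ∀ W, V.IsMaxGSub W → W = V.rad := by
    intro W hW
    refine le_antisymm (fun x hx => ?_) (sInf_le hW)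
    by_contra hxr
    apply hW.2.1
    rw [eq_top_iff]
    intro y _
    obtain ⟨c, hc⟩ := exists_smul_eq_of_finrank_eq_one h
      (x := V.qmap _ V.rad_isGSub x) (fun h0 => hxr ((qmap_eq_zero _).1 h0))
      (V.qmap _ V.rad_isGSub y)
    have : y - c • x ∈ V.rad := by
      rw [← qmap_eq_zero V.rad_isGSub, map_sub, map_smul]
      exact sub_eq_zero.2 hc.symm
    rw [← sub_add_cancel y (c • x)]
    exact add_mem ((sInf_le hW : V.rad ≤ W) this) (W.smul_mem c hx)
  refine ⟨V.rad_isGSub, ?_, ?_⟩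
  · intro ht
    have : Nontrivial V.cosoc := Module.nontrivial_of_finrank_pos (R := k) (by rw [h]; exact one_pos)
    obtain ⟨x, hx⟩ := exists_ne (0 : V.cosoc)
    obtain ⟨y, rfl⟩ := qmap_surjective V.rad_isGSub x
    exact hx ((qmap_eq_zero _).2 (by rw [ht]; trivial))
  · intro W hW ht
    -- A graded submodule is proper exactly when it misses the generator `v`, a condition preserved
    -- by unions of chains. So every proper graded submodule lies in a maximal one.
    obtain ⟨M, hWM, hM⟩ := zorn_le_nonempty₀ {W | V.IsGSub W ∧ v ∉ W} (by
      intro C hC hchain W₀ hW₀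
      have hdir : DirectedOn (· ≤ ·) C := hchain.directedOn
      refine ⟨sSup C, ⟨(V.isGSub_iff _).2 ⟨fun a x hx => ?_, fun d x hx => ?_⟩, fun hx => ?_⟩,
        fun W hW => le_sSup hW⟩
      · obtain ⟨W, hW, hx⟩ := (Submodule.mem_sSup_of_directed ⟨W₀, hW₀⟩ hdir).1 hx
        exact le_sSup hW ((hC hW).1.1 a x hx)
      · obtain ⟨W, hW, hx⟩ := (Submodule.mem_sSup_of_directed ⟨W₀, hW₀⟩ hdir).1 hx
        exact le_sSup hW (gproj_mem_of_homog _ (hC hW).1.2 d hx)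
      · obtain ⟨W, hW, hx⟩ := (Submodule.mem_sSup_of_directed ⟨W₀, hW₀⟩ hdir).1 hx
        exact (hC hW).2 hx) W ⟨hW, fun h => ht (hvW W hW h)⟩
    refine hWM.trans (hmax M ⟨hM.1.1, fun h => hM.1.2 (by rw [h]; trivial), fun W' hW' hle => ?_⟩).le
    by_cases h' : v ∈ W'
    · exact Or.inr (hvW W' hW' h')
    · exact Or.inl (le_antisymm (hM.2 ⟨hW', h'⟩ hle) hle)

end GMod

namespace TriBasis

variable {k : Type u} [Field k] {A : GrAlg k} {I : Type*} {U : LocalUnits A I} {W : Type*}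
  [PartialOrder W] (T : TriBasis U W)

theorem cyc_regular (w : W) :
    (T.regular w).cyc ((T.ge w).cornerOne (T.eBar w) : T.cartan w) = ⊤ := by
  rw [eq_top_iff]
  intro a _
  exact ⟨a, (T.ge w).mul_cornerOne _ a⟩

variable {T}

theorem IsBasedAffineQuasiHereditary.isGreatestProper (h : T.IsBasedAffineQuasiHereditary)
    (w : W) : (T.regular w).IsGreatestProper (T.regular w).rad :=
  GMod.isGreatestProper_rad (T.cyc_regular w) (h.2 w)

theorem IsBasedAffineQuasiHereditary.rankOne_simple (h : T.IsBasedAffineQuasiHereditary) (w : W) :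
    (T.simple w).RankOne (T.toCartan w (T.e w).val) := by
  have h1 := h.2 w
  constructor
  · have : Nontrivial (T.simple w) :=
      Module.nontrivial_of_finrank_pos (R := k)
        (by rw [show Module.finrank k (T.simple w) = 1 from h1]; exact one_pos)
    obtain ⟨x, hx⟩ := exists_ne (0 : T.simple w)
    exact ⟨x, by rwa [act_toCartan_e]⟩
  · intro v v' hv
    rw [act_toCartan_e] at hv ⊢
    rw [act_toCartan_e]
    obtain ⟨c, hc⟩ := exists_smul_eq_of_finrank_eq_one (h.2 w) (x := v) hv v'
    exact ⟨c, hc.symm⟩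

theorem IsBasedAffineQuasiHereditary.irr (h : T.IsBasedAffineQuasiHereditary) (w : W) :
    (T.irr w).IsSimple ∧ ∃ r, T.IsTruncation w (T.irr w) (T.simple w) r := by
  refine T.exists_isTruncation_cosoc (GMod.qmap_mem_hom (T.regular w).rad_isGSub)
    (GMod.qmap_surjective _) ?_
  exact (congrArg (T.regular w).IsGreatestProper
    (GMod.ker_qmap (T.regular w).rad_isGSub)).mpr (h.isGreatestProper w)

theorem exists_isTruncation_of_isSimple {w : W} {Z : GMod (T.cartan w)} (hZ : Z.IsSimple) :
    (T.std w Z).cosoc.IsSimple ∧ ∃ r, T.IsTruncation w (T.std w Z).cosoc Z r := by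
  refine T.exists_isTruncation_cosoc (GMod.id_mem_hom Z) Function.surjective_id ?_
  rw [LinearMap.ker_id]
  exact hZ.isGreatestProper

end TriBasis

namespace Refinement

variable {k : Type u} [Field k] {A : GrAlg k} {I : Type*} {U : LocalUnits A I} {W : Type*}
  [PartialOrder W] {T : TriBasis U W} {B : W → Type*} [∀ w, PartialOrder (B w)]
  (R : Refinement T B)

theorem isSimple_irr (b : Σ w, B w) : (R.irr b).IsSimple :=
  (TriBasis.exists_isTruncation_of_isSimple ((R.based b.1).irr b.2).1).1

theorem exists_isTruncation_irr (b : Σ w, B w) :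
    ∃ r, T.IsTruncation b.1 (R.irr b) ((R.basis b.1).irr b.2) r :=
  (TriBasis.exists_isTruncation_of_isSimple ((R.based b.1).irr b.2).1).2

/-- Truncating L(b) to A_λ and then again inside A_λ ends at a one-dimensional module, where the
identity has rank one; the operator is lifted back through both truncations. -/
theorem exists_rankOne_irr (b : Σ w, B w) : ∃ u, (R.irr b).RankOne u := by
  obtain ⟨r, hr⟩ := R.exists_isTruncation_irr b
  obtain ⟨r', hr'⟩ := ((R.based b.1).irr b.2).2
  obtain ⟨u, hu⟩ := hr'.exists_rankOne ((R.based b.1).rankOne_simple b.2)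
  exact hr.exists_rankOne hu

theorem exists_smul_of_hom_irr (b : Σ w, B w) {f : R.irr b →ₗ[k] R.irr b}
    (hf : f ∈ GMod.hom (R.irr b) (R.irr b) 0) : ∃ c : k, f = c • LinearMap.id := by
  obtain ⟨u, hu⟩ := R.exists_rankOne_irr b
  exact hu.exists_smul (R.isSimple_irr b) hf

theorem exists_generator (b : Σ w, B w) {P : GMod A} (hP : P.IsProjectiveCover (R.irr b)) :
    ∃ i s, ∃ p ∈ P.deg s, P.act (U.one i).val p = p ∧ P.cyc p = ⊤ := by
  obtain ⟨-, f, hf, hs, hsf⟩ := hP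
  have hL := R.isSimple_irr b
  obtain ⟨i, s, l, hl, hil, hl0⟩ := (R.irr b).exists_unit_homog_ne_zero U hL.1
  obtain ⟨p, hp, hip, -, hcyc⟩ :=
    GMod.exists_generator hL hf hs hsf (U.one i).mem (U.one i).mul_self hl hil hl0
  exact ⟨i, s, p, hp, hip, hcyc⟩

/-- Projective covers of irreducible modules have pure `Δ`-flags. -/
theorem hasPureDeltaFlag_of_isProjectiveCover [∀ w, Finite (B w)] (hA : U.LocFinBddBelow)
    {b : Σ w, B w} {P : GMod A} (hP : P.IsProjectiveCover (R.irr b)) : R.HasPureDeltaFlag P := by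
  obtain ⟨i, s, p, hp, hip, hcyc⟩ := R.exists_generator b hP
  have hproj := hP.1
  obtain ⟨Γ, hΓf, hΓ, hΓi⟩ := T.exists_finite_lower i
  -- The generator has degree `s` and is fixed by `1_i`, so the degree `d` part of the w-weight
  -- space comes from finitely many Peirce components of A in degree `d - s`. This transfers both
  -- finiteness conditions from A to P.
  have hle : ∀ w d, LinearMap.range (P.act (T.e w).val) ⊓ P.deg d ≤
      ⨆ t ∈ (T.fiber_finite w).toFinset,
        (A.peirce (U.one t).val (U.one i).val ⊓ A.deg (d - s)).map (P.act.flip p) := by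
    rintro w d v ⟨hv, hvd⟩
    rw [SetLike.mem_coe] at hv
    rw [← T.act_e_of_mem_range hv, T.e_val, map_sum, LinearMap.sum_apply]
    refine Submodule.sum_mem _ fun t ht => ?_
    refine Submodule.mem_iSup_of_mem t (Submodule.mem_iSup_of_mem ht ?_)
    obtain ⟨a, ha, rfl⟩ := GMod.exists_act_of_cyc_eq_top hp hcyc hvd
    refine ⟨(U.one t).val * a * (U.one i).val, ⟨⟨?_, ?_⟩, ?_⟩, ?_⟩
    · rw [← mul_assoc, ← mul_assoc, (U.one t).mul_self]
    · rw [mul_assoc, (U.one i).mul_self]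
    · have := A.mul_mem (A.mul_mem (U.one t).mem ha) (U.one i).mem
      rwa [zero_add, add_zero] at this
    · rw [LinearMap.flip_apply, P.act_mul, P.act_mul, hip]
  refine R.hasPureDeltaFlag hproj (fun w d => ?_) (fun w => ?_) hΓf hΓ ?_
  · have hfin : ∀ t : T.S, FiniteDimensional k ↥((A.peirce (U.one t).val (U.one i).val ⊓
        A.deg (d - s)).map (P.act.flip p)) := fun t => by
      have := (hA t i).1 (d - s)
      infer_instance
    have : FiniteDimensional k ↥(⨆ t ∈ (T.fiber_finite w).toFinset,
        (A.peirce (U.one t).val (U.one i).val ⊓ A.deg (d - s)).map (P.act.flip p)) :=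
      Submodule.finiteDimensional_finset_sup _ _ |> fun h => by rwa [Finset.sup_eq_iSup] at h
    exact Submodule.finiteDimensional_of_le (hle w d)
  · choose N hN using fun t : T.S => (hA t i).2
    obtain ⟨n, hn⟩ := ((T.fiber_finite w).toFinset.image fun t => -N t).exists_le
    refine ⟨s - n, fun d hd => eq_bot_iff.2 ((hle w d).trans ?_)⟩
    refine iSup₂_le fun t ht => ?_
    have h1 := hn _ (Finset.mem_image_of_mem (fun t => -N t) ht)
    rw [hN t (d - s) (by omega), Submodule.map_bot]
  · rw [eq_top_iff, ← hcyc]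
    rintro _ ⟨a, rfl⟩
    -- Every vector is `a 1_i p`, and `a 1_i` involves only weights in the finite lower set attached
    -- to `i`.
    have : P.act.flip p a = P.act (a * (U.one i).val) p := by
      rw [P.act_mul, hip]; rfl
    rw [this]
    exact T.act_mem_layer (hΓi _ (by rw [mul_assoc, (U.one i).mul_self])) _

end Refinement

end PureBGG

/-! ### Composition multiplicities as dimensions of homomorphism spaces from projective covers. -/

namespace PureBGG

theorem sum_fin_succ_sub {n : ℕ} (g : Fin (n + 1) → ℤ) :
    ∑ r : Fin n, (g r.succ - g r.castSucc) = g (Fin.last n) - g 0 := by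
  induction n with
  | zero => simp
  | succ n ih =>
    rw [Fin.sum_univ_castSucc]
    have := ih (fun r => g r.castSucc)
    simp only [Fin.succ_castSucc, Fin.succ_last, Fin.castSucc_zero] at this ⊢
    rw [this]
    ring

namespace GMod

variable {k : Type u} [Field k] {A : GrAlg k}

theorem exists_factor {M N N' : Type*} [AddCommGroup M] [Module k M] [AddCommGroup N] [Module k N]
    [AddCommGroup N'] [Module k N'] {g : M →ₗ[k] N} (hg : Function.Surjective g) {h : M →ₗ[k] N'}
    (hle : LinearMap.ker g ≤ LinearMap.ker h) : ∃ h' : N →ₗ[k] N', ∀ x, h' (g x) = h x := by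
  refine ⟨(LinearMap.ker g).liftQ h hle ∘ₗ (g.quotKerEquivOfSurjective hg).symm.toLinearMap,
    fun x => ?_⟩
  have : (g.quotKerEquivOfSurjective hg).symm (g x) = (LinearMap.ker g).mkQ x := by
    rw [LinearEquiv.symm_apply_eq]; rfl
  change (LinearMap.ker g).liftQ h hle ((g.quotKerEquivOfSurjective hg).symm (g x)) = _
  rw [this]
  rfl

theorem exists_hom_factor {V M N : GMod A} {g : V →ₗ[k] M} (hg : g ∈ hom V M 0)
    (hs : Function.Surjective g) {h : V →ₗ[k] N} {d : ℤ} (hh : h ∈ hom V N d)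
    (hle : LinearMap.ker g ≤ LinearMap.ker h) : ∃ h' ∈ hom M N d, ∀ x, h' (g x) = h x := by
  obtain ⟨h', hh'⟩ := exists_factor hs hle
  refine ⟨h', ⟨fun n x hx => ?_, fun a x => ?_⟩, hh'⟩
  · obtain ⟨v, hv, rfl⟩ := exists_homog_preimage hg hs hx
    rw [hh']
    exact hom_deg hh hv
  · obtain ⟨v, rfl⟩ := hs x
    rw [← hom_smul hg, hh', hh', hom_smul hh]

/-- Lifting homomorphisms of arbitrary degree out of projective modules. -/
theorem Projective.exists_lift {P V V' : GMod A} (hP : P.Projective) {g : V →ₗ[k] V'}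
    (hg : g ∈ hom V V' 0) (hs : Function.Surjective g) {m : ℤ} {f : P →ₗ[k] V'}
    (hf : f ∈ hom P V' m) : ∃ h ∈ hom P V m, ∀ x, g (h x) = f x := by
  obtain ⟨h, hh, hgh⟩ := hP (V.shift m) (V'.shift m) g f
    ⟨fun n x hx => by rw [add_zero]; exact hom_deg_zero hg hx, hg.2⟩
    ⟨fun n x hx => by rw [add_zero]; exact hf.1 n x hx, hf.2⟩ hs
  refine ⟨h, ⟨fun n x hx => ?_, hh.2⟩, LinearMap.congr_fun hgh⟩
  have := hh.1 n x hx
  rw [add_zero] at this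
  exact this

/-- The source of the sign: maps of degree m out of L are degree-preserving maps out of q^(-m) L. -/
theorem hom_shift {L V : GMod A} {m : ℤ} {φ : L →ₗ[k] V} :
    (show L.shift (-m) →ₗ[k] V from φ) ∈ hom (L.shift (-m)) V 0 ↔ φ ∈ hom L V m := by
  constructor
  · intro h
    refine ⟨fun n x hx => ?_, h.2⟩
    have := h.1 (n + m) x (by
      change x ∈ L.deg (n + m + -m)
      rwa [add_neg_cancel_right])
    rwa [add_zero] at this
  · intro h
    refine ⟨fun n x hx => ?_, h.2⟩
    have := h.1 (n + -m) x hx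
    rw [neg_add_cancel_right] at this
    rw [add_zero]
    exact this

/-- The converse of `IsSection.of_hom`. -/
theorem IsSection.exists_hom {V M : GMod A} {W' W : Submodule k V} (hW' : V.IsGSub W')
    (hW : V.IsGSub W) (h : V.IsSection W' W M) :
    ∃ φ ∈ hom M (V.quot W' hW') 0, Function.Injective φ ∧
      LinearMap.range φ = W.map (V.qmap W' hW') := by
  obtain ⟨g, hg, hgk, hgd, hga⟩ := h
  obtain ⟨φ, hφ⟩ := exists_factor (h := V.qmap W' hW' ∘ₗ W.subtype) hg (by
    rw [hgk]
    intro x hx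
    exact (qmap_eq_zero hW').2 hx)
  refine ⟨φ, ⟨fun n x hx => ?_, fun a x => ?_⟩, ?_, ?_⟩
  · obtain ⟨w, rfl⟩ := hg x
    have hw : gproj V.internal n w.1 ∈ W := gproj_mem_of_homog _ hW.2 n w.2
    have hG := isInternal_sub V.internal.submodule_iSupIndep W hW.2
    have h1 := gproj_map (m := 0) hG M.internal (f := g)
      (fun n x hx => by rw [add_zero]; exact hgd n x hx) n w
    have h2 := gproj_map (m := 0) hG V.internal (f := W.subtype)
      (fun n x hx => by rw [add_zero]; exact hx) n w
    rw [add_zero] at h1 h2 ⊢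
    rw [gproj_of_mem _ hx] at h1
    rw [h1, hφ, LinearMap.comp_apply, ← h2]
    exact qmap_mem_deg hW' (gproj_mem _ _ _)
  · obtain ⟨w, rfl⟩ := hg x
    rw [← hga a w ⟨V.act a w, hW.1 a w w.2⟩ rfl, hφ, hφ]
    rfl
  · rw [← LinearMap.ker_eq_bot, eq_bot_iff]
    intro x hx
    obtain ⟨w, rfl⟩ := hg x
    rw [LinearMap.mem_ker, hφ] at hx
    have : w ∈ LinearMap.ker g := by
      rw [hgk]
      exact (qmap_eq_zero hW').1 hx
    exact this
  · ext y
    constructor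
    · rintro ⟨x, rfl⟩
      obtain ⟨w, rfl⟩ := hg x
      exact ⟨w, w.2, (hφ w).symm⟩
    · rintro ⟨w, hw, rfl⟩
      exact ⟨g ⟨w, hw⟩, hφ ⟨w, hw⟩⟩

section Cover

variable {P L : GMod A}

/-- Homomorphisms of degree `m` with image in a given subspace. -/
def homInto (P V : GMod A) (m : ℤ) (W : Submodule k V) : Submodule k (P →ₗ[k] V) where
  carrier := {f | f ∈ hom P V m ∧ ∀ v, f v ∈ W}
  add_mem' hf hg := ⟨add_mem hf.1 hg.1, fun v => add_mem (hf.2 v) (hg.2 v)⟩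
  zero_mem' := ⟨zero_mem _, fun _ => zero_mem _⟩
  smul_mem' c _ hf := ⟨Submodule.smul_mem _ c hf.1, fun v => W.smul_mem c (hf.2 v)⟩

variable {V : GMod A} {m : ℤ}

theorem homInto_mono {W W' : Submodule k V} (h : W ≤ W') : homInto P V m W ≤ homInto P V m W' :=
  fun _ hf => ⟨hf.1, fun v => h (hf.2 v)⟩

theorem homInto_top : homInto P V m ⊤ = hom P V m :=
  le_antisymm (fun _ h => h.1) fun _ h => ⟨h, fun _ => trivial⟩

theorem homInto_le (W : Submodule k V) : homInto P V m W ≤ hom P V m := fun _ h => h.1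

/-- The analogue of Schur's lemma for maps out of a projective cover. -/
theorem exists_smul_of_cover {f₀ : P →ₗ[k] L} (hf₀ : f₀ ∈ hom P L 0)
    (hs : Function.Surjective f₀) (hsf : ∀ W, P.IsGSub W → W ⊔ LinearMap.ker f₀ = ⊤ → W = ⊤)
    (hL : L.IsSimple) (hE : ∀ f ∈ hom L L 0, ∃ c : k, f = c • LinearMap.id) {ψ : P →ₗ[k] L}
    (hψ : ψ ∈ hom P L 0) : ∃ c : k, ψ = c • f₀ := by
  rcases hL.2 _ ((isGSub_ker hf₀).map hψ) with h | h
  · obtain ⟨φ, hφ, hφf⟩ := exists_hom_factor hf₀ hs hψ (by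
      intro x hx
      have : ψ x ∈ (LinearMap.ker f₀).map ψ := ⟨x, hx, rfl⟩
      rw [h] at this
      exact this)
    obtain ⟨c, rfl⟩ := hE φ hφ
    exact ⟨c, LinearMap.ext fun x => (hφf x).symm⟩
  -- Here ψ maps the kernel of `f₀` onto L, so that kernel and the kernel of ψ span P; since the
  -- former is superfluous, ψ = 0.
  · refine ⟨0, ?_⟩
    rw [zero_smul, ← LinearMap.ker_eq_top]
    refine hsf _ (isGSub_ker hψ) ?_
    rw [eq_top_iff]
    intro v _
    obtain ⟨x, hx, hxv⟩ : ψ v ∈ (LinearMap.ker f₀).map ψ := by rw [h]; trivial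
    refine Submodule.mem_sup.2 ⟨v - x, ?_, x, hx, by abel⟩
    rw [LinearMap.mem_ker, map_sub, hxv, sub_self]

/-- Sections isomorphic to `L` increase the space of homomorphisms from the projective cover. -/
theorem homInto_lt (hP : P.IsProjectiveCover L) (hL : L.IsSimple) {W' W : Submodule k V}
    (hW' : V.IsGSub W') (hW : V.IsGSub W) (hle : W' ≤ W) (h : V.IsSection W' W (L.shift (-m))) :
    homInto P V m W' < homInto P V m W := by
  obtain ⟨hproj, f₀, hf₀, hs, -⟩ := hP
  obtain ⟨φ, hφ, hφi, hφr⟩ := h.exists_hom hW' hW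
  have hφ' := hom_shift.1 hφ
  -- The composite P → L → W/W' lifts to V. The lift takes values in W, and not all of them in W',
  -- because its class modulo W' is nonzero.
  obtain ⟨f, hf, hfφ⟩ := hproj.exists_lift (qmap_mem_hom hW') (qmap_surjective hW')
    (f := (show L →ₗ[k] V.quot W' hW' from φ) ∘ₗ f₀) (m := m)
    (by have := hom_comp hφ' hf₀; rwa [zero_add] at this)
  refine lt_of_le_of_ne (homInto_mono hle) fun heq => ?_
  have hfW : f ∈ homInto P V m W := by
    refine ⟨hf, fun v => ?_⟩
    obtain ⟨w, hw, hwv⟩ : V.qmap W' hW' (f v) ∈ W.map (V.qmap W' hW') := by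
      rw [hfφ, ← hφr]
      exact ⟨f₀ v, rfl⟩
    have : f v - w ∈ W' := by
      rw [← qmap_eq_zero hW', map_sub, hwv, sub_self]
    rw [← sub_add_cancel (f v) w]
    exact add_mem (hle this) hw
  rw [← heq] at hfW
  obtain ⟨l, hl⟩ := hL.1
  obtain ⟨v, rfl⟩ := hs l
  apply hl
  apply hφi
  refine (hfφ v).symm.trans ?_
  rw [(qmap_eq_zero hW').2 (hfW.2 v)]
  exact (map_zero φ).symm

/-- A graded submodule not containing the images of all homomorphisms from the projective cover of
`L` can be enlarged by a module without such homomorphisms, followed by a copy of `L`. -/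
theorem exists_section (hP : P.IsProjectiveCover L) (hL : L.IsSimple)
    (hE : ∀ f ∈ hom L L 0, ∃ c : k, f = c • LinearMap.id) [FiniteDimensional k (hom P V m)]
    {W' : Submodule k V} (hW' : V.IsGSub W') (hlt : homInto P V m W' < hom P V m) :
    ∃ W₁ W₂, V.IsGSub W₁ ∧ V.IsGSub W₂ ∧ W' ≤ W₁ ∧ W₁ ≤ W₂ ∧ V.IsSection W₁ W₂ (L.shift (-m)) ∧
      Module.finrank k (homInto P V m W₂) ≤ Module.finrank k (homInto P V m W') + 1 := by
  classical
  obtain ⟨hproj, f₀, hf₀, hs, hsf⟩ := hP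
  have hfd : ∀ W : Submodule k V, FiniteDimensional k (homInto P V m W) := fun W =>
    Submodule.finiteDimensional_of_le (homInto_le W)
  let S : Set (P →ₗ[k] V) := {f | f ∈ hom P V m ∧ f ∉ homInto P V m W'}
  have hS : S.Nonempty := by
    obtain ⟨f, h1, h2⟩ := SetLike.exists_of_lt hlt
    exact ⟨f, h1, h2⟩
  let μ : (P →ₗ[k] V) → ℕ := fun f => Module.finrank k (homInto P V m (W' ⊔ LinearMap.range f))
  -- V may have infinite length, so composition series are unavailable. Minimality of a dimension of
  -- homomorphisms replaces minimality of a submodule.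
  obtain ⟨f, ⟨hf, hfW'⟩, hmin⟩ : ∃ f ∈ S, ∀ g ∈ S, μ f ≤ μ g := by
    refine ⟨Function.argminOn μ S hS, Function.argminOn_mem _ _ _, fun g hg => ?_⟩
    exact Function.argminOn_le μ S hg
  -- The quotient of `W₂` by this submodule is a nonzero quotient of P / ker f₀, hence a shift of L.
  let W₁ := W' ⊔ (LinearMap.ker f₀).map f
  let W₂ := W' ⊔ LinearMap.range f
  have hG₁ : V.IsGSub W₁ := hW'.sup ((isGSub_ker hf₀).map hf)
  have hG₂ : V.IsGSub W₂ := hW'.sup (isGSub_range hf)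
  have h12 : W₁ ≤ W₂ := sup_le_sup_left (LinearMap.map_le_range) _
  have hfW₂ : f ∈ homInto P V m W₂ := ⟨hf, fun v => Submodule.mem_sup_right ⟨v, rfl⟩⟩
  have hfW₁ : f ∉ homInto P V m W₁ := by
    rintro ⟨-, h⟩
    apply hfW'
    -- If `f` took values in `W₁`, the preimage of `W'` together with the superfluous kernel would
    -- be all of P, forcing `f` into `W'`.
    have : W'.comap f = ⊤ := by
      refine hsf _ (hW'.comap hf) ?_
      rw [eq_top_iff]
      intro v _
      obtain ⟨w, hw, _, ⟨x, hx, rfl⟩, hv⟩ := Submodule.mem_sup.1 (h v)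
      refine Submodule.mem_sup.2 ⟨v - x, ?_, x, hx, by abel⟩
      rw [Submodule.mem_comap, map_sub, ← hv, add_sub_cancel_right]
      exact hw
    exact ⟨hf, fun v => (this ▸ Submodule.mem_top : v ∈ W'.comap f)⟩
  -- A map into `W₁` but not into `W'` would generate a submodule admitting strictly fewer maps than
  -- that of `f`, contradicting minimality.
  have heq : homInto P V m W₁ ≤ homInto P V m W' := by
    intro g hg
    by_contra hgW'
    have h1 := hmin g ⟨hg.1, hgW'⟩
    have h2 : homInto P V m (W' ⊔ LinearMap.range g) ≤ homInto P V m W₁ :=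
      homInto_mono (sup_le le_sup_left (by rintro _ ⟨v, rfl⟩; exact hg.2 v))
    have h3 : homInto P V m W₁ < homInto P V m W₂ :=
      lt_of_le_of_ne (homInto_mono h12) fun h => hfW₁ (h ▸ hfW₂)
    have h4 := Submodule.finrank_lt_finrank_of_lt (h2.trans_lt h3)
    exact absurd h1 (not_le_of_gt h4)
  obtain ⟨g, hg, hgf⟩ := exists_hom_factor (h := V.qmap W₁ hG₁ ∘ₗ f) hf₀ hs
    (hom_comp (qmap_mem_hom hG₁) hf) (by
      intro x hx
      exact (qmap_eq_zero hG₁).2 (Submodule.mem_sup_right ⟨x, hx, rfl⟩))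
  rw [add_zero] at hg
  have hgi : Function.Injective g := by
    refine hL.injective hg fun h0 => hfW₁ ⟨hf, fun v => ?_⟩
    rw [← qmap_eq_zero hG₁]
    have := hgf v
    rw [h0] at this
    exact this.symm
  have hgr : LinearMap.range g = W₂.map (V.qmap W₁ hG₁) := by
    ext y
    constructor
    · rintro ⟨l, rfl⟩
      obtain ⟨v, rfl⟩ := hs l
      rw [hgf]
      exact ⟨f v, hfW₂.2 v, rfl⟩
    · rintro ⟨x, hx, rfl⟩
      obtain ⟨w, hw, _, ⟨v, rfl⟩, rfl⟩ := Submodule.mem_sup.1 hx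
      refine ⟨f₀ v, ?_⟩
      rw [hgf, map_add, (qmap_eq_zero hG₁).2 (Submodule.mem_sup_left hw), zero_add]
      rfl
  refine ⟨W₁, W₂, hG₁, hG₂, le_sup_left, h12,
    IsSection.of_hom hG₁ (M := L.shift (-m)) (hom_shift.2 hg) hgi hgr, ?_⟩
  -- Modulo `W₁` every map into `W₂` factors through the copy of L, so by the analogue of Schur's
  -- lemma it is a multiple of `f`.
  have hle : homInto P V m W₂ ≤ homInto P V m W' ⊔ k ∙ f := by
    intro f' hf'
    obtain ⟨ψ, hψ⟩ : ∃ ψ : P →ₗ[k] L, ∀ v, g (ψ v) = V.qmap W₁ hG₁ (f' v) := by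
      refine ⟨(LinearEquiv.ofInjective g hgi).symm.toLinearMap ∘ₗ
        (V.qmap W₁ hG₁ ∘ₗ f').codRestrict (LinearMap.range g) (fun v => ?_), fun v => ?_⟩
      · rw [hgr]
        exact ⟨f' v, hf'.2 v, rfl⟩
      · have := LinearEquiv.ofInjective_symm_apply (f := g) (h := hgi)
          ((V.qmap W₁ hG₁ ∘ₗ f').codRestrict (LinearMap.range g) (fun v => by
            rw [hgr]; exact ⟨f' v, hf'.2 v, rfl⟩) v)
        exact this
    have hψh : ψ ∈ hom P L 0 := by
      constructor
      · intro n x hx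
        rw [add_zero]
        have h1 : V.qmap W₁ hG₁ (f' x) ∈ (V.quot W₁ hG₁).deg (n + m) :=
          qmap_mem_deg hG₁ (hom_deg hf'.1 hx)
        rw [← hψ] at h1
        have h2 := hom_gproj hg n (ψ x)
        rw [gproj_of_mem _ h1] at h2
        rw [hgi h2]
        exact gproj_mem _ _ _
      · intro a x
        apply hgi
        rw [hψ, hom_smul hg, hψ, hom_smul hf'.1]
        rfl
    obtain ⟨c, hc⟩ := exists_smul_of_cover hf₀ hs hsf hL hE hψh
    have : f' - c • f ∈ homInto P V m W₁ := by
      refine ⟨sub_mem hf'.1 (Submodule.smul_mem _ _ hf), fun v => ?_⟩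
      rw [← qmap_eq_zero hG₁]
      rw [LinearMap.sub_apply, map_sub, ← hψ, hc, LinearMap.smul_apply, LinearMap.smul_apply,
        map_smul, map_smul, hgf]
      exact sub_self _
    rw [← sub_add_cancel f' (c • f)]
    exact Submodule.add_mem_sup (heq this)
      (Submodule.smul_mem _ _ (Submodule.mem_span_singleton_self f))
  refine (Submodule.finrank_mono hle).trans
    ((Submodule.finrank_add_le_finrank_add_finrank _ _).trans (Nat.add_le_add_left ?_ _))
  exact (finrank_span_le_card _).trans (by simp)

/-- `V` has a graded filtration from `0` to `W` with `j` sections isomorphic to `M`. -/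
def Reaches (V M : GMod A) (W : Submodule k V) (j : ℕ) : Prop :=
  ∃ (n : ℕ) (F : ℕ → Submodule k V) (S : Finset ℕ), (∀ r, V.IsGSub (F r)) ∧ Monotone F ∧ F 0 = ⊥ ∧
    (∀ r, n ≤ r → F r = W) ∧ (∀ r ∈ S, r < n ∧ V.IsSection (F r) (F (r + 1)) M) ∧ S.card = j

/-- Filtrations are indexed by ℕ and eventually constant, so a step is appended by changing the
value beyond `n`; no reindexing of finite types is needed. -/
theorem Reaches.extend {V M : GMod A} {W W' : Submodule k V} {j : ℕ} (h : V.Reaches M W j)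
    (hW' : V.IsGSub W') (hle : W ≤ W') :
    V.Reaches M W' j ∧ (V.IsSection W W' M → V.Reaches M W' (j + 1)) := by
  obtain ⟨n, F, S, h1, h2, h3, h4, h5, h6⟩ := h
  let F' : ℕ → Submodule k V := fun r => if r ≤ n then F r else W'
  have hF1 : ∀ r, r ≤ n → F' r = F r := fun r hr => if_pos hr
  have hF2 : ∀ r, n + 1 ≤ r → F' r = W' := fun r hr => if_neg (by omega)
  have hg : ∀ r, V.IsGSub (F' r) := fun r => by
    rcases Nat.lt_or_ge n r with hr | hr
    · rw [hF2 r hr]; exact hW'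
    · rw [hF1 r hr]; exact h1 r
  have hm : Monotone F' := by
    refine monotone_nat_of_le_succ fun r => ?_
    rcases lt_trichotomy r n with hr | rfl | hr
    · rw [hF1 r hr.le, hF1 _ hr]; exact h2 (Nat.le_succ r)
    · rw [hF1 r le_rfl, hF2 _ le_rfl, h4 r le_rfl]; exact hle
    · rw [hF2 r hr, hF2 _ (by omega)]
  have h0 : F' 0 = ⊥ := by rw [hF1 0 (Nat.zero_le n), h3]
  have hS : ∀ r ∈ S, r < n + 1 ∧ V.IsSection (F' r) (F' (r + 1)) M := fun r hr => by
    have := h5 r hr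
    refine ⟨by omega, ?_⟩
    rw [hF1 r this.1.le, hF1 _ this.1]
    exact this.2
  refine ⟨⟨n + 1, F', S, hg, hm, h0, hF2, hS, h6⟩, fun hsec => ?_⟩
  refine ⟨n + 1, F', insert n S, hg, hm, h0, hF2, fun r hr => ?_, ?_⟩
  · rcases Finset.mem_insert.1 hr with rfl | hr
    · refine ⟨by omega, ?_⟩
      rw [hF1 r le_rfl, hF2 _ le_rfl, h4 r le_rfl]
      exact hsec
    · exact hS r hr
  · rw [Finset.card_insert_of_notMem (fun hn => lt_irrefl _ (h5 n hn).1), h6]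

theorem Reaches.le_mult {V L : GMod A} {d : ℤ} {j : ℕ} (h : V.Reaches (L.shift d) ⊤ j) :
    (j : ℕ∞) ≤ V.mult L d := by
  obtain ⟨n, F, S, h1, h2, h3, h4, h5, h6⟩ := h
  let G : V.Filtration n := ⟨fun r => F r, fun r => h1 r, fun r s hrs => h2 hrs, h3, h4 _ le_rfl⟩
  refine le_trans ?_ (le_iSup₂ (f := fun (n : ℕ) (F : V.Filtration n) =>
    {r : Fin n | F.SectionIso r (L.shift d)}.encard) n G)
  rw [← h6, ← Set.encard_coe_eq_coe_finsetCard,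
    ← (Fin.val_injective (n := n)).encard_image]
  refine Set.encard_le_encard fun r hr => ?_
  exact ⟨⟨r, (h5 r hr).1⟩, (h5 r hr).2, rfl⟩

/-- Composition multiplicities of an irreducible module `L` are dimensions of spaces of homomorphisms
from its projective cover. -/
theorem mult_eq_finrank (hP : P.IsProjectiveCover L) (hL : L.IsSimple)
    (hE : ∀ f ∈ hom L L 0, ∃ c : k, f = c • LinearMap.id) (V : GMod A) (m : ℤ)
    [FiniteDimensional k (hom P V m)] :
    V.mult L (-m) = (Module.finrank k (hom P V m) : ℕ∞) := by
  classical
  have hfd : ∀ W : Submodule k V, FiniteDimensional k (homInto P V m W) := fun W =>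
    Submodule.finiteDimensional_of_le (homInto_le W)
  apply le_antisymm
  · refine iSup₂_le fun n F => ?_
    let S : Finset (Fin n) := Finset.univ.filter fun r => F.SectionIso r (L.shift (-m))
    have hS : {r : Fin n | F.SectionIso r (L.shift (-m))} = (S : Set (Fin n)) := by
      ext r; simp [S]
    rw [hS, Set.encard_coe_eq_coe_finsetCard, Nat.cast_le]
    -- The dimensions grow along the filtration, strictly at each counted section, and the
    -- differences telescope; integers avoid truncated subtraction.
    let g : Fin (n + 1) → ℤ := fun r => Module.finrank k (homInto P V m (F.toFun r))
    have hsum := sum_fin_succ_sub g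
    have hlast : g (Fin.last n) = Module.finrank k (hom P V m) := by
      simp only [g]
      rw [F.top, homInto_top]
    have h0 : 0 ≤ g 0 := Int.natCast_nonneg _
    have hmono : ∀ r : Fin n, F.toFun r.castSucc ≤ F.toFun r.succ :=
      fun r => F.mono (Fin.castSucc_lt_succ).le
    have hcard : (S.card : ℤ) ≤ ∑ r : Fin n, (g r.succ - g r.castSucc) := by
      rw [Finset.card_eq_sum_ones, Finset.sum_filter, Nat.cast_sum]
      refine Finset.sum_le_sum fun r _ => ?_
      split_ifs with hr
      · have := Submodule.finrank_lt_finrank_of_lt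
          (homInto_lt (V := V) (m := m) hP hL (F.isGSub _) (F.isGSub _) (hmono r) hr)
        simp only [g]
        push_cast
        omega
      · have := Submodule.finrank_mono (homInto_mono (P := P) (m := m) (hmono r))
        simp only [g]
        push_cast
        omega
    have : (S.card : ℤ) ≤ Module.finrank k (hom P V m) := by linarith
    exact_mod_cast this
  -- Each extension adds one copy of L and raises the dimension by at most one, so after `j`
  -- extensions some homomorphism is still missed while `j` is below the total dimension.
  · have key : ∀ j ≤ Module.finrank k (hom P V m), ∃ W, V.IsGSub W ∧
        V.Reaches (L.shift (-m)) W j ∧ Module.finrank k (homInto P V m W) ≤ j := by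
      intro j
      induction j with
      | zero =>
        intro _
        refine ⟨⊥, V.isGSub_bot, ⟨0, fun _ => ⊥, ∅, fun _ => V.isGSub_bot, monotone_const, rfl,
          fun _ _ => rfl, by simp, rfl⟩, ?_⟩
        have : homInto P V m ⊥ = ⊥ := by
          rw [eq_bot_iff]
          intro f hf
          exact (Submodule.mem_bot k).2 (LinearMap.ext fun v => (Submodule.mem_bot k).1 (hf.2 v))
        rw [this]
        simp
      | succ j ih =>
        intro hj
        obtain ⟨W, hW, hr, hd⟩ := ih (by omega)
        have hlt : homInto P V m W < hom P V m := by
          refine lt_of_le_of_ne (homInto_le W) fun h => ?_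
          rw [h] at hd
          omega
        obtain ⟨W₁, W₂, h1, h2, h3, h4, h5, h6⟩ := exists_section hP hL hE hW hlt
        exact ⟨W₂, h2, ((hr.extend h1 h3).1.extend h2 h4).2 h5, by omega⟩
    obtain ⟨W, -, hr, -⟩ := key _ le_rfl
    exact (hr.extend V.isGSub_top le_top).1.le_mult

end Cover

end GMod

end PureBGG

/-! ### Finiteness of costandard modules and of the multiplicities. -/

namespace PureBGG

namespace GMod

variable {k : Type u} [Field k] {A : GrAlg k}

theorem act_of_mem_range (V : GMod A) {η : A} (hη : η * η = η) {v : V}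
    (hv : v ∈ LinearMap.range (V.act η)) : V.act η v = v := by
  obtain ⟨v, rfl⟩ := hv
  rw [← V.act_mul, hη]

/-- Homomorphisms out of a cyclic module are determined by the image of the generator. -/
theorem hom_finite_of_cyc {P V : GMod A} {η : A} {s : ℤ} {p : P} (hp : p ∈ P.deg s)
    (hηp : P.act η p = p) (hc : P.cyc p = ⊤) (d : ℤ)
    [FiniteDimensional k ↥(LinearMap.range (V.act η) ⊓ V.deg (s + d))] :
    FiniteDimensional k (hom P V d) ∧ Module.finrank k (hom P V d) ≤
      Module.finrank k ↥(LinearMap.range (V.act η) ⊓ V.deg (s + d)) := by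
  let ev : hom P V d →ₗ[k] ↥(LinearMap.range (V.act η) ⊓ V.deg (s + d)) :=
    ((LinearMap.applyₗ (R := k) p : (P →ₗ[k] V) →ₗ[k] V) ∘ₗ (hom P V d).subtype).codRestrict _
      (fun f => ⟨⟨f.1 p, by
        change V.act η (f.1 p) = f.1 p
        rw [← hom_smul f.2, hηp]⟩, hom_deg f.2 hp⟩)
  have hev : Function.Injective ev := by
    intro f g hfg
    have h : f.1 p = g.1 p := congrArg Subtype.val hfg
    refine Subtype.ext (LinearMap.ext fun v => ?_)
    obtain ⟨a, rfl⟩ : v ∈ P.cyc p := by rw [hc]; trivial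
    change f.1 (P.act a p) = g.1 (P.act a p)
    rw [hom_smul f.2, hom_smul g.2, h]
  exact ⟨FiniteDimensional.of_injective ev hev, LinearMap.finrank_le_finrank_of_injective hev⟩

/-- Locally finite-dimensional and bounded above modules. -/
def LocFinBddAbove (V : GMod A) : Prop :=
  (∀ d, FiniteDimensional k (V.deg d)) ∧ ∃ N : ℤ, ∀ d, N < d → V.deg d = ⊥

end GMod

namespace LocalUnits

variable {k : Type u} [Field k] {A : GrAlg k} {I : Type*} {U : LocalUnits A I}

/-- The Peirce components for finite sums of distinguished idempotents are again locally
finite-dimensional and bounded below. -/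
theorem LocFinBddBelow.peirce_sum (hA : U.LocFinBddBelow) (a b : Finset I) :
    (∀ d, FiniteDimensional k
      ↥(A.peirce (∑ i ∈ a, (U.one i).val) (∑ j ∈ b, (U.one j).val) ⊓ A.deg d)) ∧
    ∃ N : ℤ, ∀ d < N,
      A.peirce (∑ i ∈ a, (U.one i).val) (∑ j ∈ b, (U.one j).val) ⊓ A.deg d = ⊥ := by
  classical
  have hle : ∀ d, A.peirce (∑ i ∈ a, (U.one i).val) (∑ j ∈ b, (U.one j).val) ⊓ A.deg d ≤
      ⨆ q ∈ a ×ˢ b, A.peirce (U.one q.1).val (U.one q.2).val ⊓ A.deg d := by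
    rintro d x ⟨⟨h1, h2⟩, hd⟩
    have hx : x = ∑ q ∈ a ×ˢ b, (U.one q.1).val * x * (U.one q.2).val := by
      rw [Finset.sum_product]
      simp_rw [← Finset.mul_sum]
      rw [← Finset.sum_mul, ← Finset.sum_mul, h1, h2]
    rw [hx]
    refine Submodule.sum_mem _ fun q hq => Submodule.mem_iSup_of_mem q
      (Submodule.mem_iSup_of_mem hq ⟨⟨?_, ?_⟩, ?_⟩)
    · rw [← mul_assoc, ← mul_assoc, (U.one _).mul_self]
    · rw [mul_assoc, (U.one _).mul_self]
    · have := A.mul_mem (A.mul_mem (U.one q.1).mem hd) (U.one q.2).mem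
      rwa [zero_add, add_zero] at this
  constructor
  · intro d
    have hfin : ∀ q : I × I, FiniteDimensional k
        ↥(A.peirce (U.one q.1).val (U.one q.2).val ⊓ A.deg d) := fun q => (hA q.1 q.2).1 d
    have : FiniteDimensional k
        ↥(⨆ q ∈ a ×ˢ b, A.peirce (U.one q.1).val (U.one q.2).val ⊓ A.deg d) :=
      Submodule.finiteDimensional_finset_sup (a ×ˢ b)
        (fun q => A.peirce (U.one q.1).val (U.one q.2).val ⊓ A.deg d) |>
          fun h => by rwa [Finset.sup_eq_iSup] at h
    exact Submodule.finiteDimensional_of_le (hle d)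
  · choose N hN using fun q : I × I => (hA q.1 q.2).2
    obtain ⟨n, hn⟩ := ((a ×ˢ b).image fun q => -N q).exists_le
    refine ⟨-n, fun d hd => eq_bot_iff.2 ((hle d).trans ?_)⟩
    refine iSup₂_le fun q hq => ?_
    have h1 := hn _ (Finset.mem_image_of_mem (fun q => -N q) hq)
    rw [hN q d (by omega)]

end LocalUnits

namespace TriBasis

variable {k : Type u} [Field k] {A : GrAlg k} {I : Type*} {U : LocalUnits A I} {W : Type*}
  [PartialOrder W] (T : TriBasis U W) {w : W}

/-- Finiteness of the components of costandardizations. -/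
theorem costd_finite {V : GMod (T.cartan w)} (hV : V.LocFinBddAbove) (p : A.Idem)
    (hfin : ∀ d, FiniteDimensional k ↥(A.peirce (T.e w).val p.val ⊓ A.deg d))
    (hbdd : ∃ N : ℤ, ∀ d < N, A.peirce (T.e w).val p.val ⊓ A.deg d = ⊥) :
    (∀ n, FiniteDimensional k
      ↥(LinearMap.range ((T.costd w V).act p.val) ⊓ (T.costd w V).deg n)) ∧
    ∃ M, ∀ n, M < n → LinearMap.range ((T.costd w V).act p.val) ⊓ (T.costd w V).deg n = ⊥ := by
  obtain ⟨N, hN⟩ := hbdd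
  obtain ⟨M, hM⟩ := hV.2
  let X : ℤ → Submodule k (T.costd w V) :=
    fun n => LinearMap.range ((T.costd w V).act p.val) ⊓ (T.costd w V).deg n
  let E : ℤ → Submodule k A := fun j => A.peirce (T.e w).val p.val ⊓ A.deg j
  -- Below degree N there is nothing to evaluate on, and above degree M - n the values land in zero
  -- components. So `f` is determined by its values in finitely many degrees, and none remain when n
  -- > M - N.
  have hzero : ∀ n, ∀ f ∈ X n, (∀ j ∈ Finset.Icc N (M - n), ∀ x ∈ E j, T.costdEval V f x = 0) →
      f = 0 := by
    rintro n f ⟨hf, hfn⟩ h0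
    apply T.costdEval_injective V
    rw [map_zero]
    refine LinearMap.ext fun x => ?_
    have hfp : ∀ x, T.costdEval V f x = T.costdEval V f (x * p.val) := fun x => by
      rw [← costdEval_act, (T.costd w V).act_of_mem_range p.mul_self hf]
    refine GMod.alg_induction (p := fun x => T.costdEval V f x = 0) (by simp)
      (fun x y hx hy => by rw [map_add, hx, hy, add_zero]) (fun j x hx => ?_) x
    rw [← (T.isCostdFun_costdEval V f).e_mul, hfp]
    have hmem : (T.e w).val * x * p.val ∈ E j := by
      refine ⟨⟨?_, ?_⟩, ?_⟩
      · rw [← mul_assoc, ← mul_assoc, (T.e w).mul_self]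
      · rw [mul_assoc, p.mul_self]
      · have := A.mul_mem (A.mul_mem (T.e w).mem hx) p.mem
        rwa [zero_add, add_zero] at this
    by_cases h1 : j < N
    · have : (T.e w).val * x * p.val = 0 := by
        have h2 : E j = ⊥ := hN j h1
        rw [h2] at hmem
        simpa using hmem
      rw [this, map_zero]
    · by_cases h2 : M - n < j
      · have := T.costdEval_mem V hfn hmem.2
        rw [hM _ (by omega)] at this
        simpa using this
      · exact h0 j (Finset.mem_Icc.2 ⟨by omega, by omega⟩) _ hmem
  constructor
  · intro n
    have h1 : ∀ j, FiniteDimensional k (E j) := hfin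
    have h2 : ∀ j, FiniteDimensional k (V.deg j) := hV.1
    let Φ : X n →ₗ[k] ((j : Finset.Icc N (M - n)) → (E j →ₗ[k] V.deg (j + n))) :=
      LinearMap.pi fun j =>
        { toFun := fun f => (T.costdEval V f.1 ∘ₗ (E j).subtype).codRestrict _
            (fun x => T.costdEval_mem V f.2.2 x.2.2)
          map_add' := fun f g => LinearMap.ext fun x => Subtype.ext
            (LinearMap.congr_fun (map_add (T.costdEval V) f.1 g.1) x.1)
          map_smul' := fun c f => LinearMap.ext fun x => Subtype.ext
            (LinearMap.congr_fun (map_smul (T.costdEval V) c f.1) x.1) }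
    have hΦ : Function.Injective Φ := by
      rw [← LinearMap.ker_eq_bot, LinearMap.ker_eq_bot']
      intro f hf
      refine Subtype.ext (hzero n f.1 f.2 fun j hj x hx => ?_)
      have := LinearMap.congr_fun (congrFun hf ⟨j, hj⟩) ⟨x, hx⟩
      exact congrArg Subtype.val this
    exact FiniteDimensional.of_injective Φ hΦ
  · refine ⟨M - N, fun n hn => eq_bot_iff.2 fun f hf => ?_⟩
    refine (Submodule.mem_bot k).2 (hzero n f hf fun j hj => ?_)
    rw [Finset.mem_Icc] at hj
    omega

theorem e_val_map (w : W) : (T.e w).val =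
    ∑ i ∈ (T.fiber_finite w).toFinset.map (Function.Embedding.subtype _), (U.one i).val := by
  rw [Finset.sum_map]
  rfl

/-- If the algebra is locally finite-dimensional and bounded below, so are the algebras `A_w`. -/
theorem cartan_finite (hA : U.LocFinBddBelow) (w : W) :
    (∀ d, FiniteDimensional k ((T.cartan w).deg d)) ∧
      ∃ N : ℤ, ∀ d < N, (T.cartan w).deg d = ⊥ := by
  classical
  have h := hA.peirce_sum ((T.fiber_finite w).toFinset.map (Function.Embedding.subtype _))
    ((T.fiber_finite w).toFinset.map (Function.Embedding.subtype _))
  rw [← T.e_val_map w] at h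
  have hle : ∀ d, (T.cartan w).deg d ≤
      (A.peirce (T.e w).val (T.e w).val ⊓ A.deg d).map (T.toCartan w) := by
    intro d c hc
    obtain ⟨a, ha, rfl⟩ := T.exists_toCartan_of_mem w hc
    refine ⟨(T.e w).val * a * (T.e w).val, ⟨⟨?_, ?_⟩, ?_⟩, ?_⟩
    · rw [← mul_assoc, ← mul_assoc, (T.e w).mul_self]
    · rw [mul_assoc, (T.e w).mul_self]
    · have := A.mul_mem (A.mul_mem (T.e w).mem ha) (T.e w).mem
      rwa [zero_add, add_zero] at this
    · rw [toCartan_mul_e, toCartan_e_mul]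
  constructor
  · intro d
    have := h.1 d
    have : FiniteDimensional k
        ↥((A.peirce (T.e w).val (T.e w).val ⊓ A.deg d).map (T.toCartan w)) :=
      Module.Finite.map _ _
    exact Submodule.finiteDimensional_of_le (hle d)
  · obtain ⟨N, hN⟩ := h.2
    refine ⟨N, fun d hd => ?_⟩
    have := hle d
    rw [hN d hd, Submodule.map_bot] at this
    exact eq_bot_iff.2 this

theorem peirce_e_finite (hA : U.LocFinBddBelow) (w : W) (i : I) :
    (∀ d, FiniteDimensional k ↥(A.peirce (T.e w).val (U.one i).val ⊓ A.deg d)) ∧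
      ∃ N : ℤ, ∀ d < N, A.peirce (T.e w).val (U.one i).val ⊓ A.deg d = ⊥ := by
  classical
  have h := hA.peirce_sum ((T.fiber_finite w).toFinset.map (Function.Embedding.subtype _)) {i}
  rw [← T.e_val_map w, Finset.sum_singleton] at h
  exact h

variable {T}

namespace IsBasedAffineQuasiHereditary

variable (h : T.IsBasedAffineQuasiHereditary) (w)

/-- The class of the identity element in the irreducible module of a graded local algebra. -/
noncomputable def simpleOne (T : TriBasis U W) (w : W) : T.simple w :=
  (T.regular w).qmap _ (T.regular w).rad_isGSub ((T.ge w).cornerOne (T.eBar w) : T.cartan w)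

theorem simpleOne_mem : simpleOne T w ∈ (T.simple w).deg 0 :=
  GMod.qmap_mem_deg (V := T.regular w) _ ((T.ge w).cornerOne_mem (T.eBar w))

include h in
theorem simpleOne_ne_zero : simpleOne T w ≠ 0 := by
  intro h0
  have h1 := (GMod.qmap_eq_zero (V := T.regular w) _).1 h0
  apply (h.isGreatestProper w).2.1
  rw [eq_top_iff, ← T.cyc_regular w]
  rintro _ ⟨a, rfl⟩
  exact (T.regular w).rad_isGSub.1 a _ h1

include h in
theorem exists_smul_simpleOne (x : T.simple w) : ∃ c : k, x = c • simpleOne T w := by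
  obtain ⟨c, hc⟩ := exists_smul_eq_of_finrank_eq_one (h.2 w) (simpleOne_ne_zero w h) x
  exact ⟨c, hc.symm⟩

include h in
-- The module is spanned by the class of the identity, which has degree 0.
theorem simple_deg (d : ℤ) (hd : d ≠ 0) : (T.simple w).deg d = ⊥ := by
  rw [eq_bot_iff]
  intro x hx
  obtain ⟨c, rfl⟩ := exists_smul_simpleOne w h x
  have h1 := gproj_of_mem (T.simple w).internal hx
  rw [map_smul, gproj_of_mem_ne _ hd.symm (simpleOne_mem w), smul_zero] at h1
  rw [← h1]
  exact zero_mem _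

include h in
theorem simple_finite : (T.simple w).LocFinBddAbove := by
  refine ⟨fun d => ?_, 0, fun d hd => simple_deg w h d hd.ne'⟩
  have : FiniteDimensional k (T.simple w) :=
    Module.finite_of_finrank_pos
      (by rw [show Module.finrank k (T.simple w) = 1 from h.2 w]; exact one_pos)
  infer_instance

end IsBasedAffineQuasiHereditary

end TriBasis

namespace Refinement

variable {k : Type u} [Field k] {A : GrAlg k} {I : Type*} {U : LocalUnits A I} {W : Type*}
  [PartialOrder W] {T : TriBasis U W} {B : W → Type*} [∀ w, PartialOrder (B w)]
  (R : Refinement T B)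

/-- The identity element of `A_w` as an idempotent. -/
noncomputable def cartanOne (T : TriBasis U W) (w : W) : (T.cartan w).Idem where
  val := (T.ge w).cornerOne (T.eBar w)
  mem := (T.ge w).cornerOne_mem (T.eBar w)
  mul_self := (T.ge w).cornerOne_mul _ _

theorem properNabla_finite (hA : U.LocFinBddBelow) (a : Σ w, B w) :
    ((R.basis a.1).properNabla a.2).LocFinBddAbove := by
  have hc := T.cartan_finite hA a.1
  -- A_w is unital: its identity acts as the identity, so one Peirce component sees the whole
  -- module. Its own system of distinguished idempotents plays no role.
  have hrange : LinearMap.range (((R.basis a.1).properNabla a.2).act (cartanOne T a.1).val) = ⊤ :=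
    LinearMap.range_eq_top.2 fun v => ⟨v, GMod.act_cornerOne (A := T.ge a.1) (T.eBar a.1) _ v⟩
  have key := (R.basis a.1).costd_finite ((R.based a.1).simple_finite a.2) (cartanOne T a.1)
    (fun d => by
      have := hc.1 d
      exact Submodule.finiteDimensional_of_le (inf_le_right (b := (T.cartan a.1).deg d)))
    (by
      obtain ⟨N, hN⟩ := hc.2
      exact ⟨N, fun d hd => by rw [hN d hd, inf_bot_eq]⟩)
  change (∀ n, FiniteDimensional k ↥(LinearMap.range
    (((R.basis a.1).properNabla a.2).act (cartanOne T a.1).val) ⊓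
      ((R.basis a.1).properNabla a.2).deg n)) ∧ ∃ M, ∀ n, M < n → LinearMap.range
    (((R.basis a.1).properNabla a.2).act (cartanOne T a.1).val) ⊓
      ((R.basis a.1).properNabla a.2).deg n = ⊥ at key
  rw [hrange] at key
  refine ⟨fun d => ?_, ?_⟩
  · have := key.1 d
    rwa [top_inf_eq] at this
  · simpa only [top_inf_eq] using key.2

/-- The weight spaces of pure proper costandard modules are finite-dimensional in each degree. -/
theorem pureProperNabla_finite (hA : U.LocFinBddBelow) (a : Σ w, B w) (i : I) (n : ℤ) :
    FiniteDimensional k ↥(LinearMap.range ((R.pureProperNabla a).act (U.one i).val) ⊓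
      (R.pureProperNabla a).deg n) := by
  have h := T.peirce_e_finite hA a.1 i
  exact (T.costd_finite (R.properNabla_finite hA a) (U.one i) h.1 h.2).1 n

theorem finiteDimensional_hom (hA : U.LocFinBddBelow) {b : Σ w, B w} {P : GMod A}
    (hP : P.IsProjectiveCover (R.irr b)) (a : Σ w, B w) (d : ℤ) :
    FiniteDimensional k (GMod.hom P (R.pureProperNabla a) d) := by
  obtain ⟨i, s, p, hp, hip, hcyc⟩ := R.exists_generator b hP
  have := R.pureProperNabla_finite hA a i (s + d)
  exact (GMod.hom_finite_of_cyc hp hip hcyc d).1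

/-- The bar and the sign in the definition of the graded dimension cancel, leaving degree `d`. -/
theorem pureDeltaMult_eq (hA : U.LocFinBddBelow) {b : Σ w, B w} {P : GMod A}
    (hP : P.IsProjectiveCover (R.irr b)) (a : Σ w, B w) (d : ℤ) :
    R.pureDeltaMult P a d = (Module.finrank k (GMod.hom P (R.pureProperNabla a) d) : ℕ∞) := by
  have := R.finiteDimensional_hom hA hP a d
  rw [pureDeltaMult, GMod.dimHom, neg_neg, ← Module.finrank_eq_rank, Cardinal.toENat_nat]

/-- Composition multiplicities as dimensions of spaces of homomorphisms. -/
theorem mult_irr {b : Σ w, B w} {P : GMod A} (hP : P.IsProjectiveCover (R.irr b)) (V : GMod A)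
    (m : ℤ) [FiniteDimensional k (GMod.hom P V m)] :
    V.mult (R.irr b) (-m) = (Module.finrank k (GMod.hom P V m) : ℕ∞) :=
  GMod.mult_eq_finrank hP (R.isSimple_irr b) (fun _ hf => R.exists_smul_of_hom_irr b hf) V m

end Refinement

end PureBGG

/-! ### Dual pairs of graded modules. -/

namespace PureBGG

namespace GrAlg

variable {k : Type u} [Field k] {A : GrAlg k}

theorem Anti.symm_map_mul (t : A.Anti) (a b : A) :
    t.toEquiv.symm (a * b) = t.toEquiv.symm b * t.toEquiv.symm a := by
  rw [LinearEquiv.symm_apply_eq, t.map_mul, LinearEquiv.apply_symm_apply,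
    LinearEquiv.apply_symm_apply]

/-- The inverse of an anti-automorphism. -/
def Anti.symm (t : A.Anti) : A.Anti where
  toEquiv := t.toEquiv.symm
  map_mul := t.symm_map_mul
  map_deg d a ha := by
    have h := gproj_map A.internal A.internal (f := t.toEquiv.toLinearMap) (m := 0)
      (fun n x hx => by rw [add_zero]; exact t.map_deg n x hx) d (t.toEquiv.symm a)
    rw [add_zero] at h
    change gproj A.internal d (t.toEquiv (t.toEquiv.symm a)) = t.toEquiv _ at h
    rw [LinearEquiv.apply_symm_apply, gproj_of_mem _ ha] at h
    rw [h, LinearEquiv.symm_apply_apply]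
    exact gproj_mem _ _ _

end GrAlg

/-- The inverse of an anti-automorphism fixing the distinguished idempotents. -/
def AntiFix.symm {k : Type u} [Field k] {A : GrAlg k} {I : Type*} {U : LocalUnits A I}
    (t : AntiFix U) : AntiFix U where
  toAnti := t.toAnti.symm
  map_one i := by
    change t.toEquiv.symm _ = _
    rw [LinearEquiv.symm_apply_eq, t.map_one]

namespace GMod

variable {k : Type u} [Field k] {A : GrAlg k}

/-- The form `β` identifies `N` with the contragredient dual of `V`, with respect to the
anti-automorphism `t`. Only functionals on `V` invariant under some element of `E` are considered. -/
structure IsDualPair (t : A → A) (E : Set A) (N V : GMod A) (β : N →ₗ[k] V →ₗ[k] k) : Prop where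
  act : ∀ a x v, β (N.act a x) v = β x (V.act (t a) v)
  deg : ∀ m n, m + n ≠ 0 → ∀ x ∈ N.deg m, ∀ v ∈ V.deg n, β x v = 0
  inj : ∀ x, β x = 0 → x = 0
  surj : ∀ m, ∀ φ : V →ₗ[k] k, (∀ n, m + n ≠ 0 → ∀ v ∈ V.deg n, φ v = 0) →
    (∃ p ∈ E, ∀ v, φ (V.act p v) = φ v) → ∃ x ∈ N.deg m, β x = φ

namespace IsDualPair

variable {t : A → A} {E : Set A} {N V : GMod A} {β : N →ₗ[k] V →ₗ[k] k}

theorem injective (h : IsDualPair t E N V β) : Function.Injective β := by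
  rw [← LinearMap.ker_eq_bot, LinearMap.ker_eq_bot']
  exact h.inj

theorem eq_of_homog {X : GMod A} {m : ℤ} {φ ψ : X →ₗ[k] k}
    (hφ : ∀ n, m + n ≠ 0 → ∀ v ∈ X.deg n, φ v = 0) (hψ : ∀ n, m + n ≠ 0 → ∀ v ∈ X.deg n, ψ v = 0)
    (h : ∀ v ∈ X.deg (-m), φ v = ψ v) : φ = ψ := by
  refine graded_ext X.internal fun n v hv => ?_
  by_cases hn : m + n = 0
  · exact h v (by rwa [show -m = n by omega])
  · rw [hφ n hn v hv, hψ n hn v hv]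

/-- A functional on a graded component, extended by zero. -/
theorem gproj_vanish {X : GMod A} {m : ℤ} (χ : X →ₗ[k] k) :
    ∀ n, m + n ≠ 0 → ∀ v ∈ X.deg n, (χ ∘ₗ gproj X.internal (-m)) v = 0 := by
  intro n hn v hv
  rw [LinearMap.comp_apply, gproj_of_mem_ne _ (by omega) hv, map_zero]

/-- Corresponding idempotent truncations of modules in duality have the same dimensions. -/
theorem finrank_eq (h : IsDualPair t E N V β) {η η' p : A} (hη : η ∈ A.deg 0) (hηη : η * η = η)
    (hη' : t η' = η) (hp : p ∈ E) (hp0 : p ∈ A.deg 0) (hηp : η * p = η) (hηη' : η' * η' = η') (m : ℤ)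
    [FiniteDimensional k ↥(LinearMap.range (N.act η') ⊓ N.deg m)] :
    FiniteDimensional k ↥(LinearMap.range (V.act η) ⊓ V.deg (-m)) ∧
      Module.finrank k ↥(LinearMap.range (V.act η) ⊓ V.deg (-m)) =
        Module.finrank k ↥(LinearMap.range (N.act η') ⊓ N.deg m) := by
  let N' : Submodule k N := LinearMap.range (N.act η') ⊓ N.deg m
  let V' : Submodule k V := LinearMap.range (V.act η) ⊓ V.deg (-m)
  -- Since `t` takes η' to η, the form pairs η' N with η V; the restricted pairing turns out to be
  -- perfect in opposite degrees.
  let Φ : N' →ₗ[k] Module.Dual k V' := (V'.subtype.dualMap ∘ₗ β) ∘ₗ N'.subtype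
  have hΦ : ∀ (x : N') (v : V'), Φ x v = β x.1 v.1 := fun _ _ => rfl
  have hx : ∀ x : N', ∀ v, β x.1 (V.act η v) = β x.1 v := fun x v => by
    rw [← hη', ← h.act, N.act_of_mem_range hηη' x.2.1]
  have hinj : Function.Injective Φ := by
    rw [← LinearMap.ker_eq_bot, LinearMap.ker_eq_bot']
    intro x h0
    refine Subtype.ext (h.inj _ ?_)
    refine eq_of_homog (m := m) (fun n hn v hv => h.deg m n hn _ x.2.2 v hv) (by simp) ?_
    intro v hv
    rw [← hx]
    exact LinearMap.congr_fun h0 ⟨V.act η v, ⟨v, rfl⟩, V.act_mem_zero hη hv⟩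
  have hsurj : Function.Surjective Φ := by
    intro χ
    -- Extends a functional on the truncation to V. The extension is invariant under `p`, as η p =
    -- η, so the surjectivity axiom applies to it.
    let P : V →ₗ[k] V' := LinearMap.codRestrict V' (V.act η ∘ₗ gproj V.internal (-m))
      (fun v => ⟨⟨_, rfl⟩, V.act_mem_zero hη (gproj_mem _ _ _)⟩)
    have hP : ∀ v ∈ V.deg (-m), (P v : V) = V.act η v := fun v hv => by
      change V.act η (gproj V.internal (-m) v) = _
      rw [gproj_of_mem _ hv]
    have hP0 : ∀ n, m + n ≠ 0 → ∀ v ∈ V.deg n, P v = 0 := fun n hn v hv => Subtype.ext (by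
      change V.act η (gproj V.internal (-m) v) = 0
      rw [gproj_of_mem_ne _ (by omega) hv, map_zero])
    have hPa : ∀ q ∈ A.deg 0, η * q = η → ∀ v, P (V.act q v) = P v := fun q hq hηq v =>
      Subtype.ext (by
        change V.act η (gproj V.internal (-m) (V.act q v)) = V.act η (gproj V.internal (-m) v)
        rw [V.act_gproj_zero hq, ← V.act_mul, hηq])
    obtain ⟨x, hxm, hxφ⟩ := h.surj m (χ ∘ₗ P) (fun n hn v hv => by
      rw [LinearMap.comp_apply, hP0 n hn v hv, map_zero]) ⟨p, hp, fun v => by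
        rw [LinearMap.comp_apply, hPa p hp0 hηp]; rfl⟩
    have hxη : N.act η' x = x := by
      apply h.injective
      ext v
      rw [h.act, hη', hxφ, LinearMap.comp_apply, hPa η hη hηη]
      rfl
    refine ⟨⟨x, ⟨x, hxη⟩, hxm⟩, ?_⟩
    ext v
    rw [hΦ, hxφ, LinearMap.comp_apply]
    congr 1
    refine Subtype.ext ?_
    rw [hP _ v.2.2, V.act_of_mem_range hηη v.2.1]
  let e : N' ≃ₗ[k] Module.Dual k V' := LinearEquiv.ofBijective Φ ⟨hinj, hsurj⟩
  have hN' : FiniteDimensional k N' := ‹_›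
  have h1 : Module.Finite k (Module.Dual k V') := Module.Finite.equiv e
  have h2 : FiniteDimensional k V' := Module.finite_dual_iff k |>.1 h1
  exact ⟨h2, by rw [← Subspace.dual_finrank_eq]; exact e.finrank_eq.symm⟩

/-- When some element of E acts as the identity, every functional on a homogeneous component of V is
represented by N, and such functionals separate vectors. -/
theorem inj_right (h : IsDualPair t E N V β) {p : A} (hp : p ∈ E) (hpV : ∀ v, V.act p v = v) (v : V)
    (hv : ∀ x, β x v = 0) : v = 0 := by
  refine gproj_ext V.internal fun d => ?_
  rw [← Module.forall_dual_apply_eq_zero_iff k]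
  intro χ
  obtain ⟨x, -, hx⟩ := h.surj (-d) _ (gproj_vanish χ) ⟨p, hp, fun v => by rw [hpV]⟩
  have := LinearMap.congr_fun hx v
  rw [hv, LinearMap.comp_apply, neg_neg] at this
  exact this.symm

/-- Over a unital algebra, duality of degreewise finite-dimensional modules is symmetric. -/
theorem flip (h : IsDualPair t E N V β) {t' : A → A} (ht : ∀ a, t (t' a) = a) {p : A} (hp : p ∈ E)
    (hpV : ∀ v, V.act p v = v) (hfin : ∀ d, FiniteDimensional k (N.deg d)) :
    IsDualPair t' E V N β.flip := by
  refine ⟨fun a v x => ?_, fun m n hmn v hv x hx => h.deg n m (by omega) x hx v hv, fun v hv =>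
    h.inj_right hp hpV v fun x => LinearMap.congr_fun hv x, ?_⟩
  · rw [LinearMap.flip_apply, LinearMap.flip_apply, h.act, ht]
  · intro m φ hφ _
    let Φ : N.deg (-m) →ₗ[k] Module.Dual k (V.deg m) :=
      ((V.deg m).subtype.dualMap ∘ₗ β) ∘ₗ (N.deg (-m)).subtype
    have hΦ : ∀ (x : N.deg (-m)) (v : V.deg m), Φ x v = β x.1 v.1 := fun _ _ => rfl
    have hinj : Function.Injective Φ := by
      rw [← LinearMap.ker_eq_bot, LinearMap.ker_eq_bot']
      intro x h0
      refine Subtype.ext (h.inj _ ?_)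
      refine eq_of_homog (m := -m) (fun n hn v hv => h.deg _ n hn _ x.2 v hv) (by simp) ?_
      intro v hv
      rw [neg_neg] at hv
      exact LinearMap.congr_fun h0 ⟨v, hv⟩
    have hsurj : Function.Surjective Φ := by
      intro χ
      let P : V →ₗ[k] V.deg m := LinearMap.codRestrict _ (gproj V.internal m) (gproj_mem _ _)
      obtain ⟨x, hxm, hxφ⟩ := h.surj (-m) (χ ∘ₗ P) (fun n hn v hv => by
        have : P v = 0 := Subtype.ext (gproj_of_mem_ne _ (by omega) hv)
        rw [LinearMap.comp_apply, this, map_zero]) ⟨p, hp, fun v => by rw [hpV]⟩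
      refine ⟨⟨x, hxm⟩, ?_⟩
      ext v
      rw [hΦ, hxφ, LinearMap.comp_apply]
      congr 1
      exact Subtype.ext (gproj_of_mem _ v.2)
    let e : N.deg (-m) ≃ₗ[k] Module.Dual k (V.deg m) := LinearEquiv.ofBijective Φ ⟨hinj, hsurj⟩
    have hN' := hfin (-m)
    have h1 : Module.Finite k (Module.Dual k (V.deg m)) := Module.Finite.equiv e
    have h2 : FiniteDimensional k (V.deg m) := Module.finite_dual_iff k |>.1 h1
    -- By the perfect pairing, a functional on N_(-m) is an element of the bidual of V_m, hence
    -- evaluation at a vector; this uses finite dimension.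
    obtain ⟨v, hv⟩ := (Module.evalEquiv k (V.deg m)).surjective
      ((φ ∘ₗ (N.deg (-m)).subtype) ∘ₗ e.symm.toLinearMap)
    refine ⟨v, v.2, eq_of_homog (m := m)
      (fun n hn x hx => h.deg n m (by omega) x hx v v.2) hφ fun x hx => ?_⟩
    have := LinearMap.congr_fun hv (e ⟨x, hx⟩)
    rw [LinearMap.comp_apply] at this
    change Φ ⟨x, hx⟩ v = φ ((e.symm (e ⟨x, hx⟩)).1) at this
    rw [LinearEquiv.symm_apply_apply, hΦ] at this
    exact this

/-- Endomorphisms have adjoints. -/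
theorem exists_adjoint (h : IsDualPair t E N V β) {p : A} (hp : p ∈ E) (hpV : ∀ v, V.act p v = v)
    {θ : V →ₗ[k] V} {d : ℤ} (hθ : θ ∈ hom V V d) :
    ∃ θ' ∈ hom N N d, ∀ x v, β (θ' x) v = β x (θ v) := by
  -- Homogeneous functionals are representable only degree by degree, so the adjoint is found on
  -- homogeneous vectors and extended by linearity.
  have key : ∀ m, ∀ x ∈ N.deg m, ∃ y ∈ N.deg (m + d), β y = β x ∘ₗ θ := fun m x hx =>
    h.surj (m + d) (β x ∘ₗ θ) (fun n hn v hv => h.deg m (n + d) (by omega) x hx _ (hom_deg hθ hv))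
      ⟨p, hp, fun v => by rw [hpV]⟩
  have hr : ∀ x, β x ∘ₗ θ ∈ LinearMap.range β := by
    intro x
    refine N.homog_induction (p := fun x => β x ∘ₗ θ ∈ LinearMap.range β) (by simp)
      (fun x y hx hy => ?_) (fun m x hx => ?_) x
    · rw [map_add, LinearMap.add_comp]
      exact add_mem hx hy
    · obtain ⟨y, -, hy⟩ := key m x hx
      exact ⟨y, hy⟩
  let θ' : N →ₗ[k] N := (LinearEquiv.ofInjective β h.injective).symm.toLinearMap ∘ₗ
    LinearMap.codRestrict (LinearMap.range β) ((LinearMap.lcomp k k θ) ∘ₗ β) hr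
  have hθ' : ∀ x, β (θ' x) = β x ∘ₗ θ := fun x =>
    LinearEquiv.ofInjective_symm_apply (f := β) (h := h.injective) ⟨β x ∘ₗ θ, hr x⟩
  refine ⟨θ', ⟨fun m x hx => ?_, fun a x => ?_⟩, fun x v => LinearMap.congr_fun (hθ' x) v⟩
  · obtain ⟨y, hy, hyx⟩ := key m x hx
    rw [← hθ'] at hyx
    rwa [← h.injective hyx]
  · apply h.injective
    rw [hθ']
    ext v
    rw [LinearMap.comp_apply, h.act, h.act, hθ', LinearMap.comp_apply, hom_smul hθ]

end IsDualPair

end GMod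

end PureBGG

/-! ### Duality between costandardization and standardization. -/

namespace PureBGG

open GMod

namespace TriBasis

variable {k : Type u} [Field k] {A : GrAlg k} {I : Type*} {U : LocalUnits A I} {W : Type*}
  [PartialOrder W] (T : TriBasis U W) {w : W}

theorem cartanAnti_toCartan (t : AntiFix U) (a : A) :
    (T.cartanAnti t w).toEquiv (T.toCartan w a) = T.toCartan w (t.toEquiv a) := by
  refine Subtype.ext (congrArg (A.toQuot (T.below w)) ?_)
  change t.toEquiv ((T.e w).val * (a * (T.e w).val)) = (T.e w).val * (t.toEquiv a * (T.e w).val)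
  rw [t.map_mul, t.map_mul, T.map_e, mul_assoc]

theorem cartanAnti_symm (t : AntiFix U) (c : T.cartan w) :
    (T.cartanAnti t w).toEquiv ((T.cartanAnti t.symm w).toEquiv c) = c := by
  obtain ⟨a, rfl⟩ := T.toCartan_surjective w c
  rw [cartanAnti_toCartan, cartanAnti_toCartan]
  exact congrArg _ (t.toEquiv.apply_symm_apply a)

theorem anti_mem_ideal (t : AntiFix U) {a : A} (ha : a ∈ A.ideal (T.below w)) :
    t.toEquiv a ∈ A.ideal (T.below w) := by
  have := t.toAnti.map_ideal (T.below w) (by rintro _ ⟨m, -, rfl⟩; exact T.map_e t m)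
  rw [← this]
  exact ⟨a, ha, rfl⟩

/-- Costandardization and standardization exchange modules in duality. -/
theorem exists_isDualPair_costd_std (t : AntiFix U) {E : Set (T.cartan w)}
    {N V : GMod (T.cartan w)} {β : N →ₗ[k] V →ₗ[k] k}
    (h : IsDualPair (T.cartanAnti t w).toEquiv E N V β) (hE : ∃ p ∈ E, ∀ v, V.act p v = v) :
    ∃ β', IsDualPair t.toEquiv {x | ∃ i, x = (U.one i).val} (T.costd w N) (T.std w V) β' := by
  obtain ⟨p, hp, hpV⟩ := hE
  have hinv : ∀ a, t.toEquiv (t.toEquiv.symm a) = a := t.toEquiv.apply_symm_apply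
  have hsd : ∀ d, ∀ a ∈ A.deg d, t.toEquiv.symm a ∈ A.deg d := t.symm.map_deg
  have hsm : ∀ a b, t.toEquiv.symm (a * b) = t.toEquiv.symm b * t.toEquiv.symm a :=
    t.toAnti.symm_map_mul
  have hse : t.toEquiv.symm (T.e w).val = (T.e w).val := T.map_e t.symm w
  -- The form is ⟨f, x ⊗ v⟩ = β(f(t⁻¹ x), v). It is balanced over A_w because f is A_w-linear and β
  -- is contravariant for the induced anti-automorphism.
  let Φ : T.costd w N → A →ₗ[k] V →ₗ[k] k := fun f =>
    (β ∘ₗ T.costdEval N f) ∘ₗ t.toEquiv.symm.toLinearMap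
  have hΦ : ∀ f u v, Φ f u v = β (T.costdEval N f (t.toEquiv.symm u)) v := fun _ _ _ => rfl
  have hex : ∀ f, ∃ g : T.std w V →ₗ[k] k, ∀ x v, g (T.stdMk V x v) = Φ f x v := by
    intro f
    have hf := T.isCostdFun_costdEval N f
    refine T.exists_std_lift V (Φ f) (fun a ha => ?_) (fun x u v => ?_)
    · ext v
      have h0 : T.costdEval N f (t.toEquiv.symm a) = 0 :=
        hf.ideal _ (T.anti_mem_ideal t.symm ha)
      rw [hΦ, h0, map_zero]
    · rw [hΦ, hΦ, hsm, hsm, hse, ← mul_assoc, hf.mul, h.act, cartanAnti_toCartan, hinv]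
  choose g hg using hex
  let β' : T.costd w N →ₗ[k] T.std w V →ₗ[k] k :=
    { toFun := g
      map_add' := fun f f' => T.std_ext V fun x v => by
        rw [LinearMap.add_apply, hg, hg, hg, hΦ, hΦ, hΦ, map_add, LinearMap.add_apply, map_add,
          LinearMap.add_apply]
      map_smul' := fun c f => T.std_ext V fun x v => by
        rw [LinearMap.smul_apply, hg, hg, hΦ, hΦ, map_smul, LinearMap.smul_apply, map_smul,
          LinearMap.smul_apply]; rfl }
  have hβ' : ∀ f x v, β' f (T.stdMk V x v) = β (T.costdEval N f (t.toEquiv.symm x)) v := hg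
  refine ⟨β', ?_, ?_, ?_, ?_⟩
  · intro a f z
    refine T.std_induction V (p := fun z => β' ((T.costd w N).act a f) z =
      β' f ((T.std w V).act (t.toEquiv a) z)) (fun x y hx hy => ?_) (fun x v => ?_) z
    · rw [map_add, map_add, map_add, hx, hy]
    · rw [hβ', std_act_mk, hβ', costdEval_act, hsm, t.toEquiv.symm_apply_apply]
  · intro m n hmn f hf z hz
    rw [std_deg_eq] at hz
    refine (Submodule.span_le.2 ?_ : _ ≤ LinearMap.ker (β' f)) hz
    rintro _ ⟨i, j, hij, x, hx, v, hv, rfl⟩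
    rw [SetLike.mem_coe, LinearMap.mem_ker, hβ']
    exact h.deg (i + m) j (by omega) _ (T.costdEval_mem N hf (hsd _ _ hx)) v hv
  · intro f hf
    apply T.costdEval_injective N
    rw [map_zero]
    refine LinearMap.ext fun x => h.inj _ (LinearMap.ext fun v => ?_)
    have := hβ' f (t.toEquiv x) v
    rw [hf, t.toEquiv.symm_apply_apply] at this
    exact this.symm
  · rintro m φ hφ ⟨_, ⟨i, rfl⟩, hφi⟩
    -- To represent φ, the formula is read backwards: the value at x of the sought function is the
    -- vector of N representing v ↦ φ(t(x) ⊗ v).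
    let ξ : A →ₗ[k] V →ₗ[k] k :=
      (T.stdMk V).compr₂ φ ∘ₗ t.toEquiv.toLinearMap
    have hξ : ∀ u v, ξ u v = φ (T.stdMk V (t.toEquiv u) v) := fun _ _ => rfl
    have key : ∀ n, ∀ x ∈ A.deg n, ∃ y ∈ N.deg (n + m), β y = ξ x := fun n x hx =>
      h.surj (n + m) (ξ x) (fun j hj v hv => by
        rw [hξ]
        exact hφ (n + j) (by omega) _ (T.stdMk_mem V (t.map_deg n x hx) hv))
        ⟨p, hp, fun v => by rw [hpV]⟩
    have hr : ∀ x, ξ x ∈ LinearMap.range β := by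
      intro x
      refine alg_induction (p := fun x => ξ x ∈ LinearMap.range β) (by simp)
        (fun x y hx hy => ?_) (fun n x hx => ?_) x
      · rw [map_add]
        exact add_mem hx hy
      · obtain ⟨y, -, hy⟩ := key n x hx
        exact ⟨y, hy⟩
    let ψ : A →ₗ[k] N := (LinearEquiv.ofInjective β h.injective).symm.toLinearMap ∘ₗ
      LinearMap.codRestrict (LinearMap.range β) ξ hr
    have hψ : ∀ x, β (ψ x) = ξ x := fun x =>
      LinearEquiv.ofInjective_symm_apply (f := β) (h := h.injective) ⟨ξ x, hr x⟩
    have hψc : T.IsCostdFun N ψ := by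
      constructor
      · intro a ha
        apply h.inj
        rw [hψ]
        ext v
        rw [hξ, T.stdMk_of_mem_ideal V (T.anti_mem_ideal t ha), LinearMap.zero_apply, map_zero]
        rfl
      · intro u a
        apply h.injective
        ext v
        rw [hψ, h.act, hψ, hξ, hξ, t.map_mul, t.map_mul, T.map_e, ← mul_assoc, stdMk_mul,
          cartanAnti_toCartan]
    have hψd : ∀ n, ∀ x ∈ A.deg n, ψ x ∈ N.deg (n + m) := by
      intro n x hx
      obtain ⟨y, hy, hyx⟩ := key n x hx
      rw [← hψ] at hyx
      rwa [← h.injective hyx]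
    -- Invariance of φ under `1_i` puts ψ into a single summand of the costandardization; this is
    -- why dual pairs only consider such functionals.
    have hψi : ∀ x, ψ (x * (U.one i).val) = ψ x := by
      intro x
      apply h.injective
      rw [hψ, hψ]
      ext v
      rw [hξ, hξ, t.map_mul, t.map_one, ← std_act_mk, hφi]
    obtain ⟨f, hf, -, hfψ⟩ := IsCostdFun.exists_costd T hψc hψd hψi
    refine ⟨f, hf, T.std_ext V fun x v => ?_⟩
    rw [hβ', hfψ, hψ, hξ, hinv]

end TriBasis

end PureBGG

/-! ### Anti-automorphisms acting on irreducible modules, and idempotents of cyclic projectives. -/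

namespace PureBGG

open GMod

namespace GMod

variable {k : Type u} [Field k] {A : GrAlg k}

theorem mem_trivDeg {d : ℤ} (h : d ≠ 0) {x : k} (hx : x ∈ trivDeg k d) : x = 0 := by
  simpa [trivDeg, h] using hx

theorem mem_degHom_trivDeg {V : GMod A} {m : ℤ} {φ : V →ₗ[k] k}
    (hφ : ∀ n, m + n ≠ 0 → ∀ v ∈ V.deg n, φ v = 0) : φ ∈ degHom V.deg (trivDeg k) m := by
  intro n x hx
  by_cases h : m + n = 0
  · rw [add_comm n m, h]
    simp [trivDeg]
  · rw [hφ n h x hx]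
    exact zero_mem _

end GMod

namespace TriBasis

variable {k : Type u} [Field k] {A : GrAlg k} {I : Type*} {U : LocalUnits A I} {W : Type*}
  [PartialOrder W] (T : TriBasis U W) {w : W}

/-- Transports the evaluation pairing between a module and its graded dual along the isomorphism;
afterwards only the pairing is used. -/
theorem isDualPair_of_iso (t : AntiFix U) {N V : GMod (T.cartan w)}
    (h : (T.cartanDual t w V).Iso N) :
    ∃ β, IsDualPair (T.cartanAnti t w).toEquiv {T.toCartan w (T.e w).val} N V β := by
  obtain ⟨θ, hθ⟩ := h
  have hθs := symm_mem_hom hθ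
  have hθs1 : ∀ m, ∀ x ∈ N.deg m, θ.symm x ∈ (T.cartanDual t w V).deg m :=
    fun m x hx => hom_deg_zero hθs hx
  let β : N →ₗ[k] V →ₗ[k] k :=
    (GMod.dualSpace V).subtype ∘ₗ (show N →ₗ[k] GMod.dualSpace V from θ.symm.toLinearMap)
  have hβ : ∀ x, β x = (show GMod.dualSpace V from θ.symm x).1 := fun _ => rfl
  refine ⟨β, fun a x v => ?_, fun m n hmn x hx v hv => ?_, fun x hx => ?_, fun m φ hφ _ => ?_⟩
  · have h1 : θ.symm (N.act a x) = (T.cartanDual t w V).act a (θ.symm x) := hom_smul hθs a x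
    rw [hβ, h1]
    rfl
  · have h1 : (show GMod.dualSpace V from θ.symm x).1 v ∈ trivDeg k (n + m) := hθs1 m x hx n v hv
    exact mem_trivDeg (by omega) h1
  · have h1 : θ.symm x = 0 := Subtype.ext hx
    exact (LinearEquiv.map_eq_zero_iff θ.symm).1 h1
  · have hm := mem_degHom_trivDeg hφ
    let φ' : T.cartanDual t w V := ⟨φ, Submodule.mem_iSup_of_mem m hm⟩
    have hφ' : φ' ∈ (T.cartanDual t w V).deg m := hm
    refine ⟨θ φ', hom_deg_zero hθ hφ', ?_⟩
    rw [hβ, θ.symm_apply_apply]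

variable {T} in
theorem IsTruncation.exists_preimage {M : GMod A} {Z : GMod (T.cartan w)} {r : M →ₗ[k] Z}
    (h : T.IsTruncation w M Z r) {d : ℤ} {y : Z} (hy : y ∈ Z.deg d) : ∃ z ∈ M.deg d, r z = y := by
  obtain ⟨z, rfl⟩ := h.surjective y
  refine ⟨gproj M.internal d z, gproj_mem _ _ _, ?_⟩
  have := gproj_map M.internal Z.internal (f := r) (m := 0)
    (fun n x hx => by rw [add_zero]; exact h.mem n x hx) d z
  rw [add_zero, gproj_of_mem _ hy] at this
  exact this.symm

/-- If the idempotent `ε` acts nontrivially on an irreducible module, then so does its image under an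
anti-automorphism, provided the analogous statement holds for the truncation. -/
theorem exists_anti_act_ne_zero (t : AntiFix U) {M : GMod A} {Z : GMod (T.cartan w)} {r : M →ₗ[k] Z}
    (hr : T.IsTruncation w M Z r) (hM : M.IsSimple) (hZ : ∃ z : Z, z ≠ 0)
    (H : ∀ q m, ∀ c ∈ (T.cartan w).deg q, ∀ z ∈ Z.deg m, Z.act c z ≠ 0 →
      ∃ y ∈ Z.deg (-(q + m)), Z.act ((T.cartanAnti t w).toEquiv c) y ≠ 0)
    {ε : A} (hε : ε ∈ A.deg 0) {s : ℤ} {l : M} (hl : l ∈ M.deg s) (hεl : M.act ε l = l)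
    (h0 : l ≠ 0) : ∃ l' ∈ M.deg (-s), M.act (t.toEquiv ε) l' ≠ 0 := by
  have hcyc := hM.cyc_eq_top hl hεl h0
  obtain ⟨z₀, hz₀⟩ := hZ
  obtain ⟨m, z, hz, hrz⟩ : ∃ m, ∃ z ∈ M.deg m, r z ≠ 0 := by
    obtain ⟨z, rfl⟩ := hr.surjective z₀
    by_contra hc
    push Not at hc
    exact hz₀ (M.homog_induction (p := fun z => r z = 0) (map_zero r)
      (fun x y hx hy => by rw [map_add, hx, hy, add_zero]) hc z)
  obtain ⟨q, b, hb, hrb⟩ : ∃ q, ∃ b ∈ A.deg q, r (M.act b l) ≠ 0 := by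
    obtain ⟨b, hb⟩ : z ∈ M.cyc l := by rw [hcyc]; trivial
    by_contra hc
    push Not at hc
    apply hrz
    rw [← hb]
    exact alg_induction (p := fun b => r (M.act b l) = 0) (by simp)
      (fun x y hx hy => by rw [map_add, LinearMap.add_apply, map_add, hx, hy, add_zero]) hc b
  have hez : M.act (T.e w).val z ≠ 0 := fun h => hrz (by rw [← hr.map_act_e, h, map_zero])
  have hezd := M.act_mem_zero (T.e w).mem hz
  obtain ⟨a, ha, hal⟩ := exists_act_of_cyc_eq_top hezd
    (hM.cyc_eq_top hezd (a := (T.e w).val) (by rw [← M.act_mul, (T.e w).mul_self]) hez) hl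
  -- The element b ε a carries e z to l and then to a vector with nonzero truncation. Its image
  -- under the anti-automorphism is τ(a) τ(ε) τ(b), so a nonzero action of that image forces τ(ε) to
  -- act nontrivially on some τ(b) e z'.
  have hc : Z.act (T.toCartan w (b * ε * a)) (r z) ≠ 0 := by
    rwa [← hr.act, M.act_mul, hal, M.act_mul, hεl]
  obtain ⟨y, hy, hyne⟩ := H _ m _ (T.toCartan_mem w (A.mul_mem (A.mul_mem hb hε) ha)) _
    (hr.mem m z hz) hc
  obtain ⟨z', hz', rfl⟩ := hr.exists_preimage hy
  rw [cartanAnti_toCartan, ← hr.act, t.map_mul, t.map_mul, M.act_mul, M.act_mul] at hyne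
  refine ⟨M.act (t.toEquiv b) (M.act (T.e w).val z'), ?_, fun h => hyne (by rw [h]; simp)⟩
  have := M.act_mem (t.map_deg q b hb) (M.act_mem_zero (T.e w).mem hz')
  rwa [show q + -(q + 0 + (s - m) + m) = -s by ring] at this

/-- Adjointness for a self-pairing: if c z ≠ 0 then some vector pairs nontrivially with c z. Moving
`c` to the other argument gives `t c` or `t' c`, according to the side on which c z stands. -/
theorem exists_act_ne_zero_of_isDualPair {t t' : T.cartan w → T.cartan w}
    (ht : ∀ c, t (t' c) = c) {E : Set (T.cartan w)} {Z : GMod (T.cartan w)} {β : Z →ₗ[k] Z →ₗ[k] k}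
    (h : IsDualPair t E Z Z β) (hE : ∃ p ∈ E, ∀ v, Z.act p v = v) {q m : ℤ} {c : T.cartan w}
    (hc : c ∈ (T.cartan w).deg q) {z : Z} (hz : z ∈ Z.deg m) (h0 : Z.act c z ≠ 0) :
    (∃ y ∈ Z.deg (-(q + m)), Z.act (t c) y ≠ 0) ∧ ∃ y ∈ Z.deg (-(q + m)), Z.act (t' c) y ≠ 0 := by
  obtain ⟨p, hp, hpZ⟩ := hE
  have hcz := Z.act_mem hc hz
  constructor
  · by_contra hne
    push Not at hne
    refine h0 (h.inj _ (IsDualPair.eq_of_homog (m := q + m)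
      (fun n hn v hv => h.deg _ n hn _ hcz v hv) (by simp) fun v hv => ?_))
    rw [h.act, hne v hv, map_zero]
    rfl
  · by_contra hne
    push Not at hne
    refine h0 (h.inj_right hp hpZ _ fun x => ?_)
    refine Z.homog_induction (p := fun x => β x (Z.act c z) = 0) (by simp)
      (fun x y hx hy => by rw [map_add, LinearMap.add_apply, hx, hy, add_zero]) (fun n x hx => ?_) x
    by_cases hn : n + (q + m) = 0
    · have h1 := h.act (t' c) x z
      rw [ht, hne x (by rwa [show -(q + m) = n by omega])] at h1
      rw [← h1, map_zero]
      rfl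
    · exact h.deg _ _ hn x hx _ hcz

end TriBasis

namespace GMod

variable {k : Type u} [Field k] {A : GrAlg k}

/-- A cyclic projective module is isomorphic to a direct summand of the regular module: it is
generated by an element `p` whose image in `A` is a homogeneous idempotent. -/
theorem Projective.exists_idempotent {I : Type*} {U : LocalUnits A I} {P : GMod A}
    (hP : P.Projective) {i : I} {s : ℤ} {p : P} (hp : p ∈ P.deg s)
    (hip : P.act (U.one i).val p = p) (hc : P.cyc p = ⊤) :
    ∃ σ : P →ₗ[k] A, (∀ a v, σ (P.act a v) = a * σ v) ∧ (∀ n, ∀ v ∈ P.deg n, σ v ∈ A.deg (n - s)) ∧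
      (∀ v, P.act (σ v) p = v) ∧ ∀ v, σ v * (U.one i).val = σ v := by
  obtain ⟨c, h1, h2, h3⟩ := hP.exists_coord U
  -- Each free generator is written as a multiple of p. Combined with the coordinates, this gives a
  -- section σ of a ↦ a p, whose value at p is the idempotent.
  choose b hb hbp using fun j : P.Homog => exists_act_of_cyc_eq_top hp hc j.2.2
  let ρ : P.Homog → A →ₗ[k] A := fun j => LinearMap.mulRight k (b j * (U.one i).val)
  let σ : P →ₗ[k] A := Finsupp.lsum k ρ ∘ₗ c
  have hσ : ∀ v, σ v = (c v).sum fun j a => a * (b j * (U.one i).val) := fun v => by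
    change Finsupp.lsum k ρ (c v) = _
    rw [Finsupp.lsum_apply]
    rfl
  refine ⟨σ, fun a v => ?_, fun n v hv => ?_, fun v => ?_, fun v => ?_⟩
  · have h4 : c (P.act a v) = Finsupp.mapRange (LinearMap.mulLeft k a) (map_zero _) (c v) := by
      ext j
      rw [h1]; rfl
    rw [hσ, hσ, h4, Finsupp.sum_mapRange_index (by simp), Finsupp.mul_sum]
    exact Finset.sum_congr rfl fun j _ => mul_assoc _ _ _
  · rw [hσ]
    refine Submodule.sum_mem _ fun j _ => ?_
    have := A.mul_mem (h2 n v hv j) (A.mul_mem (hb j) (U.one i).mem)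
    rwa [show n - j.1 + (j.1 - s + 0) = n - s by ring] at this
  · conv_rhs => rw [← h3 v]
    rw [hσ, Finsupp.sum, Finsupp.sum, map_sum, LinearMap.sum_apply]
    refine Finset.sum_congr rfl fun j _ => ?_
    rw [P.act_mul, P.act_mul, hip, hbp]
  · rw [hσ, Finsupp.sum_mul]
    refine Finset.sum_congr rfl fun j _ => ?_
    dsimp only
    rw [mul_assoc, mul_assoc, (U.one i).mul_self]

/-- The space of homomorphisms out of `A ε` is the truncation by `ε`. -/
theorem le_finrank_hom {P V : GMod A} {s : ℤ} {p : P} {σ : P →ₗ[k] A}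
    (h1 : ∀ a v, σ (P.act a v) = a * σ v) (h2 : ∀ n, ∀ v ∈ P.deg n, σ v ∈ A.deg (n - s))
    (h3 : V.act (σ p) ∘ₗ V.act (σ p) = V.act (σ p)) (d : ℤ) [FiniteDimensional k (hom P V d)] :
    Module.finrank k ↥(LinearMap.range (V.act (σ p)) ⊓ V.deg (s + d)) ≤
      Module.finrank k (hom P V d) := by
  let X : Submodule k V := LinearMap.range (V.act (σ p)) ⊓ V.deg (s + d)
  let ev : hom P V d →ₗ[k] V := (LinearMap.applyₗ (R := k) p : (P →ₗ[k] V) →ₗ[k] V) ∘ₗ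
    (hom P V d).subtype
  have hle : X ≤ LinearMap.range ev := by
    rintro _ ⟨⟨u, rfl⟩, hv⟩
    rw [SetLike.mem_coe] at hv
    -- The homomorphism sending p to a given vector of ε V.
    refine ⟨⟨V.act.flip (V.act (σ p) u) ∘ₗ σ, fun n x hx => ?_, fun a x => ?_⟩, ?_⟩
    · have := V.act_mem (h2 n x hx) hv
      rwa [show n - s + (s + d) = n + d by ring] at this
    · change V.act (σ (P.act a x)) _ = V.act a (V.act (σ x) _)
      rw [h1, V.act_mul]
    · change V.act (σ p) (V.act (σ p) u) = V.act (σ p) u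
      exact LinearMap.congr_fun h3 u
  exact (Submodule.finrank_mono hle).trans (LinearMap.finrank_range_le ev)

end GMod

end PureBGG

/-! ### Comparison of homomorphisms from P(b) into standardizations and costandardizations. -/

namespace PureBGG

open GMod

namespace Refinement

variable {k : Type u} [Field k] {A : GrAlg k} {I : Type*} {U : LocalUnits A I} {W : Type*}
  [PartialOrder W] {T : TriBasis U W} {B : W → Type*} [∀ w, PartialOrder (B w)]
  (R : Refinement T B)

/-- Homomorphisms from a projective cover to modules induced from modules in duality. -/
theorem finrank_hom_std {b : Σ w, B w} {P : GMod A} (hP : P.IsProjectiveCover (R.irr b))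
    (t : AntiFix U)
    (hirr : (T.cartanDual t b.1 ((R.basis b.1).irr b.2)).Iso ((R.basis b.1).irr b.2)) {w : W}
    {E : Set (T.cartan w)} {N V : GMod (T.cartan w)} {β : N →ₗ[k] V →ₗ[k] k}
    (hβ : IsDualPair (T.cartanAnti t.symm w).toEquiv E N V β) (hE : ∃ p ∈ E, ∀ v, V.act p v = v)
    (hfin : ∀ i n, FiniteDimensional k
      ↥(LinearMap.range ((T.costd w N).act (U.one i).val) ⊓ (T.costd w N).deg n)) (d : ℤ) :
    FiniteDimensional k (hom P (T.std w V) (-d)) ∧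
      Module.finrank k (hom P (T.std w V) (-d)) = Module.finrank k (hom P (T.costd w N) d) := by
  obtain ⟨hproj, f, hf, hs, hsf⟩ := hP
  have hL := R.isSimple_irr b
  obtain ⟨r, hr⟩ := R.exists_isTruncation_irr b
  obtain ⟨i, s, l, hl, hil, hl0⟩ := (R.irr b).exists_unit_homog_ne_zero U hL.1
  obtain ⟨p, hp, hip, hpl, hcyc⟩ :=
    GMod.exists_generator hL hf hs hsf (U.one i).mem (U.one i).mul_self hl hil hl0
  obtain ⟨σ, hσ1, hσ2, hσ3, hσ4⟩ := hproj.exists_idempotent hp hip hcyc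
  let ε : A := σ p
  have hε : ε ∈ A.deg 0 := by
    have := hσ2 s p hp
    rwa [sub_self] at this
  have hεp : P.act ε p = p := hσ3 p
  have hεε : ε * ε = ε := by
    change ε * σ p = ε
    rw [← hσ1, hεp]
  have hεi : ε * (U.one i).val = ε := hσ4 p
  have hiε : (U.one i).val * ε = ε := by
    change (U.one i).val * σ p = ε
    rw [← hσ1, hip]
  have hεl : (R.irr b).act ε l = l := by rw [← hpl, ← hom_smul hf, hεp]
  have hst : ∀ a, t.symm.toEquiv (t.toEquiv a) = a := t.toEquiv.symm_apply_apply
  -- Self-duality of L_λ(b) is used only here: it makes the images of ε under `t` and under its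
  -- inverse act nontrivially on L(b), in degree -s.
  obtain ⟨γ, hγ⟩ := T.isDualPair_of_iso t hirr
  have hH := fun q m c hc z hz h0 => T.exists_act_ne_zero_of_isDualPair (q := q) (m := m)
    (T.cartanAnti_symm t) hγ ⟨_, rfl, T.act_toCartan_e _⟩ (c := c) hc (z := z) hz h0
  have hZ := ((R.based b.1).irr b.2).1.1
  obtain ⟨l₁, hl₁, hne₁⟩ := T.exists_anti_act_ne_zero t hr hL hZ
    (fun q m c hc z hz h0 => (hH q m c hc z hz h0).1) hε hl hεl hl0
  obtain ⟨l₂, hl₂, hne₂⟩ := T.exists_anti_act_ne_zero t.symm hr hL hZ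
    (fun q m c hc z hz h0 => (hH q m c hc z hz h0).2) hε hl hεl hl0
  let ε₁ : A := t.toEquiv ε
  let ε₂ : A := t.symm.toEquiv ε
  have hε₁ : ε₁ ∈ A.deg 0 := t.map_deg 0 ε hε
  have hε₂ : ε₂ ∈ A.deg 0 := t.symm.map_deg 0 ε hε
  have hεε₁ : ε₁ * ε₁ = ε₁ := by rw [← t.map_mul, hεε]
  have hεε₂ : ε₂ * ε₂ = ε₂ := by rw [← t.symm.map_mul, hεε]
  have hiε₁ : (U.one i).val * ε₁ = ε₁ := by
    conv_lhs => rw [← t.map_one i]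
    rw [← t.map_mul, hεi]
  have hε₂i : ε₂ * (U.one i).val = ε₂ := by
    conv_lhs => rw [← t.symm.map_one i]
    rw [← t.symm.map_mul, hiε]
  -- P gains new generators of degree -s, fixed by `t(ε)` and by its counterpart for the inverse.
  -- They bound homomorphisms out of P from above, with no need to identify A t(ε) with a shift of
  -- P.
  obtain ⟨p₁, hp₁, hεp₁, -, hcyc₁⟩ := GMod.exists_generator hL hf hs hsf hε₁ hεε₁
    ((R.irr b).act_mem_zero hε₁ hl₁) (by rw [← (R.irr b).act_mul, hεε₁]) hne₁
  obtain ⟨p₂, hp₂, hεp₂, -, hcyc₂⟩ := GMod.exists_generator hL hf hs hsf hε₂ hεε₂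
    ((R.irr b).act_mem_zero hε₂ hl₂) (by rw [← (R.irr b).act_mul, hεε₂]) hne₂
  have hfd : ∀ η, (U.one i).val * η = η → ∀ n, FiniteDimensional k
      ↥(LinearMap.range ((T.costd w N).act η) ⊓ (T.costd w N).deg n) := by
    intro η hη n
    have := hfin i n
    refine Submodule.finiteDimensional_of_le (inf_le_inf_right _ ?_ :
      _ ≤ LinearMap.range ((T.costd w N).act (U.one i).val) ⊓ (T.costd w N).deg n)
    rintro _ ⟨v, rfl⟩
    exact ⟨(T.costd w N).act η v, by rw [← (T.costd w N).act_mul, hη]⟩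
  obtain ⟨β', hβ'⟩ := T.exists_isDualPair_costd_std t.symm hβ hE
  have hσε : ∀ X : GMod A, X.act (σ p) ∘ₗ X.act (σ p) = X.act (σ p) := fun X =>
    LinearMap.ext fun v => by
      rw [LinearMap.comp_apply, ← X.act_mul]
      exact congrArg (fun a => X.act a v) hεε
  have hd₁ := hfd ε₁ hiε₁ (-s + d)
  have hd₂ := hfd ε hiε (s + d)
  -- The pairing is contravariant for the inverse of `t`, so ε on the standard side matches `t(ε)`
  -- on the costandard side, and the image of ε under the inverse matches ε.
  have h₁ := hβ'.finrank_eq (η := ε) (η' := ε₁) (p := (U.one i).val) hε hεε (hst ε) ⟨i, rfl⟩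
    (U.one i).mem hεi hεε₁ (-s + d)
  have h₂ := hβ'.finrank_eq (η := ε₂) (η' := ε) (p := (U.one i).val) hε₂ hεε₂ rfl ⟨i, rfl⟩
    (U.one i).mem hε₂i hεε (s + d)
  rw [show -(-s + d) = s + -d by ring] at h₁
  rw [show -(s + d) = -s + -d by ring] at h₂
  have hf₁ := h₁.1
  have hf₂ := h₂.1
  have hc₁ := hom_finite_of_cyc hp₁ hεp₁ hcyc₁ d (V := T.costd w N)
  have hc₂ := hom_finite_of_cyc hp₂ hεp₂ hcyc₂ (-d) (V := T.std w V)
  have hg₁ := hc₁.1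
  have hg₂ := hc₂.1
  have hk₁ := le_finrank_hom hσ1 hσ2 (hσε (T.std w V)) (-d)
  have hk₂ := le_finrank_hom hσ1 hσ2 (hσε (T.costd w N)) d
  -- Each inequality runs: homomorphisms out of P are at most a truncation by an image of ε, which
  -- is dual to a truncation by ε of the other module, which is at most the homomorphisms into that
  -- module.
  refine ⟨hg₂, le_antisymm ?_ ?_⟩
  · exact hc₂.2.trans (h₂.2.le.trans hk₂)
  · exact hc₁.2.trans (h₁.2.symm.le.trans hk₁)

end Refinement

end PureBGG

/-! ### Maps of costandardizations, the generator of Δ(w), and the radical of A_w. -/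

namespace PureBGG

open GMod

namespace TriBasis

variable {k : Type u} [Field k] {A : GrAlg k} {I : Type*} {U : LocalUnits A I} {W : Type*}
  [PartialOrder W] (T : TriBasis U W) {w : W}

/-- Functoriality of costandardization with respect to homomorphisms of arbitrary degree. -/
theorem exists_costdMap {V V' : GMod (T.cartan w)} {g : V →ₗ[k] V'} {d : ℤ} (hg : g ∈ hom V V' d) :
    ∃ G ∈ hom (T.costd w V) (T.costd w V') d,
      ∀ f x, T.costdEval V' (G f) x = g (T.costdEval V f x) := by
  let X := GMod.starSpace (T.eBar w) (U.quot (T.below w)) V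
  let X' := GMod.starSpace (T.eBar w) (U.quot (T.below w)) V'
  let F : (GMod.rightIdeal (T.eBar w) →ₗ[k] V) →ₗ[k] (GMod.rightIdeal (T.eBar w) →ₗ[k] V') :=
    LinearMap.compRight k g
  have hF : ∀ f, F f = g ∘ₗ f := fun _ => rfl
  have hle : X ≤ X'.comap F := by
    refine iSup_le fun i => iSup_le fun n => ?_
    intro f hf
    refine Submodule.mem_iSup_of_mem i (Submodule.mem_iSup_of_mem (n + d) ?_)
    refine ⟨fun m x hx => ?_, fun a x => ?_, fun x => ?_⟩
    · rw [← add_assoc]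
      exact hom_deg hg (hf.1 m x hx)
    · exact (congrArg g (hf.2.1 a x)).trans (hom_smul hg a _)
    · exact congrArg g (hf.2.2 x)
  let G : T.costd w V →ₗ[k] T.costd w V' :=
    (show X →ₗ[k] X' from (F ∘ₗ X.subtype).codRestrict X' fun f => hle f.2)
  have hG : ∀ f x, T.costdEval V' (G f) x = g (T.costdEval V f x) := fun _ _ => rfl
  refine ⟨G, ⟨fun n f hf => ?_, fun a f => ?_⟩, hG⟩
  · refine T.mem_costd_deg V' fun m x hx => ?_
    rw [hG, ← add_assoc]
    exact hom_deg hg (T.costdEval_mem V hf hx)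
  · apply T.costdEval_injective V'
    ext x
    rw [hG, costdEval_act, costdEval_act, hG]

section DeltaGen

variable (w)

/-- The projection from `A` onto the regular module. -/
noncomputable def toReg : A →ₗ[k] T.regular w := T.toCartan w

/-- The generator `1` of the regular module. -/
noncomputable def regOne : T.regular w := ((T.ge w).cornerOne (T.eBar w) : T.cartan w)

/-- The preimage of the radical of the regular module. -/
noncomputable def radLift : Submodule k A := (T.regular w).rad.comap (T.toReg w)

/-- The generator `e ⊗ 1` of `Δ(w)`. -/
noncomputable def deltaGen : T.delta w := T.stdMk (T.regular w) (T.e w).val (T.regOne w)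

theorem act_regOne (u : A) : (T.regular w).act (T.toCartan w u) (T.regOne w) = T.toReg w u :=
  (T.ge w).mul_cornerOne _ _

theorem act_toReg (u v : A) : (T.regular w).act (T.toCartan w u) (T.toReg w v) =
    T.toReg w (u * (T.e w).val * v) := T.toCartan_mul w u v

theorem act_deltaGen (x : A) : (T.delta w).act x (T.deltaGen w) =
    T.stdMk (T.regular w) x (T.regOne w) :=
  (T.std_act_mk (T.regular w) _ _ _).trans (T.stdMk_mul_e (T.regular w) _ _)

theorem stdMk_toReg (x u : A) : T.stdMk (T.regular w) x (T.toReg w u) =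
    (T.delta w).act (x * (T.e w).val * u) (T.deltaGen w) :=
  (congrArg (T.stdMk (T.regular w) x) (T.act_regOne w u).symm).trans
    ((T.stdMk_mul (T.regular w) x u _).symm.trans (T.act_deltaGen w _).symm)

theorem act_mul_e_deltaGen (x : A) : (T.delta w).act (x * (T.e w).val) (T.deltaGen w) =
    (T.delta w).act x (T.deltaGen w) := by
  rw [act_deltaGen, act_deltaGen]
  exact T.stdMk_mul_e (T.regular w) _ _

theorem act_e_deltaGen : (T.delta w).act (T.e w).val (T.deltaGen w) = T.deltaGen w :=
  T.act_deltaGen w _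

theorem act_deltaGen_of_mem_ideal {x : A} (hx : x ∈ A.ideal (T.below w)) :
    (T.delta w).act x (T.deltaGen w) = 0 := by
  rw [act_deltaGen]
  exact LinearMap.congr_fun (T.stdMk_of_mem_ideal (T.regular w) hx) _

theorem deltaGen_mem : T.deltaGen w ∈ (T.delta w).deg 0 := by
  have := T.stdMk_mem (T.regular w) (T.e w).mem ((T.ge w).cornerOne_mem (T.eBar w))
  rwa [add_zero] at this

theorem cyc_deltaGen : (T.delta w).cyc (T.deltaGen w) = ⊤ := by
  rw [eq_top_iff]
  intro z _
  refine T.std_induction (T.regular w) (p := fun z => z ∈ (T.delta w).cyc (T.deltaGen w))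
    (fun x y hx hy => add_mem hx hy) (fun x v => ?_) z
  obtain ⟨u, rfl⟩ := T.toCartan_surjective w v
  exact ⟨x * (T.e w).val * u, (T.stdMk_toReg w x u).symm⟩

theorem deltaGen_induction {p : T.delta w → Prop}
    (h : ∀ x, p ((T.delta w).act x (T.deltaGen w))) (z : T.delta w) : p z := by
  obtain ⟨x, rfl⟩ : z ∈ (T.delta w).cyc (T.deltaGen w) := by rw [cyc_deltaGen]; trivial
  exact h x

variable {w}

theorem mem_hom_std {V : GMod (T.cartan w)} {N : GMod A} {f : T.std w V →ₗ[k] N} {g : ℤ}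
    (h1 : ∀ i j, ∀ x ∈ A.deg i, ∀ v ∈ V.deg j, f (T.stdMk V x v) ∈ N.deg (i + j + g))
    (h2 : ∀ a x v, f (T.stdMk V (a * x) v) = N.act a (f (T.stdMk V x v))) :
    f ∈ hom (T.std w V) N g := by
  refine ⟨fun n z hz => ?_, fun a z => ?_⟩
  · rw [std_deg_eq] at hz
    refine (Submodule.span_le.2 ?_ : _ ≤ (N.deg (n + g)).comap f) hz
    rintro _ ⟨i, j, rfl, x, hx, v, hv, rfl⟩
    exact h1 i j x hx v hv
  · refine T.std_induction V (p := fun z => f ((T.std w V).act a z) = N.act a (f z))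
      (fun x y hx hy => by simp only [map_add, hx, hy]) (fun x v => ?_) z
    rw [std_act_mk, h2]

/-- The morphism from `Δ(w)` induced by an element of an `A_w`-module. -/
theorem exists_hom_delta_std {V : GMod (T.cartan w)} {g : ℤ} {s : V} (hs : s ∈ V.deg g) :
    ∃ f ∈ hom (T.delta w) (T.std w V) g, f (T.deltaGen w) = T.stdMk V (T.e w).val s := by
  let Φ : A →ₗ[k] T.regular w →ₗ[k] T.std w V :=
    (T.stdMk V).compl₂ (show T.regular w →ₗ[k] V from V.act.flip s)
  have hΦ : ∀ x c, Φ x c = T.stdMk V x (V.act c s) := fun _ _ => rfl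
  obtain ⟨f, hf⟩ := T.exists_std_lift (T.regular w) Φ
    (fun a ha => LinearMap.ext fun c => by
      rw [hΦ, T.stdMk_of_mem_ideal V ha]; rfl)
    (fun x u c => by
      rw [hΦ, hΦ, stdMk_mul]
      exact congrArg _ (V.act_mul _ _ _).symm)
  refine ⟨f, T.mem_hom_std (fun i j x hx c hc => ?_) (fun a x c => ?_), ?_⟩
  · rw [hf, hΦ, add_assoc]
    exact T.stdMk_mem V hx (V.act_mem hc hs)
  · rw [hf, hf, hΦ, hΦ, std_act_mk]
  · refine (hf _ _).trans (congrArg (T.stdMk V (T.e w).val) ?_)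
    exact GMod.act_cornerOne _ V s

/-- The truncation of Δ(w) is the regular module. Hence an endomorphism of Δ(w) is right
multiplication by an element of A_w. -/
theorem exists_act_e_delta {n : ℤ} {y : T.delta w} (hy : y ∈ (T.delta w).deg n) :
    ∃ m ∈ A.deg n, (T.delta w).act (T.e w).val y =
      (T.delta w).act ((T.e w).val * m) (T.deltaGen w) := by
  obtain ⟨m, hm, hm'⟩ := T.exists_toCartan_of_mem w (T.retract_mem (T.regular w) hy)
  refine ⟨m, hm, (T.act_e_eq_mk (T.regular w) y).trans
    ((congrArg (T.stdMk (T.regular w) (T.e w).val) hm'.symm).trans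
      ((T.stdMk_toReg w _ m).trans ?_))⟩
  rw [(T.e w).mul_self]

theorem gproj_mem_radLift {m : A} (hm : m ∈ T.radLift w) (n : ℤ) :
    gproj A.internal n m ∈ T.radLift w := by
  have h1 := gproj_map A.internal (T.regular w).internal (f := T.toReg w) (m := 0)
    (fun n x hx => by rw [add_zero]; exact T.toCartan_mem w hx) n m
  rw [add_zero] at h1
  change T.toReg w _ ∈ (T.regular w).rad
  rw [← h1]
  exact gproj_mem_of_homog _ (T.regular w).rad_isGSub.2 n hm

variable {T}

/-- In a graded local algebra a homogeneous element outside the radical generates the whole regular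
module, so it is left invertible. -/
theorem exists_act_eq_deltaGen (h : T.IsBasedAffineQuasiHereditary) {n : ℤ} {m : A}
    (hm : m ∈ A.deg n) (hr : m ∉ T.radLift w) :
    ∃ c, (T.delta w).act (c * ((T.e w).val * m)) (T.deltaGen w) = T.deltaGen w := by
  have h1 : (T.regular w).cyc (T.toReg w m) = ⊤ := by
    by_contra h0
    refine hr ((h.isGreatestProper w).2.2 _
      ((T.regular w).isGSub_cyc (T.toCartan_mem w hm)) h0 ⟨T.toCartan w (T.e w).val, ?_⟩)
    exact T.act_toCartan_e (T.regular w) _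
  have h2 : T.regOne w ∈ (T.regular w).cyc (T.toReg w m) := by rw [h1]; trivial
  obtain ⟨c, hc⟩ := h2
  obtain ⟨c, rfl⟩ := T.toCartan_surjective w c
  refine ⟨(T.e w).val * (T.e w).val * c, ?_⟩
  have h3 := T.stdMk_toReg w (T.e w).val (c * (T.e w).val * m)
  rw [← act_toReg] at h3
  refine Eq.trans ?_ (h3.symm.trans (congrArg (T.stdMk (T.regular w) (T.e w).val) hc))
  simp only [mul_assoc]

end DeltaGen

section Simple

open IsBasedAffineQuasiHereditary

/-- The coordinate identifying the one-dimensional irreducible module with the field. -/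
theorem exists_coord_simple (h : T.IsBasedAffineQuasiHereditary) (w : W) :
    ∃ κ : T.simple w →ₗ[k] k, ∀ s, κ s • simpleOne T w = s := by
  let F := LinearMap.toSpanSingleton k (T.simple w) (simpleOne T w)
  have hF : Function.Bijective F := by
    constructor
    · rw [← LinearMap.ker_eq_bot]
      exact LinearMap.ker_toSpanSingleton k (simpleOne_ne_zero w h)
    · intro s
      obtain ⟨c, rfl⟩ := exists_smul_simpleOne w h s
      exact ⟨c, rfl⟩
  exact ⟨(LinearEquiv.ofBijective F hF).symm.toLinearMap, fun s =>
    (LinearEquiv.ofBijective F hF).apply_symm_apply s⟩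

variable {T}

theorem act_simpleOne (u : A) : (T.simple w).act (T.toCartan w u) (simpleOne T w) =
    (T.regular w).qmap _ (T.regular w).rad_isGSub (T.toReg w u) :=
  congrArg ((T.regular w).qmap _ (T.regular w).rad_isGSub) (T.act_regOne w u)

theorem act_simpleOne_eq_zero {u : A} : (T.simple w).act (T.toCartan w u) (simpleOne T w) = 0 ↔
    u ∈ T.radLift w := by
  rw [act_simpleOne]
  exact qmap_eq_zero _

/-- Modulo the radical every element is a scalar. -/
theorem sub_smul_e_mem_radLift {κ : T.simple w →ₗ[k] k} (hκ : ∀ s, κ s • simpleOne T w = s)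
    (u : A) : u - κ ((T.simple w).act (T.toCartan w u) (simpleOne T w)) • (T.e w).val ∈
      T.radLift w := by
  rw [← act_simpleOne_eq_zero, map_sub, map_smul, map_sub, map_smul, LinearMap.sub_apply,
    LinearMap.smul_apply, act_toCartan_e, hκ, sub_self]

end Simple

end TriBasis

end PureBGG

/-! ### Proper costandard modules as annihilators of the radical part of Δ(w). -/

namespace PureBGG

namespace GMod

variable {k : Type u} [Field k] {A : GrAlg k}

/-- Injectivity is stated for degree-preserving embeddings; the general case follows by dividing by
the kernel and shifting source and target. -/
theorem Injective.exists_extend {Q : GMod A} (hQ : Q.Injective) {X Y : GMod A} {g g' : ℤ}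
    {f : X →ₗ[k] Y} (hf : f ∈ hom X Y g) {f' : X →ₗ[k] Q} (hf' : f' ∈ hom X Q g')
    (hle : LinearMap.ker f ≤ LinearMap.ker f') :
    ∃ ψ ∈ hom Y Q (g' - g), ∀ x, ψ (f x) = f' x := by
  have hK := isGSub_ker hf
  let K := LinearMap.ker f
  let Z : GMod A := (X.quot K hK).shift (-g')
  let i : Z →ₗ[k] Y.shift (-(g' - g)) := K.liftQ f le_rfl
  let φ : Z →ₗ[k] Q := K.liftQ f' hle
  have hi : i ∈ hom Z (Y.shift (-(g' - g))) 0 := by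
    refine ⟨?_, ?_⟩
    · rintro n _ ⟨x, hx, rfl⟩
      have : f x ∈ Y.deg (n + 0 + -(g' - g)) := by
        have := hom_deg hf hx
        rwa [show n + -g' + g = n + 0 + -(g' - g) by ring] at this
      exact this
    · rintro a ⟨x⟩
      exact hom_smul hf a x
  have hφ : φ ∈ hom Z Q 0 := by
    refine ⟨?_, ?_⟩
    · rintro n _ ⟨x, hx, rfl⟩
      have : f' x ∈ Q.deg (n + 0) := by
        have := hom_deg hf' hx
        rwa [show n + -g' + g' = n + 0 by ring] at this
      exact this
    · rintro a ⟨x⟩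
      exact hom_smul hf' a x
  have hinj : Function.Injective i := by
    rw [← LinearMap.ker_eq_bot]
    exact Submodule.ker_liftQ_eq_bot _ _ _ le_rfl
  obtain ⟨ψ, hψ, hψφ⟩ := hQ _ _ i φ hi hφ hinj
  exact ⟨ψ, hom_shift.1 hψ, fun x => LinearMap.congr_fun hψφ (K.mkQ x)⟩

end GMod

namespace TriBasis

open GMod IsBasedAffineQuasiHereditary

variable {k : Type u} [Field k] {A : GrAlg k} {I : Type*} {U : LocalUnits A I} {W : Type*}
  [PartialOrder W] (T : TriBasis U W) {w : W}

theorem costdEval_mul (V : GMod (T.cartan w)) (f : T.costd w V) (u a : A) :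
    T.costdEval V f (u * (T.e w).val * a) = V.act (T.toCartan w u) (T.costdEval V f a) :=
  (T.isCostdFun_costdEval V f).mul u a

theorem costdEval_e_mul (V : GMod (T.cartan w)) (f : T.costd w V) (a : A) :
    T.costdEval V f ((T.e w).val * a) = T.costdEval V f a :=
  (T.isCostdFun_costdEval V f).e_mul a

theorem costd_ext {V : GMod (T.cartan w)} {f f' : T.costd w V}
    (h : ∀ x, T.costdEval V f x = T.costdEval V f' x) : f = f' :=
  T.costdEval_injective V (LinearMap.ext h)

/-- Evaluation at `e` of graded submodules. -/
theorem isGSub_eval {V : GMod (T.cartan w)} {K : Submodule k (T.costd w V)}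
    (hK : (T.costd w V).IsGSub K) :
    V.IsGSub (K.map ((T.costdEval V).flip (T.e w).val)) := by
  refine ⟨?_, homog_of_gproj V.internal ?_⟩
  · rintro c _ ⟨f, hf, rfl⟩
    obtain ⟨a, rfl⟩ := T.toCartan_surjective w c
    refine ⟨_, hK.1 (a * (T.e w).val) _ hf, ?_⟩
    rw [LinearMap.flip_apply, LinearMap.flip_apply, costdEval_act, costdEval_e_mul,
      ← costdEval_mul, mul_assoc, (T.e w).mul_self]
  · rintro d _ ⟨f, hf, rfl⟩
    refine ⟨_, gproj_mem_of_homog (T.costd w V).internal hK.2 d hf, ?_⟩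
    have := gproj_map (T.costd w V).internal V.internal
      (f := (T.costdEval V).flip (T.e w).val) (m := 0) (fun n f hf => by
        have := T.costdEval_mem V hf (T.e w).mem
        rwa [zero_add, ← add_zero n] at this) d f
    rw [add_zero] at this
    exact this.symm

theorem exists_hom_regular {V : GMod (T.cartan w)} {d : ℤ} {v : V} (hv : v ∈ V.deg d) :
    ∃ f ∈ hom (T.regular w) V d, (∀ u, f (T.toReg w u) = V.act (T.toCartan w u) v) ∧
      f (T.regOne w) = v :=
  ⟨V.act.flip v, ⟨fun _ _ hc => V.act_mem hc hv, fun a c => V.act_mul a c v⟩, fun _ => rfl,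
    GMod.act_cornerOne _ V v⟩

variable {T}

section Perp

variable {Q : GMod (T.cartan w)} {t t' : A → A} {E : Set A} {p : A}
  {γ : T.delta w →ₗ[k] T.costd w Q →ₗ[k] k}

/-- A functional on `Δ(w)` vanishing on the images of all endomorphisms given by the radical. -/
theorem exists_socle_generator (h : T.IsBasedAffineQuasiHereditary) (hp : p ∈ E)
    (hpV : ∀ (V : GMod A) (v : V), V.act p v = v)
    (hflip : IsDualPair t' E (T.costd w Q) (T.delta w) γ.flip) :
    ∃ v, v ≠ 0 ∧ ∀ x, ∀ m ∈ T.radLift w,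
      γ ((T.delta w).act (x * (T.e w).val * m) (T.deltaGen w)) v = 0 := by
  obtain ⟨κ, hκ⟩ := exists_coord_simple T h w
  obtain ⟨f, hf, hfδ⟩ := T.exists_hom_delta_std (simpleOne_mem (T := T) w)
  have hact : ∀ x, T.retract (T.simple w) (f ((T.delta w).act x (T.deltaGen w))) =
      (T.simple w).act (T.toCartan w x) (simpleOne T w) := fun x => by
    rw [hom_smul hf, hfδ, std_act_mk, stdMk_mul_e, retract_mk]
  -- The functional Δ(w) → proper standard module → irreducible A_w-module ≅ k. It is nonzero on the
  -- generator and vanishes on everything produced by the radical.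
  let φ : T.delta w →ₗ[k] k := κ ∘ₗ T.retract (T.simple w) ∘ₗ f
  have hφ : ∀ z, φ z = κ (T.retract (T.simple w) (f z)) := fun _ => rfl
  have hdeg : ∀ n, 0 + n ≠ 0 → ∀ z ∈ (T.delta w).deg n, φ z = 0 := by
    intro n hn z hz
    have h1 := T.retract_mem (T.simple w) (hom_deg_zero hf hz)
    rw [simple_deg w h n (by omega), Submodule.mem_bot] at h1
    rw [hφ, h1, map_zero]
  obtain ⟨v, -, hv⟩ := hflip.surj 0 φ hdeg ⟨p, hp, fun z => by rw [hpV]⟩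
  have hv' : ∀ z, γ z v = φ z := fun z => LinearMap.congr_fun hv z
  refine ⟨v, fun h0 => ?_, fun x m hm => ?_⟩
  · have h1 := hv' (T.deltaGen w)
    have h2 := hact (T.e w).val
    rw [act_e_deltaGen, act_toCartan_e] at h2
    rw [h0, map_zero, hφ, h2] at h1
    have h3 := hκ (simpleOne T w)
    rw [← h1, zero_smul] at h3
    exact simpleOne_ne_zero w h h3.symm
  · rw [hv', hφ, hact, act_toCartan_mul, act_simpleOne_eq_zero.2 hm, map_zero, map_zero]

variable {ι : T.simple w →ₗ[k] Q}

/-- Right multiplication by a homogeneous radical element m is an endomorphism θ of Δ(w), and the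
claim is that its adjoint θ' on costd Q kills every function with values in the socle of Q. θ' kills
one nonzero vector, so its kernel yields a nonzero graded submodule of Q. That submodule contains
the socle by essentiality, which is enough to determine θ' on such functions. -/
theorem pairing_eq_zero_of_mem_range (h : T.IsBasedAffineQuasiHereditary)
    (hιe : ∀ K, Q.IsGSub K → K ⊓ LinearMap.range ι = ⊥ → K = ⊥) (hp : p ∈ E)
    (hpV : ∀ (V : GMod A) (v : V), V.act p v = v)
    (hγ : IsDualPair t E (T.delta w) (T.costd w Q) γ)
    (hflip : IsDualPair t' E (T.costd w Q) (T.delta w) γ.flip)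
    {v : T.costd w Q} (hv : ∀ x, T.costdEval Q v x ∈ LinearMap.range ι) (x : A) {m : A}
    (hm : m ∈ T.radLift w) :
    γ ((T.delta w).act (x * (T.e w).val * m) (T.deltaGen w)) v = 0 := by
  obtain ⟨κ, hκ⟩ := exists_coord_simple T h w
  let F : A →ₗ[k] k := (γ.flip v) ∘ₗ ((T.delta w).act.flip (T.deltaGen w)) ∘ₗ
    (LinearMap.mulLeft k (x * (T.e w).val))
  suffices hF : T.radLift w ≤ LinearMap.ker F from hF hm
  refine (homog_of_gproj A.internal fun d y hy => T.gproj_mem_radLift hy d).trans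
    (iSup_le fun g => ?_)
  rintro m ⟨hm, hmg⟩
  change γ ((T.delta w).act (x * (T.e w).val * m) (T.deltaGen w)) v = 0
  obtain ⟨θ, hθ, hθδ⟩ := T.exists_hom_delta_std (V := T.regular w) (T.toCartan_mem w hmg)
  have hθδ' : ∀ x, θ ((T.delta w).act x (T.deltaGen w)) =
      (T.delta w).act (x * (T.e w).val * m) (T.deltaGen w) := fun x => by
    refine (hom_smul hθ x _).trans ((congrArg _ (hθδ.trans (T.stdMk_toReg w _ m))).trans ?_)
    refine ((T.delta w).act_mul _ _ _).symm.trans ?_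
    rw [(T.e w).mul_self, mul_assoc]
  obtain ⟨θ', hθ', hadj⟩ := hflip.exists_adjoint hp (hpV _) (show θ ∈ hom _ (T.delta w) g from hθ)
  have hadj' : ∀ y z, γ y (θ' z) = γ (θ y) z := fun y z => hadj z y
  obtain ⟨v0, hv0, hv0'⟩ := exists_socle_generator h hp hpV hflip
  have h0 : θ' v0 = 0 := by
    refine hγ.inj_right hp (hpV _) _ fun y => ?_
    refine T.deltaGen_induction w (p := fun y => γ y (θ' v0) = 0) (fun x => ?_) y
    rw [hadj', hθδ']
    exact hv0' x m hm
  -- Evaluation at e turns submodules of costd Q into submodules of Q, where essentiality of the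
  -- socle can be used.
  let Q0 := (LinearMap.ker θ').map ((T.costdEval Q).flip (T.e w).val)
  have hQ0 : Q.IsGSub Q0 := T.isGSub_eval (isGSub_ker hθ')
  have hne : Q0 ≠ ⊥ := by
    intro hb
    refine hv0 (T.costd_ext fun y => ?_)
    have h1 : T.costdEval Q ((T.costd w Q).act y v0) (T.e w).val ∈ Q0 :=
      ⟨_, (isGSub_ker hθ').1 y v0 h0, rfl⟩
    rw [hb, Submodule.mem_bot, costdEval_act, costdEval_e_mul] at h1
    rw [h1, map_zero, LinearMap.zero_apply]
  have hle : LinearMap.range ι ≤ Q0 := by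
    have h1 : Q0 ⊓ LinearMap.range ι ≠ ⊥ := fun hb => hne (hιe Q0 hQ0 hb)
    obtain ⟨_, ⟨hq, s, rfl⟩, hs⟩ := Submodule.exists_mem_ne_zero_of_ne_bot h1
    have hs1 : ι s = κ s • ι (simpleOne T w) := by rw [← map_smul, hκ]
    have hκs : κ s ≠ 0 := fun hc => hs (by rw [hs1, hc, zero_smul])
    rw [hs1] at hq
    have h2 := (Submodule.smul_mem_iff Q0 hκs).1 hq
    rintro _ ⟨s', rfl⟩
    rw [← hκ s', map_smul]
    exact Q0.smul_mem _ h2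
  have hθv : θ' v = 0 := by
    refine T.costd_ext fun y => ?_
    obtain ⟨u', hu', hu''⟩ := hle (hv y)
    -- The e-part of a costandardization is determined by the value at e, and both sides have the
    -- value v(y) there.
    have h1 : (T.costd w Q).act ((T.e w).val * y) v = (T.costd w Q).act (T.e w).val u' := by
      refine T.costd_ext fun z => ?_
      rw [costdEval_act, costdEval_act, ← mul_assoc, costdEval_mul, ← hu'', LinearMap.flip_apply,
        ← costdEval_mul, mul_assoc, (T.e w).mul_self]
    have h2 : T.costdEval Q (θ' v) y =
        T.costdEval Q (θ' ((T.costd w Q).act ((T.e w).val * y) v)) (T.e w).val := by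
      rw [hom_smul hθ', costdEval_act, costdEval_e_mul, costdEval_e_mul]
    rw [h2, h1, hom_smul hθ', (show θ' u' = 0 from hu'), map_zero, map_zero,
      LinearMap.zero_apply, LinearMap.zero_apply]
  rw [← hθδ', ← hadj', hθv, map_zero]

/-- Suppose a value q of v lies outside the socle. Injectivity of Q provides an endomorphism ψ of Q
sending q into the socle without killing it, while ψ does kill some nonzero m q with m in the
radical. The adjoint on Δ(w) of the induced endomorphism of costd Q is right multiplication by some
m'. If m' is in the radical, the hypothesis on v contradicts ψ q ≠ 0; otherwise the adjoint is onto,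
contradicting the kernel. -/
theorem mem_range_of_pairing_eq_zero (h : T.IsBasedAffineQuasiHereditary) (hQ : Q.Injective)
    (hι : ι ∈ hom (T.simple w) Q 0) (hιi : Function.Injective ι)
    (hιe : ∀ K, Q.IsGSub K → K ⊓ LinearMap.range ι = ⊥ → K = ⊥) (hp : p ∈ E)
    (hpV : ∀ (V : GMod A) (v : V), V.act p v = v)
    (hγ : IsDualPair t E (T.delta w) (T.costd w Q) γ)
    {d : ℤ} {v : T.costd w Q} (hvd : v ∈ (T.costd w Q).deg d)
    (hv : ∀ x, ∀ m ∈ T.radLift w,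
      γ ((T.delta w).act (x * (T.e w).val * m) (T.deltaGen w)) v = 0) (x : A) :
    T.costdEval Q v x ∈ LinearMap.range ι := by
  obtain ⟨κ, hκ⟩ := exists_coord_simple T h w
  refine alg_induction (p := fun x => T.costdEval Q v x ∈ LinearMap.range ι)
    (by rw [map_zero]; exact zero_mem _) (fun x y hx hy => by rw [map_add]; exact add_mem hx hy)
    (fun n u hu => ?_) x
  by_contra hq
  have hqd := T.costdEval_mem Q hvd hu
  set q := T.costdEval Q v u
  have hq0 : q ≠ 0 := fun h0 => hq (h0 ▸ zero_mem _)
  have hs1 : ι (simpleOne T w) ∈ Q.deg 0 := hom_deg_zero hι (simpleOne_mem w)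
  have hs0 : ι (simpleOne T w) ≠ 0 := fun h0 =>
    simpleOne_ne_zero w h (hιi (by rw [h0, map_zero]))
  obtain ⟨f, hf, -, hf'⟩ := T.exists_hom_regular hqd
  obtain ⟨f₁, hf₁, hf₁m, hf₁'⟩ := T.exists_hom_regular hs1
  have hann : ∀ m ∈ T.radLift w, Q.act (T.toCartan w m) (ι (simpleOne T w)) = 0 := fun m hm => by
    rw [← hom_smul hι, act_simpleOne_eq_zero.2 hm, map_zero]
  -- The annihilator of q ≠ 0 is a proper graded left ideal, so it lies in the radical, which
  -- annihilates the socle generator. Thus q ↦ socle generator is well defined on the submodule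
  -- generated by q.
  have hle : LinearMap.ker f ≤ LinearMap.ker f₁ := by
    have h1 : LinearMap.ker f ≠ ⊤ := fun ht => by
      have : f (T.regOne w) = 0 := by
        rw [← LinearMap.mem_ker, ht]; trivial
      exact hq0 (hf'.symm.trans this)
    intro c hc
    have h2 := (h.isGreatestProper w).2.2 _ (isGSub_ker hf) h1 hc
    obtain ⟨m, rfl⟩ := T.toCartan_surjective w c
    exact (hf₁m m).trans (hann m h2)
  obtain ⟨ψ, hψ, hψf⟩ := hQ.exists_extend hf hf₁ hle
  have hψq : ψ q = ι (simpleOne T w) := by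
    have := hψf (T.regOne w)
    rwa [hf', hf₁'] at this
  -- Otherwise A_w acts on q by scalars, and the line of q would be a graded submodule meeting the
  -- socle trivially.
  obtain ⟨m, hm, hmq⟩ : ∃ m ∈ T.radLift w, Q.act (T.toCartan w m) q ≠ 0 := by
    by_contra! hall
    have hK : Q.IsGSub (Submodule.span k {q}) := by
      refine ⟨fun c y hy => ?_, homog_span fun y hy => ⟨n + d, by
        rw [Set.mem_singleton_iff.1 hy]; exact hqd⟩⟩
      obtain ⟨b, rfl⟩ := Submodule.mem_span_singleton.1 hy
      obtain ⟨m, rfl⟩ := T.toCartan_surjective w c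
      have h1 := hall _ (sub_smul_e_mem_radLift hκ m)
      rw [map_sub, map_smul, map_sub, map_smul, LinearMap.sub_apply, LinearMap.smul_apply,
        act_toCartan_e, sub_eq_zero] at h1
      rw [map_smul, h1]
      exact Submodule.smul_mem _ _ (Submodule.smul_mem _ _ (Submodule.mem_span_singleton_self q))
    have hbot : Submodule.span k {q} ⊓ LinearMap.range ι = ⊥ := by
      rw [eq_bot_iff]
      rintro y ⟨hy, hy'⟩
      obtain ⟨b, rfl⟩ := Submodule.mem_span_singleton.1 hy
      by_cases hb : b = 0
      · rw [hb, zero_smul]; exact zero_mem _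
      · exact absurd ((Submodule.smul_mem_iff _ hb).1 hy') hq
    have := hιe _ hK hbot
    rw [Submodule.span_singleton_eq_bot] at this
    exact hq0 this
  obtain ⟨Ψ, hΨ, hΨe⟩ := T.exists_costdMap hψ
  let v1 := (T.costd w Q).act (m * (T.e w).val * u) v
  have hv1 : ∀ y, T.costdEval Q v1 (y * (T.e w).val) =
      Q.act (T.toCartan w y) (Q.act (T.toCartan w m) q) := fun y => by
    rw [costdEval_act, costdEval_mul, costdEval_mul]
  have hv1' : ∀ y, T.costdEval Q ((T.costd w Q).act (T.e w).val v1) y =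
      Q.act (T.toCartan w y) (Q.act (T.toCartan w m) q) := fun y => by
    rw [costdEval_act, hv1]
  have hΨv1 : Ψ ((T.costd w Q).act (T.e w).val v1) = 0 := by
    refine T.costd_ext fun y => ?_
    rw [hΨe, hv1', hom_smul hψ, hom_smul hψ, hψq, hann m hm, map_zero, map_zero,
      LinearMap.zero_apply]
  have hne : (T.costd w Q).act (T.e w).val v1 ≠ 0 := fun h0 => by
    have := hv1' (T.e w).val
    rw [h0, map_zero, LinearMap.zero_apply, act_toCartan_e] at this
    exact hmq this.symm
  -- The endomorphism Ψ of costd Q is carried to Δ(w), where it is governed by the image of one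
  -- generator.
  obtain ⟨θ, hθ, hadj⟩ := hγ.exists_adjoint hp (hpV _) hΨ
  obtain ⟨m', hm', hm''⟩ := T.exists_act_e_delta (hom_deg hθ (T.deltaGen_mem w))
  have hθδ : θ (T.deltaGen w) = (T.delta w).act ((T.e w).val * m') (T.deltaGen w) := by
    rw [← hm'', ← hom_smul hθ, act_e_deltaGen]
  by_cases hr : m' ∈ T.radLift w
  · have h1 : Ψ v = 0 := by
      refine hγ.inj_right hp (hpV _) _ fun y => ?_
      refine T.deltaGen_induction w (p := fun y => γ y (Ψ v) = 0) (fun y => ?_) y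
      rw [← hadj, hom_smul hθ, hθδ, ← act_mul, ← mul_assoc]
      exact hv y m' hr
    have h2 := hΨe v u
    rw [h1, map_zero, LinearMap.zero_apply] at h2
    exact hs0 (hψq.symm.trans h2.symm)
  · obtain ⟨c, hc⟩ := exists_act_eq_deltaGen h hm' hr
    rw [act_mul, ← hθδ, ← hom_smul hθ] at hc
    refine hne (hγ.inj_right hp (hpV _) _ fun y => ?_)
    refine T.deltaGen_induction w (p := fun y => γ y _ = 0) (fun y => ?_) y
    rw [← hc, ← hom_smul hθ, hadj, hΨv1, map_zero]

end Perp

end TriBasis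

end PureBGG

/-! ### Pairing of proper standard and proper costandard modules, and conclusion. -/

namespace PureBGG

namespace TriBasis

open GMod IsBasedAffineQuasiHereditary

variable {k : Type u} [Field k] {A : GrAlg k} {I : Type*} {U : LocalUnits A I} {W : Type*}
  [PartialOrder W] {T : TriBasis U W} {w : W}

/-- Pulling values back along the embedding g gives the right function; what has to be ensured is
that it lies in the direct sum over the distinguished idempotents. -/
theorem exists_costd_preimage {V V' : GMod (T.cartan w)} {g : V →ₗ[k] V'} (hg : g ∈ hom V V' 0)
    (hi : Function.Injective g) {G : T.costd w V →ₗ[k] T.costd w V'}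
    (hG : ∀ f x, T.costdEval V' (G f) x = g (T.costdEval V f x)) {p : A}
    (hp : ∀ v : T.costd w V', (T.costd w V').act p v = v) {d : ℤ} {v : T.costd w V'}
    (hv : v ∈ (T.costd w V').deg d) (hr : ∀ x, T.costdEval V' v x ∈ LinearMap.range g) :
    ∃ n ∈ (T.costd w V).deg d, G n = v := by
  have hrefl : ∀ n s, g s ∈ V'.deg n → s ∈ V.deg n := by
    intro n s hs
    have h1 := hom_gproj_zero hg n s
    rw [gproj_of_mem _ hs] at h1
    rw [hi h1]
    exact gproj_mem _ _ _
  let r : LinearMap.range g →ₗ[k] V := (LinearEquiv.ofInjective g hi).symm.toLinearMap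
  have hgr : ∀ y, g (r y) = y := fun y =>
    congrArg Subtype.val ((LinearEquiv.ofInjective g hi).apply_symm_apply y)
  -- Decomposing `p` into homogeneous elements fixed on the left by some `1_i` makes each piece of
  -- `p v` homogeneous and fixed by one `1_i`, so its pullback lies in one summand.
  have hex : ∃ n, G n = (T.costd w V').act p v := by
    refine unit_homog_induction U (p := fun a => ∃ n, G n = (T.costd w V').act a v)
      ⟨0, by simp⟩ ?_ ?_ p
    · rintro x y ⟨n, hn⟩ ⟨n', hn'⟩
      exact ⟨n + n', by rw [map_add, map_add, hn, hn', LinearMap.add_apply]⟩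
    · intro i m a ha hia
      let v' := (T.costd w V').act a v
      have hr' : ∀ x, T.costdEval V' v' x ∈ LinearMap.range g := fun x => by
        rw [costdEval_act]; exact hr _
      let φ : A →ₗ[k] V := r ∘ₗ (T.costdEval V' v').codRestrict _ hr'
      have hφ : ∀ x, g (φ x) = T.costdEval V' v' x := fun x => hgr _
      have hc : T.IsCostdFun V φ := by
        constructor
        · intro x hx
          refine hi ?_
          rw [hφ, (T.isCostdFun_costdEval V' v').ideal x hx, map_zero]
        · intro u x
          refine hi ?_
          rw [hφ, costdEval_mul, hom_smul hg, hφ]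
      have hd : ∀ n, ∀ x ∈ A.deg n, φ x ∈ V.deg (n + (m + d)) := fun n x hx => by
        refine hrefl _ _ ?_
        rw [hφ]
        exact T.costdEval_mem V' ((T.costd w V').act_mem ha hv) hx
      have h1 : (T.costd w V').act (U.one i).val v' = v' := by rw [← act_mul, hia]
      have hone : ∀ x, φ (x * (U.one i).val) = φ x := fun x => by
        refine hi ?_
        rw [hφ, hφ, ← costdEval_act, h1]
      obtain ⟨f, -, -, hf⟩ := IsCostdFun.exists_costd T hc hd hone
      refine ⟨f, T.costd_ext fun x => ?_⟩
      rw [hG, hf, hφ]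
  obtain ⟨n, hn⟩ := hex
  rw [hp] at hn
  refine ⟨n, T.mem_costd_deg V fun m x hx => hrefl _ _ ?_, hn⟩
  rw [← hG, hn]
  exact T.costdEval_mem V' hv hx

/-- A pairing of `Δ(w)` with the costandardization of an injective hull of the simple `A_w`-module
induces a pairing of the proper costandard with the proper standard module. -/
theorem exists_isDualPair_proper (h : T.IsBasedAffineQuasiHereditary) {Q : GMod (T.cartan w)}
    (hQ : Q.IsInjectiveHull (T.simple w)) {t t' : A → A} (ht : ∀ a, t (t' a) = a) {E : Set A}
    {p : A} (hp : p ∈ E) (hpV : ∀ (V : GMod A) (v : V), V.act p v = v)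
    (hfin : ∀ d, FiniteDimensional k (A.deg d))
    {γ : T.delta w →ₗ[k] T.costd w Q →ₗ[k] k}
    (hγ : IsDualPair t E (T.delta w) (T.costd w Q) γ) :
    ∃ β, IsDualPair t' E (T.costd w (T.simple w)) (T.std w (T.simple w)) β := by
  obtain ⟨hQi, ι, hι, hιi, hιe⟩ := hQ
  obtain ⟨κ, hκ⟩ := exists_coord_simple T h w
  have hflip : IsDualPair t' E (T.costd w Q) (T.delta w) γ.flip := by
    -- Symmetry of the pairing needs finite-dimensional components of Δ(w), which follow from its
    -- being cyclic on a generator of degree 0.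
    refine hγ.flip ht hp (hpV _) fun d => ?_
    have := hfin (d - 0)
    refine Submodule.finiteDimensional_of_le
      (S₂ := (A.deg (d - 0)).map ((T.delta w).act.flip (T.deltaGen w))) fun z hz => ?_
    obtain ⟨a, ha, hz⟩ := exists_act_of_cyc_eq_top (T.deltaGen_mem w) (T.cyc_deltaGen w) hz
    exact ⟨a, ha, hz⟩
  obtain ⟨G, hG, hGe⟩ := T.exists_costdMap hι
  have hGi : Function.Injective G := fun f f' hff => T.costd_ext fun x => hιi (by
    rw [← hGe, ← hGe, hff])
  -- The pairing of x ⊗ s with n is the given pairing of x applied to the generator of Δ(w) with the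
  -- image of n in costd Q, scaled by the coordinate of s.
  let Φ : A →ₗ[k] T.simple w →ₗ[k] (T.costd w (T.simple w) →ₗ[k] k) :=
    ((LinearMap.lsmul k (T.costd w (T.simple w) →ₗ[k] k)).flip.compl₂ κ) ∘ₗ
      (show A →ₗ[k] (T.costd w (T.simple w) →ₗ[k] k) from
        (LinearMap.lcomp k k G) ∘ₗ γ ∘ₗ (T.delta w).act.flip (T.deltaGen w))
  have hΦ : ∀ x s n, Φ x s n = κ s * γ ((T.delta w).act x (T.deltaGen w)) (G n) :=
    fun _ _ _ => rfl
  obtain ⟨B, hB⟩ := T.exists_std_lift (T.simple w) Φ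
    (fun a ha => LinearMap.ext fun s => LinearMap.ext fun n => by
      rw [hΦ, T.act_deltaGen_of_mem_ideal w ha, map_zero, LinearMap.zero_apply, mul_zero]; rfl)
    (fun x u s => LinearMap.ext fun n => by
      rw [hΦ, hΦ]
      -- Modulo the radical `u` is a scalar multiple of e, and radical elements contribute nothing
      -- to the pairing with functions valued in the socle; so the form is balanced over A_w.
      have h1 := pairing_eq_zero_of_mem_range h hιe hp hpV hγ hflip
        (v := G n) (fun y => by rw [hGe]; exact ⟨_, rfl⟩) x (sub_smul_e_mem_radLift hκ u)
      rw [mul_sub, map_sub, LinearMap.sub_apply, map_sub, LinearMap.sub_apply, sub_eq_zero] at h1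
      rw [h1, mul_smul_comm, mul_assoc, (T.e w).mul_self, map_smul, LinearMap.smul_apply,
        act_mul_e_deltaGen, map_smul, LinearMap.smul_apply, smul_eq_mul, ← mul_assoc,
        ← smul_eq_mul (κ s), ← map_smul κ, ← map_smul, hκ])
  have hB' : ∀ x s n, B (T.stdMk (T.simple w) x s) n =
      κ s * γ ((T.delta w).act x (T.deltaGen w)) (G n) := fun x s n =>
    (LinearMap.congr_fun (hB x s) n).trans (hΦ x s n)
  refine ⟨B.flip, ⟨fun a n z => ?_, fun m d hmd n hn z hz => ?_, fun n hn => ?_,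
    fun m φ hφ hφp => ?_⟩⟩
  · refine T.std_induction (T.simple w)
      (p := fun z => B z ((T.costd w (T.simple w)).act a n) = B ((T.std w (T.simple w)).act (t' a) z) n)
      (fun x y hx hy => ?_) (fun x s => ?_) z
    · rw [map_add, map_add, LinearMap.add_apply, hx, hy, map_add, LinearMap.add_apply]
    · refine (hB' x s _).trans (Eq.trans ?_
        ((LinearMap.congr_fun (congrArg B (T.std_act_mk (T.simple w) (t' a) x s)) n).trans
          (hB' _ s n)).symm)
      rw [act_mul, hγ.act (t' a), ht, hom_smul hG]
  · change B z n = 0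
    have hz' : z ∈ Submodule.span k {z | ∃ i j, i + j = d ∧ ∃ x ∈ A.deg i,
        ∃ v ∈ (T.simple w).deg j, z = T.stdMk (T.simple w) x v} := by
      rw [← std_deg_eq]; exact hz
    refine (Submodule.span_le.2 ?_ : _ ≤ LinearMap.ker (B.flip n)) hz'
    rintro _ ⟨i, j, rfl, x, hx, s, hs, rfl⟩
    refine (hB' x s n).trans ?_
    by_cases hj : j = 0
    · subst hj
      rw [hγ.deg (i + 0) m (by omega) _ ((T.delta w).act_mem hx (T.deltaGen_mem w)) _
        (hom_deg_zero hG hn), mul_zero]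
    · rw [simple_deg w h j hj, Submodule.mem_bot] at hs
      rw [hs, map_zero, zero_mul]
  · have hκ0 : κ (simpleOne T w) ≠ 0 := fun h0 => by
      have h1 := hκ (simpleOne T w)
      rw [h0, zero_smul] at h1
      exact simpleOne_ne_zero w h h1.symm
    refine hGi ((hγ.inj_right hp (hpV _) _ fun y => ?_).trans (map_zero G).symm)
    refine T.deltaGen_induction w (p := fun y => γ y (G n) = 0) (fun x => ?_) y
    have h1 := hB' x (simpleOne T w) n
    have h2 : B (T.stdMk (T.simple w) x (simpleOne T w)) n = 0 := LinearMap.congr_fun hn _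
    rw [h2] at h1
    exact (mul_eq_zero.1 h1.symm).resolve_left hκ0
  · obtain ⟨f, hf, hfδ⟩ := T.exists_hom_delta_std (simpleOne_mem (T := T) w)
    have hfx : ∀ x, f ((T.delta w).act x (T.deltaGen w)) =
        T.stdMk (T.simple w) x (simpleOne T w) := fun x => by
      rw [hom_smul hf, hfδ, std_act_mk, stdMk_mul_e]
    let φ' : T.delta w →ₗ[k] k := φ ∘ₗ f
    have hφ' : ∀ y, φ' y = φ (f y) := fun _ => rfl
    obtain ⟨v, hvd, hv⟩ := hflip.surj m φ'
      (fun n hn y hy => hφ n hn _ (hom_deg_zero hf hy)) ⟨p, hp, fun z => by rw [hpV]⟩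
    have hv' : ∀ z, γ z v = φ' z := fun z => LinearMap.congr_fun hv z
    -- A functional on the proper standard module, pulled back to Δ(w), is represented by some v in
    -- costd Q. It vanishes on the radical part, so v takes values in the socle and comes from the
    -- proper costandard module.
    have hrange := mem_range_of_pairing_eq_zero h hQi hι hιi hιe hp hpV hγ hvd
      (fun x m hm => by
        rw [hv', hφ', hfx, stdMk_mul, act_simpleOne_eq_zero.2 hm, map_zero]
        exact map_zero φ)
    obtain ⟨n, hn, rfl⟩ := exists_costd_preimage hι hιi hGe (hpV _) hvd hrange
    refine ⟨n, hn, T.std_ext (T.simple w) fun x s => (hB' x s n).trans ?_⟩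
    rw [hv', hφ', hfx]
    refine (map_smul φ (κ s) _).symm.trans (congrArg φ ?_)
    refine (map_smul (T.stdMk (T.simple w) x) (κ s) _).symm.trans ?_
    rw [hκ]

end TriBasis

namespace Refinement

open GMod

variable {k : Type u} [Field k] {A : GrAlg k} {I : Type*} {U : LocalUnits A I} {W : Type*}
  [PartialOrder W] {T : TriBasis U W} {B : W → Type*} [∀ w, PartialOrder (B w)]
  (R : Refinement T B)

/-- Homomorphisms from an indecomposable projective to proper standard and proper costandard
modules, in the presence of a duality. -/
theorem finrank_hom_pureProperDelta (hA : U.LocFinBddBelow) {b : Σ w, B w} {P : GMod A}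
    (hP : P.IsProjectiveCover (R.irr b)) (t : AntiFix U)
    (hirr : (T.cartanDual t b.1 ((R.basis b.1).irr b.2)).Iso ((R.basis b.1).irr b.2))
    (a : Σ w, B w) {Q : GMod ((R.basis a.1).cartan a.2)}
    (hQ : Q.IsInjectiveHull ((R.basis a.1).simple a.2))
    (hd : (T.cartanDual t a.1 ((R.basis a.1).costd a.2 Q)).Iso ((R.basis a.1).delta a.2))
    (d : ℤ) :
    FiniteDimensional k (hom P (R.pureProperDelta a) (-d)) ∧
      Module.finrank k (hom P (R.pureProperDelta a) (-d)) =
        Module.finrank k (hom P (R.pureProperNabla a) d) := by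
  obtain ⟨γ, hγ⟩ := T.isDualPair_of_iso t hd
  obtain ⟨β, hβ⟩ := TriBasis.exists_isDualPair_proper (R.based a.1) hQ
    (t' := (T.cartanAnti t.symm a.1).toEquiv) (T.cartanAnti_symm t) (Set.mem_singleton _)
    (fun V v => T.act_toCartan_e V v) (T.cartan_finite hA a.1).1 hγ
  exact R.finrank_hom_std hP t hirr hβ
    ⟨_, Set.mem_singleton _, fun v => T.act_toCartan_e _ v⟩
    (fun i n => R.pureProperNabla_finite hA a i n) d

end Refinement

end PureBGG
theorem mainTheorem12 {k : Type u} [Field k] [IsAlgClosed k] {A : PureBGG.GrAlg k} {I : Type*}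
    (U : PureBGG.LocalUnits A I) (hA : U.LocFinBddBelow) {W : Type*} [PartialOrder W]
    (T : PureBGG.TriBasis U W) {B : W → Type*} [∀ w, PartialOrder (B w)] [∀ w, Finite (B w)]
    (R : PureBGG.Refinement T B) (P : (Σ w, B w) → PureBGG.GMod A)
    (hP : ∀ b, (P b).IsProjectiveCover (R.irr b)) (a b : Σ w, B w) :
    R.HasPureDeltaFlag (P b) ∧
    (∀ d : ℤ, R.pureDeltaMult (P b) a d ≠ ⊤) ∧
    (∀ d : ℤ, R.pureDeltaMult (P b) a d = (R.pureProperNabla a).mult (R.irr b) (-d)) ∧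
    ∀ t : PureBGG.AntiFix U,
      (∀ w (c : B w), (T.cartanDual t w ((R.basis w).irr c)).Iso ((R.basis w).irr c)) →
      ∀ Q : ∀ w (c : B w), PureBGG.GMod ((R.basis w).cartan c),
        (∀ w (c : B w), (Q w c).IsInjectiveHull ((R.basis w).simple c)) →
        (∀ w (c : B w),
          (T.cartanDual t w ((R.basis w).costd c (Q w c))).Iso ((R.basis w).delta c)) →
        ∀ d : ℤ, R.pureDeltaMult (P b) a d = (R.pureProperDelta a).mult (R.irr b) d := by
  refine ⟨R.hasPureDeltaFlag_of_isProjectiveCover hA (hP b), fun d => ?_, fun d => ?_, ?_⟩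
  · rw [R.pureDeltaMult_eq hA (hP b)]
    exact ENat.natCast_ne_top _
  · have := R.finiteDimensional_hom hA (hP b) a d
    rw [R.pureDeltaMult_eq hA (hP b), R.mult_irr (hP b)]
  · intro t hirr Q hQ hd d
    obtain ⟨h1, h2⟩ := R.finrank_hom_pureProperDelta hA (hP b) t (hirr b.1 b.2) a
      (hQ a.1 a.2) (hd a.1 a.2) d
    -- Duality reverses the degree of homomorphisms and passing to multiplicities reverses it again,
    -- which is why no bar appears in the second formula.
    rw [R.pureDeltaMult_eq hA (hP b), ← h2, ← R.mult_irr (hP b), neg_neg]
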